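/- **Setting.** Let $n\ge 2$, let $M,\tilde M$ be smooth $n$-dimensional manifolds with the same boundary $\partial M=\partial\tilde M$, let $\iota$ denote either boundary inclusion, and let $\iota^*$ denote restriction of covectors over the boundary to vectors tangent to the boundary. "Homogeneous" means positively homogeneous in the fibre variable; homogeneous maps are those commuting with the dilations $(x,\xi)\mapsto(x,\lambda\xi)$, $\lambda>0$. Let $H\in C^\infty(T^*M\setminus0)$ be real, homogeneous of degree $2$, with $dH\ne0$ on $\{H=0\}$; let $X_H=H_\xi\partial_x-H_x\partial_\xi$ and $\Phi^t$ be its Hamiltonian vector field and flow, and $\sigma=d\xi\wedge dx$. Let $U,V\subset\partial M$ be open and disjoint, and let $\mathcal U\subset T^*U$ be nonempty, open and conic, with a smooth homogeneous map $\zeta:\mathcal U\to T^*M\setminus0$ such that $\iota^*\circ\zeta=\mathrm{Id}$, $H\circ\zeta=0$, and $H_\xi$ points strictly into $M$ at each point of $\zeta(\mathcal U)$. Let $\Gamma_0$ be the set of all points on the bicharacteristics $t\mapsto\Phi^t(\zeta(q))$, $t\ge0$, $q\in\mathcal U$ (integral curves of $X_H$ in $T^*M\setminus 0$), let $\Gamma_U,\Gamma_V$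 be the parts of $\Gamma_0$ over $U,V$, and put $$\ell_-(p)=\inf\{t\ge0:\pi\Phi^{-t}(p)\in U\},\qquad \ell_+(p)=\inf\{t\ge0:\pi\Phi^{t}(p)\in V\},\qquad p\in\Gamma_0 .$$ Assume that each bicharacteristic issued from $\zeta(\mathcal U)$ reaches $V$, and that $H_\xi$ is not tangent to $V$ at the first hit; that $\zeta(q)$ is the only $p\in\Gamma_U$ with $\iota^*p=q$, for each $q\in\mathcal U$; and that $\ell_\pm$ are smooth on $\Gamma_0$. The scattering relation at zero energy is $S_0^H(q)=\iota^*\,\Phi^{\ell_+(\zeta(q))}(\zeta(q))$, $q\in\mathcal U$. Let $\sigma_0$ be the restriction of $\sigma$ to $\Gamma_0$. Let $\tilde H$ on $T^*\tilde M\setminus0$, with $\tilde\zeta$ on the same $\mathcal U$ and with the same $U,V$, satisfy the same assumptions, and denote the corresponding objects with tildes. For $\kappa:\Gamma_0\to\tilde\Gamma_0$ consider the boundary conditions $$\kappa(\Gamma_U)=\tilde\Gamma_U,\qquad \kappa(\Gamma_V)=\tilde\Gamma_V,\qquad \iota^*\circ\kappa=\iota^*\ \text{ on }\Gamma_U\cup\Gamma_V.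 \tag{1}$$ **Theorem.** (a) If there is a smooth homogeneous diffeomorphism $\kappa:\Gamma_0\to\tilde\Gamma_0$ with $\kappa^*\tilde\sigma_0=\sigma_0$ and (1), then $S_0^H=S_0^{\tilde H}$ on $\mathcal U$. (b) Conversely, assume $S_0^H=S_0^{\tilde H}$ on $\mathcal U$. Call $\mu$ admissible if $\mu\in C^\infty(\Gamma_0)$ is positive, homogeneous of degree $0$, and the Hamiltonian $\breve H=\mu H$ (with $\mu$ extended smoothly off $\Gamma_0$; its flow on $\Gamma_0$ does not depend on the extension) satisfies $\breve\ell_+\circ\zeta=\tilde\ell_+\circ\tilde\zeta$ on $\mathcal U$, where $\breve\Phi^t$, $\breve\ell_\pm$ are the flow, entry and exit times of $\breve H$ on $\Gamma_0$. Then: 1. an admissible $\mu$ exists; 2. if $\mu$ and $\mu'$ are admissible, then $\int_0^{\ell_+(\zeta(q))}(\mu^{-1}-\mu'^{-1})(\gamma(t))\,dt=0$ for every $q\in\mathcal U$, where $\gamma(t)=\Phi^t(\zeta(q))$ is the null bicharacteristic issued from $\zeta(q)$; 3. for each admissible $\mu$ there is a unique smooth homogeneous diffeomorphism $\kappa:\Gamma_0\to\tilde\Gamma_0$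 with $\kappa^*\tilde\sigma_0=\sigma_0$, satisfying (1), and conjugating the flows of $\breve H=\mu H$ and $\tilde H$, that is, $\kappa\circ\breve\Phi^t(p)=\tilde\Phi^t\circ\kappa(p)$ for all $p\in\Gamma_0$ and $t\in[-\breve\ell_-(p),\breve\ell_+(p)]$. -/

import Mathlib

open Set Filter Topology
open scoped Manifold ContDiff

namespace ZeroEnergy

noncomputable section

/-- The cotangent bundle `T*M` of a manifold `M` modelled on `I`, as the bundle of continuous
linear forms on the tangent bundle, with Mathlib's vector bundle and manifold structure. -/
abbrev Cotangent {E : Type*} [NormedAddCommGroup E] [NormedSpace ℝ E] {A : Type*}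
    [TopologicalSpace A] (I : ModelWithCorners ℝ E A) (M : Type*) [TopologicalSpace M]
    [ChartedSpace A M] [IsManifold I ∞ M] : Type _ :=
  Bundle.TotalSpace (E →L[ℝ] ℝ) (fun x : M => TangentSpace I x →L[ℝ] Bundle.Trivial M ℝ x)

/-- The model with corners of the cotangent bundle of a manifold modelled on `I`. -/
abbrev cotModel {E : Type*} [NormedAddCommGroup E] [NormedSpace ℝ E] {A : Type*}
    [TopologicalSpace A] (I : ModelWithCorners ℝ E A) :
    ModelWithCorners ℝ (E × (E →L[ℝ] ℝ)) (ModelProd A (E →L[ℝ] ℝ)) :=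
  I.prod 𝓘(ℝ, E →L[ℝ] ℝ)

section General

variable {E : Type*} [NormedAddCommGroup E] [NormedSpace ℝ E] {A : Type*}
  [TopologicalSpace A] {I : ModelWithCorners ℝ E A} {M : Type*} [TopologicalSpace M]
  [ChartedSpace A M] [IsManifold I ∞ M]

/-- The dilation `(x, ξ) ↦ (x, c ξ)` in the fibres of `T*M`. -/
def dil (c : ℝ) (p : Cotangent I M) : Cotangent I M := ⟨p.proj, c • p.snd⟩

/-- The canonical symplectic form `σ = dξ ∧ dx` of `T*M` at `p`.  In Mathlib the tangent space at
`p` is the model space `E × E*`, a vector being represented by its components in the preferred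
chart at `p`.  The preferred chart of `T*M` at `p` consists of the preferred chart `x` of `M` at
the foot point of `p` together with the dual fibre coordinates `ξ`
(`FiberBundle.chartedSpace_chartAt`, `hom_chart`), so that the components of `v` are
`(dx(v), dξ(v))`. -/
def symp (p : Cotangent I M) (v w : TangentSpace (cotModel I) p) : ℝ :=
  let v' : E × (E →L[ℝ] ℝ) := v
  let w' : E × (E →L[ℝ] ℝ) := w
  v'.2 w'.1 - w'.2 v'.1

/-- The differential `dH` at `p` of a real function on `T*M`. -/
def dFun (H : Cotangent I M → ℝ) (p : Cotangent I M) (w : TangentSpace (cotModel I) p) : ℝ :=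
  mfderiv (cotModel I) 𝓘(ℝ, ℝ) H p w

/-- `X` is the value at `p ∈ T*M ∖ 0` of the Hamiltonian vector field
`X_H = H_ξ ∂_x - H_x ∂_ξ` of `H`, that is, `σ(w, X) = dH(w)` for all `w`. -/
def IsHamVec (H : Cotangent I M → ℝ) (p : Cotangent I M) (X : TangentSpace (cotModel I) p) :
    Prop :=
  p.snd ≠ 0 ∧ ∀ w : TangentSpace (cotModel I) p, symp p w X = dFun H p w

/-- `X` is the value at `p ∈ Γ` of the Hamiltonian vector field of `μ H`, where the function `μ` on
`Γ` is extended smoothly to a neighbourhood of `p` in `T*M`.  (If `H = 0` on `Γ`, then `X` does not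
depend on the extension.) -/
def IsHamVecMul (Γ : Set (Cotangent I M)) (μ H : Cotangent I M → ℝ) (p : Cotangent I M)
    (X : TangentSpace (cotModel I) p) : Prop :=
  p ∈ Γ ∧ ∃ μe : Cotangent I M → ℝ, ContMDiffAt (cotModel I) 𝓘(ℝ, ℝ) ∞ μe p ∧
    (∀ᶠ p' in 𝓝[Γ] p, μe p' = μ p') ∧ IsHamVec (fun p' => μe p' * H p') p X

/-- `γ` is, on the set of times `s`, an integral curve of the vector field whose value at `p` is
the vector `X` with `R p X`. -/
def IsIntegralCurve (R : ∀ p : Cotangent I M, TangentSpace (cotModel I) p → Prop)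
    (γ : ℝ → Cotangent I M) (s : Set ℝ) : Prop :=
  ∀ t ∈ s, ∃ X : TangentSpace (cotModel I) (γ t), R (γ t) X ∧
    HasMFDerivWithinAt 𝓘(ℝ, ℝ) (cotModel I) γ s t ((1 : ℝ →L[ℝ] ℝ).smulRight X)

/-- The graph of the flow: `Φ^t(p)` is defined and equal to `p'` (`t` may be negative). -/
def FlowsTo (R : ∀ p : Cotangent I M, TangentSpace (cotModel I) p → Prop)
    (t : ℝ) (p p' : Cotangent I M) : Prop :=
  ∃ γ : ℝ → Cotangent I M, IsIntegralCurve R γ (uIcc 0 t) ∧ γ 0 = p ∧ γ t = p'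

/-- `ℓ₊(p) = inf {t ≥ 0 : π Φ^t(p) ∈ V}`, with `V` a subset of the base. -/
def exitTime (R : ∀ p : Cotangent I M, TangentSpace (cotModel I) p → Prop) (V : Set M)
    (p : Cotangent I M) : ℝ :=
  sInf {t : ℝ | 0 ≤ t ∧ ∃ p', FlowsTo R t p p' ∧ p'.proj ∈ V}

/-- `ℓ₋(p) = inf {t ≥ 0 : π Φ^{-t}(p) ∈ U}`, with `U` a subset of the base. -/
def entryTime (R : ∀ p : Cotangent I M, TangentSpace (cotModel I) p → Prop) (U : Set M)
    (p : Cotangent I M) : ℝ :=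
  sInf {t : ℝ | 0 ≤ t ∧ ∃ p', FlowsTo R (-t) p p' ∧ p'.proj ∈ U}

/-- Smooth Hamiltonians on `T*M ∖ 0`, positively homogeneous of degree two, with `dH ≠ 0` on
`H = 0`. -/
structure IsHamiltonian (H : Cotangent I M → ℝ) : Prop where
  smooth : ContMDiffOn (cotModel I) 𝓘(ℝ, ℝ) ∞ H {p | p.snd ≠ 0}
  homogeneous : ∀ (c : ℝ) (p : Cotangent I M), 0 < c → p.snd ≠ 0 → H (dil c p) = c ^ 2 * H p
  nondegenerate : ∀ p : Cotangent I M, p.snd ≠ 0 → H p = 0 → ∃ w, dFun H p w ≠ 0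

end General

section Boundary

variable {d : ℕ}
  {B : Type*} [TopologicalSpace B] [ChartedSpace (EuclideanSpace ℝ (Fin d)) B]
  [IsManifold (𝓡 d) ∞ B]
  {M : Type*} [TopologicalSpace M] [ChartedSpace (EuclideanHalfSpace (d + 1)) M]
  [IsManifold (𝓡∂ (d + 1)) ∞ M]

/-- `ι : B → M` identifies the manifold `B` with the boundary of `M`: it is a smooth embedding
with image `∂M`. -/
structure IsBoundaryInclusion (ι : B → M) : Prop where
  smooth : ContMDiff (𝓡 d) (𝓡∂ (d + 1)) ∞ ι
  embedding : IsEmbedding ι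
  immersion : ∀ b : B, Function.Injective (mfderiv (𝓡 d) (𝓡∂ (d + 1)) ι b)
  range_eq : range ι = (𝓡∂ (d + 1)).boundary M

/-- `ι*(p) = q`: the foot point of `p ∈ T*M` is the boundary point `q.proj`, and `q` is the
restriction of the covector `p` to the tangent space of the boundary. -/
def IsRestriction (ι : B → M) (p : Cotangent (𝓡∂ (d + 1)) M) (q : Cotangent (𝓡 d) B) : Prop :=
  ∃ ξ : TangentSpace (𝓡∂ (d + 1)) (ι q.proj) →L[ℝ] Bundle.Trivial M ℝ (ι q.proj),
    p = ⟨ι q.proj, ξ⟩ ∧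
      ∀ v : TangentSpace (𝓡 d) q.proj, q.snd v = ξ (mfderiv (𝓡 d) (𝓡∂ (d + 1)) ι q.proj v)

/-- `⟨dρ, dπ X⟩` for a vector `X` tangent to `T*M` at a point `p` over `∂M`, where the boundary
defining function `ρ ≥ 0` is the zeroth coordinate of the preferred chart of `M` at the foot point
of `p`. -/
def normalVelocity (p : Cotangent (𝓡∂ (d + 1)) M)
    (X : TangentSpace (cotModel (𝓡∂ (d + 1))) p) : ℝ :=
  let X' : EuclideanSpace ℝ (Fin (d + 1)) × (EuclideanSpace ℝ (Fin (d + 1)) →L[ℝ] ℝ) := X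
  X'.1 0

/-- The boundary covector `p` is incoming: `H_ξ(p)` points strictly into `M`. -/
def IsIncoming (H : Cotangent (𝓡∂ (d + 1)) M → ℝ) (p : Cotangent (𝓡∂ (d + 1)) M) : Prop :=
  ∃ X, IsHamVec H p X ∧ 0 < normalVelocity p X

/-- The boundary covector `p` is transversal: `H_ξ(p)` is not tangent to `∂M`. -/
def IsTransversal (H : Cotangent (𝓡∂ (d + 1)) M → ℝ) (p : Cotangent (𝓡∂ (d + 1)) M) : Prop :=
  ∃ X, IsHamVec H p X ∧ normalVelocity p X ≠ 0

/-- The set `Γ₀` of all covectors on the bicharacteristics of `H` issued from the covectors `ζ q`,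
`q ∈ 𝒰`. -/
def Gamma (H : Cotangent (𝓡∂ (d + 1)) M → ℝ) (𝒰 : Set (Cotangent (𝓡 d) B))
    (ζ : Cotangent (𝓡 d) B → Cotangent (𝓡∂ (d + 1)) M) : Set (Cotangent (𝓡∂ (d + 1)) M) :=
  {p | ∃ q ∈ 𝒰, ∃ t : ℝ, 0 ≤ t ∧ FlowsTo (IsHamVec H) t (ζ q) p}

/-- The part of a subset of `T*M` that lies over the subset `W` of the boundary. -/
def partOver (ι : B → M) (W : Set B) (Γ : Set (Cotangent (𝓡∂ (d + 1)) M)) :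
    Set (Cotangent (𝓡∂ (d + 1)) M) :=
  {p ∈ Γ | p.proj ∈ ι '' W}

/-- The local setting of scattering at zero energy for `H`: `𝒰` is a nonempty open conic subset of
`T*U` (a conic neighbourhood of some `(x₀, ξ⁰')`), and `ζ` solves `H = 0` smoothly and
homogeneously over `𝒰`, with incoming values; each bicharacteristic issued from `ζ(𝒰)` hits `V`,
transversally at the first hit; `ζ` is the only right inverse of the restriction to the boundary
within `Γ₀|_U`; and `ℓ₊`, `ℓ₋` are smooth on `Γ₀`. -/
structure ScatteringSetup (ι : B → M) (U V : Set B) (𝒰 : Set (Cotangent (𝓡 d) B))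
    (H : Cotangent (𝓡∂ (d + 1)) M → ℝ)
    (ζ : Cotangent (𝓡 d) B → Cotangent (𝓡∂ (d + 1)) M) : Prop where
  nonempty : 𝒰.Nonempty
  isOpen : IsOpen 𝒰
  over_U : ∀ q ∈ 𝒰, q.proj ∈ U
  conic : ∀ q ∈ 𝒰, ∀ c : ℝ, 0 < c → dil c q ∈ 𝒰
  smooth_zeta : ContMDiffOn (cotModel (𝓡 d)) (cotModel (𝓡∂ (d + 1))) ∞ ζ 𝒰
  restriction_zeta : ∀ q ∈ 𝒰, IsRestriction ι (ζ q) q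
  zero_energy : ∀ q ∈ 𝒰, H (ζ q) = 0
  homogeneous_zeta : ∀ q ∈ 𝒰, ∀ c : ℝ, 0 < c → ζ (dil c q) = dil c (ζ q)
  incoming : ∀ q ∈ 𝒰, IsIncoming H (ζ q)
  exits : ∀ q ∈ 𝒰, ∃ p, FlowsTo (IsHamVec H) (exitTime (IsHamVec H) (ι '' V) (ζ q)) (ζ q) p ∧
    p.proj ∈ ι '' V ∧ IsTransversal H p
  unique_zeta : ∀ p ∈ partOver ι U (Gamma H 𝒰 ζ), ∀ q ∈ 𝒰, IsRestriction ι p q → p = ζ q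
  smooth_exit : ContMDiffOn (cotModel (𝓡∂ (d + 1))) 𝓘(ℝ, ℝ) ∞
    (exitTime (IsHamVec H) (ι '' V)) (Gamma H 𝒰 ζ)
  smooth_entry : ContMDiffOn (cotModel (𝓡∂ (d + 1))) 𝓘(ℝ, ℝ) ∞
    (entryTime (IsHamVec H) (ι '' U)) (Gamma H 𝒰 ζ)

/-- The graph of the scattering relation at zero energy `S₀ = ι* ∘ Ŝ₀ ∘ ζ`, where
`Ŝ₀(p) = Φ^{ℓ₊(p)}(p)`: one has `q' = S₀(q)`. -/
def Scatters (ι : B → M) (V : Set B) (H : Cotangent (𝓡∂ (d + 1)) M → ℝ)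
    (ζ : Cotangent (𝓡 d) B → Cotangent (𝓡∂ (d + 1)) M) (q q' : Cotangent (𝓡 d) B) : Prop :=
  ∃ p, FlowsTo (IsHamVec H) (exitTime (IsHamVec H) (ι '' V) (ζ q)) (ζ q) p ∧
    q'.proj ∈ V ∧ IsRestriction ι p q'

variable {M' : Type*} [TopologicalSpace M'] [ChartedSpace (EuclideanHalfSpace (d + 1)) M']
  [IsManifold (𝓡∂ (d + 1)) ∞ M']

/-- The scattering relations of `H` and `H'` agree on `𝒰`. -/
def SameScattering (ι : B → M) (ι' : B → M') (V : Set B) (𝒰 : Set (Cotangent (𝓡 d) B))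
    (H : Cotangent (𝓡∂ (d + 1)) M → ℝ) (H' : Cotangent (𝓡∂ (d + 1)) M' → ℝ)
    (ζ : Cotangent (𝓡 d) B → Cotangent (𝓡∂ (d + 1)) M)
    (ζ' : Cotangent (𝓡 d) B → Cotangent (𝓡∂ (d + 1)) M') : Prop :=
  ∀ q ∈ 𝒰, ∀ q', Scatters ι V H ζ q q' ↔ Scatters ι' V H' ζ' q q'

/-- `κ` restricts to a smooth homogeneous diffeomorphism from `Γ` onto `Γ'`. -/
structure IsHomDiffeo (Γ : Set (Cotangent (𝓡∂ (d + 1)) M)) (Γ' : Set (Cotangent (𝓡∂ (d + 1)) M'))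
    (κ : Cotangent (𝓡∂ (d + 1)) M → Cotangent (𝓡∂ (d + 1)) M') : Prop where
  smooth : ContMDiffOn (cotModel (𝓡∂ (d + 1))) (cotModel (𝓡∂ (d + 1))) ∞ κ Γ
  bijOn : BijOn κ Γ Γ'
  smooth_inv : ∃ κi : Cotangent (𝓡∂ (d + 1)) M' → Cotangent (𝓡∂ (d + 1)) M,
    InvOn κi κ Γ Γ' ∧ ContMDiffOn (cotModel (𝓡∂ (d + 1))) (cotModel (𝓡∂ (d + 1))) ∞ κi Γ'
  homogeneous : ∀ p ∈ Γ, ∀ c : ℝ, 0 < c → κ (dil c p) = dil c (κ p)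

/-- `κ* σ₀' = σ₀` on `Γ`, where `Γ` is a piece of the hypersurface `H = 0`, so that `T_p Γ` is the
kernel of `dH` at `p`; the derivative of `κ` along `Γ` is uniquely determined there. -/
def PreservesSymp (H : Cotangent (𝓡∂ (d + 1)) M → ℝ) (Γ : Set (Cotangent (𝓡∂ (d + 1)) M))
    (κ : Cotangent (𝓡∂ (d + 1)) M → Cotangent (𝓡∂ (d + 1)) M') : Prop :=
  ∀ p ∈ Γ, ∀ L, HasMFDerivWithinAt (cotModel (𝓡∂ (d + 1))) (cotModel (𝓡∂ (d + 1))) κ Γ p L →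
    ∀ v w : TangentSpace (cotModel (𝓡∂ (d + 1))) p, dFun H p v = 0 → dFun H p w = 0 →
      symp (κ p) (L v) (L w) = symp p v w

/-- The boundary conditions `κ(Γ_U) = Γ'_U`, `κ(Γ_V) = Γ'_V` and `ι* ∘ κ = ι*` on `Γ_U ∪ Γ_V`. -/
structure BoundaryConditions (ι : B → M) (ι' : B → M') (U V : Set B)
    (Γ : Set (Cotangent (𝓡∂ (d + 1)) M)) (Γ' : Set (Cotangent (𝓡∂ (d + 1)) M'))
    (κ : Cotangent (𝓡∂ (d + 1)) M → Cotangent (𝓡∂ (d + 1)) M') : Prop where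
  image_U : κ '' partOver ι U Γ = partOver ι' U Γ'
  image_V : κ '' partOver ι V Γ = partOver ι' V Γ'
  restriction : ∀ p ∈ partOver ι U Γ ∪ partOver ι V Γ, ∀ q, IsRestriction ι p q ↔ IsRestriction ι' (κ p) q

/-- `μ` is a positive smooth function on `Γ₀`, homogeneous of degree zero, such that the exit times
of `μ H` and of `H'` agree: `ℓ₊^{μ H} ∘ ζ = ℓ₊^{H'} ∘ ζ'` on `𝒰`. -/
structure IsAdmissible (ι : B → M) (ι' : B → M') (V : Set B) (𝒰 : Set (Cotangent (𝓡 d) B))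
    (H : Cotangent (𝓡∂ (d + 1)) M → ℝ) (H' : Cotangent (𝓡∂ (d + 1)) M' → ℝ)
    (ζ : Cotangent (𝓡 d) B → Cotangent (𝓡∂ (d + 1)) M)
    (ζ' : Cotangent (𝓡 d) B → Cotangent (𝓡∂ (d + 1)) M')
    (μ : Cotangent (𝓡∂ (d + 1)) M → ℝ) : Prop where
  smooth : ContMDiffOn (cotModel (𝓡∂ (d + 1))) 𝓘(ℝ, ℝ) ∞ μ (Gamma H 𝒰 ζ)
  pos : ∀ p ∈ Gamma H 𝒰 ζ, 0 < μ p
  homogeneous : ∀ p ∈ Gamma H 𝒰 ζ, ∀ c : ℝ, 0 < c → μ (dil c p) = μ p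
  exit_eq : ∀ q ∈ 𝒰, exitTime (IsHamVecMul (Gamma H 𝒰 ζ) μ H) (ι '' V) (ζ q) =
    exitTime (IsHamVec H') (ι' '' V) (ζ' q)

/-- `κ` conjugates the flow of `μ H` on `Γ` to the flow of `H'`: for `p ∈ Γ` and
`-ℓ₋^{μ H}(p) ≤ t ≤ ℓ₊^{μ H}(p)` both flows are defined and `κ(Φ^t_{μ H}(p)) = Φ^t_{H'}(κ(p))`. -/
def ConjugatesFlows (ι : B → M) (U V : Set B) (Γ : Set (Cotangent (𝓡∂ (d + 1)) M))
    (μ H : Cotangent (𝓡∂ (d + 1)) M → ℝ) (H' : Cotangent (𝓡∂ (d + 1)) M' → ℝ)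
    (κ : Cotangent (𝓡∂ (d + 1)) M → Cotangent (𝓡∂ (d + 1)) M') : Prop :=
  ∀ p ∈ Γ, ∀ t ∈ Icc (-entryTime (IsHamVecMul Γ μ H) (ι '' U) p)
      (exitTime (IsHamVecMul Γ μ H) (ι '' V) p),
    ∃ p', FlowsTo (IsHamVecMul Γ μ H) t p p' ∧ FlowsTo (IsHamVec H') t (κ p) (κ p')

end Boundary

end

end ZeroEnergy

/-! Let T(q) be the time at which the bicharacteristic issued from ζ(q) first hits V. Everything is
read in the coordinates (q, s) ∈ 𝒰 × [0, 1] of the map `flowBox`, (q, s) ↦ Φ^{sT(q)}(ζ(q)). It is a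
bijection onto Γ₀ (`IsScattering.flowBox_bijOn`): a bicharacteristic can neither be continued past a
transversal hit of V nor arrive at an incoming covector, because the normal coordinate of M cannot
become negative. Continuity of ℓ₋ excludes returns to U (`notMem_U`), so Γ_U and Γ_V are the faces s
= 0 and s = 1.

In these coordinates the Liouville form ξ dx becomes the Liouville form of T*∂M in the variable q.
At s = 0 this is the identity ι* ∘ ζ = Id. Along the flow nothing changes, because Euler's identity
gives ξ·H_ξ = 2H = 0 and because σ(X_H, ·) vanishes on vectors tangent to H = 0
(`liouville_transport`, `liouville_flowRep`). Hence σ₀ becomes the canonical form in q alone, and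
its kernel is spanned by ∂_s.

The coordinates are smooth in both directions up to the faces. Forward, this is smooth dependence of
flows on parameters (`contDiffOn_flow`). Backward, it is the inverse function theorem for a C¹
extension of the flow across the faces, completed by one direction transversal to H = 0
(`exists_extension`, `exists_chart_inverse`).

Part (a): in these coordinates κ preserves a form in q alone, so it maps the kernel ∂_s into the
kernel (`exists_param_map`), and therefore bicharacteristics into bicharacteristics
(`exists_flowBox_eq`). The boundary conditions and the uniqueness of ζ' give κ ∘ ζ = ζ', so the end
of the bicharacteristic of q goes to the end of the bicharacteristic with the same q. There ι* ∘ κ =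
ι* says that the scattering relations agree.

Part (b): where H = 0 the Hamiltonian field of μH is μX_H, so its clock along a bicharacteristic is
∫ μ⁻¹ dt (`travelTime`), and admissibility prescribes the total of this integral as T'. The function
T/T', constant along each bicharacteristic, is admissible. The map κ has to be (q, s) ↦ (q, σ(q,
s)), with σ the normalized travel time. It preserves σ₀ whatever σ is, because it fixes q; equality
of the scattering relations is the boundary condition at s = 1. -/

namespace ZeroEnergy
noncomputable section
-- Charts of the cotangent bundle and the Liouville form
section Charts
variable {E : Type*} [NormedAddCommGroup E] [NormedSpace ℝ E] {A : Type*}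
  [TopologicalSpace A] {I : ModelWithCorners ℝ E A} {M : Type*} [TopologicalSpace M]
  [ChartedSpace A M] [IsManifold I ∞ M]

/-- The preferred chart of `T*M` at `p`, as a partial equivalence to `E × E*`. -/
abbrev cchart (p : Cotangent I M) : PartialEquiv (Cotangent I M) (E × (E →L[ℝ] ℝ)) :=
  extChartAt (cotModel I) p

theorem cchart_fst (p₀ p : Cotangent I M) :
    (cchart p₀ p).1 = extChartAt I p₀.proj p.proj := by
  simp only [cchart, extChartAt_coe, Function.comp]
  erw [hom_chart]
  rfl

theorem mem_cchart_source {p₀ p : Cotangent I M} :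
    p ∈ (cchart p₀).source ↔ p.proj ∈ (chartAt A p₀.proj).source := by
  rw [cchart, extChartAt_source, FiberBundle.chartedSpace_chartAt]
  simp only [mfld_simps, TangentBundle.trivializationAt_baseSet]
  constructor
  · exact fun h => h.1.1
  · intro h
    refine ⟨⟨h, trivial⟩, ?_⟩
    rw [Bundle.Trivialization.coe_fst']
    · exact h
    · rw [hom_trivializationAt_baseSet]
      exact ⟨h, trivial⟩

/-- The trivialization of the dual bundle is precomposition with the inverse tangent trivialization,
which is the derivative of the inverse base chart. -/
theorem cchart_snd (p₀ p : Cotangent I M) (hp : p ∈ (cchart p₀).source) (e : E) :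
    (cchart p₀ p).2 e = p.snd (mfderivWithin 𝓘(ℝ, E) I (extChartAt I p₀.proj).symm (range I)
      (extChartAt I p₀.proj p.proj) e) := by
  rw [mem_cchart_source] at hp
  simp only [cchart, extChartAt_coe, Function.comp]
  erw [hom_chart]
  simp only [ContinuousLinearMap.inCoordinates]
  erw [← TangentBundle.symmL_trivializationAt hp]
  simp
  rfl

theorem range_cotModel : range (cotModel I) = range I ×ˢ (univ : Set (E →L[ℝ] ℝ)) := by
  rw [modelWithCorners_prod_coe, range_prodMap]; simp

/-- The fibre part is unrestricted, so the target of a chart is stable under dilations. -/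
theorem cchart_target (p : Cotangent I M) :
    (cchart p).target = (extChartAt I p.proj).target ×ˢ (univ : Set (E →L[ℝ] ℝ)) := by
  rw [cchart, FiberBundle.extChartAt_target]
  simp only [hom_trivializationAt_baseSet, TangentBundle.trivializationAt_baseSet,
    Bundle.Trivial.fiberBundle_trivializationAt', Bundle.Trivial.trivialization_baseSet, inter_univ]
  congr 1
  refine inter_eq_left.2 fun x hx => ?_
  have := (extChartAt I p.proj).map_target hx
  rwa [extChartAt_source] at this

/-- In particular a covector and its dilates have the same preferred chart, which makes the
derivative of a dilation computable in a single chart. -/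
theorem cchart_congr {p₀ p₁ : Cotangent I M} (h : p₀.proj = p₁.proj) :
    cchart p₀ = cchart p₁ := by
  rw [cchart, cchart, FiberBundle.extChartAt, FiberBundle.extChartAt, h]

theorem cchart_snd_eq_zero_iff {p₀ p : Cotangent I M} (hp : p ∈ (cchart p₀).source) :
    (cchart p₀ p).2 = 0 ↔ p.snd = 0 := by
  have hp' : p.proj ∈ (extChartAt I p₀.proj).source := by
    rw [extChartAt_source]; exact mem_cchart_source.1 hp
  constructor
  · intro h
    ext e
    have h1 := cchart_snd p₀ p hp (mfderiv I 𝓘(ℝ, E) (extChartAt I p₀.proj) p.proj e)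
    rw [h] at h1
    have h2 := congrArg (fun L => L e)
      (mfderivWithin_extChartAt_symm_comp_mfderiv_extChartAt' (I := I) hp')
    erw [ContinuousLinearMap.comp_apply] at h2
    erw [h2] at h1
    exact h1.symm
  · intro h
    ext e
    rw [cchart_snd p₀ p hp, h]
    rfl

theorem proj_contMDiff : ContMDiff (cotModel I) I ∞
    (fun p : Cotangent I M => p.proj) :=
  Bundle.contMDiff_proj _

theorem mfderiv_proj (p : Cotangent I M) (v : TangentSpace (cotModel I) p) :
    mfderiv (cotModel I) I (fun p : Cotangent I M => p.proj) p v =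
      (show E × (E →L[ℝ] ℝ) from v).1 := by
  rw [MDifferentiableAt.mfderiv (proj_contMDiff.mdifferentiableAt (by simp))]
  have h1 : fderivWithin ℝ (Prod.fst : E × (E →L[ℝ] ℝ) → E) (range (cotModel I)) (cchart p p)
      = ContinuousLinearMap.fst ℝ E (E →L[ℝ] ℝ) :=
    fderivWithin_fst ((cotModel I).uniqueDiffOn _ (extChartAt_target_subset_range p (mem_extChartAt_target p)))
  have h2 : fderivWithin ℝ (writtenInExtChartAt (cotModel I) I p (fun p : Cotangent I M => p.proj))
      (range (cotModel I)) (cchart p p) = fderivWithin ℝ (Prod.fst : E × (E →L[ℝ] ℝ) → E) (range (cotModel I)) (cchart p p) := by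
    refine Filter.EventuallyEq.fderivWithin_eq ?_ ?_
    · filter_upwards [extChartAt_target_mem_nhdsWithin (I := cotModel I) p] with w hw
      simp only [writtenInExtChartAt, Function.comp]
      rw [← cchart_fst, (cchart p).right_inv hw]
    · simp only [writtenInExtChartAt, Function.comp]
      rw [← cchart_fst, (cchart p).right_inv (mem_extChartAt_target p)]
  erw [h2, h1]
  rfl

theorem mdifferentiableAt_cchart {p₀ p : Cotangent I M} (hp : p ∈ (cchart p₀).source) :
    MDifferentiableAt (cotModel I) 𝓘(ℝ, E × (E →L[ℝ] ℝ)) (cchart p₀) p :=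
  mdifferentiableAt_extChartAt (by rwa [extChartAt_source] at hp)

/-- The derivative at `p` of the preferred chart at `p₀`. -/
def dchart (p₀ p : Cotangent I M) : (E × (E →L[ℝ] ℝ)) →L[ℝ] (E × (E →L[ℝ] ℝ)) :=
  mfderiv (cotModel I) 𝓘(ℝ, E × (E →L[ℝ] ℝ)) (cchart p₀) p

theorem dchart_fst {p₀ p : Cotangent I M} (hp : p ∈ (cchart p₀).source) (v : E × (E →L[ℝ] ℝ)) :
    (dchart p₀ p v).1 = mfderiv I 𝓘(ℝ, E) (extChartAt I p₀.proj) p.proj v.1 := by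
  have hp' : p.proj ∈ (chartAt A p₀.proj).source := mem_cchart_source.1 hp
  have h1 : HasMFDerivAt (cotModel I) 𝓘(ℝ, E) (fun p' => (cchart p₀ p').1) p
      ((ContinuousLinearMap.fst ℝ E (E →L[ℝ] ℝ)).comp (dchart p₀ p)) :=
    HasMFDerivAt.comp (I' := 𝓘(ℝ, E × (E →L[ℝ] ℝ))) p
      (g := (Prod.fst : E × (E →L[ℝ] ℝ) → E))
      (hasFDerivAt_fst.hasMFDerivAt) (mdifferentiableAt_cchart hp).hasMFDerivAt
  have h2 : HasMFDerivAt (cotModel I) 𝓘(ℝ, E) (fun p' : Cotangent I M =>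
      extChartAt I p₀.proj p'.proj) p
      ((mfderiv I 𝓘(ℝ, E) (extChartAt I p₀.proj) p.proj).comp
        (mfderiv (cotModel I) I (fun p : Cotangent I M => p.proj) p)) :=
    HasMFDerivAt.comp (I' := I) p (mdifferentiableAt_extChartAt hp').hasMFDerivAt
      (proj_contMDiff.mdifferentiableAt (by simp)).hasMFDerivAt
  rw [funext (cchart_fst p₀)] at h1
  have h3 := congrArg (fun L => L v) (hasMFDerivAt_unique h1 h2)
  refine h3.trans ?_
  erw [ContinuousLinearMap.comp_apply, mfderiv_proj]

/-- Invariance of the Liouville form `ξ dx`. -/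
theorem cchart_liouville {p₀ p : Cotangent I M} (hp : p ∈ (cchart p₀).source)
    (v : E × (E →L[ℝ] ℝ)) : (cchart p₀ p).2 (dchart p₀ p v).1 = p.snd v.1 := by
  have hp' : p.proj ∈ (extChartAt I p₀.proj).source := by
    rw [extChartAt_source]; exact mem_cchart_source.1 hp
  rw [cchart_snd p₀ p hp, dchart_fst hp]
  congr 1
  have := mfderivWithin_extChartAt_symm_comp_mfderiv_extChartAt' (I := I) hp'
  exact congrArg (fun L => L v.1) this

theorem dchart_self (p : Cotangent I M) : dchart p p = ContinuousLinearMap.id ℝ _ :=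
  mfderiv_extChartAt_self (I := cotModel I) (x := p)

theorem dchart_surjective {p₀ p : Cotangent I M} (hp : p ∈ (cchart p₀).source) :
    Function.Surjective (dchart p₀ p) := by
  obtain ⟨e, he⟩ := isInvertible_mfderiv_extChartAt (I := cotModel I) hp
  intro w
  refine ⟨e.symm w, ?_⟩
  have := congrArg (fun L => L (e.symm w)) he
  exact this.symm.trans (e.apply_symm_apply w)

/-- The differential of `f` at `p`, computed in the preferred chart at `p₀`. -/
theorem fderivWithin_cchart_symm {F : Type*} [NormedAddCommGroup F] [NormedSpace ℝ F]
    {f : Cotangent I M → F} {p₀ p : Cotangent I M} (hp : p ∈ (cchart p₀).source)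
    (hf : MDifferentiableAt (cotModel I) 𝓘(ℝ, F) f p) (v : E × (E →L[ℝ] ℝ)) :
    fderivWithin ℝ (f ∘ (cchart p₀).symm) (range (cotModel I)) (cchart p₀ p) (dchart p₀ p v) =
      mfderiv (cotModel I) 𝓘(ℝ, F) f p v := by
  obtain ⟨y, hy, rfl⟩ : ∃ y ∈ (cchart p₀).target, (cchart p₀).symm y = p :=
    ⟨_, (cchart p₀).map_source hp, (cchart p₀).left_inv hp⟩
  rw [(cchart p₀).right_inv hy]
  have hU : UniqueDiffWithinAt ℝ (range (cotModel I)) y :=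
    (cotModel I).uniqueDiffOn _ (extChartAt_target_subset_range p₀ hy)
  have h1 : HasMFDerivWithinAt 𝓘(ℝ, E × (E →L[ℝ] ℝ)) (cotModel I) (cchart p₀).symm
      (range (cotModel I)) y _ := (mdifferentiableWithinAt_extChartAt_symm hy).hasMFDerivWithinAt
  have h2 := HasMFDerivAt.comp_hasMFDerivWithinAt y hf.hasMFDerivAt h1
  have h4 : HasFDerivWithinAt (f ∘ (cchart p₀).symm)
      ((show (E × (E →L[ℝ] ℝ)) →L[ℝ] F from mfderiv (cotModel I) 𝓘(ℝ, F) f ((cchart p₀).symm y)).comp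
        (show (E × (E →L[ℝ] ℝ)) →L[ℝ] (E × (E →L[ℝ] ℝ)) from mfderivWithin 𝓘(ℝ, E × (E →L[ℝ] ℝ))
          (cotModel I) (cchart p₀).symm (range (cotModel I)) y)) (range (cotModel I)) y :=
    h2.hasFDerivWithinAt
  rw [h4.fderivWithin hU]
  have h3 := congrArg (fun L => L v)
    (mfderivWithin_extChartAt_symm_comp_mfderiv_extChartAt (I := cotModel I) hy)
  exact congrArg (mfderiv (cotModel I) 𝓘(ℝ, F) f ((cchart p₀).symm y)) h3

/-- Second derivatives within the range of the model are symmetric at such points, including those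
over the boundary. -/
theorem mem_closure_interior_range {p₀ : Cotangent I M} {y : E × (E →L[ℝ] ℝ)}
    (hy : y ∈ (cchart p₀).target) : y ∈ closure (interior (range (cotModel I))) :=
  (cotModel I).range_subset_closure_interior (extChartAt_target_subset_range p₀ hy)

end Charts

/-! ### Exterior derivative of the Liouville form and invariance of the symplectic form -/

section Symplectic

variable {D E F : Type*} [NormedAddCommGroup D] [NormedSpace ℝ D] [NormedAddCommGroup E]
  [NormedSpace ℝ E]

/-- If the pullback `g · Df` of the Liouville form is the one-form `Θ` near `x`, then the pullback of
its differential at `x` is the differential of `Θ`. -/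
theorem liouville_differential {s : Set D} {x : D} {f : D → E} {g : D → E →L[ℝ] ℝ}
    {Θ : D → D →L[ℝ] ℝ} {g' : D →L[ℝ] E →L[ℝ] ℝ} {Θ' : D →L[ℝ] D →L[ℝ] ℝ}
    (hs : UniqueDiffOn ℝ s) (hx : x ∈ s) (hxi : x ∈ closure (interior s))
    (hf : ContDiffWithinAt ℝ 2 f s x) (hg : HasFDerivWithinAt g g' s x)
    (hΘ : HasFDerivWithinAt Θ Θ' s x)
    (h : ∀ᶠ y in 𝓝[s] x, ∀ u, g y (fderivWithin ℝ f s y u) = Θ y u) (u v : D) :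
    g' u (fderivWithin ℝ f s x v) - g' v (fderivWithin ℝ f s x u) = Θ' u v - Θ' v u := by
  have hf' : DifferentiableWithinAt ℝ (fderivWithin ℝ f s) s x :=
    (hf.fderivWithin_right hs (m := 1) (by norm_num) hx).differentiableWithinAt (by simp)
  have h1 := hg.clm_comp hf'.hasFDerivWithinAt
  have h2 : HasFDerivWithinAt (fun y => (g y).comp (fderivWithin ℝ f s y)) Θ' s x := by
    refine hΘ.congr_of_eventuallyEq ?_ ?_
    · filter_upwards [h] with y hy
      ext u
      exact hy u
    · ext u
      exact h.self_of_nhdsWithin hx u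
  have h3 := (hs x hx).eq h1 h2
  have hsymm := hf.isSymmSndFDerivWithinAt (by simp) hs hxi hx
  have huv := congrArg (fun L => L u v) h3
  have hvu := congrArg (fun L => L v u) h3
  have h4 := hsymm u v
  simp only [add_apply, ContinuousLinearMap.comp_apply,
    ContinuousLinearMap.compL_apply, ContinuousLinearMap.flip_apply] at huv hvu
  rw [← huv, ← hvu, h4]
  ring

end Symplectic

section SympInvariance

variable {E : Type*} [NormedAddCommGroup E] [NormedSpace ℝ E] {A : Type*}
  [TopologicalSpace A] {I : ModelWithCorners ℝ E A} {M : Type*} [TopologicalSpace M]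
  [ChartedSpace A M] [IsManifold I ∞ M]

/-- The standard symplectic form of `E × E*`. -/
def sympE (v w : E × (E →L[ℝ] ℝ)) : ℝ := v.2 w.1 - w.2 v.1

/-- The Liouville form of `E × E*`. -/
def liouE : (E × (E →L[ℝ] ℝ)) →L[ℝ] (E × (E →L[ℝ] ℝ)) →L[ℝ] ℝ :=
  ((ContinuousLinearMap.compL ℝ (E × (E →L[ℝ] ℝ)) E ℝ).flip (ContinuousLinearMap.fst ℝ _ _)).comp
    (ContinuousLinearMap.snd ℝ _ _)

theorem hasFDerivWithinAt_liouE {s : Set (E × (E →L[ℝ] ℝ))} {x : E × (E →L[ℝ] ℝ)} :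
    HasFDerivWithinAt (fun y : E × (E →L[ℝ] ℝ) => liouE y) liouE s x :=
  ContinuousLinearMap.hasFDerivWithinAt (𝕜 := ℝ) (E := E × (E →L[ℝ] ℝ))
    (F := (E × (E →L[ℝ] ℝ)) →L[ℝ] ℝ) liouE

theorem contDiffWithinAt_cchart_transition {p₀ p : Cotangent I M} (hp : p ∈ (cchart p₀).source) :
    ContDiffWithinAt ℝ ∞ (cchart p₀ ∘ (cchart p).symm) (range (cotModel I)) (cchart p p) := by
  have := contDiffWithinAt_ext_coord_change (I := cotModel I) (n := ∞) p₀ p (y := cchart p p)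
    (by
      rw [PartialEquiv.trans_source, PartialEquiv.symm_source]
      refine ⟨mem_extChartAt_target p, ?_⟩
      rw [mem_preimage, (cchart p).left_inv (mem_extChartAt_source p)]
      exact hp)
  exact this

/-- Invariance of the symplectic form. -/
theorem sympE_dchart {p₀ p : Cotangent I M} (hp : p ∈ (cchart p₀).source)
    (v w : E × (E →L[ℝ] ℝ)) : sympE (dchart p₀ p v) (dchart p₀ p w) = symp p v w := by
  have hs := (cotModel I).uniqueDiffOn
  have hx : cchart p p ∈ range (cotModel I) :=
    extChartAt_target_subset_range p (mem_extChartAt_target p)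
  have hC := contDiffWithinAt_cchart_transition hp
  set τ := cchart p₀ ∘ (cchart p).symm with hτ
  have hder : ∀ y ∈ (cchart p).target, (cchart p).symm y ∈ (cchart p₀).source →
      ∀ v, fderivWithin ℝ τ (range (cotModel I)) y (dchart p ((cchart p).symm y) v) =
        dchart p₀ ((cchart p).symm y) v := by
    intro y hy hy' v
    have := fderivWithin_cchart_symm ((cchart p).map_target hy) (mdifferentiableAt_cchart hy') v
    rwa [(cchart p).right_inv hy] at this
  have hcont : ContinuousWithinAt (cchart p).symm (range (cotModel I)) (cchart p p) :=
    (continuousAt_extChartAt_symm p).continuousWithinAt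
  have hev : ∀ᶠ y in 𝓝[range (cotModel I)] (cchart p p), y ∈ (cchart p).target ∧
      (cchart p).symm y ∈ (cchart p₀).source := by
    refine Filter.Eventually.and (extChartAt_target_mem_nhdsWithin p) ?_
    refine hcont (?_ : (cchart p₀).source ∈ _)
    rw [(cchart p).left_inv (mem_extChartAt_source p)]
    exact extChartAt_source_mem_nhds' hp
  have hdiff : DifferentiableWithinAt ℝ τ (range (cotModel I)) (cchart p p) :=
    hC.differentiableWithinAt (by simp)
  -- The transition map between two charts preserves ξ dx, by `cchart_liouville` in both charts;
  -- taking differentials gives the symplectic form.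
  have key := liouville_differential (f := fun y => (τ y).1) (g := fun y => (τ y).2)
    (Θ := fun y => liouE y) (Θ' := liouE) hs hx
    (mem_closure_interior_range (mem_extChartAt_target p))
    (hC.of_le (by norm_cast)).fst (hdiff.hasFDerivWithinAt.snd)
    hasFDerivWithinAt_liouE ?_ v w
  · rw [hdiff.hasFDerivWithinAt.fst.fderivWithin (hs _ hx)] at key
    have h1 : ∀ v, fderivWithin ℝ τ (range (cotModel I)) (cchart p p) v = dchart p₀ p v := by
      intro v
      have h := hder _ (mem_extChartAt_target p)
      rw [(cchart p).left_inv (mem_extChartAt_source p)] at h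
      have h := h hp v
      rwa [dchart_self] at h
    simp only [ContinuousLinearMap.comp_apply, h1] at key
    exact key
  · have hC1 : ∀ᶠ y in 𝓝[range (cotModel I)] (cchart p p),
        DifferentiableWithinAt ℝ τ (range (cotModel I)) y := by
      have h := (hC.of_le (m := 1) (by norm_cast)).eventually (by simp)
      rw [insert_eq_of_mem hx] at h
      filter_upwards [h] with y hy using hy.differentiableWithinAt (by simp)
    filter_upwards [hev, hC1, self_mem_nhdsWithin] with y hy hyd hyr u
    obtain ⟨v, rfl⟩ := dchart_surjective ((cchart p).map_target hy.1) u
    rw [hyd.hasFDerivWithinAt.fst.fderivWithin (hs _ hyr)]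
    simp only [ContinuousLinearMap.comp_apply]
    rw [hder y hy.1 hy.2]
    have h1 := cchart_liouville hy.2 v
    have h2 := cchart_liouville ((cchart p).map_target hy.1) v
    rw [(cchart p).right_inv hy.1] at h2
    exact h1.trans h2.symm

end SympInvariance
end
end ZeroEnergy

namespace ZeroEnergy
noncomputable section

/-! ### Hamiltonian vector fields in charts -/

section SympIso
variable {E : Type*} [NormedAddCommGroup E] [NormedSpace ℝ E]

/-- Vectors (e, 0) test the fibre part and vectors (0, g) the base part; continuous functionals
separate points, so no finite dimension is needed. -/
theorem eq_zero_of_sympE_eq_zero {X : E × (E →L[ℝ] ℝ)} (h : ∀ w, sympE w X = 0) : X = 0 := by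
  have h1 : X.2 = 0 := by
    ext e
    simpa [sympE] using h (e, 0)
  have h2 : X.1 = 0 := by
    refine SeparatingDual.eq_zero_of_forall_dual_eq_zero (R := ℝ) fun g => ?_
    simpa [sympE] using h (0, g)
  exact Prod.ext h2 h1

theorem sympE_sub_right (v w w' : E × (E →L[ℝ] ℝ)) :
    sympE v (w - w') = sympE v w - sympE v w' := by
  simp only [sympE, Prod.fst_sub, Prod.snd_sub, map_sub, sub_apply]
  ring

theorem sympE_swap (v w : E × (E →L[ℝ] ℝ)) : sympE v w = - sympE w v := by
  simp [sympE]

/-- Nondegeneracy is injectivity, and a finite-dimensional space has the dimension of its dual. -/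
theorem exists_dualEquiv {W : Type*} [NormedAddCommGroup W] [NormedSpace ℝ W]
    [FiniteDimensional ℝ W] (b : W →L[ℝ] W →L[ℝ] ℝ)
    (hb : ∀ X, (∀ w, b w X - b X w = 0) → X = 0) :
    ∃ e : W ≃L[ℝ] (W →L[ℝ] ℝ), ∀ X w, e X w = b w X - b X w := by
  have hinj : Function.Injective (b.flip - b).toLinearMap := by
    rw [← LinearMap.ker_eq_bot, LinearMap.ker_eq_bot']
    intro X hX
    exact hb X fun w => congrArg (fun L => L w) hX
  have hdim : Module.finrank ℝ W = Module.finrank ℝ (W →L[ℝ] ℝ) := by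
    rw [← LinearEquiv.finrank_eq (LinearMap.toContinuousLinearMap (𝕜 := ℝ) (E := W) (F' := ℝ))]
    exact (Subspace.dual_finrank_eq (K := ℝ)).symm
  exact ⟨(LinearMap.linearEquivOfInjective _ hinj hdim).toContinuousLinearEquiv, fun X w => rfl⟩

variable [FiniteDimensional ℝ E]

theorem exists_sympIso : ∃ e : (E × (E →L[ℝ] ℝ)) ≃L[ℝ] ((E × (E →L[ℝ] ℝ)) →L[ℝ] ℝ),
    ∀ X w, e X w = sympE w X :=
  exists_dualEquiv (W := E × (E →L[ℝ] ℝ)) liouE fun _ h => eq_zero_of_sympE_eq_zero h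

/-- The isomorphism `X ↦ σ(·, X)` of `E × E*` with its dual. -/
def sympIso : (E × (E →L[ℝ] ℝ)) ≃L[ℝ] ((E × (E →L[ℝ] ℝ)) →L[ℝ] ℝ) :=
  exists_sympIso.choose

theorem sympIso_apply (X w : E × (E →L[ℝ] ℝ)) : sympIso X w = sympE w X :=
  exists_sympIso.choose_spec X w

theorem sympE_sympIso_symm (l : (E × (E →L[ℝ] ℝ)) →L[ℝ] ℝ) (w : E × (E →L[ℝ] ℝ)) :
    sympE w (sympIso.symm l) = l w := by
  rw [← sympIso_apply, ContinuousLinearEquiv.apply_symm_apply]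

theorem eq_sympIso_symm {l : (E × (E →L[ℝ] ℝ)) →L[ℝ] ℝ} {X : E × (E →L[ℝ] ℝ)}
    (h : ∀ w, sympE w X = l w) : X = sympIso.symm l := by
  rw [ContinuousLinearEquiv.eq_symm_apply]
  refine ContinuousLinearMap.ext fun w => ?_
  rw [sympIso_apply]
  exact h w

end SympIso

section Curves

variable {W : Type*} [NormedAddCommGroup W] [NormedSpace ℝ W] {A' : Type*} [TopologicalSpace A']
  {J : ModelWithCorners ℝ W A'} {N : Type*} [TopologicalSpace N] [ChartedSpace A' N]
  {F : Type*} [NormedAddCommGroup F] [NormedSpace ℝ F]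

theorem hasDerivWithinAt_comp_of_hasMFDerivAt {γ : ℝ → N} {s : Set ℝ} {t : ℝ} {f : N → F}
    {X : TangentSpace J (γ t)} {L : TangentSpace J (γ t) →L[ℝ] F}
    (hf : HasMFDerivAt J 𝓘(ℝ, F) f (γ t) L)
    (hγ : HasMFDerivWithinAt 𝓘(ℝ, ℝ) J γ s t ((1 : ℝ →L[ℝ] ℝ).smulRight X)) :
    HasDerivWithinAt (fun t => f (γ t)) (L X) s t := by
  have h1 := (HasMFDerivAt.comp_hasMFDerivWithinAt t hf hγ).hasFDerivWithinAt
  have h2 : HasFDerivWithinAt (fun t => f (γ t)) ((1 : ℝ →L[ℝ] ℝ).smulRight (L X)) s t := by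
    refine HasFDerivWithinAt.congr_fderiv h1 ?_
    ext
    change L ((1 : ℝ) • X) = (1 : ℝ) • L X
    rw [one_smul, one_smul]
  simpa using h2.hasDerivWithinAt

theorem hasMFDerivWithinAt_comp_hasDerivWithinAt {γ : ℝ → N} {a : ℝ → ℝ} {s s' : Set ℝ} {t a' : ℝ}
    {X : TangentSpace J (γ (a t))} (ha : HasDerivWithinAt a a' s' t) (hs : MapsTo a s' s)
    (hγ : HasMFDerivWithinAt 𝓘(ℝ, ℝ) J γ s (a t) ((1 : ℝ →L[ℝ] ℝ).smulRight X)) :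
    HasMFDerivWithinAt 𝓘(ℝ, ℝ) J (fun t => γ (a t)) s' t
      ((1 : ℝ →L[ℝ] ℝ).smulRight (a' • X)) := by
  have h1 := HasMFDerivWithinAt.comp t hγ ha.hasFDerivWithinAt.hasMFDerivWithinAt hs
  refine HasMFDerivWithinAt.congr_mfderiv h1 ?_
  ext
  change ((1 : ℝ) • a') • X = (1 : ℝ) • (a' • X)
  simp

end Curves

section HamField
variable {E : Type*} [NormedAddCommGroup E] [NormedSpace ℝ E] {A : Type*}
  [TopologicalSpace A] {I : ModelWithCorners ℝ E A} {M : Type*} [TopologicalSpace M]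
  [ChartedSpace A M] [IsManifold I ∞ M]

theorem isOpen_nonzero : IsOpen {p : Cotangent I M | p.snd ≠ 0} := by
  rw [isOpen_iff_mem_nhds]
  intro p hp
  have h1 : ContinuousAt (fun p' => (cchart p p').2) p :=
    continuous_snd.continuousAt.comp (continuousAt_extChartAt p)
  have h2 : (cchart p p).2 ≠ 0 := fun h =>
    hp ((cchart_snd_eq_zero_iff (mem_extChartAt_source p)).1 h)
  filter_upwards [h1.eventually_ne h2, extChartAt_source_mem_nhds (I := cotModel I) p] with p' h3 h4 h5
  exact h3 ((cchart_snd_eq_zero_iff h4).2 h5)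

theorem IsHamiltonian.contMDiffAt {H : Cotangent I M → ℝ} (hH : IsHamiltonian H)
    {p : Cotangent I M} (hp : p.snd ≠ 0) : ContMDiffAt (cotModel I) 𝓘(ℝ, ℝ) ∞ H p :=
  hH.smooth.contMDiffAt (isOpen_nonzero.mem_nhds hp)

theorem IsHamiltonian.mdifferentiableAt {H : Cotangent I M → ℝ} (hH : IsHamiltonian H)
    {p : Cotangent I M} (hp : p.snd ≠ 0) : MDifferentiableAt (cotModel I) 𝓘(ℝ, ℝ) H p :=
  (hH.contMDiffAt hp).mdifferentiableAt (by simp)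

theorem IsHamVec.unique {H : Cotangent I M → ℝ} {p : Cotangent I M}
    {X Y : TangentSpace (cotModel I) p} (hX : IsHamVec H p X) (hY : IsHamVec H p Y) : X = Y := by
  have h0 : (show E × (E →L[ℝ] ℝ) from X) - (show E × (E →L[ℝ] ℝ) from Y) = 0 :=
    eq_zero_of_sympE_eq_zero fun w => by
      rw [sympE_sub_right, sub_eq_zero]
      exact (hX.2 w).trans (hY.2 w).symm
  exact sub_eq_zero.1 h0

theorem IsHamVec.dFun_self {H : Cotangent I M → ℝ} {p : Cotangent I M}
    {X : TangentSpace (cotModel I) p} (hX : IsHamVec H p X) : dFun H p X = 0 := by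
  rw [← hX.2 X, symp, sub_self]

theorem IsHamVec.ne_zero {H : Cotangent I M → ℝ} {p : Cotangent I M}
    {X : TangentSpace (cotModel I) p} (hH : IsHamiltonian H) (h0 : H p = 0)
    (hX : IsHamVec H p X) : X ≠ 0 := by
  rintro rfl
  obtain ⟨w, hw⟩ := hH.nondegenerate p hX.1 h0
  refine hw ?_
  rw [← hX.2 w]
  change (show E × (E →L[ℝ] ℝ) from w).2 (0 : E) - (0 : E →L[ℝ] ℝ) _ = 0
  simp

theorem contDiffWithinAt_symm_cchart {H : Cotangent I M → ℝ} (hH : IsHamiltonian H)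
    {p₀ : Cotangent I M} {w : E × (E →L[ℝ] ℝ)} (hw : w ∈ (cchart p₀).target) (hw2 : w.2 ≠ 0) :
    ContDiffWithinAt ℝ ∞ (H ∘ (cchart p₀).symm) (range (cotModel I)) w := by
  have hs : (cchart p₀).symm w ∈ (cchart p₀).source := (cchart p₀).map_target hw
  have hne : ((cchart p₀).symm w).snd ≠ 0 := by
    intro h
    apply hw2
    rw [← (cchart_snd_eq_zero_iff hs), (cchart p₀).right_inv hw] at h
    exact h
  have h1 : ContMDiffWithinAt 𝓘(ℝ, E × (E →L[ℝ] ℝ)) (cotModel I) ∞ (cchart p₀).symm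
      (range (cotModel I)) w := contMDiffWithinAt_extChartAt_symm_range p₀ hw
  exact ((hH.contMDiffAt hne).comp_contMDiffWithinAt w h1).contDiffWithinAt

variable [FiniteDimensional ℝ E]

theorem exists_isHamVec (H : Cotangent I M → ℝ) {p : Cotangent I M} (hp : p.snd ≠ 0) :
    ∃ X, IsHamVec H p X :=
  ⟨sympIso.symm (show (E × (E →L[ℝ] ℝ)) →L[ℝ] ℝ from mfderiv (cotModel I) 𝓘(ℝ, ℝ) H p), hp,
    fun w => sympE_sympIso_symm _ w⟩

/-- The Hamiltonian vector field of `H` in the preferred chart at `p₀`. -/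
def hamField (H : Cotangent I M → ℝ) (p₀ : Cotangent I M) (w : E × (E →L[ℝ] ℝ)) :
    E × (E →L[ℝ] ℝ) :=
  sympIso.symm (fderivWithin ℝ (H ∘ (cchart p₀).symm) (range (cotModel I)) w)

/-- Both σ and dH are independent of the chart, so the vector defined by σ(w, X) = dH(w) in the
preferred chart at `p` is carried to the one defined in the chart at `p₀`. -/
theorem dchart_isHamVec {H : Cotangent I M → ℝ} (hH : IsHamiltonian H) {p₀ p : Cotangent I M}
    (hp : p ∈ (cchart p₀).source) {X : TangentSpace (cotModel I) p} (hX : IsHamVec H p X) :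
    dchart p₀ p X = hamField H p₀ (cchart p₀ p) := by
  refine eq_sympIso_symm fun w => ?_
  obtain ⟨v, rfl⟩ := dchart_surjective hp w
  rw [fderivWithin_cchart_symm hp (hH.mdifferentiableAt hX.1)]
  exact (sympE_dchart hp v X).trans (hX.2 v)

theorem contDiffOn_hamField {H : Cotangent I M → ℝ} (hH : IsHamiltonian H) (p₀ : Cotangent I M) :
    ContDiffOn ℝ ∞ (hamField H p₀) ((cchart p₀).target ∩ {w | w.2 ≠ 0}) := by
  intro w hw
  have h1 := (contDiffWithinAt_symm_cchart hH hw.1 hw.2).fderivWithin_right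
    (cotModel I).uniqueDiffOn (m := ∞) (by simp) (extChartAt_target_subset_range p₀ hw.1)
  have h2 : ContDiffWithinAt ℝ ∞ (hamField H p₀) (range (cotModel I)) w :=
    ContDiffAt.comp_contDiffWithinAt w (g := fun l => sympIso.symm l)
      (ContinuousLinearEquiv.contDiff (𝕜 := ℝ) (E := (E × (E →L[ℝ] ℝ)) →L[ℝ] ℝ)
        (F := E × (E →L[ℝ] ℝ)) sympIso.symm).contDiffAt h1
  exact h2.mono (inter_subset_left.trans (extChartAt_target_subset_range p₀))

/-- In the preferred chart at `p₀`, a bicharacteristic is an integral curve of `hamField H p₀`. -/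
theorem hasDerivWithinAt_cchart_comp {H : Cotangent I M → ℝ} (hH : IsHamiltonian H)
    {p₀ : Cotangent I M} {γ : ℝ → Cotangent I M} {s : Set ℝ}
    (hγ : IsIntegralCurve (IsHamVec H) γ s) {t : ℝ} (ht : t ∈ s)
    (hp : γ t ∈ (cchart p₀).source) :
    HasDerivWithinAt (fun t => cchart p₀ (γ t)) (hamField H p₀ (cchart p₀ (γ t))) s t := by
  obtain ⟨X, hX, hd⟩ := hγ t ht
  rw [← dchart_isHamVec hH hp hX]
  exact hasDerivWithinAt_comp_of_hasMFDerivAt (mdifferentiableAt_cchart hp).hasMFDerivAt hd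

/-- Around a nonzero covector there is a compact convex set of coordinates. -/
theorem exists_box (p₀ : Cotangent I M) (hp₀ : p₀.snd ≠ 0) :
    ∃ K : Set (E × (E →L[ℝ] ℝ)), IsCompact K ∧ Convex ℝ K ∧ (interior K).Nonempty ∧
      K ∈ 𝓝[range (cotModel I)] (cchart p₀ p₀) ∧ K ⊆ (cchart p₀).target ∩ {w | w.2 ≠ 0} := by
  have h1 : (cchart p₀).target ∩ {w | w.2 ≠ 0} ∈ 𝓝[range (cotModel I)] (cchart p₀ p₀) := by
    refine inter_mem (extChartAt_target_mem_nhdsWithin p₀) (mem_nhdsWithin_of_mem_nhds ?_)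
    refine (isOpen_ne.preimage continuous_snd).mem_nhds ?_
    exact fun h => hp₀ ((cchart_snd_eq_zero_iff (mem_extChartAt_source p₀)).1 h)
  obtain ⟨r, hr, hr'⟩ := Metric.mem_nhdsWithin_iff.1 h1
  refine ⟨Metric.closedBall (cchart p₀ p₀) (r / 2) ∩ range (cotModel I), ?_, ?_, ?_, ?_, ?_⟩
  · exact (isCompact_closedBall _ _).inter_right (cotModel I).isClosed_range
  · exact (convex_closedBall _ _).inter (cotModel I).convex_range
  -- Over the boundary the centre lies on the edge of the half space; interior points of the box
  -- come from the closure of the interior of the range.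
  · rw [interior_inter]
    obtain ⟨y, hy⟩ := mem_closure_iff_nhds.1
      (mem_closure_interior_range (mem_extChartAt_target p₀)) _
      (Metric.ball_mem_nhds (cchart p₀ p₀) (half_pos hr))
    exact ⟨y, Metric.ball_subset_interior_closedBall hy.1, hy.2⟩
  · exact inter_mem (mem_nhdsWithin_of_mem_nhds (Metric.closedBall_mem_nhds _ (half_pos hr)))
      self_mem_nhdsWithin
  · refine (inter_subset_inter_left _ ?_).trans hr'
    exact Metric.closedBall_subset_ball (by linarith)

end HamField
end
end ZeroEnergy

namespace ZeroEnergy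
noncomputable section

/-! ### Linear differential equations and Lipschitz estimates -/

section LinearODE

variable {V : Type*} [NormedAddCommGroup V] [NormedSpace ℝ V]

/-- Concatenation of solutions. The derivative within the union is checked on each interval
separately; on the interval that does not contain `t` there is nothing to check, since it is closed.
-/
theorem hasDerivWithinAt_ite_Icc {x y : ℝ → V} {x' y' : ℝ → V} {a b c : ℝ} (hab : a ≤ b)
    (hbc : b ≤ c) (hx : ∀ t ∈ Icc a b, HasDerivWithinAt x (x' t) (Icc a b) t)
    (hy : ∀ t ∈ Icc b c, HasDerivWithinAt y (y' t) (Icc b c) t) (h : x b = y b) (h' : x' b = y' b)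
    {t : ℝ} (ht : t ∈ Icc a c) :
    HasDerivWithinAt (fun t => if t ≤ b then x t else y t) (if t ≤ b then x' t else y' t)
      (Icc a c) t := by
  rw [← Icc_union_Icc_eq_Icc hab hbc]
  refine HasDerivWithinAt.union ?_ ?_
  · by_cases htb : t ≤ b
    · rw [if_pos htb]
      exact (hx t ⟨ht.1, htb⟩).congr (fun s hs => by rw [if_pos hs.2]) (by rw [if_pos htb])
    · refine HasFDerivWithinAt.of_notMem_closure ?_
      rw [isClosed_Icc.closure_eq]
      exact fun h => htb h.2
  · by_cases hbt : b ≤ t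
    · have h1 : (if t ≤ b then x' t else y' t) = y' t := by
        split_ifs with h2
        · rw [le_antisymm h2 hbt, h']
        · rfl
      have h2 : ∀ s ∈ Icc b c, (if s ≤ b then x s else y s) = y s := by
        intro s hs
        split_ifs with h2
        · rw [le_antisymm h2 hs.1, h]
        · rfl
      rw [h1]
      exact (hy t ⟨hbt, ht.2⟩).congr h2 (h2 t ⟨hbt, ht.2⟩)
    · refine HasFDerivWithinAt.of_notMem_closure ?_
      rw [isClosed_Icc.closure_eq]
      exact fun h => hbt h.1

variable [CompleteSpace V]

/-- Picard–Lindelöf on the ball of radius ‖x₁‖ around x₁, where the field is at most 2C‖x₁‖. The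
admissible step 1/(2C) does not depend on x₁, so the steps can be chained. -/
theorem exists_linear_ODE_step {A : ℝ → V →L[ℝ] V} {b c : ℝ} (hbc : b ≤ c)
    (hA : ContinuousOn A (Icc b c)) {C : NNReal} (hC : ∀ t ∈ Icc b c, ‖A t‖ ≤ C)
    (hs : C * (c - b) ≤ 1 / 2) (x₁ : V) :
    ∃ y : ℝ → V, y b = x₁ ∧ ∀ t ∈ Icc b c, HasDerivWithinAt y (A t (y t)) (Icc b c) t := by
  have hP : IsPicardLindelof (fun t x => A t x) (⟨b, left_mem_Icc.2 hbc⟩ : Icc b c) x₁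
      ‖x₁‖₊ 0 (C * (‖x₁‖₊ + ‖x₁‖₊)) C := by
    refine ⟨fun t ht => ?_, fun x _ => ?_, fun t ht x hx => ?_, ?_⟩
    · refine LipschitzOnWith.of_dist_le_mul fun x _ y _ => ?_
      rw [dist_eq_norm, dist_eq_norm, ← map_sub]
      exact (A t).le_of_opNorm_le (hC t ht) _
    · exact hA.clm_apply continuousOn_const
    · refine ((A t).le_of_opNorm_le (hC t ht) x).trans ?_
      push_cast
      gcongr
      have : ‖x - x₁‖ ≤ ‖x₁‖ := by simpa [dist_eq_norm] using hx
      calc ‖x‖ = ‖x₁ + (x - x₁)‖ := by abel_nf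
        _ ≤ _ := (norm_add_le _ _).trans (by gcongr)
    · push_cast
      rw [max_eq_left (by simpa using hbc)]
      have : 0 ≤ ‖x₁‖ := norm_nonneg _
      nlinarith
  exact hP.exists_eq_forall_mem_Icc_hasDerivWithinAt₀

/-- Solutions of linear differential equations exist globally. -/
theorem exists_linear_ODE {A : ℝ → V →L[ℝ] V} {α β : ℝ} (hαβ : α ≤ β)
    (hA : ContinuousOn A (Icc α β)) (x₀ : V) :
    ∃ x : ℝ → V, x α = x₀ ∧ ∀ t ∈ Icc α β, HasDerivWithinAt x (A t (x t)) (Icc α β) t := by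
  obtain ⟨C', hC'⟩ := isCompact_Icc.exists_bound_of_continuousOn hA
  set C : NNReal := Real.toNNReal C' + 1 with hCdef
  have hC : ∀ t ∈ Icc α β, ‖A t‖ ≤ C := fun t ht => (hC' t ht).trans (by
    rw [hCdef]; push_cast
    exact (Real.le_coe_toNNReal C').trans (by linarith))
  have hC1 : (0 : ℝ) < C := by rw [hCdef]; positivity
  -- This is the step allowed by `exists_linear_ODE_step`, the same from every initial value.
  set δ : ℝ := 1 / (2 * C) with hδ
  have hδ0 : 0 < δ := by positivity
  have key : ∀ n : ℕ, ∀ c ∈ Icc α β, c ≤ α + n * δ →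
      ∃ x : ℝ → V, x α = x₀ ∧ ∀ t ∈ Icc α c, HasDerivWithinAt x (A t (x t)) (Icc α c) t := by
    intro n
    induction n with
    | zero =>
      intro c hc hc'
      have : c = α := le_antisymm (by simpa using hc') hc.1
      subst this
      refine ⟨fun _ => x₀, rfl, fun t ht => ?_⟩
      have : t = c := by simpa using ht
      subst this
      rw [Icc_self]
      exact HasFDerivWithinAt.singleton
    | succ n ih =>
      intro c hc hc'
      set b := max α (c - δ) with hb
      have hbc : b ≤ c := max_le hc.1 (by linarith)
      have hab : α ≤ b := le_max_left _ _
      obtain ⟨x, hx0, hx⟩ := ih b ⟨hab, hbc.trans hc.2⟩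
        (max_le (by have : (0 : ℝ) ≤ n * δ := by positivity
                    linarith) (by push_cast at hc'; linarith))
      have hsub : Icc b c ⊆ Icc α β := Icc_subset_Icc hab hc.2
      obtain ⟨y, hy0, hy⟩ := exists_linear_ODE_step hbc (hA.mono hsub) (fun t ht => hC t (hsub ht))
        (by
          have : c - b ≤ δ := by linarith [le_max_right α (c - δ)]
          calc (C : ℝ) * (c - b) ≤ C * δ := by gcongr
            _ = 1 / 2 := by rw [hδ]; field_simp) (x b)
      refine ⟨fun t => if t ≤ b then x t else y t, by simp [hab, hx0], fun t ht => ?_⟩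
      have := hasDerivWithinAt_ite_Icc hab hbc hx hy hy0.symm (by rw [hy0]) ht
      convert this using 1
      split_ifs with h <;> simp [h]
  obtain ⟨n, hn⟩ := exists_nat_ge ((β - α) / δ)
  exact key n β (right_mem_Icc.2 hαβ) (by
    rw [div_le_iff₀ hδ0] at hn
    linarith)

end LinearODE

section Flow

variable {E : Type*} [NormedAddCommGroup E] [NormedSpace ℝ E]

theorem _root_.HasDerivWithinAt.Ici_of_Icc {x : ℝ → E} {x' : E} {α β t : ℝ}
    (h : HasDerivWithinAt x x' (Icc α β) t) (ht : t ∈ Ico α β) : HasDerivWithinAt x x' (Ici t) t :=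
  (h.mono_of_mem_nhdsWithin (Icc_mem_nhdsGE_of_mem ht))

/-- The derivative is bounded by compactness, and convexity turns the bound into a Lipschitz
constant. Positivity of `C` is for the division by it in Grönwall's inequality. -/
theorem exists_lipschitz_of_contDiffOn {F : Type*} [NormedAddCommGroup F] [NormedSpace ℝ F]
    {K : Set E} {Y : E → F} (hK : IsCompact K) (hKc : Convex ℝ K)
    (hKi : (interior K).Nonempty) (hY : ContDiffOn ℝ 1 Y K) :
    ∃ C : NNReal, 0 < C ∧ (∀ x ∈ K, ‖fderivWithin ℝ Y K x‖ ≤ C) ∧ LipschitzOnWith C Y K := by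
  have hU : UniqueDiffOn ℝ K := uniqueDiffOn_convex hKc hKi
  obtain ⟨C', hC'⟩ := hK.exists_bound_of_continuousOn (hY.continuousOn_fderivWithin hU le_rfl)
  have hC : ∀ x ∈ K, ‖fderivWithin ℝ Y K x‖ ≤ (Real.toNNReal C' + 1 : NNReal) := fun x hx =>
    (hC' x hx).trans (by push_cast; exact (Real.le_coe_toNNReal C').trans (by linarith))
  refine ⟨Real.toNNReal C' + 1, by positivity, hC, ?_⟩
  exact hKc.lipschitzOnWith_of_nnnorm_fderivWithin_le (hY.differentiableOn (by simp))
    fun x hx => hC x hx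

/-- On the segment from `a` to `b` the derivative differs from that at `a` by at most C‖b - a‖;
apply the mean value inequality. -/
theorem norm_sub_sub_le_sq {K : Set E} {Y : E → E} (hKc : Convex ℝ K) {C : NNReal}
    (hY : DifferentiableOn ℝ Y K) (hC : LipschitzOnWith C (fderivWithin ℝ Y K) K) {a b : E}
    (ha : a ∈ K) (hb : b ∈ K) :
    ‖Y b - Y a - fderivWithin ℝ Y K a (b - a)‖ ≤ C * ‖b - a‖ ^ 2 := by
  have hseg : segment ℝ a b ⊆ K := hKc.segment_subset ha hb
  have := Convex.norm_image_sub_le_of_norm_hasFDerivWithin_le' (𝕜 := ℝ) (f := Y)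
    (f' := fderivWithin ℝ Y K) (φ := fderivWithin ℝ Y K a) (C := C * ‖b - a‖) (s := segment ℝ a b)
    (fun x hx => ((hY x (hseg hx)).hasFDerivWithinAt).mono hseg) (fun x hx => ?_)
    (convex_segment a b) (left_mem_segment ℝ a b) (right_mem_segment ℝ a b)
  · rw [pow_two, ← mul_assoc]
    exact this
  · refine (hC.norm_sub_le (hseg hx) ha).trans ?_
    gcongr
    exact norm_sub_le_of_mem_segment hx

end Flow
end
end ZeroEnergy

namespace ZeroEnergy
noncomputable section

/-! ### Smooth dependence of flows on parameters -/

section Flow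

universe u
variable {P : Type*} [NormedAddCommGroup P] [NormedSpace ℝ P]

/-- A curve in `K`, on the time interval `[α, β]`, integral for the vector field `Y`. -/
def IsFlowLine {E : Type*} [NormedAddCommGroup E] [NormedSpace ℝ E] (Y : E → E) (K : Set E)
    (α β : ℝ) (g : ℝ → E) : Prop :=
  (∀ t ∈ Icc α β, g t ∈ K) ∧ ∀ t ∈ Icc α β, HasDerivWithinAt g (Y (g t)) (Icc α β) t

namespace IsFlowLine

variable {E : Type*} [NormedAddCommGroup E] [NormedSpace ℝ E] {Y : E → E} {K : Set E}
  {α β : ℝ} {g g₁ : ℝ → E}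

theorem continuousOn (h : IsFlowLine Y K α β g) : ContinuousOn g (Icc α β) :=
  fun t ht => (h.2 t ht).continuousWithinAt

theorem norm_sub_le (h : IsFlowLine Y K α β g) (h₁ : IsFlowLine Y K α β g₁) {C : NNReal}
    (hC : LipschitzOnWith C Y K) {t : ℝ} (ht : t ∈ Icc α β) :
    ‖g₁ t - g t‖ ≤ Real.exp (C * (β - α)) * ‖g₁ α - g α‖ := by
  have := dist_le_of_trajectories_ODE_of_mem (v := fun _ => Y) (s := fun _ => K)
    (fun _ _ => hC) h₁.continuousOn (fun t ht => (h₁.2 t (Ico_subset_Icc_self ht)).Ici_of_Icc ht)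
    (fun t ht => h₁.1 t (Ico_subset_Icc_self ht)) h.continuousOn
    (fun t ht => (h.2 t (Ico_subset_Icc_self ht)).Ici_of_Icc ht)
    (fun t ht => h.1 t (Ico_subset_Icc_self ht)) le_rfl t ht
  rw [dist_eq_norm, dist_eq_norm, mul_comm] at this
  refine this.trans ?_
  gcongr
  exact ht.2

theorem eqOn (h : IsFlowLine Y K α β g) (h₁ : IsFlowLine Y K α β g₁) {C : NNReal}
    (hC : LipschitzOnWith C Y K) (h0 : g₁ α = g α) : EqOn g₁ g (Icc α β) := by
  intro t ht
  have := h.norm_sub_le h₁ hC ht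
  rw [h0, sub_self, norm_zero, mul_zero] at this
  exact sub_eq_zero.1 (norm_le_zero_iff.1 this)

/-- The variational equation J' = DY(g) J is linear in J, hence globally solvable; J turns out to be
the derivative of the flow in the initial value. -/
theorem exists_variation [CompleteSpace E] (h : IsFlowLine Y K α β g) (hαβ : α ≤ β)
    (hY : ContinuousOn (fderivWithin ℝ Y K) K) :
    ∃ J : ℝ → E →L[ℝ] E, J α = ContinuousLinearMap.id ℝ E ∧
      ∀ t ∈ Icc α β, HasDerivWithinAt J ((fderivWithin ℝ Y K (g t)).comp (J t)) (Icc α β) t :=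
  exists_linear_ODE (V := E →L[ℝ] E)
    (A := fun t => ContinuousLinearMap.compL ℝ E E E (fderivWithin ℝ Y K (g t))) hαβ
    ((ContinuousLinearMap.compL ℝ E E E).continuous.comp_continuousOn
      (hY.comp h.continuousOn h.1)) _

theorem norm_variation_le (h : IsFlowLine Y K α β g) {C : NNReal}
    (hC : ∀ x ∈ K, ‖fderivWithin ℝ Y K x‖ ≤ C) {J : ℝ → E →L[ℝ] E}
    (hJ0 : J α = ContinuousLinearMap.id ℝ E)
    (hJ : ∀ t ∈ Icc α β, HasDerivWithinAt J ((fderivWithin ℝ Y K (g t)).comp (J t)) (Icc α β) t)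
    {t : ℝ} (ht : t ∈ Icc α β) : ‖J t‖ ≤ Real.exp (C * (β - α)) := by
  have := norm_le_gronwallBound_of_norm_deriv_right_le (f := J) (δ := 1) (K := C) (ε := 0)
    (fun t ht => (hJ t ht).continuousWithinAt)
    (fun t ht => (hJ t (Ico_subset_Icc_self ht)).Ici_of_Icc ht)
    (by rw [hJ0]; exact ContinuousLinearMap.norm_id_le)
    (fun t ht => by
      rw [add_zero]
      refine (ContinuousLinearMap.opNorm_comp_le _ _).trans ?_
      gcongr
      exact hC _ (h.1 t (Ico_subset_Icc_self ht))) t ht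
  rw [gronwallBound_ε0, one_mul] at this
  refine this.trans ?_
  gcongr
  exact ht.2

/-- The remainder r = g₁ - g - J a vanishes initially and satisfies ‖r'‖ ≤ C‖r‖ + C₂(D‖a‖)², by the
quadratic Taylor estimate and the Lipschitz dependence of g₁ - g on a. Grönwall then gives r =
O(‖a‖²). -/
theorem norm_sub_variation_le (h : IsFlowLine Y K α β g) (h₁ : IsFlowLine Y K α β g₁)
    (hKc : Convex ℝ K) (hYd : DifferentiableOn ℝ Y K) {C C₂ : NNReal} (hC0 : 0 < C)
    (hC : ∀ x ∈ K, ‖fderivWithin ℝ Y K x‖ ≤ C) (hCL : LipschitzOnWith C Y K)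
    (hC₂ : LipschitzOnWith C₂ (fderivWithin ℝ Y K) K) {J : ℝ → E →L[ℝ] E}
    (hJ0 : J α = ContinuousLinearMap.id ℝ E)
    (hJ : ∀ t ∈ Icc α β, HasDerivWithinAt J ((fderivWithin ℝ Y K (g t)).comp (J t)) (Icc α β) t)
    {t : ℝ} (ht : t ∈ Icc α β) :
    ‖g₁ t - g t - J t (g₁ α - g α)‖ ≤
      C₂ * Real.exp (C * (β - α)) ^ 2 / C * Real.exp (C * (β - α)) * ‖g₁ α - g α‖ ^ 2 := by
  set D := Real.exp (C * (β - α)) with hD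
  set a := g₁ α - g α with ha
  have hd : ∀ t ∈ Icc α β, HasDerivWithinAt (fun t => g₁ t - g t - J t a)
      (Y (g₁ t) - Y (g t) - (fderivWithin ℝ Y K (g t)).comp (J t) a) (Icc α β) t := fun t ht =>
    ((h₁.2 t ht).sub (h.2 t ht)).sub (by
      simpa using (hJ t ht).clm_apply (hasDerivWithinAt_const t _ a))
  have hb : ∀ t ∈ Icc α β, ‖Y (g₁ t) - Y (g t) - (fderivWithin ℝ Y K (g t)).comp (J t) a‖ ≤
      C * ‖g₁ t - g t - J t a‖ + C₂ * (D * ‖a‖) ^ 2 := by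
    intro t ht
    have h1 : Y (g₁ t) - Y (g t) - (fderivWithin ℝ Y K (g t)).comp (J t) a =
        fderivWithin ℝ Y K (g t) (g₁ t - g t - J t a) +
          (Y (g₁ t) - Y (g t) - fderivWithin ℝ Y K (g t) (g₁ t - g t)) := by
      simp only [ContinuousLinearMap.comp_apply, map_sub]
      abel
    rw [h1]
    refine (norm_add_le _ _).trans (add_le_add ?_ ?_)
    · exact ContinuousLinearMap.le_of_opNorm_le _ (hC _ (h.1 t ht)) _
    · refine (norm_sub_sub_le_sq hKc hYd hC₂ (h.1 t ht) (h₁.1 t ht)).trans ?_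
      gcongr
      exact h.norm_sub_le h₁ hCL ht
  have := norm_le_gronwallBound_of_norm_deriv_right_le (δ := 0) (K := C)
    (fun t ht => (hd t ht).continuousWithinAt)
    (fun t ht => (hd t (Ico_subset_Icc_self ht)).Ici_of_Icc ht)
    (by simp [hJ0, ha])
    (fun t ht => hb t (Ico_subset_Icc_self ht)) t ht
  rw [gronwallBound_of_K_ne_0 (by positivity)] at this
  refine this.trans ?_
  simp only [zero_mul, zero_add]
  calc C₂ * (D * ‖a‖) ^ 2 / C * (Real.exp (C * (t - α)) - 1)
      ≤ C₂ * (D * ‖a‖) ^ 2 / C * D := by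
        gcongr
        rw [hD]
        have : Real.exp (C * (t - α)) ≤ Real.exp (C * (β - α)) := by
          gcongr
          exact ht.2
        linarith
    _ = _ := by ring

end IsFlowLine

theorem hasFDerivWithinAt_comp_snd {F : Type*} [NormedAddCommGroup F] [NormedSpace ℝ F]
    {g : ℝ → F} {g' : F} {s : Set ℝ} {Q : Set P} {q : P} {t : ℝ} (hg : HasDerivWithinAt g g' s t) :
    HasFDerivWithinAt (fun x : P × ℝ => g x.2) ((ContinuousLinearMap.snd ℝ P ℝ).smulRight g')
      (Q ×ˢ s) (q, t) := by
  have h1 : HasFDerivWithinAt (Prod.snd : P × ℝ → ℝ) (ContinuousLinearMap.snd ℝ P ℝ)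
    (Q ×ˢ s) (q, t) := hasFDerivWithinAt_snd
  refine (HasFDerivWithinAt.comp (q, t) (g := g) hg.hasFDerivWithinAt h1
    (fun x hx => hx.2)).congr_fderiv ?_
  ext <;> simp

/-- Smooth dependence on parameters: a family of integral curves in a compact convex set is as
smooth as its initial values. -/
theorem contDiffOn_flow {Q : Set P} (hQ : IsOpen Q) {α β : ℝ} (hαβ : α ≤ β) (n : ℕ) :
    ∀ (E : Type u) [NormedAddCommGroup E] [NormedSpace ℝ E] [FiniteDimensional ℝ E]
      (K : Set E) (_ : IsCompact K) (_ : Convex ℝ K) (_ : (interior K).Nonempty)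
      (Y : E → E) (_ : ContDiffOn ℝ ∞ Y K) (G : P → ℝ → E)
      (_ : ∀ q ∈ Q, IsFlowLine Y K α β (G q)) (_ : ContDiffOn ℝ n (fun q => G q α) Q),
      ContDiffOn ℝ n (fun x : P × ℝ => G x.1 x.2) (Q ×ˢ Icc α β) := by
  -- The phase space is quantified inside the induction, because the step from n to n + 1 applies
  -- the hypothesis to the flow on `E × (E →L[ℝ] E)` formed by the curve and its variation.
  induction n with
  | zero =>
    intro E _ _ _ K hK hKc hKi Y hY G hG hG0
    obtain ⟨C, hC0, hC, hCL⟩ := exists_lipschitz_of_contDiffOn hK hKc hKi (hY.of_le (by norm_cast))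
    rw [Nat.cast_zero, contDiffOn_zero] at hG0 ⊢
    rintro ⟨q, t⟩ ⟨hq, ht⟩
    rw [ContinuousWithinAt, tendsto_iff_norm_sub_tendsto_zero]
    have h1 : Tendsto (fun x : P × ℝ => Real.exp (C * (β - α)) * ‖G x.1 α - G q α‖ +
        ‖G q x.2 - G q t‖) (𝓝[Q ×ˢ Icc α β] (q, t)) (𝓝 (Real.exp (C * (β - α)) * 0 + 0)) := by
      refine Tendsto.add (Tendsto.const_mul _ ?_) ?_
      · rw [← tendsto_iff_norm_sub_tendsto_zero]
        exact (hG0 q hq).tendsto.comp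
          (continuousWithinAt_fst.tendsto_nhdsWithin (fun x hx => hx.1))
      · rw [← tendsto_iff_norm_sub_tendsto_zero]
        exact ((hG q hq).continuousOn t ht).tendsto.comp
          (continuousWithinAt_snd.tendsto_nhdsWithin (fun x hx => hx.2))
    rw [mul_zero, add_zero] at h1
    refine squeeze_zero' (Eventually.of_forall fun _ => norm_nonneg _) ?_ h1
    filter_upwards [self_mem_nhdsWithin] with x hx
    calc ‖G x.1 x.2 - G q t‖ = ‖(G x.1 x.2 - G q x.2) + (G q x.2 - G q t)‖ := by abel_nf
      _ ≤ _ := (norm_add_le _ _).trans (by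
        gcongr
        exact (hG q hq).norm_sub_le (hG x.1 hx.1) hCL hx.2)
  | succ n ih =>
    intro E _ _ _ K hK hKc hKi Y hY G hG hG0
    have hU : UniqueDiffOn ℝ K := uniqueDiffOn_convex hKc hKi
    have hY' : ContDiffOn ℝ ∞ (fderivWithin ℝ Y K) K := hY.fderivWithin hU (by simp)
    obtain ⟨C, hC0, hC, hCL⟩ := exists_lipschitz_of_contDiffOn hK hKc hKi (hY.of_le (by norm_cast))
    obtain ⟨C₂, -, -, hC₂⟩ := exists_lipschitz_of_contDiffOn hK hKc hKi (hY'.of_le (by norm_cast))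
    have hYd : DifferentiableOn ℝ Y K := hY.differentiableOn (by simp)
    have hex : ∀ q ∈ Q, ∃ J : ℝ → E →L[ℝ] E, J α = ContinuousLinearMap.id ℝ E ∧
        ∀ t ∈ Icc α β, HasDerivWithinAt J ((fderivWithin ℝ Y K (G q t)).comp (J t))
          (Icc α β) t := fun q hq => (hG q hq).exists_variation hαβ hY'.continuousOn
    choose! J hJ0 hJ using hex
    set D := Real.exp (C * (β - α)) with hD
    have hG0n : ContDiffOn ℝ n (fun q => G q α) Q := hG0.of_le (by norm_cast; omega)
    have hGn := ih E K hK hKc hKi Y hY G hG hG0n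
    have hJn : ContDiffOn ℝ n (fun x : P × ℝ => J x.1 x.2) (Q ×ˢ Icc α β) := by
      -- The radius is Grönwall's bound for J; the initial value J = id does not depend on the
      -- parameter.
      have := ih (E × (E →L[ℝ] E)) (K ×ˢ Metric.closedBall 0 D)
        (hK.prod (isCompact_closedBall _ _)) (hKc.prod (convex_closedBall _ _))
        (by
          rw [interior_prod_eq]
          refine hKi.prod ⟨0, Metric.ball_subset_interior_closedBall ?_⟩
          exact Metric.mem_ball_self (Real.exp_pos _))
        (fun x => (Y x.1, (fderivWithin ℝ Y K x.1).comp x.2))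
        (ContDiffOn.prodMk (hY.comp contDiffOn_fst fun x hx => hx.1)
          ((hY'.comp contDiffOn_fst fun x hx => hx.1).clm_comp contDiffOn_snd))
        (fun q t => (G q t, J q t))
        (fun q hq => ⟨fun t ht => ⟨(hG q hq).1 t ht, by
          rw [mem_closedBall_zero_iff]
          exact (hG q hq).norm_variation_le hC (hJ0 q hq) (hJ q hq) ht⟩,
          fun t ht => ((hG q hq).2 t ht).prodMk (hJ q hq t ht)⟩)
        (hG0n.prodMk (contDiffOn_const.congr fun q hq => hJ0 q hq))
      exact this.snd
    have hder : ∀ x ∈ Q ×ˢ Icc α β, HasFDerivWithinAt (fun x : P × ℝ => G x.1 x.2)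
        ((J x.1 x.2).comp ((fderiv ℝ (fun q => G q α) x.1).comp (ContinuousLinearMap.fst ℝ P ℝ)) +
          (ContinuousLinearMap.snd ℝ P ℝ).smulRight (Y (G x.1 x.2))) (Q ×ˢ Icc α β) x := by
      rintro ⟨q, t⟩ ⟨hq, ht⟩
      have hf : HasFDerivWithinAt (fun x : P × ℝ => G x.1 α)
          ((fderiv ℝ (fun q => G q α) q).comp (ContinuousLinearMap.fst ℝ P ℝ))
          (Q ×ˢ Icc α β) (q, t) := by
        have h1 : HasFDerivAt (fun q => G q α) (fderiv ℝ (fun q => G q α) q) q :=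
          ((hG0.contDiffAt (hQ.mem_nhds hq)).differentiableAt (by simp)).hasFDerivAt
        exact (h1.comp (q, t) (hasFDerivAt_fst (𝕜 := ℝ) (E := P) (F := ℝ) (p := (q, t)))).hasFDerivWithinAt
      have h1 : HasFDerivWithinAt (fun x : P × ℝ => G q x.2)
          ((ContinuousLinearMap.snd ℝ P ℝ).smulRight (Y (G q t))) (Q ×ˢ Icc α β) (q, t) :=
        hasFDerivWithinAt_comp_snd ((hG q hq).2 t ht)
      have hJx : HasFDerivWithinAt (fun x : P × ℝ => J q x.2)
          ((ContinuousLinearMap.snd ℝ P ℝ).smulRight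
            ((fderivWithin ℝ Y K (G q t)).comp (J q t))) (Q ×ˢ Icc α β) (q, t) :=
        hasFDerivWithinAt_comp_snd (hJ q hq t ht)
      have h2 := hJx.clm_apply (hf.sub_const (G q α))
      have h3 : HasFDerivWithinAt (fun x : P × ℝ => G x.1 x.2 - G q x.2 - J q x.2 (G x.1 α - G q α))
          (0 : P × ℝ →L[ℝ] E) (Q ×ˢ Icc α β) (q, t) := by
        -- A quadratic remainder has derivative zero, so only the terms `h1` and `h2` contribute to
        -- the derivative of G. In `h2` the derivative of J drops out, because its factor vanishes
        -- at the base point.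
        refine Asymptotics.IsBigO.hasFDerivWithinAt (n := 2) ?_ ⟨hq, ht⟩ (by norm_num)
        have hO : (fun x : P × ℝ => G x.1 α - G q α) =O[𝓝[Q ×ˢ Icc α β] (q, t)]
            (fun x => x - (q, t)) := hf.isBigO_sub
        refine Asymptotics.IsBigO.trans ?_ (hO.norm_norm.pow 2)
        refine Asymptotics.IsBigO.of_bound (C₂ * D ^ 2 / C * D) ?_
        filter_upwards [self_mem_nhdsWithin] with x hx
        rw [norm_pow, norm_norm]
        exact (hG q hq).norm_sub_variation_le (hG x.1 hx.1) hKc hYd hC0 hC hCL hC₂ (hJ0 q hq)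
          (hJ q hq) hx.2
      have h4 := (h3.add h2).add h1
      refine (h4.congr_of_eventuallyEq ?_ ?_).congr_fderiv ?_
      · refine Eventually.of_forall fun x => ?_
        simp
      · simp
      · ext x <;> simp
    rw [Nat.cast_add, Nat.cast_one, contDiffOn_succ_iff_hasFDerivWithinAt (by simp)]
    intro x hx
    refine ⟨Q ×ˢ Icc α β, ?_, by simp, _, hder, ?_⟩
    · rw [insert_eq_of_mem hx]
      exact self_mem_nhdsWithin
    · refine ContDiffOn.add ?_ ?_
      · refine hJn.clm_comp (ContDiffOn.clm_comp ?_ contDiffOn_const)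
        exact (hG0.fderiv_of_isOpen hQ (by norm_cast)).comp contDiffOn_fst (fun x hx => hx.1)
      · refine ContDiffOn.smulRight contDiffOn_const ?_
        exact (hY.of_le (by exact_mod_cast le_top)).comp hGn fun x hx => (hG x.1 hx.1).1 x.2 hx.2

end Flow
end
end ZeroEnergy

namespace ZeroEnergy
noncomputable section

/-! ### Integral curves: reparametrization, energy, uniqueness -/

section GeneralCurves
variable {E : Type*} [NormedAddCommGroup E] [NormedSpace ℝ E] {A : Type*}
  [TopologicalSpace A] {I : ModelWithCorners ℝ E A} {M : Type*} [TopologicalSpace M]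
  [ChartedSpace A M] [IsManifold I ∞ M]

/-- Covectors at one point are separated by their common chart, the others by their foot points. -/
instance cotangent_t2Space [T2Space M] : T2Space (Cotangent I M) := by
  rw [t2Space_iff_disjoint_nhds]
  intro p p' hpp'
  by_cases h : p.proj = p'.proj
  · have hs' : p' ∈ (cchart p).source := by
      rw [mem_cchart_source, ← h]
      exact mem_chart_source A p.proj
    have h1 : cchart p p ≠ cchart p p' := fun h2 =>
      hpp' ((cchart p).injOn (mem_extChartAt_source p) hs' h2)
    exact (continuousAt_extChartAt p).tendsto.disjoint (disjoint_nhds_nhds.2 h1)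
      (continuousAt_extChartAt' hs').tendsto
  · exact proj_contMDiff.continuous.continuousAt.tendsto.disjoint (disjoint_nhds_nhds.2 h)
      proj_contMDiff.continuous.continuousAt.tendsto

variable {R R' : ∀ p : Cotangent I M, TangentSpace (cotModel I) p → Prop}
  {γ γ₁ γ₂ : ℝ → Cotangent I M} {s s' : Set ℝ} {H : Cotangent I M → ℝ} {a b t : ℝ}

theorem IsIntegralCurve.mono (h : IsIntegralCurve R γ s) (hs : s' ⊆ s) :
    IsIntegralCurve R γ s' := fun t ht => by
  obtain ⟨X, hX, hd⟩ := h t (hs ht)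
  exact ⟨X, hX, hd.mono hs⟩

theorem IsIntegralCurve.continuousOn (h : IsIntegralCurve R γ s) : ContinuousOn γ s :=
  fun t ht => (h t ht).choose_spec.2.continuousWithinAt

/-- Reparametrization of integral curves. -/
theorem IsIntegralCurve.reparam (h : IsIntegralCurve R γ s) {α : ℝ → ℝ} {α' : ℝ → ℝ}
    (hα : ∀ t ∈ s', HasDerivWithinAt α (α' t) s' t) (hs : MapsTo α s' s)
    (hR : ∀ t ∈ s', ∀ X, R (γ (α t)) X → R' (γ (α t)) (α' t • X)) :
    IsIntegralCurve R' (fun t => γ (α t)) s' := by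
  intro t ht
  obtain ⟨X, hX, hd⟩ := h (α t) (hs ht)
  exact ⟨α' t • X, hR t ht X hX, hasMFDerivWithinAt_comp_hasDerivWithinAt (hα t ht) hs hd⟩

theorem dFun_neg (p : Cotangent I M) (w : TangentSpace (cotModel I) p) :
    dFun (fun p => - H p) p w = - dFun H p w := by
  change mfderiv (cotModel I) 𝓘(ℝ, ℝ) (-H) p w = _
  rw [mfderiv_neg]
  rfl

theorem IsHamVec.neg {p : Cotangent I M} {X : TangentSpace (cotModel I) p} (h : IsHamVec H p X) :
    IsHamVec (fun p => - H p) p (-X) := by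
  refine ⟨h.1, fun w => ?_⟩
  rw [dFun_neg, ← h.2 w]
  change (show E × (E →L[ℝ] ℝ) from w).2 (-(show E × (E →L[ℝ] ℝ) from X).1) -
    (-(show E × (E →L[ℝ] ℝ) from X).2) (show E × (E →L[ℝ] ℝ) from w).1 = - symp p w X
  simp only [symp, map_neg, neg_apply]
  ring

theorem IsHamiltonian.neg (hH : IsHamiltonian H) : IsHamiltonian (fun p => - H p) where
  smooth := hH.smooth.neg
  homogeneous c p hc hp := by rw [hH.homogeneous c p hc hp]; ring
  nondegenerate p hp h0 := by
    obtain ⟨w, hw⟩ := hH.nondegenerate p hp (neg_eq_zero.1 h0)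
    exact ⟨w, by rw [dFun_neg]; exact neg_ne_zero.2 hw⟩

/-- Time reversal. -/
theorem IsIntegralCurve.reverse (h : IsIntegralCurve (IsHamVec H) γ s) {c : ℝ}
    (hs : MapsTo (fun t => c - t) s' s) :
    IsIntegralCurve (IsHamVec fun p => - H p) (fun t => γ (c - t)) s' :=
  h.reparam (α := fun t => c - t) (α' := fun _ => -1)
    (fun t _ => by simpa using (hasDerivWithinAt_id t _).const_sub c) hs fun t _ X hX => by
      rw [neg_one_smul]
      exact hX.neg

theorem IsIntegralCurve.const_energy (hH : IsHamiltonian H)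
    (h : IsIntegralCurve (IsHamVec H) γ (Icc a b)) (ht : t ∈ Icc a b) : H (γ t) = H (γ a) := by
  have hd : ∀ t ∈ Icc a b, HasDerivWithinAt (fun t => H (γ t)) 0 (Icc a b) t := by
    intro t ht
    obtain ⟨X, hX, hd⟩ := h t ht
    have := hasDerivWithinAt_comp_of_hasMFDerivAt (hH.mdifferentiableAt hX.1).hasMFDerivAt hd
    exact this.congr_deriv hX.dFun_self
  exact constant_of_has_deriv_right_zero (fun t ht => (hd t ht).continuousWithinAt)
    (fun t ht => (hd t (Ico_subset_Icc_self ht)).Ici_of_Icc ht) t ht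

theorem IsIntegralCurve.snd_ne_zero (h : IsIntegralCurve (IsHamVec H) γ s) (ht : t ∈ s) :
    (γ t).snd ≠ 0 := (h t ht).choose_spec.1.1

theorem cchart_mem_range (p₀ p : Cotangent I M) : cchart p₀ p ∈ range (cotModel I) := by
  rw [cchart, extChartAt_coe]
  exact mem_range_self _

theorem eventually_mem_box {p₀ : Cotangent I M} {K : Set (E × (E →L[ℝ] ℝ))}
    (hK : K ∈ 𝓝[range (cotModel I)] (cchart p₀ p₀)) :
    ∀ᶠ p in 𝓝 p₀, p ∈ (cchart p₀).source ∧ cchart p₀ p ∈ K := by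
  refine Filter.Eventually.and (extChartAt_source_mem_nhds p₀) ?_
  exact (tendsto_nhdsWithin_iff.2 ⟨continuousAt_extChartAt p₀,
    Eventually.of_forall fun p => cchart_mem_range p₀ p⟩).eventually hK

variable [FiniteDimensional ℝ E]

theorem IsIntegralCurve.isFlowLine (hH : IsHamiltonian H) {p₀ : Cotangent I M}
    {K : Set (E × (E →L[ℝ] ℝ))} (h : IsIntegralCurve (IsHamVec H) γ (Icc a b))
    (hK : ∀ t ∈ Icc a b, γ t ∈ (cchart p₀).source ∧ cchart p₀ (γ t) ∈ K) :
    IsFlowLine (hamField H p₀) K a b (fun t => cchart p₀ (γ t)) :=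
  ⟨fun t ht => (hK t ht).2, fun t ht => hasDerivWithinAt_cchart_comp hH h ht (hK t ht).1⟩

/-- Uniqueness of bicharacteristics. -/
theorem IsIntegralCurve.eqOn [T2Space M] (hH : IsHamiltonian H)
    (h₁ : IsIntegralCurve (IsHamVec H) γ₁ (Icc a b))
    (h₂ : IsIntegralCurve (IsHamVec H) γ₂ (Icc a b)) (h0 : γ₁ a = γ₂ a) :
    EqOn γ₁ γ₂ (Icc a b) := by
  -- The set of agreement is closed, because the cotangent bundle is Hausdorff, and it extends to
  -- the right by Lipschitz uniqueness in a box around the current common point.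
  refine IsClosed.Icc_subset_of_forall_exists_gt (s := {t | γ₁ t = γ₂ t}) ?_ h0 ?_
  · have h3 : ContinuousOn (fun t => (γ₁ t, γ₂ t)) (Icc a b) :=
      h₁.continuousOn.prodMk h₂.continuousOn
    have := h3.preimage_isClosed_of_isClosed isClosed_Icc isClosed_diagonal
    rwa [inter_comm] at this
  · rintro x ⟨hx, hxab⟩ y hy
    have hxI := Ico_subset_Icc_self hxab
    obtain ⟨K, hKc, hKconv, hKi, hKn, hKt⟩ := exists_box (γ₁ x) (h₁.snd_ne_zero hxI)
    have hle : 𝓝[≥] x ≤ 𝓝[Icc a b] x := by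
      rw [nhdsWithin_le_iff]
      exact Icc_mem_nhdsGE_of_mem hxab
    have e1 : ∀ᶠ t in 𝓝[≥] x, γ₁ t ∈ (cchart (γ₁ x)).source ∧ cchart (γ₁ x) (γ₁ t) ∈ K :=
      ((h₁.continuousOn x hxI).eventually (eventually_mem_box hKn)).filter_mono hle
    have e2 : ∀ᶠ t in 𝓝[≥] x, γ₂ t ∈ (cchart (γ₁ x)).source ∧ cchart (γ₁ x) (γ₂ t) ∈ K := by
      have h : ∀ᶠ p in 𝓝 (γ₂ x), p ∈ (cchart (γ₁ x)).source ∧ cchart (γ₁ x) p ∈ K := by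
        rw [← show γ₁ x = γ₂ x from hx]
        exact eventually_mem_box hKn
      exact ((h₂.continuousOn x hxI).eventually h).filter_mono hle
    have e3 : ∀ᶠ t in 𝓝[≥] x, t ∈ Icc a b ∧ t ∈ Icc a y :=
      Filter.Eventually.and (Icc_mem_nhdsGE_of_mem hxab)
        (Icc_mem_nhdsGE_of_mem ⟨hxab.1, hy⟩)
    obtain ⟨c, hc, hsub⟩ := mem_nhdsGE_iff_exists_Icc_subset.1 ((e1.and e2).and e3)
    have hxc : x < c := hc
    have hIsub : Icc x c ⊆ Icc a b := fun t ht => (hsub ht).2.1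
    obtain ⟨C, -, -, hCL⟩ := exists_lipschitz_of_contDiffOn hKc hKconv hKi
      (((contDiffOn_hamField hH (γ₁ x)).mono hKt).of_le (by norm_cast))
    have f1 := (h₁.mono hIsub).isFlowLine hH (fun t ht => (hsub ht).1.1)
    have f2 := (h₂.mono hIsub).isFlowLine hH (fun t ht => (hsub ht).1.2)
    have hcI : c ∈ Icc x c := right_mem_Icc.2 hxc.le
    have := f2.eqOn f1 hCL (by rw [show γ₁ x = γ₂ x from hx]) hcI
    refine ⟨c, ?_, hxc, (hsub hcI).2.2.2⟩
    exact (cchart (γ₁ x)).injOn (hsub hcI).1.1.1 (hsub hcI).1.2.1 this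

end GeneralCurves

/-! ### Homogeneity of the Hamiltonian flow -/

section Dilation
variable {E : Type*} [NormedAddCommGroup E] [NormedSpace ℝ E] {A : Type*}
  [TopologicalSpace A] {I : ModelWithCorners ℝ E A} {M : Type*} [TopologicalSpace M]
  [ChartedSpace A M] [IsManifold I ∞ M] {H : Cotangent I M → ℝ}

/-- The dilation `(x, ξ) ↦ (x, c ξ)` of `E × E*`. -/
def dilE (c : ℝ) : (E × (E →L[ℝ] ℝ)) →L[ℝ] (E × (E →L[ℝ] ℝ)) :=
  (ContinuousLinearMap.fst ℝ E (E →L[ℝ] ℝ)).prod (c • ContinuousLinearMap.snd ℝ E (E →L[ℝ] ℝ))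

@[simp] theorem dilE_apply (c : ℝ) (w : E × (E →L[ℝ] ℝ)) : dilE c w = (w.1, c • w.2) := rfl

theorem dil_mem_source {p₀ p : Cotangent I M} (c : ℝ) (hp : p ∈ (cchart p₀).source) :
    dil c p ∈ (cchart p₀).source := by
  rw [mem_cchart_source] at hp ⊢
  exact hp

theorem cchart_dil {p₀ p : Cotangent I M} (c : ℝ) (hp : p ∈ (cchart p₀).source) :
    cchart p₀ (dil c p) = dilE c (cchart p₀ p) := by
  refine Prod.ext ?_ ?_
  · rw [dilE_apply, cchart_fst, cchart_fst]
    rfl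
  · ext e
    rw [dilE_apply, cchart_snd _ _ (dil_mem_source c hp)]
    change c • p.snd _ = c • (cchart p₀ p).2 e
    rw [cchart_snd _ _ hp]
    rfl

theorem continuous_dil (c : ℝ) : Continuous (dil c : Cotangent I M → Cotangent I M) := by
  rw [continuous_iff_continuousAt]
  intro p
  have h1 : (cchart p).symm ∘ dilE c ∘ cchart p =ᶠ[𝓝 p] dil c := by
    filter_upwards [extChartAt_source_mem_nhds (I := cotModel I) p] with p' hp'
    change (cchart p).symm (dilE c (cchart p p')) = _
    rw [← cchart_dil c hp', (cchart p).left_inv (dil_mem_source c hp')]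
  refine ContinuousAt.congr ?_ h1
  refine ContinuousAt.comp ?_ ((dilE c).continuous.continuousAt.comp (continuousAt_extChartAt p))
  change ContinuousAt (cchart p).symm (dilE c (cchart p p))
  rw [← cchart_dil c (mem_extChartAt_source p)]
  exact continuousAt_extChartAt_symm' (dil_mem_source c (mem_extChartAt_source p))

theorem hasMFDerivAt_dil (c : ℝ) (p : Cotangent I M) :
    HasMFDerivAt (cotModel I) (cotModel I) (dil c) p (dilE c : (E × (E →L[ℝ] ℝ)) →L[ℝ] _) := by
  refine ⟨(continuous_dil c).continuousAt, ?_⟩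
  have h1 : HasFDerivWithinAt (dilE c : E × (E →L[ℝ] ℝ) → _) (dilE c) (range (cotModel I))
      (cchart p p) :=
    ContinuousLinearMap.hasFDerivWithinAt (𝕜 := ℝ) (E := E × (E →L[ℝ] ℝ)) (F := E × (E →L[ℝ] ℝ)) _
  refine h1.congr_of_eventuallyEq ?_ ?_
  · filter_upwards [extChartAt_target_mem_nhdsWithin (I := cotModel I) p] with w hw
    change cchart (dil c p) (dil c ((cchart p).symm w)) = _
    rw [cchart_congr (show (dil c p).proj = p.proj from rfl),
      cchart_dil c ((cchart p).map_target hw), (cchart p).right_inv hw]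
  · change cchart (dil c p) (dil c ((cchart p).symm (cchart p p))) = _
    rw [cchart_congr (show (dil c p).proj = p.proj from rfl),
      (cchart p).left_inv (mem_extChartAt_source p), cchart_dil c (mem_extChartAt_source p)]

theorem dil_snd_ne_zero {p : Cotangent I M} {c : ℝ} (hc : 0 < c) (hp : p.snd ≠ 0) :
    (dil c p).snd ≠ 0 := by
  change c • p.snd ≠ 0
  exact smul_ne_zero hc.ne' hp

theorem dFun_dil (hH : IsHamiltonian H) {c : ℝ} (hc : 0 < c) {p : Cotangent I M} (hp : p.snd ≠ 0)
    (v : E × (E →L[ℝ] ℝ)) : dFun H (dil c p) (dilE c v) = c ^ 2 * dFun H p v := by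
  have h1 := HasMFDerivAt.comp p (hH.mdifferentiableAt (dil_snd_ne_zero hc hp)).hasMFDerivAt
    (hasMFDerivAt_dil c p)
  have h2 := (hH.mdifferentiableAt hp).hasMFDerivAt.const_smul (c ^ 2)
  have h3 : H ∘ dil c =ᶠ[𝓝 p] c ^ 2 • H := by
    filter_upwards [isOpen_nonzero.mem_nhds hp] with p' hp'
    exact hH.homogeneous c p' hc hp'
  have h4 := hasMFDerivAt_unique h1 (h2.congr_of_eventuallyEq h3)
  exact congrArg (fun L => L v) h4

theorem sympE_dilE (c : ℝ) (v X : E × (E →L[ℝ] ℝ)) :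
    sympE (dilE c v) (c • dilE c X) = c ^ 2 * sympE v X := by
  simp only [sympE, dilE_apply, Prod.smul_fst, Prod.smul_snd, map_smul, smul_eq_mul, smul_apply]
  ring

theorem exists_dilE_eq {c : ℝ} (hc : c ≠ 0) (w : E × (E →L[ℝ] ℝ)) : ∃ v, dilE c v = w :=
  ⟨dilE c⁻¹ w, by simp only [dilE_apply, smul_smul, mul_inv_cancel₀ hc, one_smul]⟩

/-- The dilation by c multiplies σ by c and H by c², so it carries X_H to c⁻¹ X_H. Dilated
bicharacteristics therefore run c times faster. -/
theorem IsHamVec.dil (hH : IsHamiltonian H) {c : ℝ} (hc : 0 < c) {p : Cotangent I M}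
    {X : TangentSpace (cotModel I) p} (h : IsHamVec H p X) :
    IsHamVec H (dil c p) (c • dilE c (show E × (E →L[ℝ] ℝ) from X)) := by
  refine ⟨dil_snd_ne_zero hc h.1, fun w => ?_⟩
  obtain ⟨v, rfl⟩ := exists_dilE_eq hc.ne' w
  refine (sympE_dilE c v X).trans ?_
  rw [dFun_dil hH hc h.1, ← h.2 v]
  rfl

theorem IsIntegralCurve.dil (hH : IsHamiltonian H) {c : ℝ} (hc : 0 < c) {γ : ℝ → Cotangent I M}
    {t : ℝ} (h : IsIntegralCurve (IsHamVec H) γ (Icc 0 t)) :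
    IsIntegralCurve (IsHamVec H) (fun s => ZeroEnergy.dil c (γ (c * s))) (Icc 0 (t / c)) := by
  intro s hs
  have hmaps : MapsTo (fun s => c * s) (Icc 0 (t / c)) (Icc 0 t) := fun s hs =>
    ⟨mul_nonneg hc.le hs.1, by
      have := hs.2
      rw [le_div_iff₀ hc] at this
      linarith⟩
  obtain ⟨X, hX, hd⟩ := h (c * s) (hmaps hs)
  refine ⟨_, hX.dil hH hc, ?_⟩
  have h1 : HasMFDerivWithinAt 𝓘(ℝ, ℝ) (cotModel I) (fun s => γ (c * s)) (Icc 0 (t / c)) s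
      ((1 : ℝ →L[ℝ] ℝ).smulRight (c • X)) :=
    hasMFDerivWithinAt_comp_hasDerivWithinAt (a := fun s => c * s)
      (by simpa using (hasDerivWithinAt_id s _).const_mul c) hmaps hd
  have h2 := HasMFDerivAt.comp_hasMFDerivWithinAt s (hasMFDerivAt_dil c (γ (c * s))) h1
  refine HasMFDerivWithinAt.congr_mfderiv h2 ?_
  ext1
  change dilE c ((1 : ℝ) • (c • (show E × (E →L[ℝ] ℝ) from X))) =
    (1 : ℝ) • (c • dilE c (show E × (E →L[ℝ] ℝ) from X))
  rw [one_smul, one_smul, map_smul]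

end Dilation

/-! ### Normal coordinate of curves at the boundary -/

section Boundary
variable {d : ℕ} {M : Type*} [TopologicalSpace M] [ChartedSpace (EuclideanHalfSpace (d + 1)) M]
  [IsManifold (𝓡∂ (d + 1)) ∞ M] {H : Cotangent (𝓡∂ (d + 1)) M → ℝ}
  {γ : ℝ → Cotangent (𝓡∂ (d + 1)) M} {s : Set ℝ} {t a b : ℝ}

theorem mem_range_half {w : EuclideanSpace ℝ (Fin (d + 1)) ×
    (EuclideanSpace ℝ (Fin (d + 1)) →L[ℝ] ℝ)} :
    w ∈ range (cotModel (𝓡∂ (d + 1))) ↔ 0 ≤ w.1 0 := by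
  rw [range_cotModel, mem_prod, range_modelWithCornersEuclideanHalfSpace]
  simp

theorem cchart_normal_nonneg (p₀ p : Cotangent (𝓡∂ (d + 1)) M) : 0 ≤ (cchart p₀ p).1 0 :=
  mem_range_half.1 (cchart_mem_range p₀ p)

/-- Points over the boundary have vanishing normal coordinate in every chart. -/
theorem boundary_iff {p₀ p : Cotangent (𝓡∂ (d + 1)) M} (hp : p ∈ (cchart p₀).source) :
    p.proj ∈ (𝓡∂ (d + 1)).boundary M ↔ (cchart p₀ p).1 0 = 0 := by
  have h1 : p.proj ∈ (𝓡∂ (d + 1)).boundary M ↔ ¬ (𝓡∂ (d + 1)).IsInteriorPoint p.proj := by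
    rw [← ModelWithCorners.isBoundaryPoint_iff_not_isInteriorPoint]
    rfl
  have hps := mem_cchart_source.1 hp
  have h3 : (extChartAt (𝓡∂ (d + 1)) p₀.proj p.proj ∈
      interior (extChartAt (𝓡∂ (d + 1)) p₀.proj).target) ↔
      extChartAt (𝓡∂ (d + 1)) p₀.proj p.proj ∈ interior (range (𝓡∂ (d + 1))) :=
    ⟨fun h => interior_mono (extChartAt_target_subset_range _) h, fun h =>
      (chartAt _ p₀.proj).mem_interior_extend_target
        ((chartAt _ p₀.proj).map_source hps) h⟩
  rw [h1, ModelWithCorners.isInteriorPoint_iff_of_mem_atlas (n := ∞) (by simp)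
    (chart_mem_atlas _ p₀.proj) hps]
  change ¬ (extChartAt (𝓡∂ (d + 1)) p₀.proj p.proj ∈
      interior (extChartAt (𝓡∂ (d + 1)) p₀.proj).target) ↔ _
  rw [h3, cchart_fst, interior_range_modelWithCornersEuclideanHalfSpace]
  have h2 := cchart_normal_nonneg p₀ p
  rw [cchart_fst] at h2
  change ¬ (0 < (extChartAt (𝓡∂ (d + 1)) p₀.proj p.proj) 0) ↔ _
  rw [not_lt]
  exact ⟨fun h => le_antisymm h h2, fun h => h.le⟩

theorem hasDerivWithinAt_normal {X : TangentSpace (cotModel (𝓡∂ (d + 1))) (γ t)}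
    (hd : HasMFDerivWithinAt 𝓘(ℝ, ℝ) (cotModel (𝓡∂ (d + 1))) γ s t
      ((1 : ℝ →L[ℝ] ℝ).smulRight X)) :
    HasDerivWithinAt (fun t' => (cchart (γ t) (γ t')).1 0) (normalVelocity (γ t) X) s t := by
  have h1 := hasDerivWithinAt_comp_of_hasMFDerivAt
    (mdifferentiableAt_cchart (mem_extChartAt_source (γ t))).hasMFDerivAt hd
  have h2 : HasDerivWithinAt (fun t' => cchart (γ t) (γ t'))
      (show EuclideanSpace ℝ (Fin (d + 1)) × (EuclideanSpace ℝ (Fin (d + 1)) →L[ℝ] ℝ) from X) s t := by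
    have h3 := congrArg (fun L => L X) (dchart_self (γ t))
    refine h1.congr_deriv ?_
    exact h3
  have h4 := (EuclideanSpace.proj (𝕜 := ℝ) (0 : Fin (d + 1))).hasFDerivAt.comp_hasDerivWithinAt t h2.fst
  exact h4

/-- The normal coordinate is nonnegative and vanishes at `t`, so it has an interior minimum there.
-/
theorem normalVelocity_eq_zero {X : TangentSpace (cotModel (𝓡∂ (d + 1))) (γ t)}
    (hb : (γ t).proj ∈ (𝓡∂ (d + 1)).boundary M) (hs : s ∈ 𝓝 t)
    (hd : HasMFDerivWithinAt 𝓘(ℝ, ℝ) (cotModel (𝓡∂ (d + 1))) γ s t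
      ((1 : ℝ →L[ℝ] ℝ).smulRight X)) : normalVelocity (γ t) X = 0 := by
  refine IsLocalMin.hasDerivAt_eq_zero (a := t) ?_ ((hasDerivWithinAt_normal hd).hasDerivAt hs)
  refine Eventually.of_forall fun t' => ?_
  change (cchart (γ t) (γ t)).1 0 ≤ (cchart (γ t) (γ t')).1 0
  rw [(boundary_iff (mem_extChartAt_source (γ t))).1 hb]
  exact cchart_normal_nonneg _ _

/-- A nonnegative normal coordinate that reaches zero has nonpositive difference quotients from the
left. -/
theorem normalVelocity_nonpos {X : TangentSpace (cotModel (𝓡∂ (d + 1))) (γ t)} (hat : a < t)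
    (hb : (γ t).proj ∈ (𝓡∂ (d + 1)).boundary M)
    (hd : HasMFDerivWithinAt 𝓘(ℝ, ℝ) (cotModel (𝓡∂ (d + 1))) γ (Icc a t) t
      ((1 : ℝ →L[ℝ] ℝ).smulRight X)) : normalVelocity (γ t) X ≤ 0 := by
  have h1 := hasDerivWithinAt_normal hd
  have h0 := (boundary_iff (mem_extChartAt_source (γ t))).1 hb
  have h2 : HasDerivWithinAt (fun t' => (cchart (γ t) (γ t')).1 0) (normalVelocity (γ t) X)
      (Iio t) t := h1.mono_of_mem_nhdsWithin (Icc_mem_nhdsLT_of_mem ⟨hat, le_rfl⟩)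
  rw [hasDerivWithinAt_iff_tendsto_slope' (by simp)] at h2
  refine le_of_tendsto h2 ?_
  filter_upwards [self_mem_nhdsWithin] with t' ht'
  rw [slope_def_field, h0, sub_zero]
  exact div_nonpos_of_nonneg_of_nonpos (cchart_normal_nonneg _ _) (sub_nonpos.2 (le_of_lt ht'))

end Boundary
end
end ZeroEnergy

namespace ZeroEnergy
noncomputable section

/-! ### Structure of Γ₀: the bicharacteristics from entry to exit -/

section Scattering
variable {d : ℕ}
  {B : Type*} [TopologicalSpace B] [ChartedSpace (EuclideanSpace ℝ (Fin d)) B]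
  [IsManifold (𝓡 d) ∞ B]
  {M : Type*} [TopologicalSpace M] [ChartedSpace (EuclideanHalfSpace (d + 1)) M]
  [IsManifold (𝓡∂ (d + 1)) ∞ M]

/-- A scattering setup together with the standing assumptions on `H`, `ι`, `U`, `V`. -/
structure IsScattering (ι : B → M) (U V : Set B) (𝒰 : Set (Cotangent (𝓡 d) B))
    (H : Cotangent (𝓡∂ (d + 1)) M → ℝ)
    (ζ : Cotangent (𝓡 d) B → Cotangent (𝓡∂ (d + 1)) M) : Prop
    extends ScatteringSetup ι U V 𝒰 H ζ where
  ham : IsHamiltonian H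
  incl : IsBoundaryInclusion (d := d) ι
  disj : Disjoint U V

/-- The time at which the bicharacteristic issued from `ζ q` hits `V`. -/
def hitTime (ι : B → M) (V : Set B) (H : Cotangent (𝓡∂ (d + 1)) M → ℝ)
    (ζ : Cotangent (𝓡 d) B → Cotangent (𝓡∂ (d + 1)) M) (q : Cotangent (𝓡 d) B) : ℝ :=
  exitTime (IsHamVec H) (ι '' V) (ζ q)

open Classical in
/-- The bicharacteristic issued from `ζ q`. -/
def bichar (ι : B → M) (V : Set B) (H : Cotangent (𝓡∂ (d + 1)) M → ℝ)
    (ζ : Cotangent (𝓡 d) B → Cotangent (𝓡∂ (d + 1)) M) (q : Cotangent (𝓡 d) B) :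
    ℝ → Cotangent (𝓡∂ (d + 1)) M :=
  if h : ∃ γ : ℝ → Cotangent (𝓡∂ (d + 1)) M,
      IsIntegralCurve (IsHamVec H) γ (Icc 0 (hitTime ι V H ζ q)) ∧ γ 0 = ζ q
  then h.choose else fun _ => ζ q

/-- The bicharacteristics issued from `ζ(𝒰)`, parametrized by `[0, 1]`. -/
def flowBox (ι : B → M) (V : Set B) (H : Cotangent (𝓡∂ (d + 1)) M → ℝ)
    (ζ : Cotangent (𝓡 d) B → Cotangent (𝓡∂ (d + 1)) M) (z : Cotangent (𝓡 d) B × ℝ) :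
    Cotangent (𝓡∂ (d + 1)) M :=
  bichar ι V H ζ z.1 (z.2 * hitTime ι V H ζ z.1)

variable {ι : B → M} {U V : Set B} {𝒰 : Set (Cotangent (𝓡 d) B)}
  {H : Cotangent (𝓡∂ (d + 1)) M → ℝ} {ζ : Cotangent (𝓡 d) B → Cotangent (𝓡∂ (d + 1)) M}
  {q q' : Cotangent (𝓡 d) B} {t t' : ℝ} {p : Cotangent (𝓡∂ (d + 1)) M}

theorem IsRestriction.proj_eq (h : IsRestriction ι p q) : p.proj = ι q.proj := by
  obtain ⟨ξ, rfl, -⟩ := h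
  rfl

theorem IsRestriction.unique (hι : IsBoundaryInclusion (d := d) ι) (h : IsRestriction ι p q)
    (h' : IsRestriction ι p q') : q = q' := by
  obtain ⟨ξ, rfl, h1⟩ := h
  obtain ⟨ξ', h2, h3⟩ := h'
  obtain ⟨x, η⟩ := q
  obtain ⟨x', η'⟩ := q'
  have hx : x = x' := hι.embedding.injective (congrArg Bundle.TotalSpace.proj h2)
  subst hx
  have hξ : ξ = ξ' := by
    injection h2
  subst hξ
  congr 1
  ext v
  exact (h1 v).trans (h3 v).symm

theorem flowsTo_of_curve {R : ∀ p : Cotangent (𝓡∂ (d + 1)) M,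
    TangentSpace (cotModel (𝓡∂ (d + 1))) p → Prop} {γ : ℝ → Cotangent (𝓡∂ (d + 1)) M}
    {a b x y : ℝ} (h : IsIntegralCurve R γ (Icc a b)) (hx : x ∈ Icc a b) (hy : y ∈ Icc a b) :
    FlowsTo R (y - x) (γ x) (γ y) := by
  refine ⟨fun t => γ (x + t), h.reparam (α := fun t => x + t) (α' := fun _ => 1)
    (fun t _ => by simpa using (hasDerivWithinAt_id t _).const_add x) (fun t ht => ?_)
    fun t _ X hX => by rwa [one_smul], by simp, by simp⟩
  rw [mem_uIcc] at ht
  rcases ht with ht | ht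
  · exact ⟨by linarith [hx.1, ht.1], by linarith [ht.2, hy.2]⟩
  · exact ⟨by linarith [hy.1, ht.1], by linarith [ht.2, hx.2]⟩

theorem exitTime_le {R : ∀ p : Cotangent (𝓡∂ (d + 1)) M,
    TangentSpace (cotModel (𝓡∂ (d + 1))) p → Prop} {Z : Set M} {p' : Cotangent (𝓡∂ (d + 1)) M}
    (ht : 0 ≤ t) (h : FlowsTo R t p p') (hZ : p'.proj ∈ Z) : exitTime R Z p ≤ t :=
  csInf_le ⟨0, fun _ h => h.1⟩ ⟨ht, p', h, hZ⟩

theorem entryTime_le {R : ∀ p : Cotangent (𝓡∂ (d + 1)) M,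
    TangentSpace (cotModel (𝓡∂ (d + 1))) p → Prop} {Z : Set M} {p' : Cotangent (𝓡∂ (d + 1)) M}
    (ht : 0 ≤ t) (h : FlowsTo R (-t) p p') (hZ : p'.proj ∈ Z) : entryTime R Z p ≤ t :=
  csInf_le ⟨0, fun _ h => h.1⟩ ⟨ht, p', h, hZ⟩

theorem exitTime_nonneg (R : ∀ p : Cotangent (𝓡∂ (d + 1)) M,
    TangentSpace (cotModel (𝓡∂ (d + 1))) p → Prop) (Z : Set M) (p : Cotangent (𝓡∂ (d + 1)) M) :
    0 ≤ exitTime R Z p := Real.sInf_nonneg fun _ h => h.1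

theorem entryTime_nonneg (R : ∀ p : Cotangent (𝓡∂ (d + 1)) M,
    TangentSpace (cotModel (𝓡∂ (d + 1))) p → Prop) (Z : Set M) (p : Cotangent (𝓡∂ (d + 1)) M) :
    0 ≤ entryTime R Z p := Real.sInf_nonneg fun _ h => h.1

theorem flowBox_one : flowBox ι V H ζ (q, 1) = bichar ι V H ζ q (hitTime ι V H ζ q) := by
  rw [flowBox, one_mul]

namespace IsScattering

variable (S : IsScattering ι U V 𝒰 H ζ)
include S

theorem proj_zeta (hq : q ∈ 𝒰) : (ζ q).proj = ι q.proj := (S.restriction_zeta q hq).proj_eq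

theorem mem_boundary (b : B) : ι b ∈ (𝓡∂ (d + 1)).boundary M := by
  rw [← S.incl.range_eq]
  exact mem_range_self b

theorem image_inter (b : B) (hb : b ∈ U) : ι b ∉ ι '' V := by
  rintro ⟨b', hb', h⟩
  exact disjoint_left.1 S.disj hb (S.incl.embedding.injective h ▸ hb')

theorem zeta_inj (hq : q ∈ 𝒰) (hq' : q' ∈ 𝒰) (h : ζ q = ζ q') : q = q' :=
  (S.restriction_zeta q hq).unique S.incl (h ▸ S.restriction_zeta q' hq')

/-- At time zero the curve is over U, which is disjoint from V, whereas the exit point lies over V.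
-/
theorem hitTime_pos (hq : q ∈ 𝒰) : 0 < hitTime ι V H ζ q := by
  refine lt_of_le_of_ne (exitTime_nonneg _ _ _) fun h => ?_
  obtain ⟨p, ⟨γ, -, h0, h1⟩, hV, -⟩ := S.exits q hq
  change γ (hitTime ι V H ζ q) = p at h1
  rw [← h, h0] at h1
  rw [← h1, S.proj_zeta hq] at hV
  exact S.image_inter _ (S.over_U q hq) hV

theorem exists_curve (hq : q ∈ 𝒰) : ∃ γ : ℝ → Cotangent (𝓡∂ (d + 1)) M,
    IsIntegralCurve (IsHamVec H) γ (Icc 0 (hitTime ι V H ζ q)) ∧ γ 0 = ζ q ∧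
    (γ (hitTime ι V H ζ q)).proj ∈ ι '' V ∧ IsTransversal H (γ (hitTime ι V H ζ q)) := by
  obtain ⟨p, ⟨γ, hγ, h0, h1⟩, hV, ht⟩ := S.exits q hq
  change IsIntegralCurve (IsHamVec H) γ (uIcc 0 (hitTime ι V H ζ q)) at hγ
  rw [uIcc_of_le (S.hitTime_pos hq).le] at hγ
  exact ⟨γ, hγ, h0, by rwa [← h1] at hV, by rwa [← h1] at ht⟩

theorem bichar_curve (hq : q ∈ 𝒰) :
    IsIntegralCurve (IsHamVec H) (bichar ι V H ζ q) (Icc 0 (hitTime ι V H ζ q)) ∧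
      bichar ι V H ζ q 0 = ζ q := by
  obtain ⟨γ, h1, h2, -⟩ := S.exists_curve hq
  have h : ∃ γ : ℝ → Cotangent (𝓡∂ (d + 1)) M,
      IsIntegralCurve (IsHamVec H) γ (Icc 0 (hitTime ι V H ζ q)) ∧ γ 0 = ζ q := ⟨γ, h1, h2⟩
  rw [bichar, dif_pos h]
  exact h.choose_spec

theorem zero_mem (hq : q ∈ 𝒰) : (0 : ℝ) ∈ Icc 0 (hitTime ι V H ζ q) :=
  left_mem_Icc.2 (S.hitTime_pos hq).le

theorem hitTime_mem (hq : q ∈ 𝒰) : hitTime ι V H ζ q ∈ Icc 0 (hitTime ι V H ζ q) :=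
  right_mem_Icc.2 (S.hitTime_pos hq).le

theorem notMem_V (hq : q ∈ 𝒰) (ht : t ∈ Ico 0 (hitTime ι V H ζ q)) :
    (bichar ι V H ζ q t).proj ∉ ι '' V := fun h => by
  have h1 := flowsTo_of_curve (S.bichar_curve hq).1 (S.zero_mem hq) (Ico_subset_Icc_self ht)
  rw [sub_zero, (S.bichar_curve hq).2] at h1
  exact absurd (exitTime_le ht.1 h1 h) (not_le.2 ht.2)

/-- A curve arriving at the boundary has nonpositive normal velocity, but `ζ q` is incoming. -/
theorem curve_ne_zeta {γ : ℝ → Cotangent (𝓡∂ (d + 1)) M} {a : ℝ} (hq : q ∈ 𝒰) (hat : a < t)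
    (h : IsIntegralCurve (IsHamVec H) γ (Icc a t)) : γ t ≠ ζ q := fun h0 => by
  have hb : (γ t).proj ∈ (𝓡∂ (d + 1)).boundary M := by
    rw [h0, S.proj_zeta hq]
    exact S.mem_boundary _
  obtain ⟨X, hX, hpos⟩ := S.incoming q hq
  rw [← h0] at X hX hpos
  obtain ⟨X', hX', hd⟩ := h t (right_mem_Icc.2 hat.le)
  have := normalVelocity_nonpos hat hb hd
  rw [hX'.unique hX] at this
  linarith

theorem mul_hitTime_mem (hq : q ∈ 𝒰) (ht : t ∈ Icc (0 : ℝ) 1) :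
    t * hitTime ι V H ζ q ∈ Icc 0 (hitTime ι V H ζ q) :=
  ⟨mul_nonneg ht.1 (S.hitTime_pos hq).le, mul_le_of_le_one_left (S.hitTime_pos hq).le ht.2⟩

theorem flowBox_zero (hq : q ∈ 𝒰) : flowBox ι V H ζ (q, 0) = ζ q := by
  rw [flowBox, zero_mul, (S.bichar_curve hq).2]

/-- Positive normal velocity at `ζ q` makes the normal coordinate positive just after the entry. -/
theorem eventually_notMem_boundary (hq : q ∈ 𝒰) :
    ∀ᶠ t in 𝓝[>] 0, (bichar ι V H ζ q t).proj ∉ (𝓡∂ (d + 1)).boundary M := by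
  obtain ⟨X, hX, hpos⟩ := S.incoming q hq
  have hpos' := S.hitTime_pos hq
  rw [← (S.bichar_curve hq).2] at X hX hpos
  obtain ⟨X', hX', hd⟩ := (S.bichar_curve hq).1 0 (S.zero_mem hq)
  rw [← hX'.unique hX] at hpos
  have h1 := hasDerivWithinAt_normal hd
  have h2 : HasDerivWithinAt (fun t' => (cchart (bichar ι V H ζ q 0) (bichar ι V H ζ q t')).1 0)
      (normalVelocity (bichar ι V H ζ q 0) X') (Ioi 0) 0 :=
    h1.mono_of_mem_nhdsWithin (Icc_mem_nhdsGT_of_mem ⟨le_rfl, hpos'⟩)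
  rw [hasDerivWithinAt_iff_tendsto_slope' (by simp)] at h2
  have hc : ContinuousWithinAt (bichar ι V H ζ q) (Ioi 0) 0 :=
    ((S.bichar_curve hq).1.continuousOn 0 (S.zero_mem hq)).mono_of_mem_nhdsWithin
      (Icc_mem_nhdsGT_of_mem ⟨le_rfl, hpos'⟩)
  have h0 := (boundary_iff (mem_extChartAt_source (bichar ι V H ζ q 0))).1
    (by rw [(S.bichar_curve hq).2, S.proj_zeta hq]; exact S.mem_boundary _)
  filter_upwards [h2.eventually (lt_mem_nhds hpos), self_mem_nhdsWithin,
    hc.eventually (extChartAt_source_mem_nhds (I := cotModel (𝓡∂ (d + 1))) (bichar ι V H ζ q 0))] with t ht htpos hs hb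
  rw [boundary_iff hs] at hb
  rw [slope_def_field, h0, hb] at ht
  simp at ht

variable [T2Space M]

theorem exit_spec (hq : q ∈ 𝒰) : (bichar ι V H ζ q (hitTime ι V H ζ q)).proj ∈ ι '' V ∧
    IsTransversal H (bichar ι V H ζ q (hitTime ι V H ζ q)) := by
  obtain ⟨γ, h1, h2, h3, h4⟩ := S.exists_curve hq
  have h5 := (S.bichar_curve hq).1.eqOn S.ham h1 ((S.bichar_curve hq).2.trans h2.symm)
    (S.hitTime_mem hq)
  rw [h5]
  exact ⟨h3, h4⟩

/-- If the curve went on, the exit would be an interior minimum of the normal coordinate, so the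
velocity there would be tangent to the boundary, against transversality. -/
theorem curve_le {γ : ℝ → Cotangent (𝓡∂ (d + 1)) M} (hq : q ∈ 𝒰)
    (h : IsIntegralCurve (IsHamVec H) γ (Icc 0 t)) (h0 : γ 0 = ζ q) : t ≤ hitTime ι V H ζ q := by
  by_contra! hlt
  have hpos := S.hitTime_pos hq
  have h1 := (h.mono (Icc_subset_Icc_right hlt.le)).eqOn S.ham (S.bichar_curve hq).1
    (h0.trans (S.bichar_curve hq).2.symm) (S.hitTime_mem hq)
  obtain ⟨hV, X, hX, hne⟩ := S.exit_spec hq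
  rw [← h1] at hV
  obtain ⟨X', hX', hd⟩ := h _ ⟨hpos.le, hlt.le⟩
  have hb : (γ (hitTime ι V H ζ q)).proj ∈ (𝓡∂ (d + 1)).boundary M := by
    obtain ⟨b, -, hb⟩ := hV
    rw [← hb]
    exact S.mem_boundary b
  have h2 := normalVelocity_eq_zero hb (Icc_mem_nhds hpos hlt) hd
  -- The vector lives in the tangent space at the point of `γ`; it is generalized so that this point
  -- can be rewritten as the point of `bichar`.
  revert hX' h2
  generalize X' = Y
  clear hd
  revert Y
  rw [h1]
  intro Y hY h2
  rw [hY.unique hX] at h2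
  exact hne h2

theorem curve_eqOn {γ : ℝ → Cotangent (𝓡∂ (d + 1)) M} (hq : q ∈ 𝒰)
    (h : IsIntegralCurve (IsHamVec H) γ (Icc 0 t)) (h0 : γ 0 = ζ q) :
    EqOn γ (bichar ι V H ζ q) (Icc 0 t) :=
  h.eqOn S.ham ((S.bichar_curve hq).1.mono (Icc_subset_Icc_right (S.curve_le hq h h0)))
    (h0.trans (S.bichar_curve hq).2.symm)

/-- By `curve_le` and uniqueness, arbitrary curves and times in the definition of Γ₀ reduce to the
chosen bicharacteristics and to times up to the hit. -/
theorem mem_Gamma_iff : p ∈ Gamma H 𝒰 ζ ↔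
    ∃ q ∈ 𝒰, ∃ t ∈ Icc 0 (hitTime ι V H ζ q), bichar ι V H ζ q t = p := by
  constructor
  · rintro ⟨q, hq, t, ht, γ, hγ, h0, rfl⟩
    rw [uIcc_of_le ht] at hγ
    exact ⟨q, hq, t, ⟨ht, S.curve_le hq hγ h0⟩,
      (S.curve_eqOn hq hγ h0 (right_mem_Icc.2 ht)).symm⟩
  · rintro ⟨q, hq, t, ht, rfl⟩
    refine ⟨q, hq, t, ht.1, bichar ι V H ζ q, ?_, (S.bichar_curve hq).2, rfl⟩
    rw [uIcc_of_le ht.1]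
    exact (S.bichar_curve hq).1.mono (Icc_subset_Icc_right ht.2)

theorem bichar_mem (hq : q ∈ 𝒰) (ht : t ∈ Icc 0 (hitTime ι V H ζ q)) :
    bichar ι V H ζ q t ∈ Gamma H 𝒰 ζ := S.mem_Gamma_iff.2 ⟨q, hq, t, ht, rfl⟩

theorem zeta_mem (hq : q ∈ 𝒰) : ζ q ∈ Gamma H 𝒰 ζ :=
  (S.bichar_curve hq).2 ▸ S.bichar_mem hq (S.zero_mem hq)

theorem energy_eq_zero (hp : p ∈ Gamma H 𝒰 ζ) : H p = 0 := by
  obtain ⟨q, hq, t, ht, rfl⟩ := S.mem_Gamma_iff.1 hp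
  rw [(S.bichar_curve hq).1.const_energy S.ham ht, (S.bichar_curve hq).2, S.zero_energy q hq]

theorem snd_ne_zero (hp : p ∈ Gamma H 𝒰 ζ) : p.snd ≠ 0 := by
  obtain ⟨q, hq, t, ht, rfl⟩ := S.mem_Gamma_iff.1 hp
  exact (S.bichar_curve hq).1.snd_ne_zero ht

/-- Backward uniqueness. -/
theorem bichar_sub_eq {γ : ℝ → Cotangent (𝓡∂ (d + 1)) M} (hq : q ∈ 𝒰)
    (ht : t ∈ Icc 0 (hitTime ι V H ζ q)) {r : ℝ} (hr : r ∈ Icc 0 t)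
    (h : IsIntegralCurve (IsHamVec H) γ (Icc (t' - r) t')) (h0 : γ t' = bichar ι V H ζ q t) :
    γ (t' - r) = bichar ι V H ζ q (t - r) := by
  have h1 : IsIntegralCurve (IsHamVec fun p => - H p) (fun x => γ (t' - x)) (Icc 0 r) :=
    h.reverse fun x hx => ⟨by linarith [hx.2], by linarith [hx.1]⟩
  have h2 : IsIntegralCurve (IsHamVec fun p => - H p) (fun x => bichar ι V H ζ q (t - x))
      (Icc 0 r) :=
    (S.bichar_curve hq).1.reverse fun x hx =>
      ⟨by linarith [hx.2, hr.2], by linarith [hx.1, ht.2]⟩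
  exact h1.eqOn S.ham.neg h2 (by simpa using h0) (right_mem_Icc.2 hr.1)

/-- Run both curves backward from the common point for the shorter time. One of them is then at its
initial covector, and by `curve_ne_zeta` the other cannot have arrived there after a positive time.
-/
theorem bichar_inj (hq : q ∈ 𝒰) (hq' : q' ∈ 𝒰) (ht : t ∈ Icc 0 (hitTime ι V H ζ q))
    (ht' : t' ∈ Icc 0 (hitTime ι V H ζ q'))
    (h : bichar ι V H ζ q t = bichar ι V H ζ q' t') : q = q' ∧ t = t' := by
  wlog hle : t ≤ t' generalizing q q' t t'
  · exact (this hq' hq ht' ht h.symm (le_of_not_ge hle)).imp Eq.symm Eq.symm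
  have h1 := S.bichar_sub_eq hq ht (r := t) (t' := t') ⟨ht.1, le_rfl⟩
    ((S.bichar_curve hq').1.mono (Icc_subset_Icc (sub_nonneg.2 hle) ht'.2)) h.symm
  rw [sub_self, (S.bichar_curve hq).2] at h1
  have h2 : t = t' := by
    by_contra hne
    have hlt : 0 < t' - t := sub_pos.2 (lt_of_le_of_ne hle hne)
    exact S.curve_ne_zeta hq hlt ((S.bichar_curve hq').1.mono
      (Icc_subset_Icc_right (by linarith [ht'.2, ht.1]))) h1
  subst h2
  rw [sub_self, (S.bichar_curve hq').2] at h1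
  exact ⟨S.zeta_inj hq hq' h1.symm, rfl⟩

/-- Backward uniqueness: any curve run backward for a time less than `t` stays on the same
bicharacteristic, which has not met U there. -/
theorem entryTime_eq (hq : q ∈ 𝒰) (ht : t ∈ Icc 0 (hitTime ι V H ζ q))
    (h : ∀ r ∈ Ioc 0 t, (bichar ι V H ζ q r).proj ∉ ι '' U) :
    entryTime (IsHamVec H) (ι '' U) (bichar ι V H ζ q t) = t := by
  have h1 := flowsTo_of_curve (S.bichar_curve hq).1 ht (S.zero_mem hq)
  rw [zero_sub] at h1
  have h2 : (bichar ι V H ζ q 0).proj ∈ ι '' U := by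
    rw [(S.bichar_curve hq).2, S.proj_zeta hq]
    exact mem_image_of_mem _ (S.over_U q hq)
  refine le_antisymm (entryTime_le ht.1 h1 h2) (le_csInf ⟨t, ht.1, _, h1, h2⟩ ?_)
  rintro r ⟨hr, p', ⟨γ, hγ, h0, rfl⟩, hU⟩
  by_contra! hrt
  rw [uIcc_of_ge (neg_nonpos.2 hr)] at hγ
  have h3 := S.bichar_sub_eq hq ht (r := r) (t' := 0) (γ := γ) ⟨hr, hrt.le⟩
    (by rwa [zero_sub]) h0
  rw [zero_sub] at h3
  rw [h3] at hU
  exact h (t - r) ⟨sub_pos.2 hrt, by linarith⟩ hU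

/-- The bicharacteristics do not return to `U`. -/
theorem notMem_U (hq : q ∈ 𝒰) (ht : t ∈ Ioc 0 (hitTime ι V H ζ q)) :
    (bichar ι V H ζ q t).proj ∉ ι '' U := fun hU => by
  -- Along the curve ℓ₋ equals the elapsed time as long as there is no return, while it is zero at a
  -- return; this contradicts continuity.
  set e : ℝ → ℝ := fun t => entryTime (IsHamVec H) (ι '' U) (bichar ι V H ζ q t) with he
  have hec : ContinuousOn e (Icc 0 (hitTime ι V H ζ q)) :=
    S.smooth_entry.continuousOn.comp (S.bichar_curve hq).1.continuousOn
      fun t ht => S.bichar_mem hq ht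
  have hzero : ∀ t ∈ Icc 0 (hitTime ι V H ζ q), (bichar ι V H ζ q t).proj ∈ ι '' U → e t = 0 := by
    intro t ht hU
    have h1 := flowsTo_of_curve (S.bichar_curve hq).1 ht ht
    rw [sub_self, ← neg_zero] at h1
    exact le_antisymm (entryTime_le le_rfl h1 hU) (entryTime_nonneg _ _ _)
  obtain ⟨ε, hε, hεs⟩ := mem_nhdsGT_iff_exists_Ioc_subset.1 (S.eventually_notMem_boundary hq)
  have hε : 0 < ε := hε
  have hnU : ∀ r ∈ Ioc 0 ε, (bichar ι V H ζ q r).proj ∉ ι '' U := by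
    rintro r hr ⟨b, -, hb⟩
    exact hεs hr (hb ▸ S.mem_boundary b)
  have hεt : ε < t := by
    by_contra! h
    exact hnU t ⟨ht.1, h⟩ hU
  have hsub : Icc ε t ⊆ Icc 0 (hitTime ι V H ζ q) := Icc_subset_Icc hε.le ht.2
  -- The first zero of ℓ₋ replaces the first return, because its zero set is closed while the set of
  -- times over U need not be. No return can precede this zero.
  have hC : IsCompact (Icc ε t ∩ e ⁻¹' {0}) :=
    isCompact_Icc.of_isClosed_subset
      ((hec.mono hsub).preimage_isClosed_of_isClosed isClosed_Icc isClosed_singleton)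
      inter_subset_left
  obtain ⟨m, ⟨hm, hem⟩, hmin⟩ := hC.exists_isLeast
    ⟨t, right_mem_Icc.2 hεt.le, hzero t (Ioc_subset_Icc_self ht) hU⟩
  have hem : e m = 0 := hem
  have hno : ∀ r ∈ Ioo 0 m, (bichar ι V H ζ q r).proj ∉ ι '' U := by
    intro r hr hrU
    rcases le_total r ε with h | h
    · exact hnU r ⟨hr.1, h⟩ hrU
    · have hrI : r ∈ Icc ε t := ⟨h, hr.2.le.trans hm.2⟩
      exact absurd (hmin ⟨hrI, hzero r (hsub hrI) hrU⟩) (not_le.2 hr.2)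
  have hm0 : 0 < m := hε.trans_le hm.1
  have h1 : Tendsto e (𝓝[<] m) (𝓝 (e m)) :=
    ((hec m (hsub hm)).mono_of_mem_nhdsWithin
      (mem_of_superset (Icc_mem_nhdsLT_of_mem ⟨hm0, le_rfl⟩)
        (Icc_subset_Icc_right (hsub hm).2))).tendsto
  have h2 : Tendsto e (𝓝[<] m) (𝓝 m) := by
    refine (tendsto_id.mono_left nhdsWithin_le_nhds).congr' ?_
    filter_upwards [Ioo_mem_nhdsLT_of_mem (⟨hm0, le_rfl⟩ : m ∈ Ioc 0 m)] with r hr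
    exact (S.entryTime_eq hq ⟨hr.1.le, hr.2.le.trans (hsub hm).2⟩ fun x hx =>
      hno x ⟨hx.1, hx.2.trans_lt hr.2⟩).symm
  have := tendsto_nhds_unique h1 h2
  linarith

theorem partOver_U : partOver ι U (Gamma H 𝒰 ζ) = ζ '' 𝒰 := by
  ext p
  constructor
  · rintro ⟨hp, hU⟩
    obtain ⟨q, hq, t, ht, rfl⟩ := S.mem_Gamma_iff.1 hp
    rcases ht.1.eq_or_lt with rfl | h
    · exact ⟨q, hq, (S.bichar_curve hq).2.symm⟩
    · exact absurd hU (S.notMem_U hq ⟨h, ht.2⟩)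
  · rintro ⟨q, hq, rfl⟩
    refine ⟨S.zeta_mem hq, ?_⟩
    rw [S.proj_zeta hq]
    exact mem_image_of_mem _ (S.over_U q hq)

theorem partOver_V : partOver ι V (Gamma H 𝒰 ζ) =
    (fun q => bichar ι V H ζ q (hitTime ι V H ζ q)) '' 𝒰 := by
  ext p
  constructor
  · rintro ⟨hp, hV⟩
    obtain ⟨q, hq, t, ht, rfl⟩ := S.mem_Gamma_iff.1 hp
    rcases ht.2.eq_or_lt with rfl | h
    · exact ⟨q, hq, rfl⟩
    · exact absurd hV (S.notMem_V hq ⟨ht.1, h⟩)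
  · rintro ⟨q, hq, rfl⟩
    exact ⟨S.bichar_mem hq (S.hitTime_mem hq), (S.exit_spec hq).1⟩

/-- The dilated and accelerated curve starts at `ζ (dil c q)` and is over V after the time T/c. The
infimum gives one inequality for the new hitting time and `curve_le` the other. -/
theorem bichar_dil (hq : q ∈ 𝒰) {c : ℝ} (hc : 0 < c) :
    hitTime ι V H ζ (dil c q) = hitTime ι V H ζ q / c ∧
    ∀ t ∈ Icc 0 (hitTime ι V H ζ q / c),
      bichar ι V H ζ (dil c q) t = dil c (bichar ι V H ζ q (c * t)) := by
  have h1 := (S.bichar_curve hq).1.dil S.ham hc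
  have h0 : dil c (bichar ι V H ζ q (c * 0)) = ζ (dil c q) := by
    rw [mul_zero, (S.bichar_curve hq).2, S.homogeneous_zeta q hq c hc]
  have hq' := S.conic q hq c hc
  have hnn : 0 ≤ hitTime ι V H ζ q / c := div_nonneg (S.hitTime_pos hq).le hc.le
  refine ⟨le_antisymm ?_ (S.curve_le hq' h1 h0), fun t ht => (S.curve_eqOn hq' h1 h0 ht).symm⟩
  have h2 := flowsTo_of_curve h1 (left_mem_Icc.2 hnn) (right_mem_Icc.2 hnn)
  rw [h0, sub_zero] at h2
  refine exitTime_le hnn h2 ?_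
  rw [mul_div_cancel₀ _ hc.ne']
  exact (S.exit_spec hq).1

theorem smooth_hitTime : ContMDiffOn (cotModel (𝓡 d)) 𝓘(ℝ, ℝ) ∞ (hitTime ι V H ζ) 𝒰 :=
  S.smooth_exit.comp S.smooth_zeta fun _ hq => S.zeta_mem hq

/-- Since T > 0, time can be normalized to [0, 1]; the parameter domain becomes a product that
serves for both Hamiltonians. -/
theorem flowBox_bijOn : BijOn (flowBox ι V H ζ) (𝒰 ×ˢ Icc 0 1) (Gamma H 𝒰 ζ) := by
  refine ⟨fun z hz => S.bichar_mem hz.1 (S.mul_hitTime_mem hz.1 hz.2), ?_, ?_⟩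
  · rintro ⟨q, s⟩ hz ⟨q', s'⟩ hz' h
    obtain ⟨h1, h2⟩ := S.bichar_inj hz.1 hz'.1 (S.mul_hitTime_mem hz.1 hz.2)
      (S.mul_hitTime_mem hz'.1 hz'.2) h
    change q = q' at h1
    subst h1
    exact Prod.ext rfl (mul_right_cancel₀ (S.hitTime_pos hz.1).ne' h2)
  · intro p hp
    obtain ⟨q, hq, t, ht, rfl⟩ := S.mem_Gamma_iff.1 hp
    have hpos := S.hitTime_pos hq
    refine ⟨(q, t / hitTime ι V H ζ q), ⟨hq, div_nonneg ht.1 hpos.le, div_le_one_of_le₀ ht.2 hpos.le⟩,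
      ?_⟩
    rw [flowBox, div_mul_cancel₀ _ hpos.ne']

theorem flowBox_dil (hq : q ∈ 𝒰) {c : ℝ} (hc : 0 < c) (ht : t ∈ Icc (0 : ℝ) 1) :
    flowBox ι V H ζ (dil c q, t) = dil c (flowBox ι V H ζ (q, t)) := by
  obtain ⟨h1, h2⟩ := S.bichar_dil hq hc
  have h3 := S.mul_hitTime_mem hq ht
  rw [flowBox, flowBox, h1, h2 _ ⟨?_, ?_⟩, mul_div_assoc', mul_div_cancel₀ _ hc.ne']
  · exact mul_nonneg ht.1 (div_nonneg (S.hitTime_pos hq).le hc.le)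
  · rw [mul_div_assoc']
    exact div_le_div_of_nonneg_right h3.2 hc.le

end IsScattering
end Scattering
end
end ZeroEnergy

namespace ZeroEnergy
noncomputable section

/-! ### Transport of one-forms along flows -/

theorem subset_closure_interior_prod_Icc {P : Type*} [TopologicalSpace P] {N : Set P} (hN : IsOpen N) {α β : ℝ} (hαβ : α < β) :
    N ×ˢ Icc α β ⊆ closure (interior (N ×ˢ Icc α β)) := by
  rw [interior_prod_eq, closure_prod_eq, hN.interior_eq, interior_Icc, closure_Ioo hαβ.ne]
  exact prod_mono_left subset_closure

section Transport
variable {P E : Type*} [NormedAddCommGroup P] [NormedSpace ℝ P] [NormedAddCommGroup E]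
  [NormedSpace ℝ E]

theorem uniqueDiffOn_prod_Icc {N : Set P} (hN : IsOpen N) {α β : ℝ} (hαβ : α < β) :
    UniqueDiffOn ℝ (N ×ˢ Icc α β) := hN.uniqueDiffOn.prod (uniqueDiffOn_Icc hαβ)

theorem hasDerivWithinAt_prodMk {N : Set P} {α β : ℝ} {z : P} (hz : z ∈ N) {s : ℝ}
    {F : Type*} [NormedAddCommGroup F] [NormedSpace ℝ F] {f : P × ℝ → F} {f' : P × ℝ →L[ℝ] F}
    (hf : HasFDerivWithinAt f f' (N ×ˢ Icc α β) (z, s)) :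
    HasDerivWithinAt (fun s => f (z, s)) (f' (0, 1)) (Icc α β) s :=
  hf.comp_hasDerivWithinAt s ((hasDerivWithinAt_const s _ z).prodMk (hasDerivWithinAt_id s _))
    fun _ ht => ⟨hz, ht⟩

/-- If the Liouville form and the symplectic form vanish on the flow direction, then the pull-back
of the Liouville form is constant along the flow. -/
theorem liouville_transport {N : Set P} (hN : IsOpen N) {α β : ℝ} (hαβ : α < β) {f : P × ℝ → E}
    {g : P × ℝ → E →L[ℝ] ℝ} (hf : ContDiffOn ℝ ∞ f (N ×ˢ Icc α β))
    (hg : ContDiffOn ℝ ∞ g (N ×ˢ Icc α β))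
    (h1 : ∀ x ∈ N ×ˢ Icc α β, g x (fderivWithin ℝ f (N ×ˢ Icc α β) x (0, 1)) = 0)
    (h2 : ∀ x ∈ N ×ˢ Icc α β, ∀ u,
      fderivWithin ℝ g (N ×ˢ Icc α β) x (0, 1) (fderivWithin ℝ f (N ×ˢ Icc α β) x u) -
      fderivWithin ℝ g (N ×ˢ Icc α β) x u (fderivWithin ℝ f (N ×ˢ Icc α β) x (0, 1)) = 0)
    {z : P} (hz : z ∈ N) {s : ℝ} (hs : s ∈ Icc α β) (u : P × ℝ) :
    g (z, s) (fderivWithin ℝ f (N ×ˢ Icc α β) (z, s) u) =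
      g (z, α) (fderivWithin ℝ f (N ×ˢ Icc α β) (z, α) u) := by
  set S := N ×ˢ Icc α β with hS
  have hU : UniqueDiffOn ℝ S := uniqueDiffOn_prod_Icc hN hαβ
  set Θ : P × ℝ → P × ℝ →L[ℝ] ℝ := fun x => (g x).comp (fderivWithin ℝ f S x) with hΘ
  have hΘd : ContDiffOn ℝ ∞ Θ S := hg.clm_comp (hf.fderivWithin hU le_rfl)
  have hd : ∀ s ∈ Icc α β, HasDerivWithinAt (fun s => Θ (z, s) u) 0 (Icc α β) s := by
    intro s hs
    have hx : (z, s) ∈ S := ⟨hz, hs⟩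
    have hΘ1 := (hΘd.differentiableOn (by simp) (z, s) hx).hasFDerivWithinAt
    have hg1 := (hg.differentiableOn (by simp) (z, s) hx).hasFDerivWithinAt
    have h3 := liouville_differential hU hx (subset_closure_interior_prod_Icc hN hαβ hx)
      ((hf (z, s) hx).of_le (by norm_cast)) hg1 hΘ1
      (by filter_upwards [self_mem_nhdsWithin] with y hy u using rfl) (0, 1) u
    rw [h2 _ hx u] at h3
    -- Cartan's formula: Θ(∂_s) vanishes identically, hence so does its derivative in the direction
    -- u, and dΘ(∂_s, u) = 0 then forces the s-derivative of Θ(u) to vanish.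
    have h4 : fderivWithin ℝ Θ S (z, s) u (0, 1) = 0 := by
      have h5 := hΘ1.clm_apply (hasFDerivWithinAt_const ((0 : P), (1 : ℝ)) (z, s) S)
      have h6 : HasFDerivWithinAt (fun x => Θ x (0, 1)) (0 : P × ℝ →L[ℝ] ℝ) S (z, s) :=
        (hasFDerivWithinAt_const (0 : ℝ) (z, s) S).congr (fun x hx => h1 x hx) (h1 _ hx)
      have h7 := congrArg (fun L => L u) ((hU (z, s) hx).eq h5 h6)
      simpa using h7
    have h8 := hasDerivWithinAt_prodMk hz (hΘ1.clm_apply (hasFDerivWithinAt_const u (z, s) S))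
    refine h8.congr_deriv ?_
    simp only [map_zero, add_apply, ContinuousLinearMap.comp_apply, zero_apply, zero_add,
      ContinuousLinearMap.flip_apply]
    linarith
  exact constant_of_has_deriv_right_zero (fun t ht => (hd t ht).continuousWithinAt)
    (fun t ht => (hd t (Ico_subset_Icc_self ht)).Ici_of_Icc ht) s hs

/-- A continuous curve that starts in `O ⊆ Z` and is in `O` as long as it has been in `Z` stays
in `O`. -/
theorem curve_confined {X : Type*} [TopologicalSpace X] {γ : ℝ → X} {a b : ℝ} {O Z : Set X}
    (hO : IsOpen O) (hZ : IsClosed Z) (hOZ : O ⊆ Z) (hγ : ContinuousOn γ (Icc a b)) (ha : γ a ∈ O)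
    (h : ∀ s ∈ Icc a b, (∀ r ∈ Icc a s, γ r ∈ Z) → γ s ∈ O) : ∀ s ∈ Icc a b, γ s ∈ O := by
  by_contra! hne
  obtain ⟨s, hs, hsO⟩ := hne
  have hC : IsCompact (Icc a b ∩ γ ⁻¹' Oᶜ) :=
    isCompact_Icc.of_isClosed_subset
      (hγ.preimage_isClosed_of_isClosed isClosed_Icc hO.isClosed_compl) inter_subset_left
  obtain ⟨m, ⟨hm, hmO⟩, hmin⟩ := hC.exists_isLeast ⟨s, hs, hsO⟩
  have hlt : ∀ r ∈ Ico a m, γ r ∈ O := by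
    intro r hr
    by_contra hr'
    exact absurd (hmin ⟨⟨hr.1, hr.2.le.trans hm.2⟩, hr'⟩) (not_le.2 hr.2)
  have ham : a < m := lt_of_le_of_ne hm.1 (by rintro rfl; exact hmO ha)
  have hmZ : γ m ∈ Z := by
    have h1 : ContinuousWithinAt γ (Ico a m) m :=
      (hγ m hm).mono fun r hr => ⟨hr.1, hr.2.le.trans hm.2⟩
    refine hZ.closure_subset_iff.2 hOZ (h1.mem_closure ?_ hlt)
    rw [closure_Ico ham.ne]
    exact right_mem_Icc.2 ham.le
  refine hmO (h m hm fun r hr => ?_)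
  rcases hr.2.eq_or_lt with rfl | h1
  · exact hmZ
  · exact hOZ (hlt r ⟨hr.1, h1⟩)

theorem contDiffOn_flow_infty {P : Type} [NormedAddCommGroup P] [NormedSpace ℝ P]
    {E : Type} [NormedAddCommGroup E] [NormedSpace ℝ E] [FiniteDimensional ℝ E]
    {Q : Set P} (hQ : IsOpen Q) {α β : ℝ} (hαβ : α ≤ β)
    {K : Set E} (hK : IsCompact K) (hKc : Convex ℝ K) (hKi : (interior K).Nonempty)
    {Y : E → E} (hY : ContDiffOn ℝ ∞ Y K) {G : P → ℝ → E}
    (hG : ∀ q ∈ Q, IsFlowLine Y K α β (G q)) (hG0 : ContDiffOn ℝ ∞ (fun q => G q α) Q) :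
    ContDiffOn ℝ ∞ (fun x : P × ℝ => G x.1 x.2) (Q ×ˢ Icc α β) :=
  contDiffOn_infty.2 fun n => contDiffOn_flow hQ hαβ n E K hK hKc hKi Y hY G hG
    (contDiffOn_infty.1 hG0 n)

/-- Smooth dependence on parameters for `y' = τ Y(y)`, where `τ` depends on the parameter. -/
theorem contDiffOn_scaled_flow {P : Type} [NormedAddCommGroup P] [NormedSpace ℝ P]
    {E : Type} [NormedAddCommGroup E] [NormedSpace ℝ E] [FiniteDimensional ℝ E]
    {Q : Set P} (hQ : IsOpen Q) {α β : ℝ} (hαβ : α ≤ β)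
    {K : Set E} (hK : IsCompact K) (hKc : Convex ℝ K) (hKi : (interior K).Nonempty)
    {Y : E → E} (hY : ContDiffOn ℝ ∞ Y K) {τ : P → ℝ} {a b : ℝ} (hab : a < b)
    (hτ : ContDiffOn ℝ ∞ τ Q) (hτK : MapsTo τ Q (Icc a b)) {G : P → ℝ → E}
    (hG : ∀ q ∈ Q, ∀ t ∈ Icc α β, G q t ∈ K ∧
      HasDerivWithinAt (G q) (τ q • Y (G q t)) (Icc α β) t)
    (hG0 : ContDiffOn ℝ ∞ (fun q => G q α) Q) :
    ContDiffOn ℝ ∞ (fun x : P × ℝ => G x.1 x.2) (Q ×ˢ Icc α β) := by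
  -- The speed τ is adjoined as an unknown that is constant in time, which makes the field
  -- independent of the parameter.
  have h1 := contDiffOn_flow_infty (E := ℝ × E) hQ hαβ (K := Icc a b ×ˢ K)
    (isCompact_Icc.prod hK) ((convex_Icc a b).prod hKc)
    (by
      rw [interior_prod_eq, interior_Icc]
      exact (nonempty_Ioo.2 hab).prod hKi)
    (Y := fun y => (0, y.1 • Y y.2))
    (contDiffOn_const.prodMk (contDiffOn_fst.smul (hY.comp contDiffOn_snd fun y hy => hy.2)))
    (G := fun q t => (τ q, G q t))
    (fun q hq => ⟨fun t ht => ⟨hτK hq, (hG q hq t ht).1⟩, fun t ht =>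
      (hasDerivWithinAt_const t _ (τ q)).prodMk (hG q hq t ht).2⟩)
    (hτ.prodMk hG0)
  exact contDiff_snd.comp_contDiffOn h1

end Transport

/-! ### Euler's identity for the Hamiltonian field -/

section Euler
variable {E : Type*} [NormedAddCommGroup E] [NormedSpace ℝ E] {A : Type*}
  [TopologicalSpace A] {I : ModelWithCorners ℝ E A} {M : Type*} [TopologicalSpace M]
  [ChartedSpace A M] [IsManifold I ∞ M] {H : Cotangent I M → ℝ}

theorem dilE_mem_target {p₀ : Cotangent I M} {w : E × (E →L[ℝ] ℝ)} (hw : w ∈ (cchart p₀).target)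
    (c : ℝ) : dilE c w ∈ (cchart p₀).target := by
  rw [cchart_target] at hw ⊢
  exact ⟨hw.1, mem_univ _⟩

theorem symm_dilE {p₀ : Cotangent I M} {w : E × (E →L[ℝ] ℝ)} (hw : w ∈ (cchart p₀).target)
    (c : ℝ) : (cchart p₀).symm (dilE c w) = dil c ((cchart p₀).symm w) := by
  have h := cchart_dil c ((cchart p₀).map_target hw)
  rw [(cchart p₀).right_inv hw] at h
  rw [← h, (cchart p₀).left_inv (dil_mem_source c ((cchart p₀).map_target hw))]

theorem symm_snd_ne_zero {p₀ : Cotangent I M} {w : E × (E →L[ℝ] ℝ)} (hw : w ∈ (cchart p₀).target)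
    (hw2 : w.2 ≠ 0) : ((cchart p₀).symm w).snd ≠ 0 := by
  rw [Ne, ← cchart_snd_eq_zero_iff ((cchart p₀).map_target hw), (cchart p₀).right_inv hw]
  exact hw2

variable [FiniteDimensional ℝ E]

theorem sympE_hamField (p₀ : Cotangent I M) (w v : E × (E →L[ℝ] ℝ)) :
    sympE v (hamField H p₀ w) =
      fderivWithin ℝ (H ∘ (cchart p₀).symm) (range (cotModel I)) w v :=
  sympE_sympIso_symm _ _

/-- Euler's identity `ξ · H_ξ = 2 H`. -/
theorem euler_hamField (hH : IsHamiltonian H) {p₀ : Cotangent I M} {w : E × (E →L[ℝ] ℝ)}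
    (hw : w ∈ (cchart p₀).target) (hw2 : w.2 ≠ 0) :
    w.2 (hamField H p₀ w).1 = 2 * H ((cchart p₀).symm w) := by
  -- Pairing X_H with the vertical vector (0, ξ) gives ξ·H_ξ, so it is the derivative of H along the
  -- ray c ↦ (x, cξ), where H is quadratic in c.
  have h1 : w.2 (hamField H p₀ w).1 =
      fderivWithin ℝ (H ∘ (cchart p₀).symm) (range (cotModel I)) w (0, w.2) := by
    rw [← sympE_hamField]
    simp [sympE]
  have h2 := ((contDiffWithinAt_symm_cchart hH hw hw2).differentiableWithinAt
    (by simp)).hasFDerivWithinAt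
  have h3 : HasDerivWithinAt (fun c : ℝ => dilE c w) (0, w.2) (Ioi 0) 1 := by
    have h4 : HasDerivWithinAt (fun c : ℝ => c • w.2) w.2 (Ioi 0) 1 := by
      simpa using (hasDerivWithinAt_id (1 : ℝ) (Ioi 0)).smul_const w.2
    exact (hasDerivWithinAt_const (1 : ℝ) (Ioi 0) w.1).prodMk h4
  have e1 : dilE 1 w = w := by simp
  have h2' : HasFDerivWithinAt (H ∘ (cchart p₀).symm)
      (fderivWithin ℝ (H ∘ (cchart p₀).symm) (range (cotModel I)) w)
      (range (cotModel I)) (dilE 1 w) := by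
    rw [e1]
    exact h2
  have h5 := h2'.comp_hasDerivWithinAt 1 h3
    fun c _ => extChartAt_target_subset_range p₀ (dilE_mem_target hw c)
  have h6 : HasDerivWithinAt (fun c : ℝ => c ^ 2 * H ((cchart p₀).symm w))
      (2 * H ((cchart p₀).symm w)) (Ioi 0) 1 := by
    have := ((hasDerivWithinAt_id (1 : ℝ) (Ioi 0)).pow 2).mul_const (H ((cchart p₀).symm w))
    simpa using this
  have h7 : HasDerivWithinAt (fun c : ℝ => c ^ 2 * H ((cchart p₀).symm w))
      (fderivWithin ℝ (H ∘ (cchart p₀).symm) (range (cotModel I)) w (0, w.2)) (Ioi 0) 1 := by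
    have hc : ∀ c ∈ Ioi (0 : ℝ), c ^ 2 * H ((cchart p₀).symm w) =
        (H ∘ (cchart p₀).symm) (dilE c w) := fun c hc => by
      rw [Function.comp_apply, symm_dilE hw, hH.homogeneous c _ hc (symm_snd_ne_zero hw hw2)]
    exact h5.congr hc (hc 1 (mem_Ioi.2 one_pos))
  rw [h1]
  exact (uniqueDiffOn_Ioi 0 1 (mem_Ioi.2 one_pos)).eq_deriv _ h7 h6

end Euler
end
end ZeroEnergy

namespace ZeroEnergy
noncomputable section

/-- The model space `ℝⁿ × (ℝⁿ)*` of the cotangent bundle. -/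
abbrev Phase (n : ℕ) : Type :=
  EuclideanSpace ℝ (Fin n) × (EuclideanSpace ℝ (Fin n) →L[ℝ] ℝ)

/-! ### The flow-out in local parameters and its Liouville form at the entry -/

section FlowParam
variable {d : ℕ}
  {B : Type*} [TopologicalSpace B] [ChartedSpace (EuclideanSpace ℝ (Fin d)) B]
  [IsManifold (𝓡 d) ∞ B]
  {M : Type*} [TopologicalSpace M] [ChartedSpace (EuclideanHalfSpace (d + 1)) M]
  [IsManifold (𝓡∂ (d + 1)) ∞ M]

/-- The image of `𝒰` in the chart of `T*B` at `q₀`. -/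
def paramSet (𝒰 : Set (Cotangent (𝓡 d) B)) (q₀ : Cotangent (𝓡 d) B) : Set (Phase d) :=
  (cchart q₀).target ∩ (cchart q₀).symm ⁻¹' 𝒰

/-- `flowBox` in the chart of `T*B` at `q₀`. -/
def flowParam (ι : B → M) (V : Set B) (H : Cotangent (𝓡∂ (d + 1)) M → ℝ)
    (ζ : Cotangent (𝓡 d) B → Cotangent (𝓡∂ (d + 1)) M) (q₀ : Cotangent (𝓡 d) B)
    (x : Phase d × ℝ) : Cotangent (𝓡∂ (d + 1)) M :=
  flowBox ι V H ζ ((cchart q₀).symm x.1, x.2)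

/-- The hitting time in the chart of `T*B` at `q₀`. -/
def timeParam (ι : B → M) (V : Set B) (H : Cotangent (𝓡∂ (d + 1)) M → ℝ)
    (ζ : Cotangent (𝓡 d) B → Cotangent (𝓡∂ (d + 1)) M) (q₀ : Cotangent (𝓡 d) B)
    (z : Phase d) : ℝ :=
  hitTime ι V H ζ ((cchart q₀).symm z)

/-- Near the parameters `N`, at the time `s`, the flow is smooth in the parameters and pulls back
the Liouville form to the Liouville form. -/
def IsGoodTime (ι : B → M) (V : Set B) (𝒰 : Set (Cotangent (𝓡 d) B))
    (H : Cotangent (𝓡∂ (d + 1)) M → ℝ)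
    (ζ : Cotangent (𝓡 d) B → Cotangent (𝓡∂ (d + 1)) M) (q₀ : Cotangent (𝓡 d) B) (s : ℝ) : Prop :=
  ∃ N : Set (Phase d), IsOpen N ∧ cchart q₀ q₀ ∈ N ∧ N ⊆ paramSet 𝒰 q₀ ∧
    ContMDiffOn 𝓘(ℝ, Phase d) (cotModel (𝓡∂ (d + 1))) ∞ (fun z => flowParam ι V H ζ q₀ (z, s)) N ∧
    ∀ z ∈ N, ∀ a : Phase d, (flowParam ι V H ζ q₀ (z, s)).snd
      (show Phase (d + 1) from mfderiv 𝓘(ℝ, Phase d) (cotModel (𝓡∂ (d + 1)))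
        (fun z => flowParam ι V H ζ q₀ (z, s)) z a).1 = z.2 a.1

/-- The representation of the flow in the charts at `q₀` and `p₀`. -/
def flowRep (ι : B → M) (V : Set B) (H : Cotangent (𝓡∂ (d + 1)) M → ℝ)
    (ζ : Cotangent (𝓡 d) B → Cotangent (𝓡∂ (d + 1)) M) (q₀ : Cotangent (𝓡 d) B)
    (p₀ : Cotangent (𝓡∂ (d + 1)) M) (x : Phase d × ℝ) : Phase (d + 1) :=
  cchart p₀ (flowParam ι V H ζ q₀ x)

/-- On the product of `N` and `[α, β]`, the flow stays in the chart at `p₀`, is smooth, and pulls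
back the Liouville form to the Liouville form. -/
structure IsFlowChart (ι : B → M) (V : Set B) (𝒰 : Set (Cotangent (𝓡 d) B))
    (H : Cotangent (𝓡∂ (d + 1)) M → ℝ)
    (ζ : Cotangent (𝓡 d) B → Cotangent (𝓡∂ (d + 1)) M) (q₀ : Cotangent (𝓡 d) B)
    (p₀ : Cotangent (𝓡∂ (d + 1)) M) (N : Set (Phase d)) (α β : ℝ) : Prop where
  isOpen : IsOpen N
  subset : N ⊆ paramSet 𝒰 q₀
  center : cchart q₀ q₀ ∈ N
  lt : α < β
  Icc_subset : Icc α β ⊆ Icc 0 1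
  mem_source : ∀ x ∈ N ×ˢ Icc α β, flowParam ι V H ζ q₀ x ∈ (cchart p₀).source
  smooth : ContDiffOn ℝ ∞ (flowRep ι V H ζ q₀ p₀) (N ×ˢ Icc α β)
  liouville : ∀ x ∈ N ×ˢ Icc α β, ∀ u : Phase d × ℝ,
    (flowRep ι V H ζ q₀ p₀ x).2
      (fderivWithin ℝ (flowRep ι V H ζ q₀ p₀) (N ×ˢ Icc α β) x u).1 = x.1.2 u.1.1

variable {ι : B → M} {U V : Set B} {𝒰 : Set (Cotangent (𝓡 d) B)}
  {H : Cotangent (𝓡∂ (d + 1)) M → ℝ} {ζ : Cotangent (𝓡 d) B → Cotangent (𝓡∂ (d + 1)) M}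
  {q₀ : Cotangent (𝓡 d) B} {p₀ : Cotangent (𝓡∂ (d + 1)) M} {N : Set (Phase d)} {α β s : ℝ}

theorem isOpen_paramSet (h𝒰 : IsOpen 𝒰) : IsOpen (paramSet 𝒰 q₀) :=
  (continuousOn_extChartAt_symm q₀).isOpen_inter_preimage (isOpen_extChartAt_target q₀) h𝒰

theorem center_mem_paramSet (hq₀ : q₀ ∈ 𝒰) : cchart q₀ q₀ ∈ paramSet 𝒰 q₀ := by
  refine ⟨mem_extChartAt_target q₀, ?_⟩
  rw [mem_preimage, (cchart q₀).left_inv (mem_extChartAt_source q₀)]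
  exact hq₀

theorem flowParam_center (s : ℝ) :
    flowParam ι V H ζ q₀ (cchart q₀ q₀, s) = flowBox ι V H ζ (q₀, s) := by
  rw [flowParam, (cchart q₀).left_inv (mem_extChartAt_source q₀)]

theorem contMDiffOn_cchart_symm (q₀ : Cotangent (𝓡 d) B) :
    ContMDiffOn 𝓘(ℝ, Phase d) (cotModel (𝓡 d)) ∞ (cchart q₀).symm (cchart q₀).target :=
  contMDiffOn_extChartAt_symm q₀

theorem cchart_symm_liouville {z : Phase d} (hz : z ∈ (cchart q₀).target) (a : Phase d) :
    ((cchart q₀).symm z).snd (show Phase d from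
      mfderiv 𝓘(ℝ, Phase d) (cotModel (𝓡 d)) (cchart q₀).symm z a).1 = z.2 a.1 := by
  have hs := (cchart q₀).map_target hz
  have h1 : HasMFDerivAt 𝓘(ℝ, Phase d) (cotModel (𝓡 d)) (cchart q₀).symm z
      (mfderiv 𝓘(ℝ, Phase d) (cotModel (𝓡 d)) (cchart q₀).symm z) :=
    (((contMDiffOn_cchart_symm q₀).contMDiffAt
      ((isOpen_extChartAt_target q₀).mem_nhds hz)).mdifferentiableAt (by simp)).hasMFDerivAt
  have h2 := HasMFDerivAt.comp z (mdifferentiableAt_cchart hs).hasMFDerivAt h1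
  have h3 : HasMFDerivAt 𝓘(ℝ, Phase d) 𝓘(ℝ, Phase d) (cchart q₀ ∘ (cchart q₀).symm) z
      (ContinuousLinearMap.id ℝ (Phase d)) := by
    refine (hasMFDerivAt_id z).congr_of_eventuallyEq ?_
    filter_upwards [(isOpen_extChartAt_target q₀).mem_nhds hz] with y hy
      using (cchart q₀).right_inv hy
  have h4 : dchart q₀ ((cchart q₀).symm z)
      (mfderiv 𝓘(ℝ, Phase d) (cotModel (𝓡 d)) (cchart q₀).symm z a) = a :=
    congrArg (fun L => L a) (hasMFDerivAt_unique h2 h3)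
  have h5 := cchart_liouville hs (show Phase d from
    mfderiv 𝓘(ℝ, Phase d) (cotModel (𝓡 d)) (cchart q₀).symm z a)
  rw [h4, (cchart q₀).right_inv hz] at h5
  exact h5.symm

theorem IsRestriction.apply {p : Cotangent (𝓡∂ (d + 1)) M} {q : Cotangent (𝓡 d) B}
    (h : IsRestriction ι p q) {v : EuclideanSpace ℝ (Fin (d + 1))} {e : EuclideanSpace ℝ (Fin d)}
    (hv : v = mfderiv (𝓡 d) (𝓡∂ (d + 1)) ι q.proj e) : p.snd v = q.snd e := by
  obtain ⟨ξ, rfl, h1⟩ := h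
  rw [hv]
  exact (h1 e).symm

theorem contMDiffOn_of_cchart {F : Type*} [NormedAddCommGroup F] [NormedSpace ℝ F] {N : Set F}
    {f : F → Cotangent (𝓡∂ (d + 1)) M} (hf : ∀ z ∈ N, f z ∈ (cchart p₀).source)
    (h : ContDiffOn ℝ ∞ (fun z => cchart p₀ (f z)) N) :
    ContMDiffOn 𝓘(ℝ, F) (cotModel (𝓡∂ (d + 1))) ∞ f N := by
  have h1 : ContMDiffOn 𝓘(ℝ, F) (cotModel (𝓡∂ (d + 1))) ∞
      (fun z => (cchart p₀).symm (cchart p₀ (f z))) N :=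
    (contMDiffOn_extChartAt_symm (I := cotModel (𝓡∂ (d + 1))) p₀).comp h.contMDiffOn
      fun z hz => (cchart p₀).map_source (hf z hz)
  exact h1.congr fun z hz => ((cchart p₀).left_inv (hf z hz)).symm

theorem contMDiffOn_flowParam (hsource : ∀ x ∈ N ×ˢ Icc α β,
      flowParam ι V H ζ q₀ x ∈ (cchart p₀).source)
    (hsm : ContDiffOn ℝ ∞ (flowRep ι V H ζ q₀ p₀) (N ×ˢ Icc α β)) (hs : s ∈ Icc α β) :
    ContMDiffOn 𝓘(ℝ, Phase d) (cotModel (𝓡∂ (d + 1))) ∞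
      (fun z => flowParam ι V H ζ q₀ (z, s)) N :=
  contMDiffOn_of_cchart (p₀ := p₀) (fun z hz => hsource (z, s) ⟨hz, hs⟩)
    (hsm.comp (contDiffOn_id.prodMk contDiffOn_const) fun _ hz => ⟨hz, hs⟩)

/-- Links the chart-free pull-back at a fixed time in `IsGoodTime` with the coordinate version in
`IsFlowChart`; this lets the identity pass from one chart to the next. -/
theorem flowRep_liouville (hN : IsOpen N) (hsource : ∀ x ∈ N ×ˢ Icc α β,
      flowParam ι V H ζ q₀ x ∈ (cchart p₀).source)
    (hsm : ContDiffOn ℝ ∞ (flowRep ι V H ζ q₀ p₀) (N ×ˢ Icc α β)) (hs : s ∈ Icc α β)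
    {z : Phase d} (hz : z ∈ N) (a : Phase d) :
    (flowParam ι V H ζ q₀ (z, s)).snd
      (show Phase (d + 1) from mfderiv 𝓘(ℝ, Phase d) (cotModel (𝓡∂ (d + 1)))
        (fun z => flowParam ι V H ζ q₀ (z, s)) z a).1 =
    (flowRep ι V H ζ q₀ p₀ (z, s)).2
      (fderivWithin ℝ (flowRep ι V H ζ q₀ p₀) (N ×ˢ Icc α β) (z, s) (a, 0)).1 := by
  have hx : (z, s) ∈ N ×ˢ Icc α β := ⟨hz, hs⟩
  have h1 : HasMFDerivAt 𝓘(ℝ, Phase d) (cotModel (𝓡∂ (d + 1)))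
      (fun z => flowParam ι V H ζ q₀ (z, s)) z (mfderiv 𝓘(ℝ, Phase d) (cotModel (𝓡∂ (d + 1)))
      (fun z => flowParam ι V H ζ q₀ (z, s)) z) :=
    (((contMDiffOn_flowParam hsource hsm hs).contMDiffAt (hN.mem_nhds hz)).mdifferentiableAt
      (by simp)).hasMFDerivAt
  have h2 := HasMFDerivAt.comp z (mdifferentiableAt_cchart (hsource _ hx)).hasMFDerivAt h1
  have h3 := (hsm.differentiableOn (by simp) _ hx).hasFDerivWithinAt
  have h4 : HasFDerivAt (fun z : Phase d => (z, s)) (ContinuousLinearMap.inl ℝ (Phase d) ℝ) z :=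
    hasFDerivAt_prodMk_left z s
  have hm : MapsTo (fun z : Phase d => (z, s)) N (N ×ˢ Icc α β) := fun y hy => ⟨hy, hs⟩
  have h5 := (h3.comp z h4.hasFDerivWithinAt hm).hasFDerivAt
    (hN.mem_nhds hz)
  have h6 := congrArg (fun L => L a) (hasMFDerivAt_unique h2 h5.hasMFDerivAt)
  have h8 := cchart_liouville (hsource _ hx) (show Phase (d + 1) from
    mfderiv 𝓘(ℝ, Phase d) (cotModel (𝓡∂ (d + 1))) (fun z => flowParam ι V H ζ q₀ (z, s)) z a)
  refine h8.symm.trans ?_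
  exact congrArg (fun v : Phase (d + 1) => (flowRep ι V H ζ q₀ p₀ (z, s)).2 v.1) h6

theorem IsFlowChart.isGoodTime (h : IsFlowChart ι V 𝒰 H ζ q₀ p₀ N α β) (hs : s ∈ Icc α β) :
    IsGoodTime ι V 𝒰 H ζ q₀ s :=
  ⟨N, h.isOpen, h.center, h.subset, contMDiffOn_flowParam h.mem_source h.smooth hs,
    fun z hz a => (flowRep_liouville h.isOpen h.mem_source h.smooth hs hz a).trans
      (h.liouville _ ⟨hz, hs⟩ (a, 0))⟩

namespace IsScattering

variable (S : IsScattering ι U V 𝒰 H ζ)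
include S

/-- At time zero the flow is ζ, which covers ι. Hence ξ dx pulled back by ζ evaluates `ζ q` on
vectors tangent to the boundary, where it restricts to q. -/
theorem isGoodTime_zero (hq₀ : q₀ ∈ 𝒰) : IsGoodTime ι V 𝒰 H ζ q₀ 0 := by
  have hopen := isOpen_paramSet (q₀ := q₀) S.isOpen
  have heq : ∀ z ∈ paramSet 𝒰 q₀, flowParam ι V H ζ q₀ (z, 0) = ζ ((cchart q₀).symm z) :=
    fun z hz => S.flowBox_zero hz.2
  have hsm : ContMDiffOn 𝓘(ℝ, Phase d) (cotModel (𝓡∂ (d + 1))) ∞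
      (fun z => flowParam ι V H ζ q₀ (z, 0)) (paramSet 𝒰 q₀) :=
    (S.smooth_zeta.comp ((contMDiffOn_cchart_symm q₀).mono inter_subset_left)
      (fun z hz => hz.2)).congr heq
  refine ⟨paramSet 𝒰 q₀, hopen, center_mem_paramSet hq₀, subset_rfl, hsm, fun z hz a => ?_⟩
  set q := (cchart q₀).symm z with hq
  have hq𝒰 : q ∈ 𝒰 := hz.2
  have h1 : HasMFDerivAt 𝓘(ℝ, Phase d) (cotModel (𝓡∂ (d + 1)))
      (fun z => flowParam ι V H ζ q₀ (z, 0)) z (mfderiv 𝓘(ℝ, Phase d) (cotModel (𝓡∂ (d + 1)))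
      (fun z => flowParam ι V H ζ q₀ (z, 0)) z) :=
    ((hsm.contMDiffAt (hopen.mem_nhds hz)).mdifferentiableAt (by simp)).hasMFDerivAt
  have h2 := HasMFDerivAt.comp z ((proj_contMDiff _).mdifferentiableAt (by simp)).hasMFDerivAt h1
  have h3 : HasMFDerivAt 𝓘(ℝ, Phase d) (cotModel (𝓡 d)) (cchart q₀).symm z
      (mfderiv 𝓘(ℝ, Phase d) (cotModel (𝓡 d)) (cchart q₀).symm z) :=
    (((contMDiffOn_cchart_symm q₀).contMDiffAt
      ((isOpen_extChartAt_target q₀).mem_nhds hz.1)).mdifferentiableAt (by simp)).hasMFDerivAt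
  have h4 := HasMFDerivAt.comp z ((proj_contMDiff _).mdifferentiableAt (by simp)).hasMFDerivAt h3
  have h5 := HasMFDerivAt.comp z ((S.incl.smooth _).mdifferentiableAt (by simp)).hasMFDerivAt h4
  have h6 : (fun p : Cotangent (𝓡∂ (d + 1)) M => p.proj) ∘
      (fun z => flowParam ι V H ζ q₀ (z, 0)) =ᶠ[𝓝 z]
      ι ∘ (fun q : Cotangent (𝓡 d) B => q.proj) ∘ (cchart q₀).symm := by
    filter_upwards [hopen.mem_nhds hz] with y hy
    change (flowParam ι V H ζ q₀ (y, 0)).proj = ι ((cchart q₀).symm y).proj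
    rw [heq y hy, S.proj_zeta hy.2]
  have h7 := congrArg (fun L => L a) (hasMFDerivAt_unique h2 (h5.congr_of_eventuallyEq h6))
  obtain ⟨ξ, hξ, hres⟩ := S.restriction_zeta q hq𝒰
  rw [← cchart_symm_liouville hz.1 a]
  have h8 : IsRestriction ι (flowParam ι V H ζ q₀ (z, 0)) q := by
    rw [heq z hz]
    exact S.restriction_zeta q hq𝒰
  refine h8.apply ?_
  have h9 := mfderiv_proj (flowParam ι V H ζ q₀ (z, 0)) (mfderiv 𝓘(ℝ, Phase d)
    (cotModel (𝓡∂ (d + 1))) (fun z => flowParam ι V H ζ q₀ (z, 0)) z a)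
  have h10 := mfderiv_proj q (mfderiv 𝓘(ℝ, Phase d) (cotModel (𝓡 d)) (cchart q₀).symm z a)
  exact h9.symm.trans (h7.trans
    (congrArg (fun e => mfderiv (𝓡 d) (𝓡∂ (d + 1)) ι q.proj e) h10))

theorem contDiffOn_timeParam [T2Space M] :
    ContDiffOn ℝ ∞ (timeParam ι V H ζ q₀) (paramSet 𝒰 q₀) :=
  contMDiffOn_iff_contDiffOn.1 (S.smooth_hitTime.comp
    ((contMDiffOn_cchart_symm q₀).mono inter_subset_left) fun _ hz => hz.2)

theorem hasDerivWithinAt_flowRep {z : Phase d} (hz : z ∈ paramSet 𝒰 q₀) (hs : s ∈ Icc (0 : ℝ) 1)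
    (hp : flowParam ι V H ζ q₀ (z, s) ∈ (cchart p₀).source) :
    HasDerivWithinAt (fun s => flowRep ι V H ζ q₀ p₀ (z, s))
      (timeParam ι V H ζ q₀ z • hamField H p₀ (flowRep ι V H ζ q₀ p₀ (z, s))) (Icc 0 1) s := by
  have h1 := hasDerivWithinAt_cchart_comp S.ham (S.bichar_curve hz.2).1
    (S.mul_hitTime_mem hz.2 hs) hp
  have h2 : HasDerivWithinAt (fun s => s * timeParam ι V H ζ q₀ z) (timeParam ι V H ζ q₀ z)
      (Icc 0 1) s := by
    simpa using (hasDerivWithinAt_id s (Icc 0 1)).mul_const (timeParam ι V H ζ q₀ z)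
  exact h1.scomp s h2 fun r hr => S.mul_hitTime_mem hz.2 hr

theorem flowParam_mem [T2Space M] {z : Phase d} (hz : z ∈ paramSet 𝒰 q₀)
    (hs : s ∈ Icc (0 : ℝ) 1) : flowParam ι V H ζ q₀ (z, s) ∈ Gamma H 𝒰 ζ :=
  S.flowBox_bijOn.mapsTo ⟨hz.2, hs⟩

theorem continuousOn_flowParam {z : Phase d} (hz : z ∈ paramSet 𝒰 q₀) :
    ContinuousOn (fun s => flowParam ι V H ζ q₀ (z, s)) (Icc 0 1) := by
  have h1 : ContinuousOn (fun s => s * timeParam ι V H ζ q₀ z) (Icc 0 1) := by fun_prop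
  have h2 : MapsTo (fun s => s * timeParam ι V H ζ q₀ z) (Icc 0 1)
    (Icc 0 (timeParam ι V H ζ q₀ z)) := fun _ hr => S.mul_hitTime_mem hz.2 hr
  have h3 := (S.bichar_curve hz.2).1.continuousOn
  have h4 := ContinuousOn.comp h3 h1 h2
  exact h4

end IsScattering
end FlowParam
end
end ZeroEnergy

namespace ZeroEnergy
noncomputable section

theorem sympE_smul_left {E : Type*} [NormedAddCommGroup E] [NormedSpace ℝ E] (c : ℝ)
    (v w : E × (E →L[ℝ] ℝ)) : sympE (c • v) w = c * sympE v w := by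
  simp only [sympE, Prod.smul_fst, Prod.smul_snd, map_smul, smul_apply, smul_eq_mul]
  ring

/-! ### Propagation of smoothness and of the Liouville form along the flow -/

section FlowChart
variable {d : ℕ}
  {B : Type*} [TopologicalSpace B] [ChartedSpace (EuclideanSpace ℝ (Fin d)) B]
  [IsManifold (𝓡 d) ∞ B]
  {M : Type*} [TopologicalSpace M] [ChartedSpace (EuclideanHalfSpace (d + 1)) M]
  [IsManifold (𝓡∂ (d + 1)) ∞ M] [T2Space M]
  {ι : B → M} {U V : Set B} {𝒰 : Set (Cotangent (𝓡 d) B)}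
  {H : Cotangent (𝓡∂ (d + 1)) M → ℝ} {ζ : Cotangent (𝓡 d) B → Cotangent (𝓡∂ (d + 1)) M}
  {q₀ : Cotangent (𝓡 d) B} {p₀ : Cotangent (𝓡∂ (d + 1)) M} {N : Set (Phase d)} {α β s : ℝ}

namespace IsScattering

variable (S : IsScattering ι U V 𝒰 H ζ)
include S

section Local
variable (hN : IsOpen N) (hNs : N ⊆ paramSet 𝒰 q₀) (hαβ : α < β) (hI : Icc α β ⊆ Icc 0 1)
  (hsource : ∀ x ∈ N ×ˢ Icc α β, flowParam ι V H ζ q₀ x ∈ (cchart p₀).source)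
  (hsm : ContDiffOn ℝ ∞ (flowRep ι V H ζ q₀ p₀) (N ×ˢ Icc α β))
include hNs hI hsource

theorem flowRep_mem {x : Phase d × ℝ} (hx : x ∈ N ×ˢ Icc α β) :
    flowRep ι V H ζ q₀ p₀ x ∈ (cchart p₀).target ∧ (flowRep ι V H ζ q₀ p₀ x).2 ≠ 0 ∧
      H ((cchart p₀).symm (flowRep ι V H ζ q₀ p₀ x)) = 0 := by
  have h1 := S.flowParam_mem (hNs hx.1) (hI hx.2)
  refine ⟨(cchart p₀).map_source (hsource x hx), ?_, ?_⟩
  · rw [flowRep, Ne, cchart_snd_eq_zero_iff (hsource x hx)]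
    exact S.snd_ne_zero h1
  · rw [flowRep, (cchart p₀).left_inv (hsource x hx)]
    exact S.energy_eq_zero h1

include hαβ hsm

theorem fderivWithin_flowRep_time {x : Phase d × ℝ} (hx : x ∈ N ×ˢ Icc α β) :
    fderivWithin ℝ (flowRep ι V H ζ q₀ p₀) (N ×ˢ Icc α β) x (0, 1) =
      timeParam ι V H ζ q₀ x.1 • hamField H p₀ (flowRep ι V H ζ q₀ p₀ x) := by
  have h1 := hasDerivWithinAt_prodMk (z := x.1) (s := x.2) hx.1
    (hsm.differentiableOn (by simp) x hx).hasFDerivWithinAt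
  have h2 := (S.hasDerivWithinAt_flowRep (hNs hx.1) (hI hx.2) (hsource x hx)).mono hI
  exact (uniqueDiffOn_Icc hαβ _ hx.2).eq_deriv _ h1 h2

include hN

theorem dH_flowRep {x : Phase d × ℝ} (hx : x ∈ N ×ˢ Icc α β) (u : Phase d × ℝ) :
    fderivWithin ℝ (H ∘ (cchart p₀).symm) (range (cotModel (𝓡∂ (d + 1))))
      (flowRep ι V H ζ q₀ p₀ x)
      (fderivWithin ℝ (flowRep ι V H ζ q₀ p₀) (N ×ˢ Icc α β) x u) = 0 := by
  obtain ⟨h1, h2, h3⟩ := S.flowRep_mem hNs hI hsource hx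
  have h4 := ((contDiffWithinAt_symm_cchart S.ham h1 h2).differentiableWithinAt
    (by simp)).hasFDerivWithinAt
  have h5 := h4.comp x (hsm.differentiableOn (by simp) x hx).hasFDerivWithinAt
    (fun y _ => cchart_mem_range p₀ _)
  have h6 : HasFDerivWithinAt ((H ∘ (cchart p₀).symm) ∘ flowRep ι V H ζ q₀ p₀)
      (0 : Phase d × ℝ →L[ℝ] ℝ) (N ×ˢ Icc α β) x :=
    (hasFDerivWithinAt_const (0 : ℝ) x _).congr
      (fun y hy => (S.flowRep_mem hNs hI hsource hy).2.2) h3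
  exact congrArg (fun L => L u) ((uniqueDiffOn_prod_Icc hN hαβ x hx).eq h5 h6)

/-- Euler's identity on H = 0 makes the Liouville form vanish on X_H, and σ(X_H, ·) = -dH vanishes
on the image of the flow, where H = 0. So `liouville_transport` reduces the identity to the initial
time `α`. -/
theorem liouville_flowRep
    (h0 : ∀ z ∈ N, ∀ a : Phase d, (flowParam ι V H ζ q₀ (z, α)).snd
      (show Phase (d + 1) from mfderiv 𝓘(ℝ, Phase d) (cotModel (𝓡∂ (d + 1)))
        (fun z => flowParam ι V H ζ q₀ (z, α)) z a).1 = z.2 a.1)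
    {x : Phase d × ℝ} (hx : x ∈ N ×ˢ Icc α β) (u : Phase d × ℝ) :
    (flowRep ι V H ζ q₀ p₀ x).2
      (fderivWithin ℝ (flowRep ι V H ζ q₀ p₀) (N ×ˢ Icc α β) x u).1 = x.1.2 u.1.1 := by
  set w := flowRep ι V H ζ q₀ p₀ with hw
  set Ω := N ×ˢ Icc α β with hΩ
  have hU : UniqueDiffOn ℝ Ω := uniqueDiffOn_prod_Icc hN hαβ
  have hfd : ∀ x ∈ Ω, ∀ u, fderivWithin ℝ (fun x => (w x).1) Ω x u = (fderivWithin ℝ w Ω x u).1 :=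
    fun x hx u => congrArg (fun L => L u)
      ((hsm.differentiableOn (by simp) x hx).hasFDerivWithinAt.fst.fderivWithin (hU x hx))
  have hgd : ∀ x ∈ Ω, ∀ u, fderivWithin ℝ (fun x => (w x).2) Ω x u = (fderivWithin ℝ w Ω x u).2 :=
    fun x hx u => congrArg (fun L => L u)
      ((hsm.differentiableOn (by simp) x hx).hasFDerivWithinAt.snd.fderivWithin (hU x hx))
  have h1 : ∀ x ∈ Ω, (w x).2 (fderivWithin ℝ w Ω x (0, 1)).1 = 0 := by
    intro x hx
    obtain ⟨h1, h2, h3⟩ := S.flowRep_mem hNs hI hsource hx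
    rw [S.fderivWithin_flowRep_time hNs hαβ hI hsource hsm hx, Prod.smul_fst, map_smul,
      euler_hamField S.ham h1 h2, h3, mul_zero, smul_zero]
  have h2 : ∀ x ∈ Ω, ∀ u, sympE (fderivWithin ℝ w Ω x (0, 1)) (fderivWithin ℝ w Ω x u) = 0 := by
    intro x hx u
    rw [S.fderivWithin_flowRep_time hNs hαβ hI hsource hsm hx, sympE_smul_left, sympE_swap,
      sympE_hamField, S.dH_flowRep hN hNs hαβ hI hsource hsm hx, neg_zero, mul_zero]
  obtain ⟨z, s⟩ := x
  have h3 := liouville_transport hN hαβ (f := fun x => (w x).1) (g := fun x => (w x).2)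
    (contDiff_fst.comp_contDiffOn hsm) (contDiff_snd.comp_contDiffOn hsm)
    (fun x hx => by rw [hfd x hx]; exact h1 x hx)
    (fun x hx u => by rw [hfd x hx, hfd x hx, hgd x hx, hgd x hx]; exact h2 x hx u) hx.1 hx.2 u
  have hα : α ∈ Icc α β := left_mem_Icc.2 hαβ.le
  have hxα : (z, α) ∈ Ω := ⟨hx.1, hα⟩
  rw [← hΩ, hfd _ hx, hfd _ hxα] at h3
  refine h3.trans ?_
  -- The time component contributes nothing, since the Liouville form vanishes on the flow
  -- direction.
  have h4 : u = (u.1, 0) + u.2 • ((0 : Phase d), (1 : ℝ)) := by simp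
  rw [h4, map_add, map_smul, Prod.fst_add, Prod.smul_fst, map_add, map_smul, h1 _ hxα, smul_zero,
    add_zero, ← flowRep_liouville hN hsource hsm hα hx.1, h0 z hx.1]
  simp

end Local

/-- Near each time, smoothness in the parameters propagates. -/
theorem exists_flowChart_of_isGoodTime (hq₀ : q₀ ∈ 𝒰) {s₀ : ℝ} (hs₀ : s₀ ∈ Icc (0 : ℝ) 1) :
    ∃ δ > 0, ∀ s₁ ∈ Ico (0 : ℝ) 1, s₀ - δ < s₁ → s₁ ≤ s₀ → IsGoodTime ι V 𝒰 H ζ q₀ s₁ →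
      ∃ N, IsFlowChart ι V 𝒰 H ζ q₀ (flowBox ι V H ζ (q₀, s₀)) N s₁ (min (s₀ + δ) 1) := by
  set p₀ := flowBox ι V H ζ (q₀, s₀) with hp₀
  have hp₀Γ : p₀ ∈ Gamma H 𝒰 ζ := S.flowBox_bijOn.mapsTo ⟨hq₀, hs₀⟩
  obtain ⟨K, hK, hKc, hKi, hKn, hKt⟩ := exists_box p₀ (S.snd_ne_zero hp₀Γ)
  set w₀ := cchart p₀ p₀ with hw₀
  obtain ⟨R, hR, hRK⟩ : ∃ R > 0, Metric.ball w₀ (2 * R) ∩ range (cotModel (𝓡∂ (d + 1))) ⊆ K := by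
    obtain ⟨ε, hε, h⟩ := Metric.mem_nhdsWithin_iff.1 hKn
    exact ⟨ε / 2, half_pos hε, by rwa [mul_div_cancel₀ _ two_ne_zero]⟩
  have hYs := (contDiffOn_hamField S.ham p₀).mono hKt
  obtain ⟨C₀, hC₀⟩ := hK.exists_bound_of_continuousOn hYs.continuousOn
  set z₀ := cchart q₀ q₀ with hz₀
  have hz₀mem : z₀ ∈ paramSet 𝒰 q₀ := center_mem_paramSet hq₀
  have hopen := isOpen_paramSet (q₀ := q₀) S.isOpen
  set T := timeParam ι V H ζ q₀ with hT
  have hTpos : ∀ z ∈ paramSet 𝒰 q₀, 0 < T z := fun z hz => S.hitTime_pos hz.2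
  have hTs : ContDiffOn ℝ ∞ T (paramSet 𝒰 q₀) := S.contDiffOn_timeParam
  set b := T z₀ + 1 with hb
  have hb0 : 0 < b := by linarith [hTpos z₀ hz₀mem]
  set C := (|C₀| + 1) * b with hC
  have hCpos : 0 < C := by positivity
  -- Input for `curve_confined`: while a curve is in the compact set `Z` its speed is at most `C`,
  -- and over the short time interval this keeps it in the open set `O`.
  set O : Set (Cotangent (𝓡∂ (d + 1)) M) :=
    (cchart p₀).source ∩ cchart p₀ ⁻¹' Metric.ball w₀ (2 * R) with hO
  set Z : Set (Cotangent (𝓡∂ (d + 1)) M) := (cchart p₀).symm '' K with hZ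
  have hOo : ∀ r, IsOpen ((cchart p₀).source ∩ cchart p₀ ⁻¹' Metric.ball w₀ r) := fun r =>
    (continuousOn_extChartAt p₀).isOpen_inter_preimage (isOpen_extChartAt_source p₀)
      Metric.isOpen_ball
  have hZc : IsClosed Z := (hK.image_of_continuousOn ((continuousOn_extChartAt_symm p₀).mono
    (hKt.trans inter_subset_left))).isClosed
  have hOZ : O ⊆ Z := fun p hp =>
    ⟨cchart p₀ p, hRK ⟨hp.2, cchart_mem_range p₀ p⟩, (cchart p₀).left_inv hp.1⟩
  have hZK : ∀ p ∈ Z, p ∈ (cchart p₀).source ∧ cchart p₀ p ∈ K := by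
    rintro p ⟨w, hw, rfl⟩
    have hwt := (hKt hw).1
    exact ⟨(cchart p₀).map_target hwt, by rwa [(cchart p₀).right_inv hwt]⟩
  have hO₀ : ∀ᶠ s in 𝓝[Icc 0 1] s₀, flowParam ι V H ζ q₀ (z₀, s) ∈
      (cchart p₀).source ∩ cchart p₀ ⁻¹' Metric.ball w₀ R := by
    refine (S.continuousOn_flowParam hz₀mem s₀ hs₀).eventually_mem ((hOo R).mem_nhds ?_)
    have h1 : flowParam ι V H ζ q₀ (z₀, s₀) = p₀ := flowParam_center s₀
    change flowParam ι V H ζ q₀ (z₀, s₀) ∈ _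
    rw [h1]
    exact ⟨mem_extChartAt_source p₀, Metric.mem_ball_self hR⟩
  obtain ⟨δ₀, hδ₀, hδ₀s⟩ := Metric.mem_nhdsWithin_iff.1 hO₀
  -- During a time 2δ a curve moves by less than R, so curves that start in the ball of radius R
  -- stay in the ball of radius 2R. The bound δ₀ puts the central curve in the smaller ball at time
  -- s₁.
  set δ := min δ₀ (R / (4 * C)) with hδ
  have hδpos : 0 < δ := lt_min hδ₀ (by positivity)
  have hδC : C * (2 * δ) < R := by
    have h1 : δ ≤ R / (4 * C) := min_le_right _ _
    have h2 : C * (2 * (R / (4 * C))) = R / 2 := by field_simp; norm_num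
    have h3 : C * (2 * δ) ≤ C * (2 * (R / (4 * C))) := by gcongr
    linarith
  refine ⟨δ, hδpos, fun s₁ hs₁ hlt hle hgood => ?_⟩
  obtain ⟨N₁, hN₁o, hz₀N₁, hN₁s, hN₁sm, hN₁L⟩ := hgood
  set s₂ := min (s₀ + δ) 1 with hs₂
  have hs₁₂ : s₁ < s₂ := lt_min (by linarith) hs₁.2
  have hI : Icc s₁ s₂ ⊆ Icc 0 1 := Icc_subset_Icc hs₁.1 (min_le_right _ _)
  have hlen : s₂ - s₁ ≤ 2 * δ := by
    have : s₂ ≤ s₀ + δ := min_le_left _ _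
    linarith
  have hOs₁ : flowParam ι V H ζ q₀ (z₀, s₁) ∈
      (cchart p₀).source ∩ cchart p₀ ⁻¹' Metric.ball w₀ R := by
    refine hδ₀s ⟨?_, hs₁.1, hs₁.2.le⟩
    rw [Metric.mem_ball, Real.dist_eq, abs_lt]
    have : δ ≤ δ₀ := min_le_left _ _
    constructor <;> linarith
  set N : Set (Phase d) := (N₁ ∩ (fun z => flowParam ι V H ζ q₀ (z, s₁)) ⁻¹'
    ((cchart p₀).source ∩ cchart p₀ ⁻¹' Metric.ball w₀ R)) ∩ (paramSet 𝒰 q₀ ∩ T ⁻¹' Iio b) with hN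
  have hNo : IsOpen N := (hN₁sm.continuousOn.isOpen_inter_preimage hN₁o (hOo R)).inter
    (hTs.continuousOn.isOpen_inter_preimage hopen isOpen_Iio)
  have hconf : ∀ z ∈ N, ∀ s ∈ Icc s₁ s₂, flowParam ι V H ζ q₀ (z, s) ∈ O := by
    intro z hz
    have hzp := hz.2.1
    refine curve_confined (hOo _) hZc hOZ ((S.continuousOn_flowParam hzp).mono hI)
      ⟨hz.1.2.1, Metric.ball_subset_ball (by linarith) hz.1.2.2⟩ fun s hs hr => ?_
    refine ⟨(hZK _ (hr s (right_mem_Icc.2 hs.1))).1, ?_⟩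
    have hder : ∀ r ∈ Icc s₁ s, HasDerivWithinAt (fun s => flowRep ι V H ζ q₀ p₀ (z, s))
        (T z • hamField H p₀ (flowRep ι V H ζ q₀ p₀ (z, r))) (Icc s₁ s) r := fun r hr' =>
      (S.hasDerivWithinAt_flowRep hzp (hI ⟨hr'.1, hr'.2.trans hs.2⟩) (hZK _ (hr r hr')).1).mono
        ((Icc_subset_Icc_right hs.2).trans hI)
    have hbd : ∀ r ∈ Icc s₁ s, ‖T z • hamField H p₀ (flowRep ι V H ζ q₀ p₀ (z, r))‖ ≤ C := by
      intro r hr'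
      have h1 := hC₀ _ (hZK _ (hr r hr')).2
      have h2 : ‖T z‖ ≤ b := by
        rw [Real.norm_of_nonneg (hTpos z hzp).le]
        exact (show T z < b from hz.2.2).le
      rw [norm_smul, hC, mul_comm]
      exact mul_le_mul (h1.trans ((le_abs_self _).trans (by linarith))) h2 (norm_nonneg _)
        (by positivity)
    have h3 := (convex_Icc s₁ s).norm_image_sub_le_of_norm_hasDerivWithin_le hder hbd
      (left_mem_Icc.2 hs.1) (right_mem_Icc.2 hs.1)
    have h4 : ‖s - s₁‖ ≤ 2 * δ := by
      rw [Real.norm_of_nonneg (by linarith [hs.1])]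
      linarith [hs.2]
    have h5 : C * ‖s - s₁‖ ≤ C * (2 * δ) := by gcongr
    have h6 : dist (cchart p₀ (flowParam ι V H ζ q₀ (z, s₁))) w₀ < R := hz.1.2.2
    rw [mem_preimage, Metric.mem_ball]
    calc dist (flowRep ι V H ζ q₀ p₀ (z, s)) w₀
        ≤ dist (flowRep ι V H ζ q₀ p₀ (z, s)) (flowRep ι V H ζ q₀ p₀ (z, s₁)) +
          dist (flowRep ι V H ζ q₀ p₀ (z, s₁)) w₀ := dist_triangle _ _ _
      _ < R + R := by
        refine add_lt_add ?_ h6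
        rw [dist_eq_norm]
        exact (h3.trans h5).trans_lt hδC
      _ = 2 * R := by ring
  have hsource : ∀ x ∈ N ×ˢ Icc s₁ s₂, flowParam ι V H ζ q₀ x ∈ (cchart p₀).source :=
    fun x hx => (hconf x.1 hx.1 x.2 hx.2).1
  have hNs : N ⊆ paramSet 𝒰 q₀ := fun z hz => hz.2.1
  have hG0 : ContDiffOn ℝ ∞ (fun z => flowRep ι V H ζ q₀ p₀ (z, s₁)) N := by
    refine contMDiffOn_iff_contDiffOn.1 ?_
    exact (contMDiffOn_extChartAt (I := cotModel (𝓡∂ (d + 1))) (x := p₀)).comp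
      (hN₁sm.mono fun z hz => hz.1.1) fun z hz => by
        rw [← extChartAt_source (I := cotModel (𝓡∂ (d + 1)))]
        exact hz.1.2.1
  have hsm : ContDiffOn ℝ ∞ (flowRep ι V H ζ q₀ p₀) (N ×ˢ Icc s₁ s₂) :=
    contDiffOn_scaled_flow hNo hs₁₂.le hK hKc hKi hYs hb0 (hTs.mono hNs)
      (fun z hz => ⟨(hTpos z (hNs hz)).le, le_of_lt hz.2.2⟩)
      (G := fun z s => flowRep ι V H ζ q₀ p₀ (z, s))
      (fun z hz s hs => ⟨(hZK _ (hOZ (hconf z hz s hs))).2,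
        (S.hasDerivWithinAt_flowRep (hNs hz) (hI hs) (hconf z hz s hs).1).mono hI⟩) hG0
  have hz₀N : z₀ ∈ N := ⟨⟨hz₀N₁, hOs₁⟩, hz₀mem, by
    change T z₀ < b
    linarith⟩
  exact ⟨N, hNo, hNs, hz₀N, hs₁₂, hI, hsource, hsm, fun x hx u =>
    S.liouville_flowRep hNo hNs hs₁₂ hI hsource hsm (fun z hz a => hN₁L z hz.1.1 a) hx u⟩

/-- At the infimum m of the bad times the step δ does not depend on the starting time. A good time
just before m, or time 0, therefore gives a chart reaching past m, which contains a bad time. -/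
theorem isGoodTime (hq₀ : q₀ ∈ 𝒰) (hs : s ∈ Icc (0 : ℝ) 1) : IsGoodTime ι V 𝒰 H ζ q₀ s := by
  by_contra hbad
  set Bad : Set ℝ := {s ∈ Icc (0 : ℝ) 1 | ¬ IsGoodTime ι V 𝒰 H ζ q₀ s} with hBad
  have hne : Bad.Nonempty := ⟨s, hs, hbad⟩
  have hbdd : BddBelow Bad := ⟨0, fun r hr => hr.1.1⟩
  set m := sInf Bad with hm
  have hm0 : 0 ≤ m := le_csInf hne fun r hr => hr.1.1
  have hm1 : m ≤ 1 := (csInf_le hbdd ⟨hs, hbad⟩).trans hs.2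
  obtain ⟨δ, hδ, hstep⟩ := S.exists_flowChart_of_isGoodTime hq₀ ⟨hm0, hm1⟩
  obtain ⟨s₂, hs₂, hs₂m⟩ := exists_lt_of_csInf_lt hne (show sInf Bad < m + δ by linarith)
  have hms₂ : m ≤ s₂ := csInf_le hbdd hs₂
  obtain ⟨s₁, hs₁, h1, h2, h3⟩ : ∃ s₁ ∈ Ico (0 : ℝ) 1, m - δ < s₁ ∧ s₁ ≤ m ∧
      IsGoodTime ι V 𝒰 H ζ q₀ s₁ := by
    rcases hm0.eq_or_lt with h | h
    · exact ⟨0, ⟨le_rfl, one_pos⟩, by linarith, h.le, S.isGoodTime_zero hq₀⟩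
    · have hlt : max (m - δ / 2) 0 < m := max_lt (by linarith) h
      refine ⟨max (m - δ / 2) 0, ⟨le_max_right _ _, hlt.trans_le hm1⟩,
        lt_of_lt_of_le (by linarith) (le_max_left _ _), hlt.le, ?_⟩
      by_contra hng
      exact absurd (csInf_le hbdd ⟨⟨le_max_right _ _, (hlt.trans_le hm1).le⟩, hng⟩) (not_le.2 hlt)
  obtain ⟨N, hN⟩ := hstep s₁ hs₁ h1 h2 h3
  exact hs₂.2 (hN.isGoodTime ⟨h2.trans hms₂, le_min hs₂m.le hs₂.1.2⟩)

/-- The last two alternatives say that s₀ is an endpoint of the chart only at entry or exit, where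
the boundary geometry is known. -/
theorem exists_flowChart (hq₀ : q₀ ∈ 𝒰) {s₀ : ℝ} (hs₀ : s₀ ∈ Icc (0 : ℝ) 1) :
    ∃ N α β, IsFlowChart ι V 𝒰 H ζ q₀ (flowBox ι V H ζ (q₀, s₀)) N α β ∧ s₀ ∈ Icc α β ∧
      Icc α β ∈ 𝓝[Icc 0 1] s₀ ∧ (α = 0 ∨ α < s₀) ∧ (β = 1 ∨ s₀ < β) := by
  obtain ⟨δ, hδ, hstep⟩ := S.exists_flowChart_of_isGoodTime hq₀ hs₀
  obtain ⟨s₁, hs₁, h1, h2, h3⟩ : ∃ s₁ ∈ Ico (0 : ℝ) 1, s₀ - δ < s₁ ∧ s₁ ≤ s₀ ∧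
      (s₁ = 0 ∨ s₁ < s₀) := by
    rcases hs₀.1.eq_or_lt with h | h
    · exact ⟨0, ⟨le_rfl, one_pos⟩, by linarith, h.le, Or.inl rfl⟩
    · have hlt : max (s₀ - δ / 2) 0 < s₀ := max_lt (by linarith) h
      exact ⟨max (s₀ - δ / 2) 0, ⟨le_max_right _ _, hlt.trans_le hs₀.2⟩,
        lt_of_lt_of_le (by linarith) (le_max_left _ _), hlt.le, Or.inr hlt⟩
  obtain ⟨N, hN⟩ := hstep s₁ hs₁ h1 h2 (S.isGoodTime hq₀ ⟨hs₁.1, hs₁.2.le⟩)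
  have h4 : min (s₀ + δ) 1 = 1 ∨ s₀ < min (s₀ + δ) 1 := by
    rcases le_total 1 (s₀ + δ) with h | h
    · exact Or.inl (min_eq_right h)
    · exact Or.inr (by rw [min_eq_left h]; linarith)
  refine ⟨N, s₁, _, hN, ⟨h2, le_min (by linarith) hs₀.2⟩, ?_, h3, h4⟩
  rw [mem_nhdsWithin]
  refine ⟨Ioo (s₀ - (if s₁ = 0 then 1 else s₀ - s₁)) (s₀ + δ), isOpen_Ioo, ⟨?_, by linarith⟩, ?_⟩
  · split_ifs with h
    · linarith
    · rcases h3 with h3 | h3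
      · exact absurd h3 h
      · linarith
  · rintro r ⟨hr, hr01⟩
    refine ⟨?_, le_min hr.2.le hr01.2⟩
    have := hr.1
    split_ifs at this with h
    · rw [h]
      exact hr01.1
    · linarith

end IsScattering
end FlowChart
end
end ZeroEnergy

namespace ZeroEnergy
noncomputable section

/-! ### Extension across the faces and inverse functions -/

section Reflection
variable {P W : Type*} [NormedAddCommGroup P] [NormedSpace ℝ P] [NormedAddCommGroup W]
  [NormedSpace ℝ W]

/-- Odd reflection of a continuously differentiable function across a hyperplane. -/
theorem exists_reflection_left {N : Set P} (hN : IsOpen N) {c ε : ℝ} (hε : 0 < ε) {f : P × ℝ → W}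
    (hf : ContDiffOn ℝ 1 f (N ×ˢ Icc c (c + ε))) :
    ∃ g : P × ℝ → W, EqOn g f (N ×ˢ Icc c (c + ε)) ∧ ∀ z ∈ N, ContDiffAt ℝ 1 g (z, c) := by
  set S := N ×ˢ Icc c (c + ε) with hS
  set S₂ := N ×ˢ Ioc (c - ε) c with hS₂
  have hlt : c < c + ε := by linarith
  have hU : UniqueDiffOn ℝ S := uniqueDiffOn_prod_Icc hN hlt
  set f' := fderivWithin ℝ f S with hf'
  have hf'c : ContinuousOn f' S := hf.continuousOn_fderivWithin hU le_rfl
  have hfd : ∀ x ∈ S, HasFDerivWithinAt f (f' x) S x := fun x hx =>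
    (hf.differentiableOn (by simp) x hx).hasFDerivWithinAt
  set Lσ : P × ℝ →L[ℝ] P × ℝ :=
    (ContinuousLinearMap.fst ℝ P ℝ).prod (-ContinuousLinearMap.snd ℝ P ℝ) with hLσ
  set Lπ : P × ℝ →L[ℝ] P × ℝ := (ContinuousLinearMap.fst ℝ P ℝ).prod 0 with hLπ
  set σ : P × ℝ → P × ℝ := fun x => (x.1, 2 * c - x.2) with hσ
  set π : P × ℝ → P × ℝ := fun x => (x.1, c) with hπ
  have hσd : ∀ x, HasFDerivAt σ Lσ x := fun x => by
    have h1 : HasFDerivAt (fun x : P × ℝ => 2 * c - x.2) (-ContinuousLinearMap.snd ℝ P ℝ) x :=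
      hasFDerivAt_snd.const_sub (2 * c)
    exact hasFDerivAt_fst.prodMk h1
  have hπd : ∀ x, HasFDerivAt π Lπ x := fun x => hasFDerivAt_fst.prodMk (hasFDerivAt_const c x)
  have hσm : MapsTo σ S₂ S := fun x hx =>
    ⟨hx.1, by change c ≤ 2 * c - x.2; linarith [hx.2.2],
      by change 2 * c - x.2 ≤ c + ε; linarith [hx.2.1]⟩
  have hπm : MapsTo π S₂ S := fun x hx => ⟨hx.1, le_rfl, hlt.le⟩
  have hσc : Continuous σ := by fun_prop
  have hπc : Continuous π := by fun_prop
  -- On the face both the value and the derivative match those of f: tangentially 2 - 1 = 1, and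
  -- normally the two sign changes cancel.
  set g₂ : P × ℝ → W := fun x => (2 : ℝ) • f (π x) - f (σ x) with hg₂
  set g₂' : P × ℝ → P × ℝ →L[ℝ] W :=
    fun x => (2 : ℝ) • (f' (π x)).comp Lπ - (f' (σ x)).comp Lσ with hg₂'
  have hg₂d : ∀ x ∈ S₂, HasFDerivWithinAt g₂ (g₂' x) S₂ x := fun x hx =>
    (((hfd _ (hπm hx)).comp x (hπd x).hasFDerivWithinAt hπm).const_smul (2 : ℝ)).sub
      ((hfd _ (hσm hx)).comp x (hσd x).hasFDerivWithinAt hσm)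
  have hg₂'c : ContinuousOn g₂' S₂ :=
    (((hf'c.comp hπc.continuousOn hπm).clm_comp continuousOn_const).const_smul (2 : ℝ)).sub
      ((hf'c.comp hσc.continuousOn hσm).clm_comp continuousOn_const)
  have hbd : ∀ x : P × ℝ, x.2 = c → g₂ x = f x ∧ g₂' x = f' x := by
    rintro ⟨z, s⟩ rfl
    have h1 : σ (z, s) = (z, s) := by simp only [hσ]; congr 1; ring
    refine ⟨?_, ?_⟩
    · simp only [hg₂, h1, hπ, two_smul, add_sub_cancel_right]
    · refine ContinuousLinearMap.ext fun u => ?_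
      have h2 : u = (2 : ℝ) • (u.1, 0) - (u.1, -u.2) := by
        refine Prod.ext ?_ ?_ <;> simp [two_smul]
      change (2 : ℝ) • f' (z, s) (u.1, 0) - f' (σ (z, s)) (u.1, -u.2) = f' (z, s) u
      rw [h1, ← map_smul, ← map_sub, ← h2]
  classical
  set g : P × ℝ → W := fun x => if c ≤ x.2 then f x else g₂ x with hg
  set g' : P × ℝ → P × ℝ →L[ℝ] W := fun x => if c ≤ x.2 then f' x else g₂' x with hg'
  have hgS : EqOn g f S := fun x hx => if_pos hx.2.1
  have hg'S : EqOn g' f' S := fun x hx => if_pos hx.2.1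
  have hgS₂ : EqOn g g₂ S₂ := fun x hx => by
    rcases hx.2.2.eq_or_lt with h | h
    · exact (if_pos h.ge).trans (hbd x h).1.symm
    · exact if_neg (not_le.2 h)
  have hg'S₂ : EqOn g' g₂' S₂ := fun x hx => by
    rcases hx.2.2.eq_or_lt with h | h
    · exact (if_pos h.ge).trans (hbd x h).2.symm
    · exact if_neg (not_le.2 h)
  have hdS : ∀ x ∈ S, HasFDerivWithinAt g (g' x) S x := fun x hx => by
    rw [hg'S hx]
    exact (hfd x hx).congr hgS (hgS hx)
  have hdS₂ : ∀ x ∈ S₂, HasFDerivWithinAt g (g' x) S₂ x := fun x hx => by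
    rw [hg'S₂ hx]
    exact (hg₂d x hx).congr hgS₂ (hgS₂ hx)
  have hcS : ContinuousOn g' S := hf'c.congr hg'S
  have hcS₂ : ContinuousOn g' S₂ := hg₂'c.congr hg'S₂
  have hloc : ∀ x ∈ N ×ˢ Ioo (c - ε) (c + ε), HasFDerivAt g (g' x) x ∧ ContinuousAt g' x := by
    rintro ⟨z, s⟩ ⟨hz, hs⟩
    have hNz := hN.mem_nhds hz
    rcases lt_trichotomy s c with h | rfl | h
    · have hn : S₂ ∈ 𝓝 (z, s) := prod_mem_nhds hNz (Ioc_mem_nhds hs.1 h)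
      have hm : (z, s) ∈ S₂ := ⟨hz, hs.1, h.le⟩
      exact ⟨(hdS₂ _ hm).hasFDerivAt hn, (hcS₂ _ hm).continuousAt hn⟩
    · have hm : (z, s) ∈ S := ⟨hz, le_rfl, hlt.le⟩
      have hm₂ : (z, s) ∈ S₂ := ⟨hz, hs.1, le_rfl⟩
      have hn : S ∪ S₂ ∈ 𝓝 (z, s) := by
        rw [hS, hS₂, ← prod_union]
        refine prod_mem_nhds hNz (mem_of_superset (Icc_mem_nhds
          (show s - ε / 2 < s by linarith) hlt) fun r hr => ?_)
        rcases le_total s r with h | h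
        · exact Or.inl ⟨h, hr.2⟩
        · exact Or.inr ⟨by linarith [hr.1], h⟩
      exact ⟨((hdS _ hm).union (hdS₂ _ hm₂)).hasFDerivAt hn,
        ((hcS _ hm).union (hcS₂ _ hm₂)).continuousAt hn⟩
    · have hn : S ∈ 𝓝 (z, s) := prod_mem_nhds hNz (Icc_mem_nhds h hs.2)
      have hm : (z, s) ∈ S := ⟨hz, h.le, hs.2.le⟩
      exact ⟨(hdS _ hm).hasFDerivAt hn, (hcS _ hm).continuousAt hn⟩
  refine ⟨g, hgS, fun z hz => contDiffAt_one_iff.2 ⟨g', N ×ˢ Ioo (c - ε) (c + ε), ?_, ?_, ?_⟩⟩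
  · exact prod_mem_nhds (hN.mem_nhds hz) (Ioo_mem_nhds (by linarith) hlt)
  · exact fun x hx => (hloc x hx).2.continuousWithinAt
  · exact fun x hx => (hloc x hx).1

theorem contDiff_flipTime (c : ℝ) : ContDiff ℝ ∞ (fun x : P × ℝ => (x.1, 2 * c - x.2)) :=
  contDiff_fst.prodMk (contDiff_const.sub contDiff_snd)

theorem exists_reflection_right {N : Set P} (hN : IsOpen N) {c ε : ℝ} (hε : 0 < ε) {f : P × ℝ → W}
    (hf : ContDiffOn ℝ 1 f (N ×ˢ Icc (c - ε) c)) :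
    ∃ g : P × ℝ → W, EqOn g f (N ×ˢ Icc (c - ε) c) ∧ ∀ z ∈ N, ContDiffAt ℝ 1 g (z, c) := by
  have hflip : ∀ x : P × ℝ, (x.1, 2 * c - (2 * c - x.2)) = x := fun x => Prod.ext rfl (by ring)
  obtain ⟨g, hg, hgc⟩ := exists_reflection_left hN hε (c := c)
    (f := fun x : P × ℝ => f (x.1, 2 * c - x.2))
    (hf.comp ((contDiff_flipTime c).of_le (by norm_cast)).contDiffOn fun x hx =>
      ⟨hx.1, by change c - ε ≤ 2 * c - x.2; linarith [hx.2.2],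
        by change 2 * c - x.2 ≤ c; linarith [hx.2.1]⟩)
  refine ⟨fun x => g (x.1, 2 * c - x.2), fun x hx => ?_, fun z hz => ?_⟩
  · change g (x.1, 2 * c - x.2) = f x
    have hm : (x.1, 2 * c - x.2) ∈ N ×ˢ Icc c (c + ε) :=
      ⟨hx.1, by change c ≤ 2 * c - x.2; linarith [hx.2.2],
        by change 2 * c - x.2 ≤ c + ε; linarith [hx.2.1]⟩
    exact (hg hm).trans (congrArg f (hflip x))
  · have h1 := hgc z hz
    have h2 : (z, c) = ((z, c).1, 2 * c - (z, c).2) := by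
      refine Prod.ext rfl ?_
      change c = 2 * c - c
      ring
    rw [h2] at h1
    exact h1.comp (z, c) ((contDiff_flipTime c).of_le (by norm_cast)).contDiffAt

/-- A function that vanishes for `s = c` and increases in `s` is negative for `s < c`. -/
theorem eventually_le_of_nonneg {φ : P × ℝ → ℝ} {z₀ : P} {c : ℝ} (hφ : ContDiffAt ℝ 1 φ (z₀, c))
    (h0 : ∀ᶠ z in 𝓝 z₀, φ (z, c) = 0) (hpos : 0 < fderiv ℝ φ (z₀, c) (0, 1)) :
    ∀ᶠ x in 𝓝 (z₀, c), 0 ≤ φ x → c ≤ x.2 := by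
  obtain ⟨φ', u, hu, hc, hd⟩ := contDiffAt_one_iff.1 hφ
  have h1 : φ' (z₀, c) = fderiv ℝ φ (z₀, c) := (hd _ (mem_of_mem_nhds hu)).fderiv.symm
  rw [← h1] at hpos
  have h2 : ∀ᶠ x in 𝓝 (z₀, c), 0 < φ' x (0, 1) :=
    ((hc.continuousAt hu).clm_apply continuousAt_const).eventually (lt_mem_nhds hpos)
  have h3 : ∀ᶠ x in 𝓝 (z₀, c), (x ∈ u ∧ 0 < φ' x (0, 1)) ∧ φ (x.1, c) = 0 :=
    (Filter.Eventually.and hu h2).and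
      ((continuous_fst.tendsto (z₀, c)).eventually (p := fun z => φ (z, c) = 0) h0)
  obtain ⟨ε, hε, hball⟩ := Metric.eventually_nhds_iff_ball.1 h3
  filter_upwards [Metric.ball_mem_nhds (z₀, c) hε] with x hx hnn
  by_contra! hlt
  have hmem : ∀ s ∈ Icc x.2 c, (x.1, s) ∈ Metric.ball (z₀, c) ε := by
    intro s hs
    rw [Metric.mem_ball, Prod.dist_eq, max_lt_iff] at hx ⊢
    refine ⟨hx.1, lt_of_le_of_lt ?_ hx.2⟩
    change |s - c| ≤ |x.2 - c|
    rw [abs_of_nonpos (by linarith [hs.2]), abs_of_nonpos (by linarith)]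
    linarith [hs.1]
  have hder : ∀ s ∈ Icc x.2 c, HasDerivAt (fun s => φ (x.1, s)) (φ' (x.1, s) (0, 1)) s := by
    intro s hs
    exact (hd _ (hball _ (hmem s hs)).1.1).comp_hasDerivAt s
      ((hasDerivAt_const s x.1).prodMk (hasDerivAt_id s))
  obtain ⟨ξ, hξ, hξe⟩ := exists_hasDerivAt_eq_slope (fun s => φ (x.1, s))
    (fun s => φ' (x.1, s) (0, 1)) hlt (fun s hs => (hder s hs).continuousAt.continuousWithinAt)
    (fun s hs => hder s (Ioo_subset_Icc_self hs))
  have h4 := (hball _ (hmem ξ (Ioo_subset_Icc_self hξ))).1.2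
  have h5 := (hball _ hx).2
  rw [hξe, h5] at h4
  have h6 : (0 - φ (x.1, x.2)) / (c - x.2) ≤ 0 :=
    div_nonpos_of_nonpos_of_nonneg (by simpa using hnn) (by linarith)
  linarith

end Reflection

section Inverse
variable {E F : Type*} [NormedAddCommGroup E] [NormedSpace ℝ E] [CompleteSpace E]
  [NormedAddCommGroup F] [NormedSpace ℝ F]

/-- The C¹ inverse function theorem, recording that invertibility of the derivative, an open
condition, holds at every value of the inverse. -/
theorem exists_differentiable_local_inverse {f : E → F} {x₀ : E} {e₀ : E ≃L[ℝ] F}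
    (hf : ContDiffAt ℝ 1 f x₀) (hf' : HasFDerivAt f (e₀ : E →L[ℝ] F) x₀) {s : Set E}
    (hs : s ∈ 𝓝 x₀) :
    ∃ O : Set F, IsOpen O ∧ f x₀ ∈ O ∧ ∃ r : F → E, r (f x₀) = x₀ ∧ ∀ w ∈ O, r w ∈ s ∧
      f (r w) = w ∧ (∃ e : E ≃L[ℝ] F, HasFDerivAt f (e : E →L[ℝ] F) (r w)) ∧
      DifferentiableAt ℝ r w := by
  set Φ := hf.toOpenPartialHomeomorph f hf' one_ne_zero with hΦ
  have hΦc : (Φ : E → F) = f := rfl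
  have hx₀ : x₀ ∈ Φ.source := hf.mem_toOpenPartialHomeomorph_source hf' one_ne_zero
  obtain ⟨f', u, hu, hc, hd⟩ := contDiffAt_one_iff.1 hf
  have h1 : f' x₀ = (e₀ : E →L[ℝ] F) := (hd _ (mem_of_mem_nhds hu)).unique hf'
  have h2 : ∀ᶠ x in 𝓝 x₀, f' x ∈ range ((↑) : (E ≃L[ℝ] F) → E →L[ℝ] F) := by
    refine (hc.continuousAt hu).eventually ?_
    rw [h1]
    exact ContinuousLinearEquiv.nhds e₀
  have h3 : ∀ᶠ x in 𝓝 x₀, ContDiffAt ℝ 1 f x := hf.eventually (by simp)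
  have h4 : ∀ᶠ x in 𝓝 x₀, x ∈ s ∧ (∃ e : E ≃L[ℝ] F, HasFDerivAt f (e : E →L[ℝ] F) x) ∧
      ContDiffAt ℝ 1 f x := by
    filter_upwards [hs, hu, h2, h3] with x hxs hxu hx2 hx3
    obtain ⟨e, he⟩ := hx2
    exact ⟨hxs, ⟨e, he ▸ hd x hxu⟩, hx3⟩
  obtain ⟨v, hv, hvo, hxv⟩ := eventually_nhds_iff.1 h4
  refine ⟨Φ.target ∩ Φ.symm ⁻¹' v, Φ.isOpen_inter_preimage_symm hvo, ⟨Φ.map_source hx₀, ?_⟩,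
    Φ.symm, Φ.left_inv hx₀, fun w hw => ?_⟩
  · rw [mem_preimage, show f x₀ = Φ x₀ from rfl, Φ.left_inv hx₀]
    exact hxv
  · obtain ⟨h5, ⟨e, he⟩, h6⟩ := hv _ hw.2
    exact ⟨h5, Φ.right_inv hw.1, ⟨e, he⟩,
      (Φ.contDiffAt_symm hw.1 he h6).differentiableAt (by simp)⟩

/-- Bootstrapping on Dr = (DΨ ∘ r)⁻¹: if r is Cⁿ then so is Dr. Only smoothness of Ψ within `D`
enters, so the extension used to construct r may be merely C¹. -/
theorem contDiffOn_right_inverse {D : Set E} {A : Set F} (hD : UniqueDiffOn ℝ D)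
    (hA : UniqueDiffOn ℝ A) {Ψ : E → F} (hΨ : ContDiffOn ℝ ∞ Ψ D) {r : F → E} (hr : MapsTo r A D)
    (hinv : ∀ a ∈ A, Ψ (r a) = a) (hrd : DifferentiableOn ℝ r A)
    (he : ∀ a ∈ A, ∃ e : E ≃L[ℝ] F, HasFDerivWithinAt Ψ (e : E →L[ℝ] F) D (r a)) :
    ContDiffOn ℝ ∞ r A := by
  have hder : ∀ a ∈ A, fderivWithin ℝ r A a = (fderivWithin ℝ Ψ D (r a)).inverse := by
    intro a ha
    obtain ⟨e, he⟩ := he a ha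
    have h1 := he.comp a (hrd a ha).hasFDerivWithinAt hr
    have h2 : HasFDerivWithinAt (Ψ ∘ r) (ContinuousLinearMap.id ℝ F) A a :=
      (hasFDerivWithinAt_id a A).congr (fun a ha => hinv a ha) (hinv a ha)
    have h3 := (hA a ha).eq h1 h2
    rw [he.fderivWithin (hD _ (hr ha)), ContinuousLinearMap.inverse_equiv]
    ext v
    have h4 := congrArg (fun L => L v) h3
    exact (e.eq_symm_apply).2 h4
  rw [contDiffOn_infty]
  intro n
  induction n with
  | zero => exact contDiffOn_zero.2 hrd.continuousOn
  | succ n ih =>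
    rw [Nat.cast_add, Nat.cast_one, contDiffOn_succ_iff_fderivWithin hA]
    refine ⟨hrd, fun h => absurd h (by simp), ?_⟩
    refine ContDiffOn.congr ?_ hder
    have h1 : ContDiffOn ℝ n (fun a => fderivWithin ℝ Ψ D (r a)) A :=
      ((hΨ.fderivWithin hD (m := ∞) (by simp)).of_le (by exact_mod_cast le_top)).comp ih hr
    intro a ha
    obtain ⟨e, he⟩ := he a ha
    have h2 : ContDiffAt ℝ n ContinuousLinearMap.inverse (fderivWithin ℝ Ψ D (r a)) := by
      rw [he.fderivWithin (hD _ (hr ha))]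
      exact contDiffAt_map_inverse e
    exact h2.comp_contDiffWithinAt a (h1 a ha)

/-- A smooth right inverse of `Ψ` on `R`, if `Ψ` has a continuously differentiable extension with
invertible derivative for which near `x₀` only the points of `D` are mapped to `R`. -/
theorem exists_smooth_right_inverse {D : Set E} {R : Set F} (hD : UniqueDiffOn ℝ D)
    (hR : UniqueDiffOn ℝ R) {Ψ Ψe : E → F} (hΨ : ContDiffOn ℝ ∞ Ψ D) (hext : EqOn Ψe Ψ D) {x₀ : E}
    {e₀ : E ≃L[ℝ] F} (hΨe : ContDiffAt ℝ 1 Ψe x₀) (he₀ : HasFDerivAt Ψe (e₀ : E →L[ℝ] F) x₀)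
    (hs : ∀ᶠ x in 𝓝 x₀, Ψe x ∈ R → x ∈ D) :
    ∃ O : Set F, IsOpen O ∧ Ψe x₀ ∈ O ∧ ∃ r : F → E, r (Ψe x₀) = x₀ ∧
      ContDiffOn ℝ ∞ r (R ∩ O) ∧ ∀ w ∈ R ∩ O, r w ∈ D ∧ Ψ (r w) = w := by
  obtain ⟨O, hO, hxO, r, hr0, hr⟩ := exists_differentiable_local_inverse hΨe he₀ hs
  have hmaps : MapsTo r (R ∩ O) D := fun w hw => by
    obtain ⟨h1, h2, -⟩ := hr w hw.2
    exact h1 (h2.symm ▸ hw.1)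
  have hinv : ∀ w ∈ R ∩ O, Ψ (r w) = w := fun w hw =>
    (hext (hmaps hw)).symm.trans (hr w hw.2).2.1
  refine ⟨O, hO, hxO, r, hr0, contDiffOn_right_inverse hD (hR.inter hO) hΨ hmaps hinv
    (fun w hw => (hr w hw.2).2.2.2.differentiableWithinAt) fun w hw => ?_,
    fun w hw => ⟨hmaps hw, hinv w hw⟩⟩
  obtain ⟨e, he⟩ := (hr w hw.2).2.2.1
  exact ⟨e, he.hasFDerivWithinAt.congr (fun x hx => (hext hx).symm) (hext (hmaps hw)).symm⟩

end Inverse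
end
end ZeroEnergy

namespace ZeroEnergy
noncomputable section

/-- The mirror image of `eventually_le_of_nonneg` under s ↦ 2c - s, for the exit. -/
theorem eventually_ge_of_nonneg {P : Type*} [NormedAddCommGroup P] [NormedSpace ℝ P]
    {φ : P × ℝ → ℝ} {z₀ : P} {c : ℝ} (hφ : ContDiffAt ℝ 1 φ (z₀, c))
    (h0 : ∀ᶠ z in 𝓝 z₀, φ (z, c) = 0) (hneg : fderiv ℝ φ (z₀, c) (0, 1) < 0) :
    ∀ᶠ x in 𝓝 (z₀, c), 0 ≤ φ x → x.2 ≤ c := by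
  set σ : P × ℝ → P × ℝ := fun x => (x.1, 2 * c - x.2) with hσ
  have hσσ : ∀ x, σ (σ x) = x := fun x => Prod.ext rfl (by simp [hσ])
  have hσ0 : σ (z₀, c) = (z₀, c) := Prod.ext rfl (by simp only [hσ]; ring)
  have hσc : Continuous σ := by fun_prop
  have hσd : HasFDerivAt σ ((ContinuousLinearMap.fst ℝ P ℝ).prod
      (-ContinuousLinearMap.snd ℝ P ℝ)) (z₀, c) := by
    have h1 : HasFDerivAt (fun x : P × ℝ => 2 * c - x.2) (-ContinuousLinearMap.snd ℝ P ℝ)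
      (z₀, c) := hasFDerivAt_snd.const_sub (2 * c)
    exact hasFDerivAt_fst.prodMk h1
  have hφ' : ContDiffAt ℝ 1 φ (σ (z₀, c)) := by rwa [hσ0]
  have h1 : ContDiffAt ℝ 1 (φ ∘ σ) (z₀, c) :=
    hφ'.comp (z₀, c) ((contDiff_flipTime c).of_le (by norm_cast)).contDiffAt
  have h2 : HasFDerivAt (φ ∘ σ) _ (z₀, c) :=
    (hφ'.differentiableAt (by simp)).hasFDerivAt.comp (z₀, c) hσd
  have h3 := eventually_le_of_nonneg h1
    (by
      filter_upwards [h0] with z hz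
      have : σ (z, c) = (z, c) := Prod.ext rfl (by simp only [hσ]; ring)
      rw [Function.comp_apply, this, hz])
    (by
      rw [h2.fderiv, hσ0]
      have h4 : ((0 : P), -(1 : ℝ)) = -(0, 1) := by rw [Prod.neg_mk, neg_zero]
      change 0 < fderiv ℝ φ (z₀, c) (0, -(1 : ℝ))
      rw [h4, map_neg]
      linarith)
  have h5 : Tendsto σ (𝓝 (z₀, c)) (𝓝 (z₀, c)) := by
    have := hσc.tendsto (z₀, c)
    rwa [hσ0] at this
  filter_upwards [h5.eventually h3] with x hx hnn
  rw [Function.comp_apply, hσσ] at hx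
  have h6 : c ≤ 2 * c - x.2 := hx hnn
  linarith

/-- A linear map `(u, η) ↦ J u + η e` is invertible if `J` is injective with values in the kernel
of a form that does not vanish at `e`, and the dimensions match. -/
theorem exists_equiv_of_transversal {P W : Type*} [NormedAddCommGroup P] [NormedSpace ℝ P]
    [FiniteDimensional ℝ P] [NormedAddCommGroup W] [NormedSpace ℝ W] [FiniteDimensional ℝ W]
    (hdim : Module.finrank ℝ P + 1 = Module.finrank ℝ W) {J : P →L[ℝ] W}
    (hJ : Function.Injective J) {l : W →L[ℝ] ℝ} (hl : ∀ u, l (J u) = 0) {e : W} (he : l e ≠ 0) :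
    ∃ e₀ : (P × ℝ) ≃L[ℝ] W, ∀ y, e₀ y = J y.1 + y.2 • e := by
  set L : P × ℝ →ₗ[ℝ] W := (J : P →ₗ[ℝ] W).coprod (LinearMap.toSpanSingleton ℝ W e) with hL
  have hinj : Function.Injective L := by
    rw [← LinearMap.ker_eq_bot, LinearMap.ker_eq_bot']
    rintro ⟨u, η⟩ h
    have h1 : J u + η • e = 0 := by simpa [hL] using h
    have h2 : η * l e = 0 := by
      have := congrArg l h1
      simpa [hl] using this
    have h3 : η = 0 := (mul_eq_zero.1 h2).resolve_right he
    rw [h3, zero_smul, add_zero] at h1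
    rw [h3, hJ (h1.trans (map_zero J).symm)]
    rfl
  have hd : Module.finrank ℝ (P × ℝ) = Module.finrank ℝ W := by
    rw [Module.finrank_prod, Module.finrank_self, hdim]
  exact ⟨(LinearEquiv.ofInjectiveOfFinrankEq L hinj hd).toContinuousLinearEquiv,
    fun y => by
      change L y = _
      simp [hL]⟩

theorem finrank_phase (n : ℕ) : Module.finrank ℝ (Phase n) = n + n := by
  have h1 : Module.finrank ℝ (EuclideanSpace ℝ (Fin n) →L[ℝ] ℝ) = n := by
    rw [← (LinearMap.toContinuousLinearMap :
      (EuclideanSpace ℝ (Fin n) →ₗ[ℝ] ℝ) ≃ₗ[ℝ] _).finrank_eq]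
    exact Subspace.dual_finrank_eq.trans finrank_euclideanSpace_fin
  rw [Module.finrank_prod, h1, finrank_euclideanSpace_fin]

/-- The exterior derivative of the Liouville identity. -/
theorem sympE_of_liouville {G E : Type*} [NormedAddCommGroup G] [NormedSpace ℝ G]
    [NormedAddCommGroup E] [NormedSpace ℝ E] {Ω : Set ((G × (G →L[ℝ] ℝ)) × ℝ)}
    (hU : UniqueDiffOn ℝ Ω) (hΩ : Ω ⊆ closure (interior Ω))
    {w : (G × (G →L[ℝ] ℝ)) × ℝ → E × (E →L[ℝ] ℝ)} (hw : ContDiffOn ℝ ∞ w Ω)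
    (hL : ∀ x ∈ Ω, ∀ u : (G × (G →L[ℝ] ℝ)) × ℝ,
      (w x).2 (fderivWithin ℝ w Ω x u).1 = x.1.2 u.1.1)
    {x : (G × (G →L[ℝ] ℝ)) × ℝ} (hx : x ∈ Ω) (u v : (G × (G →L[ℝ] ℝ)) × ℝ) :
    sympE (fderivWithin ℝ w Ω x u) (fderivWithin ℝ w Ω x v) = sympE u.1 v.1 := by
  have hd : ∀ x ∈ Ω, HasFDerivWithinAt w (fderivWithin ℝ w Ω x) Ω x := fun x hx =>
    (hw.differentiableOn (by simp) x hx).hasFDerivWithinAt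
  have hfd : ∀ x ∈ Ω, ∀ u, fderivWithin ℝ (fun x => (w x).1) Ω x u = (fderivWithin ℝ w Ω x u).1 :=
    fun x hx u => congrArg (fun L => L u) ((hd x hx).fst.fderivWithin (hU x hx))
  set F := ContinuousLinearMap.fst ℝ (G × (G →L[ℝ] ℝ)) ℝ with hF
  have hl : HasFDerivWithinAt (fun x : (G × (G →L[ℝ] ℝ)) × ℝ => (liouE x.1).comp F)
      (((ContinuousLinearMap.compL ℝ ((G × (G →L[ℝ] ℝ)) × ℝ) (G × (G →L[ℝ] ℝ)) ℝ).flip F).comp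
        (liouE.comp F)) Ω x :=
    ContinuousLinearMap.hasFDerivWithinAt
      (((ContinuousLinearMap.compL ℝ ((G × (G →L[ℝ] ℝ)) × ℝ) (G × (G →L[ℝ] ℝ)) ℝ).flip F).comp
        (liouE.comp F))
  have h1 := liouville_differential (f := fun x => (w x).1) (g := fun x => (w x).2)
    hU hx (hΩ hx) ((contDiff_fst.comp_contDiffOn hw x hx).of_le (by norm_cast)) (hd x hx).snd
    hl (by
      filter_upwards [self_mem_nhdsWithin] with y hy u
      rw [hfd y hy]
      exact hL y hy u) u v
  rw [hfd x hx, hfd x hx] at h1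
  exact h1

/-! ### The flow near its entry and exit -/

section Package
variable {d : ℕ}
  {B : Type*} [TopologicalSpace B] [ChartedSpace (EuclideanSpace ℝ (Fin d)) B]
  [IsManifold (𝓡 d) ∞ B]
  {M : Type*} [TopologicalSpace M] [ChartedSpace (EuclideanHalfSpace (d + 1)) M]
  [IsManifold (𝓡∂ (d + 1)) ∞ M]
  {ι : B → M} {U V : Set B} {𝒰 : Set (Cotangent (𝓡 d) B)}
  {H : Cotangent (𝓡∂ (d + 1)) M → ℝ} {ζ : Cotangent (𝓡 d) B → Cotangent (𝓡∂ (d + 1)) M}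
  {q₀ : Cotangent (𝓡 d) B} {p₀ : Cotangent (𝓡∂ (d + 1)) M} {N : Set (Phase d)} {α β s s₀ : ℝ}

theorem fderivWithin_symm_self (hH : IsHamiltonian H) (hp₀ : p₀.snd ≠ 0) (v : Phase (d + 1)) :
    fderivWithin ℝ (H ∘ (cchart p₀).symm) (range (cotModel (𝓡∂ (d + 1)))) (cchart p₀ p₀) v =
      dFun H p₀ v := by
  have h1 := fderivWithin_cchart_symm (mem_extChartAt_source p₀) (hH.mdifferentiableAt hp₀) v
  have h2 : dchart p₀ p₀ v = v := congrArg (fun L => L v) (dchart_self p₀)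
  rw [h2] at h1
  exact h1

theorem hamField_self (hH : IsHamiltonian H) {X : TangentSpace (cotModel (𝓡∂ (d + 1))) p₀}
    (hX : IsHamVec H p₀ X) : hamField H p₀ (cchart p₀ p₀) = X := by
  have h2 : dchart p₀ p₀ X = X := congrArg (fun L => L X) (dchart_self p₀)
  exact (dchart_isHamVec hH (mem_extChartAt_source p₀) hX).symm.trans h2

/-- The flow pulls back the symplectic form to the symplectic form. -/
theorem IsFlowChart.symp (C : IsFlowChart ι V 𝒰 H ζ q₀ p₀ N α β) {x : Phase d × ℝ}
    (hx : x ∈ N ×ˢ Icc α β) (u v : Phase d × ℝ) :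
    sympE (fderivWithin ℝ (flowRep ι V H ζ q₀ p₀) (N ×ˢ Icc α β) x u)
      (fderivWithin ℝ (flowRep ι V H ζ q₀ p₀) (N ×ˢ Icc α β) x v) = sympE u.1 v.1 := by
  exact sympE_of_liouville (uniqueDiffOn_prod_Icc C.isOpen C.lt)
    (subset_closure_interior_prod_Icc C.isOpen C.lt) C.smooth C.liouville hx u v

namespace IsScattering

variable (S : IsScattering ι U V 𝒰 H ζ)
include S

variable [T2Space M]

/-- Arrival from inside makes the normal velocity nonpositive, and transversality makes it nonzero.
-/
theorem exit_outgoing {q : Cotangent (𝓡 d) B} (hq : q ∈ 𝒰) :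
    ∃ X, IsHamVec H (bichar ι V H ζ q (hitTime ι V H ζ q)) X ∧
      normalVelocity (bichar ι V H ζ q (hitTime ι V H ζ q)) X < 0 := by
  obtain ⟨⟨b, -, hb⟩, X, hX, hne⟩ := S.exit_spec hq
  obtain ⟨X', hX', hd⟩ := (S.bichar_curve hq).1 _ (S.hitTime_mem hq)
  rw [hX'.unique hX] at hd
  exact ⟨X, hX, lt_of_le_of_ne (normalVelocity_nonpos (S.hitTime_pos hq)
    (hb ▸ S.mem_boundary b) hd) hne⟩

/-- A continuously differentiable extension of the flow beyond its entry and exit. -/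
theorem exists_extension (hq₀ : q₀ ∈ 𝒰) (hs₀ : s₀ ∈ Icc α β)
    (hp₀ : flowParam ι V H ζ q₀ (cchart q₀ q₀, s₀) = p₀)
    (C : IsFlowChart ι V 𝒰 H ζ q₀ p₀ N α β) (hα : α = 0 ∨ α < s₀) (hβ : β = 1 ∨ s₀ < β) :
    ∃ (fe : Phase d × ℝ → Phase (d + 1)) (e : Phase (d + 1)),
      EqOn fe (flowRep ι V H ζ q₀ p₀) (N ×ˢ Icc α β) ∧ ContDiffAt ℝ 1 fe (cchart q₀ q₀, s₀) ∧
      dFun H p₀ e ≠ 0 ∧ ∀ᶠ x in 𝓝 (cchart q₀ q₀, s₀), ∀ η : ℝ,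
        fe x + η • e ∈ range (cotModel (𝓡∂ (d + 1))) → x ∈ N ×ˢ Icc α β := by
  set z₀ : Phase d := cchart q₀ q₀ with hz₀
  have hNz := C.isOpen.mem_nhds C.center
  have hx₀ : (z₀, s₀) ∈ N ×ˢ Icc α β := ⟨C.center, hs₀⟩
  have hs₀' := C.Icc_subset hs₀
  have hp₀Γ : p₀ ∈ Gamma H 𝒰 ζ := hp₀ ▸ S.flowParam_mem (C.subset C.center) hs₀'
  have hp₀' : p₀ = flowBox ι V H ζ (q₀, s₀) := by rw [← hp₀, flowParam_center]
  have hw₀ : flowRep ι V H ζ q₀ p₀ (z₀, s₀) = cchart p₀ p₀ := by rw [flowRep, hp₀]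
  have hT : 0 < timeParam ι V H ζ q₀ z₀ := S.hitTime_pos (C.subset C.center).2
  have hU := uniqueDiffOn_prod_Icc C.isOpen C.lt
  have hJ := S.fderivWithin_flowRep_time C.subset C.lt C.Icc_subset C.mem_source C.smooth hx₀
  have hsm1 : ContDiffOn ℝ 1 (flowRep ι V H ζ q₀ p₀) (N ×ˢ Icc α β) :=
    C.smooth.of_le (by norm_cast)
  -- The conormal direction: moving along it does not change the base point, hence not the
  -- membership in the half space, and dH(e) is the normal velocity, which is nonzero at entry and
  -- exit.
  set e : Phase (d + 1) := (0, EuclideanSpace.proj (𝕜 := ℝ) (0 : Fin (d + 1))) with he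
  set ν : Phase (d + 1) →L[ℝ] ℝ := (EuclideanSpace.proj (𝕜 := ℝ) (0 : Fin (d + 1))).comp
    (ContinuousLinearMap.fst ℝ _ _) with hν
  have hνe : ∀ (w : Phase (d + 1)) (η : ℝ), (w + η • e).1 0 = ν w := fun w η => by simp [hν, he]
  have hdH : ∀ X, IsHamVec H p₀ X → dFun H p₀ e = normalVelocity p₀ X := fun X hX => by
    rw [← hX.2 e]
    change (EuclideanSpace.proj (𝕜 := ℝ) (0 : Fin (d + 1)))
      (show Phase (d + 1) from X).1 - (show Phase (d + 1) from X).2 0 = _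
    rw [map_zero, sub_zero]
    rfl
  have hder : ∀ (fe : Phase d × ℝ → Phase (d + 1)),
      EqOn fe (flowRep ι V H ζ q₀ p₀) (N ×ˢ Icc α β) → ContDiffAt ℝ 1 fe (z₀, s₀) →
      ∀ X, IsHamVec H p₀ X → ContDiffAt ℝ 1 (fun x => ν (fe x)) (z₀, s₀) ∧
        fderiv ℝ (fun x => ν (fe x)) (z₀, s₀) (0, 1) =
        timeParam ι V H ζ q₀ z₀ * normalVelocity p₀ X := by
    intro fe hfe hfec X hX
    have h1 := (hfec.differentiableAt (by simp)).hasFDerivAt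
    have h2 : HasFDerivWithinAt (flowRep ι V H ζ q₀ p₀) (fderiv ℝ fe (z₀, s₀)) (N ×ˢ Icc α β)
      (z₀, s₀) := h1.hasFDerivWithinAt.congr (fun x hx => (hfe hx).symm) (hfe hx₀).symm
    have h3 := ν.hasFDerivAt.comp (z₀, s₀) h1
    refine ⟨ν.contDiff.contDiffAt.comp (z₀, s₀) hfec, ?_⟩
    change fderiv ℝ (ν ∘ fe) (z₀, s₀) (0, 1) = _
    rw [h3.fderiv, ContinuousLinearMap.comp_apply, ← h2.fderivWithin (hU _ hx₀), hJ, hw₀,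
      map_smul, hamField_self S.ham hX]
    rfl
  have hbdry : ∀ (fe : Phase d × ℝ → Phase (d + 1)),
      EqOn fe (flowRep ι V H ζ q₀ p₀) (N ×ˢ Icc α β) → (∀ z ∈ N,
        (flowParam ι V H ζ q₀ (z, s₀)).proj ∈ (𝓡∂ (d + 1)).boundary M) →
      ∀ᶠ z in 𝓝 z₀, ν (fe (z, s₀)) = 0 := by
    intro fe hfe hb
    filter_upwards [hNz] with z hz
    have hx : (z, s₀) ∈ N ×ˢ Icc α β := ⟨hz, hs₀⟩
    rw [hfe hx]
    exact (boundary_iff (C.mem_source _ hx)).1 (hb z hz)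
  -- If s₀ = α this is the entry, s₀ = 0. The reflected flow has increasing normal coordinate there,
  -- so it stays in the half space only for s ≥ 0.
  rcases hs₀.1.eq_or_lt with h | h
  · have hα0 : α = 0 := hα.resolve_right (by linarith)
    have hs0 : s₀ = 0 := h ▸ hα0
    have hβ' : s₀ < β := h ▸ C.lt
    subst hs0
    subst hα0
    obtain ⟨fe, hfe, hfec⟩ := exists_reflection_left C.isOpen (c := 0) (ε := β) hβ'
      (f := flowRep ι V H ζ q₀ p₀) (by rwa [zero_add])
    rw [zero_add] at hfe
    have hin : IsIncoming H p₀ := by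
      rw [hp₀', S.flowBox_zero hq₀]
      exact S.incoming q₀ hq₀
    obtain ⟨X, hX, hpos⟩ := hin
    obtain ⟨h1, h2⟩ := hder fe hfe (hfec z₀ C.center) X hX
    refine ⟨fe, e, hfe, hfec z₀ C.center, by rw [hdH X hX]; exact hpos.ne', ?_⟩
    have h3 := eventually_le_of_nonneg h1 (hbdry fe hfe fun z hz => by
      rw [flowParam, S.flowBox_zero (C.subset hz).2, S.proj_zeta (C.subset hz).2]
      exact S.mem_boundary _) (by rw [h2]; positivity)
    filter_upwards [h3, prod_mem_nhds hNz (Iio_mem_nhds hβ')] with x hx hxm η hη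
    rw [mem_range_half, hνe] at hη
    exact ⟨hxm.1, hx hη, le_of_lt hxm.2⟩
  rcases hs₀.2.eq_or_lt with h' | h'
  · have hβ1 : β = 1 := hβ.resolve_right (by linarith)
    have hs1 : s₀ = 1 := h' ▸ hβ1
    subst hs1
    subst hβ1
    obtain ⟨fe, hfe, hfec⟩ := exists_reflection_right C.isOpen (c := 1) (ε := 1 - α)
      (by linarith) (f := flowRep ι V H ζ q₀ p₀) (by rwa [sub_sub_cancel])
    rw [sub_sub_cancel] at hfe
    have hout : ∃ X, IsHamVec H p₀ X ∧ normalVelocity p₀ X < 0 := by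
      rw [hp₀', flowBox_one]
      exact S.exit_outgoing hq₀
    obtain ⟨X, hX, hneg⟩ := hout
    obtain ⟨h1, h2⟩ := hder fe hfe (hfec z₀ C.center) X hX
    refine ⟨fe, e, hfe, hfec z₀ C.center, by rw [hdH X hX]; exact hneg.ne, ?_⟩
    have h3 := eventually_ge_of_nonneg h1 (hbdry fe hfe fun z hz => by
      rw [flowParam, flowBox_one]
      obtain ⟨b, -, hb⟩ := (S.exit_spec (C.subset hz).2).1
      rw [← hb]
      exact S.mem_boundary _) (by rw [h2]; exact mul_neg_of_pos_of_neg hT hneg)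
    filter_upwards [h3, prod_mem_nhds hNz (Ioi_mem_nhds h)] with x hx hxm η hη
    rw [mem_range_half, hνe] at hη
    exact ⟨hxm.1, le_of_lt hxm.2, hx hη⟩
  -- At an interior time no extension is needed, and any direction with dH ≠ 0 will do.
  · obtain ⟨e', he'⟩ := S.ham.nondegenerate p₀ (S.snd_ne_zero hp₀Γ) (S.energy_eq_zero hp₀Γ)
    have hn : N ×ˢ Icc α β ∈ 𝓝 (z₀, s₀) := prod_mem_nhds hNz (Icc_mem_nhds h h')
    refine ⟨flowRep ι V H ζ q₀ p₀, e', fun x _ => rfl, (hsm1 _ hx₀).contDiffAt hn, he', ?_⟩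
    filter_upwards [hn] with x hx η _ using hx

end IsScattering
end Package
end
end ZeroEnergy

namespace ZeroEnergy
noncomputable section

/-- Rolle's theorem on the segment, along which h has derivative η · dh(e). Thus a line in the
direction e meets {h = 0} at most once in R. -/
theorem eq_zero_of_rolle {W : Type*} [NormedAddCommGroup W] [NormedSpace ℝ W] {R : Set W}
    (hR : Convex ℝ R) {h : W → ℝ}
    {e : W} (hd : ∀ w ∈ R, HasFDerivWithinAt h (fderivWithin ℝ h R w) R w)
    (hne : ∀ w ∈ R, fderivWithin ℝ h R w e ≠ 0) {a : W} {η : ℝ} (ha : a ∈ R) (hb : a + η • e ∈ R)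
    (ha0 : h a = 0) (hb0 : h (a + η • e) = 0) : η = 0 := by
  have hmaps : MapsTo (fun t : ℝ => a + t • (η • e)) (Icc 0 1) R := by
    intro t ht
    have := hR.add_smul_sub_mem ha hb ht
    simpa using this
  have hder : ∀ t ∈ Icc (0 : ℝ) 1, HasDerivWithinAt (fun t : ℝ => h (a + t • (η • e)))
      (fderivWithin ℝ h R (a + t • (η • e)) (η • e)) (Icc 0 1) t := by
    intro t ht
    have h1 : HasDerivWithinAt (fun t : ℝ => a + t • (η • e)) (η • e) (Icc 0 1) t := by
      simpa using ((hasDerivWithinAt_id t (Icc 0 1)).smul_const (η • e)).const_add a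
    exact (hd _ (hmaps ht)).comp_hasDerivWithinAt t h1 hmaps
  obtain ⟨t, ht, h2⟩ := exists_hasDerivAt_eq_zero (f := fun t : ℝ => h (a + t • (η • e)))
    (f' := fun t => fderivWithin ℝ h R (a + t • (η • e)) (η • e)) one_pos
    (fun t ht => (hder t ht).continuousWithinAt) (by simp [ha0, hb0])
    (fun t ht => (hder t (Ioo_subset_Icc_self ht)).hasDerivAt (Icc_mem_nhds ht.1 ht.2))
  rw [map_smul, smul_eq_mul] at h2
  exact (mul_eq_zero.1 h2).resolve_right (hne _ (hmaps (Ioo_subset_Icc_self ht)))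

/-! ### Smoothness of the inverse parametrization -/

section LocalInverse
variable {d : ℕ}
  {B : Type*} [TopologicalSpace B] [ChartedSpace (EuclideanSpace ℝ (Fin d)) B]
  [IsManifold (𝓡 d) ∞ B]
  {M : Type*} [TopologicalSpace M] [ChartedSpace (EuclideanHalfSpace (d + 1)) M]
  [IsManifold (𝓡∂ (d + 1)) ∞ M]
  {ι : B → M} {U V : Set B} {𝒰 : Set (Cotangent (𝓡 d) B)}
  {H : Cotangent (𝓡∂ (d + 1)) M → ℝ} {ζ : Cotangent (𝓡 d) B → Cotangent (𝓡∂ (d + 1)) M}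
  {q₀ : Cotangent (𝓡 d) B} {p₀ : Cotangent (𝓡∂ (d + 1)) M} {N : Set (Phase d)} {α β s s₀ : ℝ}

theorem exists_dH_ne_zero_nhds (hH : IsHamiltonian H) (hp₀ : p₀.snd ≠ 0) {e : Phase (d + 1)}
    (he : dFun H p₀ e ≠ 0) :
    ∃ δ > 0, ∀ w ∈ range (cotModel (𝓡∂ (d + 1))) ∩ Metric.ball (cchart p₀ p₀) δ,
      HasFDerivWithinAt (H ∘ (cchart p₀).symm) (fderivWithin ℝ (H ∘ (cchart p₀).symm)
        (range (cotModel (𝓡∂ (d + 1)))) w) (range (cotModel (𝓡∂ (d + 1)))) w ∧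
      fderivWithin ℝ (H ∘ (cchart p₀).symm) (range (cotModel (𝓡∂ (d + 1)))) w e ≠ 0 := by
  obtain ⟨K, -, -, -, hKn, hKt⟩ := exists_box p₀ hp₀
  have hw₀ : cchart p₀ p₀ ∈ range (cotModel (𝓡∂ (d + 1))) := cchart_mem_range p₀ p₀
  have hKm : cchart p₀ p₀ ∈ K := mem_of_mem_nhdsWithin hw₀ hKn
  have hc : ContinuousWithinAt (hamField H p₀) (range (cotModel (𝓡∂ (d + 1)))) (cchart p₀ p₀) :=
    (((contDiffOn_hamField hH p₀).continuousOn.mono hKt) _ hKm).mono_of_mem_nhdsWithin hKn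
  have hL : Continuous (fun X : Phase (d + 1) => sympE e X) := by
    have h1 : (fun X : Phase (d + 1) => sympE e X) =
        fun X : Phase (d + 1) => e.2 X.1 - X.2 e.1 := rfl
    rw [h1]
    fun_prop
  have h2 : ∀ᶠ w in 𝓝[range (cotModel (𝓡∂ (d + 1)))] (cchart p₀ p₀),
      sympE e (hamField H p₀ w) ≠ 0 := by
    refine (hL.continuousAt.comp_continuousWithinAt hc).eventually_ne ?_
    change sympE e (hamField H p₀ (cchart p₀ p₀)) ≠ 0
    rw [sympE_hamField, fderivWithin_symm_self hH hp₀]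
    exact he
  obtain ⟨δ, hδ, hsub⟩ := Metric.mem_nhdsWithin_iff.1 (Filter.Eventually.and hKn h2)
  refine ⟨δ, hδ, fun w hw => ?_⟩
  obtain ⟨h3, h4⟩ := hsub ⟨hw.2, hw.1⟩
  refine ⟨((contDiffWithinAt_symm_cchart hH (hKt h3).1 (hKt h3).2).differentiableWithinAt
    (by simp)).hasFDerivWithinAt, ?_⟩
  rw [← sympE_hamField]
  exact h4

namespace IsScattering

variable (S : IsScattering ι U V 𝒰 H ζ)
include S

variable [T2Space M]

/-- The pulled-back form is nondegenerate in q, so a vector in the kernel is a multiple of ∂_s; that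
is mapped to T X_H, which is nonzero because dH ≠ 0. -/
theorem fderivWithin_flowRep_injective (hs₀ : s₀ ∈ Icc α β)
    (hp₀ : flowParam ι V H ζ q₀ (cchart q₀ q₀, s₀) = p₀)
    (C : IsFlowChart ι V 𝒰 H ζ q₀ p₀ N α β) : Function.Injective
      (fderivWithin ℝ (flowRep ι V H ζ q₀ p₀) (N ×ˢ Icc α β) (cchart q₀ q₀, s₀)) := by
  have hx₀ : (cchart q₀ q₀, s₀) ∈ N ×ˢ Icc α β := ⟨C.center, hs₀⟩
  have hp₀Γ : p₀ ∈ Gamma H 𝒰 ζ := hp₀ ▸ S.flowParam_mem (C.subset C.center) (C.Icc_subset hs₀)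
  have hw₀ : flowRep ι V H ζ q₀ p₀ (cchart q₀ q₀, s₀) = cchart p₀ p₀ := by rw [flowRep, hp₀]
  rw [injective_iff_map_eq_zero]
  intro u hu
  have h1 : u.1 = 0 := by
    refine eq_zero_of_sympE_eq_zero fun v => ?_
    have h2 := C.symp hx₀ (v, 0) u
    rw [hu] at h2
    rw [← h2]
    simp [sympE]
  have h3 : u = u.2 • ((0 : Phase d), (1 : ℝ)) := Prod.ext (by rw [h1]; simp) (by simp)
  rw [h3, map_smul, S.fderivWithin_flowRep_time C.subset C.lt C.Icc_subset C.mem_source C.smooth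
    hx₀, hw₀] at hu
  obtain ⟨X, hX⟩ := exists_isHamVec H (S.snd_ne_zero hp₀Γ)
  have h4 : hamField H p₀ (cchart p₀ p₀) ≠ 0 := by
    rw [hamField_self S.ham hX]
    exact hX.ne_zero S.ham (S.energy_eq_zero hp₀Γ)
  have h5 : timeParam ι V H ζ q₀ (cchart q₀ q₀) ≠ 0 := (S.hitTime_pos (C.subset C.center).2).ne'
  have h6 : u.2 = 0 := by
    rcases smul_eq_zero.1 hu with h | h
    · exact h
    · exact absurd h (smul_ne_zero h5 h4)
  exact Prod.ext h1 h6

/-- The flow parametrizes a hypersurface, so a transversal coordinate is added: Ψ(x, η) = f(x) + ηe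
has a smooth right inverse near the point. Where H = 0, Rolle's theorem forces η = 0, and r is the
x-component. -/
theorem exists_chart_inverse (hq₀ : q₀ ∈ 𝒰) (hs₀ : s₀ ∈ Icc α β)
    (hp₀ : flowParam ι V H ζ q₀ (cchart q₀ q₀, s₀) = p₀)
    (C : IsFlowChart ι V 𝒰 H ζ q₀ p₀ N α β) (hα : α = 0 ∨ α < s₀) (hβ : β = 1 ∨ s₀ < β) :
    ∃ (O : Set (Phase (d + 1))) (r : Phase (d + 1) → Phase d × ℝ), IsOpen O ∧ cchart p₀ p₀ ∈ O ∧
      r (cchart p₀ p₀) = (cchart q₀ q₀, s₀) ∧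
      ContDiffOn ℝ ∞ r (range (cotModel (𝓡∂ (d + 1))) ∩ O) ∧
      ∀ w ∈ range (cotModel (𝓡∂ (d + 1))) ∩ O, H ((cchart p₀).symm w) = 0 →
        r w ∈ N ×ˢ Icc α β ∧ flowRep ι V H ζ q₀ p₀ (r w) = w := by
  obtain ⟨fe, e, hfe, hfec, he, hev⟩ := S.exists_extension hq₀ hs₀ hp₀ C hα hβ
  set f := flowRep ι V H ζ q₀ p₀ with hf
  set x₀ : Phase d × ℝ := (cchart q₀ q₀, s₀) with hx₀
  set R := range (cotModel (𝓡∂ (d + 1))) with hR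
  set w₀ : Phase (d + 1) := cchart p₀ p₀ with hw₀
  have hx₀Ω : x₀ ∈ N ×ˢ Icc α β := ⟨C.center, hs₀⟩
  have hfx₀ : f x₀ = w₀ := by rw [hf, flowRep, hp₀]
  have hp₀Γ : p₀ ∈ Gamma H 𝒰 ζ := hp₀ ▸ S.flowParam_mem (C.subset C.center) (C.Icc_subset hs₀)
  have hU := uniqueDiffOn_prod_Icc C.isOpen C.lt
  have hfed := (hfec.differentiableAt (by simp)).hasFDerivAt
  have hJ : fderiv ℝ fe x₀ = fderivWithin ℝ f (N ×ˢ Icc α β) x₀ :=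
    ((hfed.hasFDerivWithinAt.congr (fun x hx => (hfe hx).symm) (hfe hx₀Ω).symm).fderivWithin
      (hU _ hx₀Ω)).symm
  obtain ⟨e₀, he₀⟩ := exists_equiv_of_transversal (P := Phase d × ℝ) (W := Phase (d + 1))
    (by rw [Module.finrank_prod, finrank_phase, finrank_phase, Module.finrank_self]; ring)
    (J := fderiv ℝ fe x₀) (by rw [hJ]; exact S.fderivWithin_flowRep_injective hs₀ hp₀ C)
    (l := fderivWithin ℝ (H ∘ (cchart p₀).symm) R w₀)
    (fun u => by
      rw [hJ, ← hfx₀]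
      exact S.dH_flowRep C.isOpen C.subset C.lt C.Icc_subset C.mem_source C.smooth hx₀Ω u)
    (e := e) (by rw [fderivWithin_symm_self S.ham (S.snd_ne_zero hp₀Γ)]; exact he)
  set Ψe : (Phase d × ℝ) × ℝ → Phase (d + 1) := fun y => fe y.1 + y.2 • e with hΨe
  set Ψ : (Phase d × ℝ) × ℝ → Phase (d + 1) := fun y => f y.1 + y.2 • e with hΨ
  have hΨs : ContDiffOn ℝ ∞ Ψ ((N ×ˢ Icc α β) ×ˢ univ) :=
    (C.smooth.comp contDiffOn_fst fun y hy => hy.1).add (contDiffOn_snd.smul contDiffOn_const)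
  have hΨec : ContDiffAt ℝ 1 Ψe (x₀, 0) :=
    (ContDiffAt.comp (x₀, (0 : ℝ)) (g := fe) hfec contDiffAt_fst).add
      (contDiffAt_snd.smul contDiffAt_const)
  have hΨed : HasFDerivAt Ψe (e₀ : (Phase d × ℝ) × ℝ →L[ℝ] Phase (d + 1)) (x₀, 0) := by
    have h1 : HasFDerivAt (fun y : (Phase d × ℝ) × ℝ => fe y.1)
        ((fderiv ℝ fe x₀).comp (ContinuousLinearMap.fst ℝ _ _)) (x₀, 0) :=
      HasFDerivAt.comp (x₀, (0 : ℝ)) (g := fe) hfed hasFDerivAt_fst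
    have h2 : HasFDerivAt (fun y : (Phase d × ℝ) × ℝ => y.2 • e)
        ((ContinuousLinearMap.snd ℝ (Phase d × ℝ) ℝ).smulRight e) (x₀, 0) :=
      hasFDerivAt_snd.smul_const e
    refine (h1.add h2).congr_fderiv (ContinuousLinearMap.ext fun y => ?_)
    exact (he₀ y).symm
  have hRu : UniqueDiffOn ℝ R := (cotModel (𝓡∂ (d + 1))).uniqueDiffOn
  obtain ⟨O, hO, hxO, r, hr0, hrs, hr⟩ := exists_smooth_right_inverse
    (D := (N ×ˢ Icc α β) ×ˢ univ) (hU.prod uniqueDiffOn_univ) hRu hΨs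
    (Ψe := Ψe) (fun y hy => by simp only [hΨe, hΨ, hfe hy.1]) hΨec hΨed
    (by
      have h3 : Tendsto (Prod.fst : (Phase d × ℝ) × ℝ → Phase d × ℝ) (𝓝 (x₀, 0)) (𝓝 x₀) :=
        continuous_fst.tendsto (x₀, (0 : ℝ))
      filter_upwards [h3.eventually hev] with y hy hyR
      exact ⟨hy y.2 hyR, mem_univ _⟩)
  have hΨe0 : Ψe (x₀, 0) = w₀ := by
    simp only [hΨe, zero_smul, add_zero]
    rw [hfe hx₀Ω, hfx₀]
  rw [hΨe0] at hxO hr0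
  obtain ⟨δ, hδ, hδs⟩ := exists_dH_ne_zero_nhds S.ham (S.snd_ne_zero hp₀Γ) he
  have hw₀R : w₀ ∈ R := cchart_mem_range p₀ p₀
  have hcont : ContinuousOn (fun w => f (r w).1) (R ∩ O) :=
    C.smooth.continuousOn.comp (continuous_fst.comp_continuousOn hrs.continuousOn)
      fun w hw => (hr w hw).1.1
  have hnear : ∀ᶠ w in 𝓝[R ∩ O] w₀, f (r w).1 ∈ Metric.ball w₀ δ := by
    refine (hcont w₀ ⟨hw₀R, hxO⟩).eventually_mem (Metric.isOpen_ball.mem_nhds ?_)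
    change f (r w₀).1 ∈ _
    rw [hr0, hfx₀]
    exact Metric.mem_ball_self hδ
  obtain ⟨δ', hδ', hδ's⟩ := Metric.mem_nhdsWithin_iff.1 hnear
  -- The ball of radius δ is where dH(e) ≠ 0; that of radius δ' puts f(r w) into it as well, so the
  -- segment needed for Rolle's theorem stays there.
  refine ⟨O ∩ (Metric.ball w₀ δ ∩ Metric.ball w₀ δ'), fun w => (r w).1,
    hO.inter (Metric.isOpen_ball.inter Metric.isOpen_ball),
    ⟨hxO, Metric.mem_ball_self hδ, Metric.mem_ball_self hδ'⟩, by simp only [hr0],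
    contDiff_fst.comp_contDiffOn (hrs.mono fun w hw => ⟨hw.1, hw.2.1⟩), fun w hw hH0 => ?_⟩
  obtain ⟨hD, hΨr⟩ := hr w ⟨hw.1, hw.2.1⟩
  have hΨr' : f (r w).1 + (r w).2 • e = w := hΨr
  have hball : f (r w).1 ∈ Metric.ball w₀ δ := hδ's ⟨hw.2.2.2, hw.1, hw.2.1⟩
  have hRconv : Convex ℝ R := (cotModel (𝓡∂ (d + 1))).convex_range
  have hη : (r w).2 = 0 := by
    have hsub : R ∩ Metric.ball w₀ δ ⊆ R := inter_subset_left
    have hfw : ∀ w ∈ R ∩ Metric.ball w₀ δ, fderivWithin ℝ (H ∘ (cchart p₀).symm)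
        (R ∩ Metric.ball w₀ δ) w = fderivWithin ℝ (H ∘ (cchart p₀).symm) R w := fun w hw =>
      fderivWithin_inter (Metric.isOpen_ball.mem_nhds hw.2)
    refine eq_zero_of_rolle (R := R ∩ Metric.ball w₀ δ) (hRconv.inter (convex_ball w₀ δ))
      (h := H ∘ (cchart p₀).symm) (e := e) (a := f (r w).1) ?_ ?_ ?_ ?_ ?_ ?_
    · intro w hw
      rw [hfw w hw]
      exact (hδs w hw).1.mono hsub
    · intro w hw
      rw [hfw w hw]
      exact (hδs w hw).2
    · exact ⟨cchart_mem_range p₀ _, hball⟩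
    · rw [hΨr']
      exact ⟨hw.1, hw.2.2.1⟩
    · exact (S.flowRep_mem C.subset C.Icc_subset C.mem_source hD.1).2.2
    · rw [hΨr']
      exact hH0
  rw [hη, zero_smul, add_zero] at hΨr'
  exact ⟨hD.1, hΨr'⟩

/-- Near each point of `Γ`, the hypersurface `H = 0` is parametrized by the flow, and the parameters
are smooth functions. -/
theorem exists_local_inverse (hq₀ : q₀ ∈ 𝒰) (hs₀ : s₀ ∈ Icc (0 : ℝ) 1) :
    ∃ ρ : Cotangent (𝓡∂ (d + 1)) M → Phase d × ℝ,
      ContMDiffAt (cotModel (𝓡∂ (d + 1))) 𝓘(ℝ, Phase d × ℝ) ∞ ρ (flowBox ι V H ζ (q₀, s₀)) ∧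
      ρ (flowBox ι V H ζ (q₀, s₀)) = (cchart q₀ q₀, s₀) ∧
      ∀ᶠ p in 𝓝 (flowBox ι V H ζ (q₀, s₀)), H p = 0 →
        ρ p ∈ paramSet 𝒰 q₀ ×ˢ Icc 0 1 ∧ flowParam ι V H ζ q₀ (ρ p) = p := by
  obtain ⟨N, α, β, C, hsI, -, hα, hβ⟩ := S.exists_flowChart hq₀ hs₀
  set p₀ := flowBox ι V H ζ (q₀, s₀) with hp₀
  obtain ⟨O, r, hO, hw₀O, hr0, hrs, hr⟩ := S.exists_chart_inverse hq₀ hsI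
    ((flowParam_center s₀).trans hp₀.symm) C hα hβ
  have hmem : ∀ᶠ p in 𝓝 p₀, p ∈ (cchart p₀).source ∧
      cchart p₀ p ∈ range (cotModel (𝓡∂ (d + 1))) ∩ O := by
    filter_upwards [extChartAt_source_mem_nhds (I := cotModel (𝓡∂ (d + 1))) p₀,
      (continuousAt_extChartAt (I := cotModel (𝓡∂ (d + 1))) p₀).eventually_mem
        (hO.mem_nhds hw₀O)] with p h1 h2
    exact ⟨h1, cchart_mem_range p₀ p, h2⟩
  refine ⟨fun p => r (cchart p₀ p), ?_, hr0, ?_⟩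
  · have h1 : ContMDiffWithinAt 𝓘(ℝ, Phase (d + 1)) 𝓘(ℝ, Phase d × ℝ) ∞ r
        (range (cotModel (𝓡∂ (d + 1))) ∩ O) (cchart p₀ p₀) :=
      (hrs _ ⟨cchart_mem_range p₀ p₀, hw₀O⟩).contMDiffWithinAt
    have h2 : ContMDiffAt (cotModel (𝓡∂ (d + 1))) 𝓘(ℝ, Phase (d + 1)) ∞ (cchart p₀) p₀ :=
      contMDiffAt_extChartAt
    exact (ContMDiffWithinAt.comp (t := range (cotModel (𝓡∂ (d + 1))) ∩ O)
      (s := {p | cchart p₀ p ∈ range (cotModel (𝓡∂ (d + 1))) ∩ O}) p₀ h1 h2.contMDiffWithinAt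
      fun p hp => hp).contMDiffAt (hmem.mono fun p hp => hp.2)
  · filter_upwards [hmem] with p hp hH0
    obtain ⟨h1, h2⟩ := hr _ hp.2 (by rwa [(cchart p₀).left_inv hp.1])
    refine ⟨⟨C.subset h1.1, C.Icc_subset h1.2⟩, ?_⟩
    exact (cchart p₀).injOn (C.mem_source _ h1) hp.1 h2

end IsScattering
end LocalInverse
end
end ZeroEnergy

namespace ZeroEnergy
noncomputable section

/-! ### The flow on the whole parameter box and the range of its derivative -/

section FlowDerivative
variable {d : ℕ}
  {B : Type*} [TopologicalSpace B] [ChartedSpace (EuclideanSpace ℝ (Fin d)) B]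
  [IsManifold (𝓡 d) ∞ B]
  {M : Type*} [TopologicalSpace M] [ChartedSpace (EuclideanHalfSpace (d + 1)) M]
  [IsManifold (𝓡∂ (d + 1)) ∞ M]
  {ι : B → M} {U V : Set B} {𝒰 : Set (Cotangent (𝓡 d) B)}
  {H : Cotangent (𝓡∂ (d + 1)) M → ℝ} {ζ : Cotangent (𝓡 d) B → Cotangent (𝓡∂ (d + 1)) M}
  {q₀ : Cotangent (𝓡 d) B} {p₀ : Cotangent (𝓡∂ (d + 1)) M} {N : Set (Phase d)} {α β s s₀ : ℝ}

/-- The parameters of the bicharacteristics, in the chart at `q₀`. -/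
def paramBox (𝒰 : Set (Cotangent (𝓡 d) B)) (q₀ : Cotangent (𝓡 d) B) : Set (Phase d × ℝ) :=
  paramSet 𝒰 q₀ ×ˢ Icc 0 1

theorem IsFlowChart.mem_nhdsWithin (C : IsFlowChart ι V 𝒰 H ζ q₀ p₀ N α β)
    (hI : Icc α β ∈ 𝓝[Icc 0 1] s₀) :
    N ×ˢ Icc α β ∈ 𝓝[paramBox 𝒰 q₀] (cchart q₀ q₀, s₀) := by
  rw [paramBox, nhdsWithin_prod_eq]
  exact prod_mem_prod (mem_nhdsWithin_of_mem_nhds (C.isOpen.mem_nhds C.center)) hI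

namespace IsScattering

variable (S : IsScattering ι U V 𝒰 H ζ)
include S

theorem uniqueDiffOn_paramBox : UniqueDiffOn ℝ (paramBox 𝒰 q₀) :=
  uniqueDiffOn_prod_Icc (isOpen_paramSet S.isOpen) one_pos

variable [T2Space M]

theorem contMDiffWithinAt_flowParam_center (hq₀ : q₀ ∈ 𝒰) (hs₀ : s₀ ∈ Icc (0 : ℝ) 1) :
    ContMDiffWithinAt 𝓘(ℝ, Phase d × ℝ) (cotModel (𝓡∂ (d + 1))) ∞ (flowParam ι V H ζ q₀)
      (paramBox 𝒰 q₀) (cchart q₀ q₀, s₀) := by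
  obtain ⟨N, α, β, C, hsI, hI, -, -⟩ := S.exists_flowChart hq₀ hs₀
  have h1 := contMDiffOn_of_cchart C.mem_source C.smooth
  exact (h1 _ ⟨C.center, hsI⟩).mono_of_mem_nhdsWithin (C.mem_nhdsWithin hI)

/-- Smoothness is known at the centre of each chart; at any other parameter one changes to the chart
centred there. -/
theorem contMDiffOn_flowParam_box :
    ContMDiffOn 𝓘(ℝ, Phase d × ℝ) (cotModel (𝓡∂ (d + 1))) ∞ (flowParam ι V H ζ q₀)
      (paramBox 𝒰 q₀) := by
  rintro ⟨z, s⟩ hx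
  set q := (cchart q₀).symm z with hq
  have hq𝒰 : q ∈ 𝒰 := hx.1.2
  set τ : Phase d × ℝ → Phase d × ℝ := fun y => (cchart q ((cchart q₀).symm y.1), y.2) with hτ
  have hsymm : ContMDiffAt 𝓘(ℝ, Phase d) (cotModel (𝓡 d)) ∞ (cchart q₀).symm z :=
    (contMDiffOn_cchart_symm q₀).contMDiffAt ((isOpen_extChartAt_target q₀).mem_nhds hx.1.1)
  have hchart : ContMDiffAt (cotModel (𝓡 d)) 𝓘(ℝ, Phase d) ∞ (cchart q) ((cchart q₀).symm z) :=
    contMDiffAt_extChartAt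
  have h1 : ContDiffAt ℝ ∞ (fun z => cchart q ((cchart q₀).symm z)) z :=
    (hchart.comp z hsymm).contDiffAt
  have hτs : ContDiffAt ℝ ∞ τ (z, s) :=
    (ContDiffAt.comp (z, s) (g := fun z => cchart q ((cchart q₀).symm z)) h1
      contDiffAt_fst).prodMk contDiffAt_snd
  have hsrc : ∀ᶠ y in 𝓝 (z, s), (cchart q₀).symm y.1 ∈ (cchart q).source := by
    have h2 := (hsymm.continuousAt.comp (x := (z, s)) (f := Prod.fst) continuousAt_fst)
    exact h2.eventually_mem (extChartAt_source_mem_nhds (I := cotModel (𝓡 d)) q)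
  set Y : Set (Phase d × ℝ) := paramBox 𝒰 q₀ ∩ {y | (cchart q₀).symm y.1 ∈ (cchart q).source}
    with hY
  have hmaps : MapsTo τ Y (paramBox 𝒰 q) := by
    rintro y ⟨hy, hys⟩
    refine ⟨⟨(cchart q).map_source hys, ?_⟩, hy.2⟩
    rw [mem_preimage, (cchart q).left_inv hys]
    exact hy.1.2
  have h3 : ContMDiffWithinAt 𝓘(ℝ, Phase d × ℝ) (cotModel (𝓡∂ (d + 1))) ∞
      (flowParam ι V H ζ q ∘ τ) Y (z, s) :=
    ContMDiffWithinAt.comp (z, s) (S.contMDiffWithinAt_flowParam_center hq𝒰 hx.2)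
      hτs.contMDiffAt.contMDiffWithinAt hmaps
  have heq : ∀ y ∈ Y, flowParam ι V H ζ q₀ y = (flowParam ι V H ζ q ∘ τ) y := by
    rintro y ⟨-, hys⟩
    simp only [Function.comp_apply, flowParam, hτ]
    rw [(cchart q).left_inv hys]
  have hxY : (z, s) ∈ Y := ⟨hx, mem_extChartAt_source q⟩
  exact (h3.congr heq (heq _ hxY)).mono_of_mem_nhdsWithin
    (inter_mem self_mem_nhdsWithin (mem_nhdsWithin_of_mem_nhds hsrc))

/-- The derivative of the flow pulls back the symplectic form to the symplectic form, and its range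
is the kernel of `dH`. -/
theorem exists_flow_derivative (hq₀ : q₀ ∈ 𝒰) (hs₀ : s₀ ∈ Icc (0 : ℝ) 1) :
    ∃ J : Phase d × ℝ →L[ℝ] Phase (d + 1),
      HasMFDerivWithinAt 𝓘(ℝ, Phase d × ℝ) (cotModel (𝓡∂ (d + 1))) (flowParam ι V H ζ q₀)
        (paramBox 𝒰 q₀) (cchart q₀ q₀, s₀) J ∧
      (∀ u v, sympE (J u) (J v) = sympE u.1 v.1) ∧
      ∀ v, dFun H (flowParam ι V H ζ q₀ (cchart q₀ q₀, s₀)) v = 0 ↔ ∃ u, J u = v := by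
  obtain ⟨N, α, β, C, hsI, hI, -, -⟩ := S.exists_flowChart hq₀ hs₀
  rw [← flowParam_center] at C
  set x₀ : Phase d × ℝ := (cchart q₀ q₀, s₀) with hx₀
  have hx₀Ω : x₀ ∈ N ×ˢ Icc α β := ⟨C.center, hsI⟩
  have hΓ := S.flowParam_mem (C.subset C.center) hs₀
  set p₀ := flowParam ι V H ζ q₀ x₀ with hp₀
  set J := fderivWithin ℝ (flowRep ι V H ζ q₀ p₀) (N ×ˢ Icc α β) x₀ with hJ
  have h1 : HasFDerivWithinAt (flowRep ι V H ζ q₀ p₀) J (N ×ˢ Icc α β) x₀ :=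
    (C.smooth.differentiableOn (by simp) _ hx₀Ω).hasFDerivWithinAt
  have hw₀ : flowRep ι V H ζ q₀ p₀ x₀ = cchart p₀ p₀ := rfl
  have hdJ : ∀ u, dFun H p₀ (J u) = 0 := fun u => by
    have h2 := S.dH_flowRep C.isOpen C.subset C.lt C.Icc_subset C.mem_source C.smooth hx₀Ω u
    rw [hw₀, fderivWithin_symm_self S.ham (S.snd_ne_zero hΓ)] at h2
    exact h2
  refine ⟨J, ?_, C.symp hx₀Ω, fun v => ⟨fun hv => ?_, ?_⟩⟩
  · have h2 : HasMFDerivWithinAt 𝓘(ℝ, Phase d × ℝ) (cotModel (𝓡∂ (d + 1)))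
        (flowParam ι V H ζ q₀) (N ×ˢ Icc α β) x₀ J := by
      refine ⟨(contMDiffOn_of_cchart C.mem_source C.smooth _ hx₀Ω).continuousWithinAt, ?_⟩
      exact h1.mono fun y hy => hy.1
    exact h2.mono_of_mem_nhdsWithin (C.mem_nhdsWithin hI)
  -- The range of J together with e is the whole space; dH vanishes on the range and not at e, so
  -- vectors in its kernel have no e-component.
  · obtain ⟨e, he⟩ : ∃ e : Phase (d + 1), dFun H p₀ e ≠ 0 :=
      S.ham.nondegenerate p₀ (S.snd_ne_zero hΓ) (S.energy_eq_zero hΓ)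
    have hl := fderivWithin_symm_self S.ham (S.snd_ne_zero hΓ)
    obtain ⟨e₀, he₀⟩ := exists_equiv_of_transversal (P := Phase d × ℝ) (W := Phase (d + 1))
      (by rw [Module.finrank_prod, finrank_phase, finrank_phase, Module.finrank_self]; ring)
      (J := J) (S.fderivWithin_flowRep_injective hsI hp₀.symm C)
      (l := fderivWithin ℝ (H ∘ (cchart p₀).symm) (range (cotModel (𝓡∂ (d + 1)))) (cchart p₀ p₀))
      (fun u => (hl _).trans (hdJ u)) (e := e) (fun h => he ((hl e).symm.trans h))
    obtain ⟨y, rfl⟩ := e₀.surjective v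
    have h3 := hl (e₀ y)
    rw [hv, he₀, map_add, map_smul, hl, hdJ, hl, zero_add] at h3
    have h4 : y.2 = 0 := (mul_eq_zero.1 h3).resolve_right he
    refine ⟨y.1, ?_⟩
    rw [he₀, h4, zero_smul, add_zero]
  · rintro ⟨u, rfl⟩
    exact hdJ u

end IsScattering
end FlowDerivative

section LocallyConstant
variable {E : Type*} [NormedAddCommGroup E] [NormedSpace ℝ E] {A : Type*}
  [TopologicalSpace A] {I : ModelWithCorners ℝ E A} {M : Type*} [TopologicalSpace M]
  [ChartedSpace A M] [IsManifold I ∞ M]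

/-- A curve whose derivative vanishes is constant. -/
theorem constant_of_derivWithin_zero {Q : ℝ → Cotangent I M} {a b : ℝ}
    (hQ : ∀ s ∈ Icc a b, ∀ᶠ s' in 𝓝[Icc a b] s, Q s' ∈ (cchart (Q s)).source)
    (hd : ∀ s ∈ Icc a b, HasDerivWithinAt (fun s' => cchart (Q s) (Q s')) 0 (Icc a b) s)
    {s t : ℝ} (hs : s ∈ Icc a b) (ht : t ∈ Icc a b) : Q s = Q t := by
  refine isPreconnected_Icc.induction₂ (fun x y => Q x = Q y) (fun x hx => ?_)
    (fun x y z _ _ _ h h' => h.trans h') (fun x y _ _ h => h.symm) hs ht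
  obtain ⟨δ, hδ, hδs⟩ := Metric.mem_nhdsWithin_iff.1 (hQ x hx)
  have hconv : Convex ℝ (Metric.ball x δ ∩ Icc a b) := (convex_ball x δ).inter (convex_Icc a b)
  have hder : ∀ y ∈ Metric.ball x δ ∩ Icc a b,
      HasDerivWithinAt (fun s => cchart (Q x) (Q s)) 0 (Metric.ball x δ ∩ Icc a b) y := by
    intro y hy
    have hys := hδs hy
    have h1 : HasFDerivWithinAt (cchart (Q x) ∘ (cchart (Q y)).symm)
        (fderivWithin ℝ (cchart (Q x) ∘ (cchart (Q y)).symm) (range (cotModel I))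
          (cchart (Q y) (Q y))) (range (cotModel I)) (cchart (Q y) (Q y)) :=
      ((contDiffWithinAt_cchart_transition hys).differentiableWithinAt
        (by simp)).hasFDerivWithinAt
    have h2 := h1.comp_hasDerivWithinAt y (hd y hy.2) fun s _ => cchart_mem_range _ _
    rw [map_zero] at h2
    have h3 : HasDerivWithinAt (fun s => cchart (Q x) (Q s)) 0 (Icc a b) y := by
      refine h2.congr_of_eventuallyEq ?_ ?_
      · filter_upwards [hQ y hy.2] with s hs
        simp only [Function.comp_apply]
        rw [(cchart (Q y)).left_inv hs]
      · simp only [Function.comp_apply]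
        rw [(cchart (Q y)).left_inv (mem_extChartAt_source (Q y))]
    exact h3.mono inter_subset_right
  filter_upwards [inter_mem (mem_nhdsWithin_of_mem_nhds (Metric.ball_mem_nhds x hδ))
    self_mem_nhdsWithin] with y hy
  have hxm : x ∈ Metric.ball x δ ∩ Icc a b := ⟨Metric.mem_ball_self hδ, hx⟩
  have h4 := hconv.norm_image_sub_le_of_norm_hasDerivWithin_le (C := 0) hder
    (fun _ _ => by rw [norm_zero]) hxm hy
  rw [zero_mul, norm_le_zero_iff, sub_eq_zero] at h4
  exact (cchart (Q x)).injOn (mem_extChartAt_source (Q x)) (hδs hy) h4.symm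

end LocallyConstant
end
end ZeroEnergy

namespace ZeroEnergy
noncomputable section

/-- A linear map of `E × E* × ℝ` that preserves the symplectic form modulo `ℝ` maps the kernel of
the form to the kernel of the form. -/
theorem fst_eq_zero_of_sympE {G : Type*} [NormedAddCommGroup G] [NormedSpace ℝ G]
    [FiniteDimensional ℝ G] (D : (G × (G →L[ℝ] ℝ)) × ℝ →L[ℝ] (G × (G →L[ℝ] ℝ)) × ℝ)
    (hD : ∀ u v, sympE (D u).1 (D v).1 = sympE u.1 v.1) : (D (0, 1)).1 = 0 := by
  set T : (G × (G →L[ℝ] ℝ)) →ₗ[ℝ] (G × (G →L[ℝ] ℝ)) :=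
    (LinearMap.fst ℝ _ _).comp ((D : (G × (G →L[ℝ] ℝ)) × ℝ →ₗ[ℝ] (G × (G →L[ℝ] ℝ)) × ℝ).comp
      (LinearMap.inl ℝ _ _)) with hT
  have hTa : ∀ a, T a = (D (a, 0)).1 := fun a => rfl
  have hinj : Function.Injective T := by
    rw [← LinearMap.ker_eq_bot, LinearMap.ker_eq_bot']
    intro a ha
    refine eq_zero_of_sympE_eq_zero fun v => ?_
    have h1 := hD (v, 0) (a, 0)
    rw [← hTa a, ha] at h1
    rw [← h1]
    simp [sympE]
  -- Now the q-part of D(∂_s) is orthogonal to every T a, hence to everything.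
  have hsurj : Function.Surjective T := LinearMap.injective_iff_surjective.1 hinj
  refine eq_zero_of_sympE_eq_zero fun b => ?_
  obtain ⟨a, rfl⟩ := hsurj b
  have h1 := hD (a, 0) (0, 1)
  rw [hTa, h1]
  simp [sympE]

/-! ### Part (a): a symplectic diffeomorphism preserves the scattering relation -/

section Kappa
variable {d : ℕ}
  {B : Type*} [TopologicalSpace B] [ChartedSpace (EuclideanSpace ℝ (Fin d)) B]
  [IsManifold (𝓡 d) ∞ B]
  {M : Type*} [TopologicalSpace M] [ChartedSpace (EuclideanHalfSpace (d + 1)) M]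
  [IsManifold (𝓡∂ (d + 1)) ∞ M] [T2Space M]
  {M' : Type*} [TopologicalSpace M'] [ChartedSpace (EuclideanHalfSpace (d + 1)) M']
  [IsManifold (𝓡∂ (d + 1)) ∞ M']
  {ι : B → M} {ι' : B → M'} {U V : Set B} {𝒰 : Set (Cotangent (𝓡 d) B)}
  {H : Cotangent (𝓡∂ (d + 1)) M → ℝ} {ζ : Cotangent (𝓡 d) B → Cotangent (𝓡∂ (d + 1)) M}
  {H' : Cotangent (𝓡∂ (d + 1)) M' → ℝ} {ζ' : Cotangent (𝓡 d) B → Cotangent (𝓡∂ (d + 1)) M'}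
  {q₀ q₀' : Cotangent (𝓡 d) B} {s₀ s₀' : ℝ}
  {κ : Cotangent (𝓡∂ (d + 1)) M → Cotangent (𝓡∂ (d + 1)) M'}

/-- Here y is κ read in the parameters on both sides. Both flows pull σ back to the form in q alone
and κ preserves σ₀, so the derivative D preserves that form and maps its kernel ∂_s into its kernel.
-/
theorem exists_param_map [T2Space M'] (S : IsScattering ι U V 𝒰 H ζ) (S' : IsScattering ι' U V 𝒰 H' ζ')
    (hκ : ContMDiffOn (cotModel (𝓡∂ (d + 1))) (cotModel (𝓡∂ (d + 1))) ∞ κ (Gamma H 𝒰 ζ))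
    (hκm : MapsTo κ (Gamma H 𝒰 ζ) (Gamma H' 𝒰 ζ'))
    (hP : PreservesSymp H (Gamma H 𝒰 ζ) κ) (hq₀ : q₀ ∈ 𝒰) (hs₀ : s₀ ∈ Icc (0 : ℝ) 1)
    (hq₀' : q₀' ∈ 𝒰) (hs₀' : s₀' ∈ Icc (0 : ℝ) 1)
    (hk : κ (flowBox ι V H ζ (q₀, s₀)) = flowBox ι' V H' ζ' (q₀', s₀')) :
    ∃ (y : Phase d × ℝ → Phase d × ℝ) (D : Phase d × ℝ →L[ℝ] Phase d × ℝ),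
      HasFDerivWithinAt y D (paramBox 𝒰 q₀) (cchart q₀ q₀, s₀) ∧ (D (0, 1)).1 = 0 ∧
      ∀ᶠ x in 𝓝[paramBox 𝒰 q₀] (cchart q₀ q₀, s₀), y x ∈ paramBox 𝒰 q₀' ∧
        flowParam ι' V H' ζ' q₀' (y x) = κ (flowParam ι V H ζ q₀ x) := by
  set x₀ : Phase d × ℝ := (cchart q₀ q₀, s₀) with hx₀
  set x₀' : Phase d × ℝ := (cchart q₀' q₀', s₀') with hx₀'
  have hx₀m : x₀ ∈ paramBox 𝒰 q₀ := ⟨center_mem_paramSet hq₀, hs₀⟩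
  have hmaps : MapsTo (flowParam ι V H ζ q₀) (paramBox 𝒰 q₀) (Gamma H 𝒰 ζ) := fun x hx =>
    S.flowParam_mem hx.1 hx.2
  obtain ⟨J, hJ, hJs, hJr⟩ := S.exists_flow_derivative hq₀ hs₀
  obtain ⟨J', hJ', hJs', -⟩ := S'.exists_flow_derivative hq₀' hs₀'
  obtain ⟨ρ, hρs, hρ0, hρ⟩ := S'.exists_local_inverse hq₀' hs₀'
  have hpk : κ (flowParam ι V H ζ q₀ x₀) = flowBox ι' V H' ζ' (q₀', s₀') := by
    rw [hx₀, flowParam_center, hk]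
  rw [← hpk] at hρs hρ0 hρ
  set L := mfderivWithin (cotModel (𝓡∂ (d + 1))) (cotModel (𝓡∂ (d + 1))) κ (Gamma H 𝒰 ζ)
    (flowParam ι V H ζ q₀ x₀) with hLdef
  have hL : HasMFDerivWithinAt (cotModel (𝓡∂ (d + 1))) (cotModel (𝓡∂ (d + 1))) κ (Gamma H 𝒰 ζ)
      (flowParam ι V H ζ q₀ x₀) L :=
    ((hκ _ (hmaps hx₀m)).mdifferentiableWithinAt (by simp)).hasMFDerivWithinAt
  have hLJ := HasMFDerivWithinAt.comp x₀ hL hJ hmaps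
  set y : Phase d × ℝ → Phase d × ℝ := fun x => ρ (κ (flowParam ι V H ζ q₀ x)) with hy
  have hyd := HasMFDerivAt.comp_hasMFDerivWithinAt x₀
    (hρs.mdifferentiableAt (by simp)).hasMFDerivAt hLJ
  set D : Phase d × ℝ →L[ℝ] Phase d × ℝ := (mfderiv (cotModel (𝓡∂ (d + 1)))
    𝓘(ℝ, Phase d × ℝ) ρ (κ (flowParam ι V H ζ q₀ x₀))).comp (L.comp J) with hD
  have hyd' : HasFDerivWithinAt y D (paramBox 𝒰 q₀) x₀ :=
    hasMFDerivWithinAt_iff_hasFDerivWithinAt.1 hyd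
  have hyx₀ : y x₀ = x₀' := hρ0
  have hev : ∀ᶠ x in 𝓝[paramBox 𝒰 q₀] x₀, y x ∈ paramBox 𝒰 q₀' ∧
      flowParam ι' V H' ζ' q₀' (y x) = κ (flowParam ι V H ζ q₀ x) := by
    have h1 : ContinuousWithinAt (fun x => κ (flowParam ι V H ζ q₀ x)) (paramBox 𝒰 q₀) x₀ :=
      hLJ.continuousWithinAt
    filter_upwards [h1.eventually hρ, self_mem_nhdsWithin] with x hx hxm
    exact hx (S'.energy_eq_zero (hκm (hmaps hxm)))
  refine ⟨y, D, hyd', ?_, hev⟩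
  have hJD : ∀ u, J' (D u) = L (J u) := by
    set Y : Set (Phase d × ℝ) := paramBox 𝒰 q₀ ∩ {x | y x ∈ paramBox 𝒰 q₀'} with hY
    have hYn : Y ∈ 𝓝[paramBox 𝒰 q₀] x₀ :=
      inter_mem self_mem_nhdsWithin (hev.mono fun x hx => hx.1)
    have hYe : 𝓝[Y] x₀ = 𝓝[paramBox 𝒰 q₀] x₀ :=
      le_antisymm (nhdsWithin_mono _ inter_subset_left) (nhdsWithin_le_iff.2 hYn)
    have hUY : UniqueMDiffWithinAt 𝓘(ℝ, Phase d × ℝ) Y x₀ := by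
      rw [uniqueMDiffWithinAt_iff_uniqueDiffWithinAt]
      exact (S.uniqueDiffOn_paramBox x₀ hx₀m).mono_nhds hYe.ge
    have hJ'y : HasMFDerivWithinAt 𝓘(ℝ, Phase d × ℝ) (cotModel (𝓡∂ (d + 1)))
        (flowParam ι' V H' ζ' q₀') (paramBox 𝒰 q₀') (y x₀) J' := by
      rw [hyx₀]
      exact hJ'
    have hyY : HasMFDerivWithinAt 𝓘(ℝ, Phase d × ℝ) 𝓘(ℝ, Phase d × ℝ) y Y x₀ D :=
      (hasMFDerivWithinAt_iff_hasFDerivWithinAt.2 hyd').mono inter_subset_left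
    have h1 := HasMFDerivWithinAt.comp x₀ hJ'y hyY fun x hx => hx.2
    have h2 : HasMFDerivWithinAt 𝓘(ℝ, Phase d × ℝ) (cotModel (𝓡∂ (d + 1)))
        (κ ∘ flowParam ι V H ζ q₀) Y x₀ (J'.comp D) := by
      refine h1.congr_of_eventuallyEq ?_ ?_
      · rw [hYe]
        filter_upwards [hev] with x hx using hx.2.symm
      · exact (hev.self_of_nhdsWithin hx₀m).2.symm
    have h3 := hUY.eq h2 (hLJ.mono inter_subset_left)
    exact fun u => congrArg (fun F => F u) h3
  have hPL : ∀ u v : Phase d × ℝ, sympE (E := EuclideanSpace ℝ (Fin (d + 1))) (L (J u)) (L (J v)) =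
      sympE (E := EuclideanSpace ℝ (Fin (d + 1))) (J u) (J v) := fun u v =>
    hP _ (hmaps hx₀m) L hL (J u) (J v) ((hJr _).2 ⟨u, rfl⟩) ((hJr _).2 ⟨v, rfl⟩)
  clear_value D L
  have hsymp : ∀ u v, sympE (D u).1 (D v).1 = sympE u.1 v.1 := fun u v =>
    (hJs' (D u) (D v)).symm.trans ((congrArg₂ sympE (hJD u) (hJD v)).trans
      ((hPL u v).trans (hJs u v)))
  exact fst_eq_zero_of_sympE D hsymp

/-- A symplectic diffeomorphism maps bicharacteristics to bicharacteristics. -/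
theorem exists_flowBox_eq [T2Space M'] (S : IsScattering ι U V 𝒰 H ζ) (S' : IsScattering ι' U V 𝒰 H' ζ')
    (hκ : ContMDiffOn (cotModel (𝓡∂ (d + 1))) (cotModel (𝓡∂ (d + 1))) ∞ κ (Gamma H 𝒰 ζ))
    (hκm : MapsTo κ (Gamma H 𝒰 ζ) (Gamma H' 𝒰 ζ'))
    (hP : PreservesSymp H (Gamma H 𝒰 ζ) κ) {q : Cotangent (𝓡 d) B} (hq : q ∈ 𝒰)
    (h0 : κ (ζ q) = ζ' q) {s : ℝ} (hs : s ∈ Icc (0 : ℝ) 1) :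
    ∃ s' ∈ Icc (0 : ℝ) 1, κ (flowBox ι V H ζ (q, s)) = flowBox ι' V H' ζ' (q, s') := by
  have hex : ∀ s, ∃ z : Cotangent (𝓡 d) B × ℝ, s ∈ Icc (0 : ℝ) 1 → z ∈ 𝒰 ×ˢ Icc (0 : ℝ) 1 ∧
      κ (flowBox ι V H ζ (q, s)) = flowBox ι' V H' ζ' z := by
    intro s
    by_cases hs : s ∈ Icc (0 : ℝ) 1
    · obtain ⟨z, hz, hz'⟩ := S'.flowBox_bijOn.surjOn (hκm (S.flowBox_bijOn.mapsTo
        (show (q, s) ∈ 𝒰 ×ˢ Icc (0 : ℝ) 1 from ⟨hq, hs⟩)))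
      exact ⟨z, fun _ => ⟨hz, hz'.symm⟩⟩
    · exact ⟨(q, 0), fun h => absurd h hs⟩
  choose Z hZ using hex
  have hinj : ∀ s ∈ Icc (0 : ℝ) 1, ∀ z ∈ 𝒰 ×ˢ Icc (0 : ℝ) 1,
      κ (flowBox ι V H ζ (q, s)) = flowBox ι' V H' ζ' z → Z s = z := fun s hs z hz h =>
    S'.flowBox_bijOn.injOn (hZ s hs).1 hz ((hZ s hs).2.symm.trans h)
  -- The initial covector of the image point has zero derivative in time, so it is constant along
  -- the bicharacteristic.
  have hloc : ∀ s ∈ Icc (0 : ℝ) 1, (∀ᶠ r in 𝓝[Icc 0 1] s, (Z r).1 ∈ (cchart (Z s).1).source) ∧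
      HasDerivWithinAt (fun r => cchart (Z s).1 (Z r).1) 0 (Icc 0 1) s := by
    intro s hs
    obtain ⟨y, D, hy, hD0, hev⟩ := exists_param_map S S' hκ hκm hP hq hs (hZ s hs).1.1
      (hZ s hs).1.2 (hZ s hs).2
    have hc : MapsTo (fun r : ℝ => (cchart q q, r)) (Icc 0 1) (paramBox 𝒰 q) := fun r hr =>
      ⟨center_mem_paramSet hq, hr⟩
    have hpair : HasDerivWithinAt (fun r : ℝ => (cchart q q, r)) ((0 : Phase d), (1 : ℝ))
        (Icc 0 1) s := (hasDerivWithinAt_const s _ (cchart q q)).prodMk (hasDerivWithinAt_id s _)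
    have h1 := hy.comp_hasDerivWithinAt s hpair hc
    have h2 : ∀ᶠ r in 𝓝[Icc 0 1] s, y (cchart q q, r) ∈ paramBox 𝒰 (Z s).1 ∧
        flowParam ι' V H' ζ' (Z s).1 (y (cchart q q, r)) =
        κ (flowParam ι V H ζ q (cchart q q, r)) :=
      (hpair.continuousWithinAt.tendsto_nhdsWithin hc).eventually hev
    have h3 : ∀ᶠ r in 𝓝[Icc 0 1] s, (Z r).1 ∈ (cchart (Z s).1).source ∧
        cchart (Z s).1 (Z r).1 = (y (cchart q q, r)).1 := by
      filter_upwards [h2, self_mem_nhdsWithin] with r hr hrm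
      obtain ⟨hr1, hr2⟩ := hr
      rw [flowParam_center] at hr2
      rw [hinj r hrm ((cchart (Z s).1).symm (y (cchart q q, r)).1, (y (cchart q q, r)).2)
        ⟨hr1.1.2, hr1.2⟩ hr2.symm]
      exact ⟨(cchart (Z s).1).map_target hr1.1.1, (cchart (Z s).1).right_inv hr1.1.1⟩
    refine ⟨h3.mono fun r hr => hr.1, ?_⟩
    have h4 : HasDerivWithinAt (fun r => (y (cchart q q, r)).1) 0 (Icc 0 1) s := by
      have h5 := (ContinuousLinearMap.fst ℝ (Phase d) ℝ).hasFDerivAt.comp_hasDerivWithinAt s h1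
      exact h5.congr_deriv hD0
    exact h4.congr_of_eventuallyEq (h3.mono fun r hr => hr.2) (h3.self_of_nhdsWithin hs).2
  have h01 : (0 : ℝ) ∈ Icc (0 : ℝ) 1 := ⟨le_rfl, zero_le_one⟩
  have hconst : (Z 0).1 = (Z s).1 := constant_of_derivWithin_zero (Q := fun s => (Z s).1)
    (fun s hs => (hloc s hs).1) (fun s hs => (hloc s hs).2) h01 hs
  have hZ0 : Z 0 = (q, 0) := hinj 0 h01 (q, 0) ⟨hq, h01⟩
    (by rw [S.flowBox_zero hq, S'.flowBox_zero hq, h0])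
  rw [hZ0] at hconst
  refine ⟨(Z s).2, (hZ s hs).1.2, (hZ s hs).2.trans ?_⟩
  rw [show Z s = (q, (Z s).2) from Prod.ext hconst.symm rfl]

/-- The image lies over U and restricts to q, and within Γ'_U only `ζ' q` does so. -/
theorem kappa_zeta (S : IsScattering ι U V 𝒰 H ζ) (S' : IsScattering ι' U V 𝒰 H' ζ')
    (hB : BoundaryConditions ι ι' U V (Gamma H 𝒰 ζ) (Gamma H' 𝒰 ζ') κ) {q : Cotangent (𝓡 d) B}
    (hq : q ∈ 𝒰) : κ (ζ q) = ζ' q := by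
  have h1 : ζ q ∈ partOver ι U (Gamma H 𝒰 ζ) := by
    rw [S.partOver_U]
    exact mem_image_of_mem _ hq
  have h2 : κ (ζ q) ∈ partOver ι' U (Gamma H' 𝒰 ζ') := by
    rw [← hB.image_U]
    exact mem_image_of_mem _ h1
  exact S'.unique_zeta _ h2 q hq
    ((hB.restriction _ (Or.inl h1) q).1 (S.restriction_zeta q hq))

theorem scatters_iff (S : IsScattering ι U V 𝒰 H ζ) {q q' : Cotangent (𝓡 d) B} (hq : q ∈ 𝒰) :
    Scatters ι V H ζ q q' ↔ q'.proj ∈ V ∧ IsRestriction ι (flowBox ι V H ζ (q, 1)) q' := by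
  rw [flowBox_one]
  constructor
  · rintro ⟨p, ⟨γ, hγ, h0, h1⟩, hV, hr⟩
    change IsIntegralCurve (IsHamVec H) γ (uIcc 0 (hitTime ι V H ζ q)) at hγ
    rw [uIcc_of_le (S.hitTime_pos hq).le] at hγ
    refine ⟨hV, ?_⟩
    rw [← S.curve_eqOn hq hγ h0 (S.hitTime_mem hq)]
    change IsRestriction ι (γ (exitTime (IsHamVec H) (ι '' V) (ζ q))) q'
    rwa [h1]
  · rintro ⟨hV, hr⟩
    refine ⟨_, ⟨bichar ι V H ζ q, ?_, (S.bichar_curve hq).2, rfl⟩, hV, hr⟩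
    change IsIntegralCurve (IsHamVec H) _ (uIcc 0 (hitTime ι V H ζ q))
    rw [uIcc_of_le (S.hitTime_pos hq).le]
    exact (S.bichar_curve hq).1

/-- A symplectic diffeomorphism that satisfies the boundary conditions preserves the scattering
relation. -/
theorem sameScattering_of_kappa [T2Space M'] (S : IsScattering ι U V 𝒰 H ζ)
    (S' : IsScattering ι' U V 𝒰 H' ζ')
    (hκ : IsHomDiffeo (Gamma H 𝒰 ζ) (Gamma H' 𝒰 ζ') κ) (hP : PreservesSymp H (Gamma H 𝒰 ζ) κ)
    (hB : BoundaryConditions ι ι' U V (Gamma H 𝒰 ζ) (Gamma H' 𝒰 ζ') κ) :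
    SameScattering ι ι' V 𝒰 H H' ζ ζ' := by
  intro q hq q'
  have h1 : (1 : ℝ) ∈ Icc (0 : ℝ) 1 := ⟨zero_le_one, le_rfl⟩
  have hmem : flowBox ι V H ζ (q, 1) ∈ partOver ι V (Gamma H 𝒰 ζ) := by
    rw [S.partOver_V, flowBox_one]
    exact ⟨q, hq, rfl⟩
  have hmem' : κ (flowBox ι V H ζ (q, 1)) ∈ partOver ι' V (Gamma H' 𝒰 ζ') := by
    rw [← hB.image_V]
    exact mem_image_of_mem _ hmem
  obtain ⟨s', hs', hk⟩ := exists_flowBox_eq S S' hκ.smooth hκ.bijOn.mapsTo hP hq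
    (kappa_zeta S S' hB hq) h1
  -- The image of the exit point lies over V, hence is the end of some bicharacteristic; as it also
  -- lies on the one of q, injectivity of the parametrization gives s' = 1.
  rw [S'.partOver_V] at hmem'
  obtain ⟨q'', hq'', he⟩ := hmem'
  have he' : flowBox ι' V H' ζ' (q'', 1) = κ (flowBox ι V H ζ (q, 1)) := by
    rw [flowBox_one]
    exact he
  rw [hk] at he'
  have h2 := S'.flowBox_bijOn.injOn ⟨hq'', h1⟩ ⟨hq, hs'⟩ he'
  have h3 : s' = 1 := (congrArg Prod.snd h2).symm
  rw [h3] at hk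
  rw [scatters_iff S hq, scatters_iff S' hq, hB.restriction _ (Or.inr hmem) q', hk]

end Kappa
end
end ZeroEnergy

namespace ZeroEnergy
noncomputable section

/-! ### Changes of time and their smooth dependence on parameters -/

/-- A positive continuous function on `[0, b]` defines a change of variable `A = ∫ φ` with inverse
`B`. -/
theorem exists_reparam {φ : ℝ → ℝ} {b : ℝ} (hb : 0 ≤ b) (hφ : ContinuousOn φ (Icc 0 b))
    (hpos : ∀ t ∈ Icc 0 b, 0 < φ t) :
    ∃ A B : ℝ → ℝ, (∀ t ∈ Icc 0 b, A t = ∫ r in (0 : ℝ)..t, φ r) ∧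
      MapsTo A (Icc 0 b) (Icc 0 (A b)) ∧ MapsTo B (Icc 0 (A b)) (Icc 0 b) ∧
      (∀ t, B (A t) = t) ∧ (∀ u, A (B u) = u) ∧ A 0 = 0 ∧ B 0 = 0 ∧
      (∀ t ∈ Icc 0 b, HasDerivAt A (φ t) t) ∧
      ∀ u ∈ Icc 0 (A b), HasDerivAt B (φ (B u))⁻¹ u := by
  -- The constant extension is bounded below by the minimum of φ, so its primitive is a bijection of
  -- the whole line.
  set ψ : ℝ → ℝ := IccExtend hb (fun x => φ x) with hψ
  have hψe : ∀ t ∈ Icc 0 b, ψ t = φ t := fun t ht => IccExtend_of_mem hb (fun x => φ x) ht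
  have hψc : Continuous ψ := (continuousOn_iff_continuous_domRestrict.1 hφ).Icc_extend'
  obtain ⟨m, hm, hmin⟩ := isCompact_Icc.exists_isMinOn (nonempty_Icc.2 hb) hφ
  have hψm : ∀ t, φ m ≤ ψ t := fun t => hmin (projIcc 0 b hb t).2
  have hcpos : 0 < φ m := hpos m hm
  have hψpos : ∀ t, 0 < ψ t := fun t => hcpos.trans_le (hψm t)
  set A : ℝ → ℝ := fun t => ∫ r in (0 : ℝ)..t, ψ r with hA
  have hAd : ∀ t, HasDerivAt A (ψ t) t := fun t => hψc.integral_hasStrictDerivAt 0 t |>.hasDerivAt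
  have hA0 : A 0 = 0 := intervalIntegral.integral_same
  have hmono : StrictMono A := strictMono_of_deriv_pos fun t => by
    rw [(hAd t).deriv]
    exact hψpos t
  have hAc : Continuous A := continuous_iff_continuousAt.2 fun t => (hAd t).continuousAt
  have hlin : Monotone fun t => A t - φ m * t := by
    refine monotone_of_hasDerivAt_nonneg (f' := fun t => ψ t - φ m) (fun t => ?_) fun t =>
      sub_nonneg.2 (hψm t)
    exact ((hAd t).sub ((hasDerivAt_id t).const_mul (φ m))).congr_deriv (by rw [mul_one])
  have hsurj : Function.Surjective A := by
    refine hAc.surjective ?_ ?_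
    · refine tendsto_atTop_mono' _ ?_ (tendsto_id.const_mul_atTop hcpos)
      filter_upwards [eventually_ge_atTop 0] with t ht
      have := hlin ht
      simp only [hA0] at this
      simp only [id]
      linarith
    · refine tendsto_atBot_mono' _ ?_ (tendsto_id.const_mul_atBot hcpos)
      filter_upwards [eventually_le_atBot 0] with t ht
      have := hlin ht
      simp only [hA0] at this
      simp only [id]
      linarith
  set e := hmono.orderIsoOfSurjective A hsurj with he
  have hBA : ∀ t, e.symm (A t) = t := fun t => e.symm_apply_apply t
  have hAB : ∀ u, A (e.symm u) = u := fun u => e.apply_symm_apply u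
  have hB0 : e.symm 0 = 0 := by rw [← hA0, hBA, hA0]
  have hBmaps : MapsTo e.symm (Icc 0 (A b)) (Icc 0 b) := fun u hu =>
    ⟨hB0 ▸ e.symm.monotone hu.1, (e.symm.monotone hu.2).trans_eq (hBA b)⟩
  refine ⟨A, e.symm, fun t ht => ?_, fun t ht => ⟨hA0 ▸ hmono.monotone ht.1, hmono.monotone ht.2⟩,
    hBmaps, hBA, hAB, hA0, hB0, fun t ht => hψe t ht ▸ hAd t, fun u hu => ?_⟩
  · refine intervalIntegral.integral_congr fun r hr => hψe r ?_
    rw [uIcc_of_le ht.1] at hr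
    exact ⟨hr.1, hr.2.trans ht.2⟩
  · have h1 := hψe _ (hBmaps hu)
    rw [← h1]
    exact (hAd (e.symm u)).of_local_left_inverse e.symm.continuous.continuousAt
      (hψpos _).ne' (Eventually.of_forall hAB)

section Primitive
variable {P : Type} [NormedAddCommGroup P] [NormedSpace ℝ P]
  {N : Set P} {F : P × ℝ → ℝ}

theorem closedBall_box_nonempty {P : Type} [PseudoMetricSpace P] (z : P) {ε : ℝ} (hε : 0 < ε) :
    (interior (Metric.closedBall z ε ×ˢ Icc (0 : ℝ) 1)).Nonempty := by
  rw [interior_prod_eq, interior_Icc]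
  exact ⟨(z, 2⁻¹), Metric.ball_subset_interior_closedBall (Metric.mem_ball_self hε),
    by norm_num, by norm_num⟩

variable [FiniteDimensional ℝ P]

/-- Primitives of smooth functions are smooth in the parameters. -/
theorem contDiffOn_primitive (hN : IsOpen N) (hF : ContDiffOn ℝ ∞ F (N ×ˢ Icc (0 : ℝ) 1)) {A : P × ℝ → ℝ}
    (hA0 : ∀ z ∈ N, A (z, 0) = 0)
    (hA : ∀ z ∈ N, ∀ s ∈ Icc (0 : ℝ) 1,
      HasDerivWithinAt (fun s => A (z, s)) (F (z, s)) (Icc 0 1) s) :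
    ContDiffOn ℝ ∞ A (N ×ˢ Icc (0 : ℝ) 1) := by
  rintro ⟨z₀, s₀⟩ ⟨hz₀, hs₀⟩
  obtain ⟨ε, hε, hεN⟩ := Metric.nhds_basis_closedBall.mem_iff.1 (hN.mem_nhds hz₀)
  have hsub : Metric.closedBall z₀ ε ×ˢ Icc (0 : ℝ) 1 ⊆ N ×ˢ Icc (0 : ℝ) 1 :=
    prod_mono hεN subset_rfl
  have hcpt : IsCompact (Metric.closedBall z₀ ε ×ˢ Icc (0 : ℝ) 1) :=
    (isCompact_closedBall z₀ ε).prod isCompact_Icc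
  obtain ⟨C, hC⟩ := hcpt.exists_bound_of_continuousOn (hF.continuousOn.mono hsub)
  set c := max C 1 with hc
  have hc1 : 0 < c := lt_of_lt_of_le one_pos (le_max_right _ _)
  have hAb : ∀ z ∈ Metric.closedBall z₀ ε, ∀ s ∈ Icc (0 : ℝ) 1, A (z, s) ∈ Icc (-c) c := by
    intro z hz s hs
    have h := Convex.norm_image_sub_le_of_norm_hasDerivWithin_le (C := c)
      (fun s hs => hA z (hεN hz) s hs)
      (fun s hs => (hC _ ⟨hz, hs⟩).trans (le_max_left _ _)) (convex_Icc 0 1)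
      (left_mem_Icc.2 zero_le_one) hs
    rw [hA0 z (hεN hz), sub_zero, sub_zero, Real.norm_of_nonneg hs.1] at h
    have h' : |A (z, s)| ≤ c := h.trans (mul_le_of_le_one_right hc1.le hs.2)
    exact abs_le.1 h'
  -- The primitive is a component of the autonomous system z' = 0, s' = 1, A' = F(z, s); the bound c
  -- confines it to a compact box.
  have hflow := contDiffOn_flow_infty (P := P) (E := (P × ℝ) × ℝ) (Q := Metric.ball z₀ ε)
    Metric.isOpen_ball (α := 0) (β := 1) zero_le_one
    (K := (Metric.closedBall z₀ ε ×ˢ Icc (0 : ℝ) 1) ×ˢ Icc (-c) c)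
    (hcpt.prod isCompact_Icc)
    (((convex_closedBall z₀ ε).prod (convex_Icc 0 1)).prod (convex_Icc _ _))
    (by
      rw [interior_prod_eq, interior_Icc]
      exact (closedBall_box_nonempty z₀ hε).prod ⟨0, by linarith, hc1⟩)
    (Y := fun x => ((0, 1), F x.1))
    (contDiffOn_const.prodMk ((hF.mono hsub).comp contDiffOn_fst fun x hx => hx.1))
    (G := fun z s => ((z, s), A (z, s)))
    (fun z hz => ⟨fun s hs => ⟨⟨Metric.ball_subset_closedBall hz, hs⟩,
      hAb z (Metric.ball_subset_closedBall hz) s hs⟩, fun s hs =>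
      ((hasDerivWithinAt_const s _ z).prodMk (hasDerivWithinAt_id s _)).prodMk
        (hA z (hεN (Metric.ball_subset_closedBall hz)) s hs)⟩)
    ((contDiffOn_id.prodMk contDiffOn_const).prodMk ((contDiffOn_const (c := (0 : ℝ))).congr
      fun z hz => hA0 z (hεN (Metric.ball_subset_closedBall hz))))
  have h1 : ContDiffWithinAt ℝ ∞ A (Metric.ball z₀ ε ×ˢ Icc (0 : ℝ) 1) (z₀, s₀) :=
    (hflow _ ⟨Metric.mem_ball_self hε, hs₀⟩).snd
  refine h1.mono_of_mem_nhdsWithin ?_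
  rw [nhdsWithin_prod_eq]
  exact prod_mem_prod (mem_nhdsWithin_of_mem_nhds (Metric.ball_mem_nhds z₀ hε)) self_mem_nhdsWithin

/-- Flows of positive smooth vector fields on `[0, 1]` are smooth in the parameters. -/
theorem contDiffOn_scalar_flow (hN : IsOpen N) (hF : ContDiffOn ℝ ∞ F (N ×ˢ Icc (0 : ℝ) 1)) {A : P × ℝ → ℝ}
    (hA0 : ∀ z ∈ N, A (z, 0) = 0)
    (hAm : ∀ z ∈ N, ∀ s ∈ Icc (0 : ℝ) 1, A (z, s) ∈ Icc (0 : ℝ) 1)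
    (hA : ∀ z ∈ N, ∀ s ∈ Icc (0 : ℝ) 1,
      HasDerivWithinAt (fun s => A (z, s)) (F (z, A (z, s))) (Icc 0 1) s) :
    ContDiffOn ℝ ∞ A (N ×ˢ Icc (0 : ℝ) 1) := by
  rintro ⟨z₀, s₀⟩ ⟨hz₀, hs₀⟩
  obtain ⟨ε, hε, hεN⟩ := Metric.nhds_basis_closedBall.mem_iff.1 (hN.mem_nhds hz₀)
  have hsub : Metric.closedBall z₀ ε ×ˢ Icc (0 : ℝ) 1 ⊆ N ×ˢ Icc (0 : ℝ) 1 :=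
    prod_mono hεN subset_rfl
  have hflow := contDiffOn_flow_infty (P := P) (E := P × ℝ) (Q := Metric.ball z₀ ε)
    Metric.isOpen_ball (α := 0) (β := 1) zero_le_one
    (K := Metric.closedBall z₀ ε ×ˢ Icc (0 : ℝ) 1)
    ((isCompact_closedBall z₀ ε).prod isCompact_Icc)
    ((convex_closedBall z₀ ε).prod (convex_Icc 0 1))
    (closedBall_box_nonempty z₀ hε)
    (Y := fun x => (0, F x))
    (contDiffOn_const.prodMk (hF.mono hsub))
    (G := fun z s => (z, A (z, s)))
    (fun z hz => ⟨fun s hs => ⟨Metric.ball_subset_closedBall hz,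
      hAm z (hεN (Metric.ball_subset_closedBall hz)) s hs⟩, fun s hs =>
      (hasDerivWithinAt_const s _ z).prodMk
        (hA z (hεN (Metric.ball_subset_closedBall hz)) s hs)⟩)
    (contDiffOn_id.prodMk ((contDiffOn_const (c := (0 : ℝ))).congr
      fun z hz => hA0 z (hεN (Metric.ball_subset_closedBall hz))))
  have h1 : ContDiffWithinAt ℝ ∞ A (Metric.ball z₀ ε ×ˢ Icc (0 : ℝ) 1) (z₀, s₀) :=
    (hflow _ ⟨Metric.mem_ball_self hε, hs₀⟩).snd
  refine h1.mono_of_mem_nhdsWithin ?_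
  rw [nhdsWithin_prod_eq]
  exact prod_mem_prod (mem_nhdsWithin_of_mem_nhds (Metric.ball_mem_nhds z₀ hε)) self_mem_nhdsWithin

end Primitive
end
end ZeroEnergy

namespace ZeroEnergy
noncomputable section

/-! ### The flow of μH as a reparametrization of the flow of H -/

section Multiplier
variable {E : Type*} [NormedAddCommGroup E] [NormedSpace ℝ E] {A : Type*}
  [TopologicalSpace A] {I : ModelWithCorners ℝ E A} {M : Type*} [TopologicalSpace M]
  [ChartedSpace A M] [IsManifold I ∞ M] {Γ : Set (Cotangent I M)} {μ H : Cotangent I M → ℝ}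
  {p : Cotangent I M}

/-- The function `μ` on `Γ` extends smoothly to a neighbourhood of `p`. -/
def HasSmoothExtension (Γ : Set (Cotangent I M)) (μ : Cotangent I M → ℝ) (p : Cotangent I M) :
    Prop :=
  ∃ μe : Cotangent I M → ℝ, ContMDiffAt (cotModel I) 𝓘(ℝ, ℝ) ∞ μe p ∧
    ∀ᶠ p' in 𝓝[Γ] p, μe p' = μ p'

/-- The term H df drops out where H = 0, so the choice of extension of μ does not matter. -/
theorem dFun_mul {f : Cotangent I M → ℝ} (hf : ContMDiffAt (cotModel I) 𝓘(ℝ, ℝ) ∞ f p)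
    (hH : IsHamiltonian H) (hp : p.snd ≠ 0) (h0 : H p = 0) (w : TangentSpace (cotModel I) p) :
    dFun (fun p' => f p' * H p') p w = f p * dFun H p w := by
  have h1 := (hf.mdifferentiableAt (by simp)).hasMFDerivAt.mul
    (hH.mdifferentiableAt hp).hasMFDerivAt
  have h2 := congrArg (fun L => L w) h1.mfderiv
  refine h2.trans ?_
  change f p * dFun H p w + H p * dFun f p w = f p * dFun H p w
  rw [h0, zero_mul, add_zero]

theorem sympE_smul_right (c : ℝ) (v w : E × (E →L[ℝ] ℝ)) : sympE v (c • w) = c * sympE v w := by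
  simp [sympE, mul_sub]

theorem IsHamVec.mul {X : TangentSpace (cotModel I) p} (hX : IsHamVec H p X)
    (hH : IsHamiltonian H) (hp : p ∈ Γ) (h0 : H p = 0) (hμ : HasSmoothExtension Γ μ p) :
    IsHamVecMul Γ μ H p (μ p • X) := by
  obtain ⟨f, hf, hfe⟩ := hμ
  refine ⟨hp, f, hf, hfe, hX.1, fun w => ?_⟩
  rw [dFun_mul hf hH hX.1 h0, hfe.self_of_nhdsWithin hp, ← hX.2 w]
  exact sympE_smul_right (μ p) w X

theorem IsHamVecMul.isHamVec {Y : TangentSpace (cotModel I) p} (hY : IsHamVecMul Γ μ H p Y)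
    (hH : IsHamiltonian H) (h0 : H p = 0) (hμ : μ p ≠ 0) : IsHamVec H p ((μ p)⁻¹ • Y) := by
  obtain ⟨hp, f, hf, hfe, hne, hY⟩ := hY
  refine ⟨hne, fun w => ?_⟩
  have h1 := hY w
  rw [dFun_mul hf hH hne h0, hfe.self_of_nhdsWithin hp] at h1
  have h2 : symp p w ((μ p)⁻¹ • Y) = (μ p)⁻¹ * symp p w Y := sympE_smul_right (μ p)⁻¹ w Y
  rw [h2, h1, inv_mul_cancel_left₀ hμ]

end Multiplier

section Travel
variable {d : ℕ}
  {B : Type*} [TopologicalSpace B] [ChartedSpace (EuclideanSpace ℝ (Fin d)) B]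
  [IsManifold (𝓡 d) ∞ B]
  {M : Type*} [TopologicalSpace M] [ChartedSpace (EuclideanHalfSpace (d + 1)) M]
  [IsManifold (𝓡∂ (d + 1)) ∞ M]
  {ι : B → M} {U V : Set B} {𝒰 : Set (Cotangent (𝓡 d) B)}
  {H μ : Cotangent (𝓡∂ (d + 1)) M → ℝ} {ζ : Cotangent (𝓡 d) B → Cotangent (𝓡∂ (d + 1)) M}
  {q : Cotangent (𝓡 d) B} {t : ℝ}

/-- The time that the flow of `μ H` needs to reach the point `bichar q a` from `ζ q`. -/
def travelTime (ι : B → M) (V : Set B) (H : Cotangent (𝓡∂ (d + 1)) M → ℝ)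
    (ζ : Cotangent (𝓡 d) B → Cotangent (𝓡∂ (d + 1)) M) (μ : Cotangent (𝓡∂ (d + 1)) M → ℝ)
    (q : Cotangent (𝓡 d) B) (a : ℝ) : ℝ :=
  ∫ r in (0 : ℝ)..a, (μ (bichar ι V H ζ q r))⁻¹

/-- `D` maps the time of the flow of `μ H`, issued from `ζ q`, to the time of the flow of `H`. -/
structure IsClock (ι : B → M) (V : Set B) (𝒰 : Set (Cotangent (𝓡 d) B))
    (H : Cotangent (𝓡∂ (d + 1)) M → ℝ) (ζ : Cotangent (𝓡 d) B → Cotangent (𝓡∂ (d + 1)) M)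
    (μ : Cotangent (𝓡∂ (d + 1)) M → ℝ) (q : Cotangent (𝓡 d) B) (L : ℝ) (D : ℝ → ℝ) : Prop where
  curve : IsIntegralCurve (IsHamVecMul (Gamma H 𝒰 ζ) μ H) (fun τ => bichar ι V H ζ q (D τ))
    (Icc 0 L)
  map_zero : D 0 = 0
  travel_mem : MapsTo (travelTime ι V H ζ μ q) (Icc 0 (hitTime ι V H ζ q)) (Icc 0 L)
  left_inv : ∀ a ∈ Icc 0 (hitTime ι V H ζ q), D (travelTime ι V H ζ μ q a) = a
  mem : MapsTo D (Icc 0 L) (Icc 0 (hitTime ι V H ζ q))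
  right_inv : ∀ τ ∈ Icc 0 L, travelTime ι V H ζ μ q (D τ) = τ
  hasDerivWithinAt_travel : ∀ a ∈ Icc 0 (hitTime ι V H ζ q),
    HasDerivWithinAt (travelTime ι V H ζ μ q) (μ (bichar ι V H ζ q a))⁻¹
      (Icc 0 (hitTime ι V H ζ q)) a
  hasDerivWithinAt : ∀ τ ∈ Icc 0 L,
    HasDerivWithinAt D (μ (bichar ι V H ζ q (D τ))) (Icc 0 L) τ

namespace IsScattering
variable (S : IsScattering ι U V 𝒰 H ζ) [T2Space M]
include S

theorem continuousOn_comp_bichar (hμ : ContinuousOn μ (Gamma H 𝒰 ζ)) (hq : q ∈ 𝒰) :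
    ContinuousOn (fun r => μ (bichar ι V H ζ q r)) (Icc 0 (hitTime ι V H ζ q)) := by
  have h1 := (S.bichar_curve hq).1.continuousOn
  have h2 := ContinuousOn.comp hμ h1 fun r hr => S.bichar_mem hq hr
  exact h2

/-- The integral curves of `μ H` are reparametrized bicharacteristics. -/
theorem curve_mul_eq (hμ : ContinuousOn μ (Gamma H 𝒰 ζ)) (hpos : ∀ p ∈ Gamma H 𝒰 ζ, 0 < μ p)
    (hq : q ∈ 𝒰) {γ : ℝ → Cotangent (𝓡∂ (d + 1)) M} (ht : 0 ≤ t)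
    (h : IsIntegralCurve (IsHamVecMul (Gamma H 𝒰 ζ) μ H) γ (Icc 0 t)) (h0 : γ 0 = ζ q) :
    ∃ b ∈ Icc 0 (hitTime ι V H ζ q), γ t = bichar ι V H ζ q b ∧ travelTime ι V H ζ μ q b = t ∧
      ∀ a ∈ Icc 0 b, HasSmoothExtension (Gamma H 𝒰 ζ) μ (bichar ι V H ζ q a) := by
  have hmem : ∀ τ ∈ Icc 0 t, γ τ ∈ Gamma H 𝒰 ζ := fun τ hτ => by
    obtain ⟨X, hX, -⟩ := h τ hτ
    exact hX.1
  have hc : ContinuousOn (fun τ => μ (γ τ)) (Icc 0 t) := by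
    have h1 := ContinuousOn.comp hμ h.continuousOn hmem
    exact h1
  -- A = ∫ μ(γ) is the time of H as a function of the time of μH; γ composed with its inverse D is a
  -- bicharacteristic of H, and D' = μ⁻¹ makes D the travel time.
  obtain ⟨A, D, -, hAm, hDm, hDA, hAD, hA0, hD0, -, hDd⟩ := exists_reparam ht hc
    fun τ hτ => hpos _ (hmem τ hτ)
  have h1 : IsIntegralCurve (IsHamVec H) (fun u => γ (D u)) (Icc 0 (A t)) :=
    h.reparam (fun u hu => (hDd u hu).hasDerivWithinAt) hDm fun u hu X hX =>
      hX.isHamVec S.ham (S.energy_eq_zero hX.1) (hpos _ hX.1).ne'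
  have h2 : γ (D 0) = ζ q := by rw [hD0, h0]
  have h3 : ∀ u ∈ Icc 0 (A t), γ (D u) = bichar ι V H ζ q u := S.curve_eqOn hq h1 h2
  have hAt : A t ∈ Icc 0 (hitTime ι V H ζ q) :=
    ⟨(hAm (right_mem_Icc.2 ht)).1, S.curve_le hq h1 h2⟩
  refine ⟨A t, hAt, ?_, ?_, fun a ha => ?_⟩
  · rw [← h3 _ (right_mem_Icc.2 hAt.1), hDA]
  · rw [travelTime, intervalIntegral.integral_eq_sub_of_hasDerivAt (f := D), hDA, hD0, sub_zero]
    · intro u hu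
      rw [uIcc_of_le hAt.1] at hu
      rw [← h3 _ hu]
      exact hDd u hu
    · refine ContinuousOn.intervalIntegrable ?_
      rw [uIcc_of_le hAt.1]
      exact ((S.continuousOn_comp_bichar hμ hq).mono (Icc_subset_Icc_right hAt.2)).inv₀ fun r hr =>
        (hpos _ (S.bichar_mem hq ⟨hr.1, hr.2.trans hAt.2⟩)).ne'
  · obtain ⟨X, ⟨-, f, hf, hfe, -⟩, -⟩ := h (D a) (hDm ha)
    rw [← h3 _ ha]
    exact ⟨f, hf, hfe⟩

/-- The flow of `μ H` along a bicharacteristic. -/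
theorem exists_isClock (hμ : ContinuousOn μ (Gamma H 𝒰 ζ)) (hpos : ∀ p ∈ Gamma H 𝒰 ζ, 0 < μ p)
    (hq : q ∈ 𝒰) (hext : ∀ a ∈ Icc 0 (hitTime ι V H ζ q),
      HasSmoothExtension (Gamma H 𝒰 ζ) μ (bichar ι V H ζ q a)) :
    ∃ D : ℝ → ℝ, IsClock ι V 𝒰 H ζ μ q (travelTime ι V H ζ μ q (hitTime ι V H ζ q)) D := by
  have hposb : ∀ a ∈ Icc 0 (hitTime ι V H ζ q), 0 < μ (bichar ι V H ζ q a) := fun a ha =>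
    hpos _ (S.bichar_mem hq ha)
  obtain ⟨A, D, hA, hAm, hDm, hDA, hAD, hA0, hD0, hAd, hDd⟩ := exists_reparam
    (φ := fun r => (μ (bichar ι V H ζ q r))⁻¹) (S.hitTime_pos hq).le
    ((S.continuousOn_comp_bichar hμ hq).inv₀ fun a ha => (hposb a ha).ne')
    fun a ha => inv_pos.2 (hposb a ha)
  have hA' : ∀ a ∈ Icc 0 (hitTime ι V H ζ q), travelTime ι V H ζ μ q a = A a := fun a ha =>
    (hA a ha).symm
  have hDd' : ∀ τ ∈ Icc 0 (A (hitTime ι V H ζ q)),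
      HasDerivWithinAt D (μ (bichar ι V H ζ q (D τ))) (Icc 0 (A (hitTime ι V H ζ q))) τ :=
    fun τ hτ => (hDd τ hτ).hasDerivWithinAt.congr_deriv (inv_inv _)
  rw [hA' _ (S.hitTime_mem hq)]
  refine ⟨D, ?_, hD0, fun a ha => ?_, fun a ha => ?_, hDm, fun τ hτ => ?_, fun a ha => ?_, hDd'⟩
  · refine (S.bichar_curve hq).1.reparam hDd' hDm fun τ hτ X hX => ?_
    have hm := S.bichar_mem hq (hDm hτ)
    exact hX.mul S.ham hm (S.energy_eq_zero hm) (hext _ (hDm hτ))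
  · rw [hA' a ha]
    exact hAm ha
  · rw [hA' a ha, hDA]
  · rw [hA' _ (hDm hτ), hAD]
  · exact (hAd a ha).hasDerivWithinAt.congr hA' (hA' a ha)

/-- A bicharacteristic is over V only at its end, so a curve of μH that reaches V has run through
all of it, and μ extends smoothly at each of its points. -/
theorem curve_mul_exit (hμ : ContinuousOn μ (Gamma H 𝒰 ζ)) (hpos : ∀ p ∈ Gamma H 𝒰 ζ, 0 < μ p)
    (hq : q ∈ 𝒰) {p' : Cotangent (𝓡∂ (d + 1)) M} (ht : 0 ≤ t)
    (h : FlowsTo (IsHamVecMul (Gamma H 𝒰 ζ) μ H) t (ζ q) p') (hV : p'.proj ∈ ι '' V) :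
    travelTime ι V H ζ μ q (hitTime ι V H ζ q) = t ∧ ∀ a ∈ Icc 0 (hitTime ι V H ζ q),
      HasSmoothExtension (Gamma H 𝒰 ζ) μ (bichar ι V H ζ q a) := by
  obtain ⟨γ, hγ, h0, rfl⟩ := h
  rw [uIcc_of_le ht] at hγ
  obtain ⟨b, hb, hγb, hbt, hext⟩ := S.curve_mul_eq hμ hpos hq ht hγ h0
  rcases hb.2.eq_or_lt with rfl | hlt
  · exact ⟨hbt, hext⟩
  · rw [hγb] at hV
    exact absurd hV (S.notMem_V hq ⟨hb.1, hlt⟩)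

theorem exitTime_mul (hμ : ContinuousOn μ (Gamma H 𝒰 ζ)) (hpos : ∀ p ∈ Gamma H 𝒰 ζ, 0 < μ p)
    (hq : q ∈ 𝒰) (hext : ∀ a ∈ Icc 0 (hitTime ι V H ζ q),
      HasSmoothExtension (Gamma H 𝒰 ζ) μ (bichar ι V H ζ q a)) :
    exitTime (IsHamVecMul (Gamma H 𝒰 ζ) μ H) (ι '' V) (ζ q) =
      travelTime ι V H ζ μ q (hitTime ι V H ζ q) := by
  obtain ⟨D, hD⟩ := S.exists_isClock hμ hpos hq hext
  have h1 := hD.travel_mem (S.hitTime_mem hq)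
  have h2 := flowsTo_of_curve hD.curve (left_mem_Icc.2 h1.1) h1
  simp only [sub_zero, hD.left_inv _ (S.hitTime_mem hq), hD.map_zero,
    (S.bichar_curve hq).2] at h2
  have h3 := (S.exit_spec hq).1
  refine le_antisymm (exitTime_le h1.1 h2 h3) (le_csInf ⟨_, h1.1, _, h2, h3⟩ ?_)
  rintro t ⟨ht, p', hp', hV⟩
  exact (S.curve_mul_exit hμ hpos hq ht hp' hV).1.le

/-- The infimum of the empty set is 0, so a nonzero exit time certifies that some integral curve of
μH reaches V; the definition of its velocities contains the extensions of μ. -/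
theorem hasSmoothExtension_of_exitTime (hμ : ContinuousOn μ (Gamma H 𝒰 ζ))
    (hpos : ∀ p ∈ Gamma H 𝒰 ζ, 0 < μ p) (hq : q ∈ 𝒰)
    (h : exitTime (IsHamVecMul (Gamma H 𝒰 ζ) μ H) (ι '' V) (ζ q) ≠ 0) :
    ∀ a ∈ Icc 0 (hitTime ι V H ζ q),
      HasSmoothExtension (Gamma H 𝒰 ζ) μ (bichar ι V H ζ q a) := by
  rcases Set.eq_empty_or_nonempty {t : ℝ | 0 ≤ t ∧ ∃ p',
    FlowsTo (IsHamVecMul (Gamma H 𝒰 ζ) μ H) t (ζ q) p' ∧ p'.proj ∈ ι '' V} with he | ⟨t, ht, p', h1, h2⟩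
  · refine absurd ?_ h
    rw [exitTime, he, Real.sInf_empty]
  · exact (S.curve_mul_exit hμ hpos hq ht h1 h2).2

end IsScattering

end Travel
end
end ZeroEnergy

namespace ZeroEnergy
noncomputable section

/-! ### Existence and comparison of admissible multipliers -/

section Admissible
variable {d : ℕ}
  {B : Type*} [TopologicalSpace B] [ChartedSpace (EuclideanSpace ℝ (Fin d)) B]
  [IsManifold (𝓡 d) ∞ B]
  {M : Type*} [TopologicalSpace M] [ChartedSpace (EuclideanHalfSpace (d + 1)) M]
  [IsManifold (𝓡∂ (d + 1)) ∞ M]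
  {M' : Type*} [TopologicalSpace M'] [ChartedSpace (EuclideanHalfSpace (d + 1)) M']
  [IsManifold (𝓡∂ (d + 1)) ∞ M']
  {ι : B → M} {ι' : B → M'} {U V : Set B} {𝒰 : Set (Cotangent (𝓡 d) B)}
  {H : Cotangent (𝓡∂ (d + 1)) M → ℝ} {ζ : Cotangent (𝓡 d) B → Cotangent (𝓡∂ (d + 1)) M}
  {H' : Cotangent (𝓡∂ (d + 1)) M' → ℝ} {ζ' : Cotangent (𝓡 d) B → Cotangent (𝓡∂ (d + 1)) M'}
  {μ : Cotangent (𝓡∂ (d + 1)) M → ℝ} {q : Cotangent (𝓡 d) B}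

theorem HasSmoothExtension.contMDiffWithinAt {Γ : Set (Cotangent (𝓡∂ (d + 1)) M)}
    {p : Cotangent (𝓡∂ (d + 1)) M} (h : HasSmoothExtension Γ μ p) (hp : p ∈ Γ) :
    ContMDiffWithinAt (cotModel (𝓡∂ (d + 1))) 𝓘(ℝ, ℝ) ∞ μ Γ p := by
  obtain ⟨f, hf, hfe⟩ := h
  exact hf.contMDiffWithinAt.congr_of_eventuallyEq (hfe.mono fun p' hp' => hp'.symm)
    (hfe.self_of_nhdsWithin hp).symm

theorem IsScattering.flowBox_div (S : IsScattering ι U V 𝒰 H ζ) (hq : q ∈ 𝒰) (a : ℝ) :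
    flowBox ι V H ζ (q, a / hitTime ι V H ζ q) = bichar ι V H ζ q a := by
  rw [flowBox, div_mul_cancel₀ _ (S.hitTime_pos hq).ne']

variable [T2Space M]

/-- A function with prescribed values along the bicharacteristics. -/
theorem IsScattering.exists_map_flowBox {X : Type*} (S : IsScattering ι U V 𝒰 H ζ)
    (f : Cotangent (𝓡 d) B × ℝ → X) : ∃ κ : Cotangent (𝓡∂ (d + 1)) M → X,
      ∀ q ∈ 𝒰, ∀ s ∈ Icc (0 : ℝ) 1, κ (flowBox ι V H ζ (q, s)) = f (q, s) := by
  have hne : Nonempty (Cotangent (𝓡 d) B × ℝ) := ⟨(S.nonempty.some, 0)⟩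
  refine ⟨fun p => f (Function.invFunOn (flowBox ι V H ζ) (𝒰 ×ˢ Icc 0 1) p), fun q hq s hs => ?_⟩
  have h1 := S.flowBox_bijOn.injOn.leftInvOn_invFunOn
    (show (q, s) ∈ 𝒰 ×ˢ Icc (0 : ℝ) 1 from ⟨hq, hs⟩)
  simp only [h1]

/-- A smooth function of the initial covector extends smoothly from the flow-out. -/
theorem IsScattering.hasSmoothExtension (S : IsScattering ι U V 𝒰 H ζ)
    {f : Cotangent (𝓡 d) B → ℝ}
    (hf : ∀ q₀, ContDiffOn ℝ ∞ (fun z => f ((cchart q₀).symm z)) (paramSet 𝒰 q₀))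
    (hμ : ∀ q ∈ 𝒰, ∀ s ∈ Icc (0 : ℝ) 1, μ (flowBox ι V H ζ (q, s)) = f q)
    {p : Cotangent (𝓡∂ (d + 1)) M} (hp : p ∈ Gamma H 𝒰 ζ) :
    HasSmoothExtension (Gamma H 𝒰 ζ) μ p := by
  obtain ⟨⟨q₀, s₀⟩, ⟨hq₀, hs₀⟩, rfl⟩ := S.flowBox_bijOn.surjOn hp
  obtain ⟨ρ, hρs, hρ0, hρ⟩ := S.exists_local_inverse hq₀ hs₀
  refine ⟨fun p => f ((cchart q₀).symm (ρ p).1), ?_, ?_⟩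
  · have h1 : ContDiffAt ℝ ∞ (fun z => f ((cchart q₀).symm z)) (cchart q₀ q₀) :=
      (hf q₀).contDiffAt ((isOpen_paramSet S.isOpen).mem_nhds (center_mem_paramSet hq₀))
    have h2 : ContDiffAt ℝ ∞ (fun x : Phase d × ℝ => f ((cchart q₀).symm x.1))
        (ρ (flowBox ι V H ζ (q₀, s₀))) := by
      rw [hρ0]
      exact ContDiffAt.comp (cchart q₀ q₀, s₀) (g := fun z => f ((cchart q₀).symm z)) h1
        contDiffAt_fst
    exact h2.contMDiffAt.comp _ hρs
  · filter_upwards [mem_nhdsWithin_of_mem_nhds hρ, self_mem_nhdsWithin] with p hp hpΓ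
    obtain ⟨h1, h2⟩ := hp (S.energy_eq_zero hpΓ)
    change flowBox ι V H ζ ((cchart q₀).symm (ρ p).1, (ρ p).2) = p at h2
    rw [← hμ ((cchart q₀).symm (ρ p).1) h1.1.2 (ρ p).2 h1.2, h2]

/-- Take μ = T/T', constant along each bicharacteristic: the exit time T becomes T/μ = T'. Both
hitting times scale by c⁻¹ under dilation, so the ratio has degree zero. -/
theorem exists_admissible [T2Space M'] (S : IsScattering ι U V 𝒰 H ζ)
    (S' : IsScattering ι' U V 𝒰 H' ζ') : ∃ μ, IsAdmissible ι ι' V 𝒰 H H' ζ ζ' μ := by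
  set f : Cotangent (𝓡 d) B → ℝ := fun q => hitTime ι V H ζ q / hitTime ι' V H' ζ' q with hf
  obtain ⟨μ, hμ⟩ := S.exists_map_flowBox fun x => f x.1
  have hfpos : ∀ q ∈ 𝒰, 0 < f q := fun q hq => div_pos (S.hitTime_pos hq) (S'.hitTime_pos hq)
  have hfs : ∀ q₀, ContDiffOn ℝ ∞ (fun z => f ((cchart q₀).symm z)) (paramSet 𝒰 q₀) := fun q₀ =>
    (S.contDiffOn_timeParam (q₀ := q₀)).div (S'.contDiffOn_timeParam (q₀ := q₀)) fun z hz =>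
      (S'.hitTime_pos hz.2).ne'
  have hext : ∀ p ∈ Gamma H 𝒰 ζ, HasSmoothExtension (Gamma H 𝒰 ζ) μ p := fun p hp =>
    S.hasSmoothExtension hfs hμ hp
  have hsm : ContMDiffOn (cotModel (𝓡∂ (d + 1))) 𝓘(ℝ, ℝ) ∞ μ (Gamma H 𝒰 ζ) := fun p hp =>
    (hext p hp).contMDiffWithinAt hp
  have hpos : ∀ p ∈ Gamma H 𝒰 ζ, 0 < μ p := fun p hp => by
    obtain ⟨⟨q, s⟩, ⟨hq, hs⟩, rfl⟩ := S.flowBox_bijOn.surjOn hp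
    rw [hμ q hq s hs]
    exact hfpos q hq
  refine ⟨μ, hsm, hpos, fun p hp c hc => ?_, fun q hq => ?_⟩
  · obtain ⟨⟨q, s⟩, ⟨hq, hs⟩, rfl⟩ := S.flowBox_bijOn.surjOn hp
    rw [← S.flowBox_dil hq hc hs, hμ _ (S.conic q hq c hc) s hs, hμ q hq s hs]
    simp only [hf]
    rw [(S.bichar_dil hq hc).1, (S'.bichar_dil hq hc).1, div_div_div_cancel_right₀ hc.ne']
  · rw [S.exitTime_mul hsm.continuousOn hpos hq fun a ha => hext _ (S.bichar_mem hq ha)]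
    change _ = hitTime ι' V H' ζ' q
    have hT := S.hitTime_pos hq
    have h1 : ∀ r ∈ uIcc 0 (hitTime ι V H ζ q), (μ (bichar ι V H ζ q r))⁻¹ = (f q)⁻¹ := by
      intro r hr
      rw [uIcc_of_le hT.le] at hr
      rw [← S.flowBox_div hq r, hμ q hq _ ⟨div_nonneg hr.1 hT.le, div_le_one_of_le₀ hr.2 hT.le⟩]
    rw [travelTime, intervalIntegral.integral_congr h1, intervalIntegral.integral_const, hf]
    simp only [sub_zero, smul_eq_mul, inv_div]
    rw [mul_div_cancel₀ _ hT.ne']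

namespace IsAdmissible

theorem intervalIntegrable (hμ : IsAdmissible ι ι' V 𝒰 H H' ζ ζ' μ)
    (S : IsScattering ι U V 𝒰 H ζ) (hq : q ∈ 𝒰) : IntervalIntegrable
    (fun r => (μ (bichar ι V H ζ q r))⁻¹) MeasureTheory.volume 0 (hitTime ι V H ζ q) := by
  refine ContinuousOn.intervalIntegrable ?_
  rw [uIcc_of_le (S.hitTime_pos hq).le]
  exact (S.continuousOn_comp_bichar hμ.smooth.continuousOn hq).inv₀ fun r hr =>
    (hμ.pos _ (S.bichar_mem hq hr)).ne'

variable (hμ : IsAdmissible ι ι' V 𝒰 H H' ζ ζ' μ) (S : IsScattering ι U V 𝒰 H ζ)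
  (S' : IsScattering ι' U V 𝒰 H' ζ')
include hμ S S'

theorem hasSmoothExtension (hq : q ∈ 𝒰) : ∀ a ∈ Icc 0 (hitTime ι V H ζ q),
    HasSmoothExtension (Gamma H 𝒰 ζ) μ (bichar ι V H ζ q a) := by
  refine S.hasSmoothExtension_of_exitTime hμ.smooth.continuousOn hμ.pos hq ?_
  rw [hμ.exit_eq q hq]
  exact (S'.hitTime_pos hq).ne'

theorem travelTime_eq (hq : q ∈ 𝒰) :
    travelTime ι V H ζ μ q (hitTime ι V H ζ q) = hitTime ι' V H' ζ' q := by
  rw [← S.exitTime_mul hμ.smooth.continuousOn hμ.pos hq (hμ.hasSmoothExtension S S' hq),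
    hμ.exit_eq q hq, hitTime]

theorem exists_isClock (hq : q ∈ 𝒰) :
    ∃ D : ℝ → ℝ, IsClock ι V 𝒰 H ζ μ q (hitTime ι' V H' ζ' q) D := by
  rw [← hμ.travelTime_eq S S' hq]
  exact S.exists_isClock hμ.smooth.continuousOn hμ.pos hq (hμ.hasSmoothExtension S S' hq)

end IsAdmissible

/-- Both integrals of μ⁻¹ are total travel times, and both equal T'. -/
theorem integral_inv_sub_inv_eq_zero (S : IsScattering ι U V 𝒰 H ζ)
    (S' : IsScattering ι' U V 𝒰 H' ζ') {μ₁ μ₂ : Cotangent (𝓡∂ (d + 1)) M → ℝ}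
    (h₁ : IsAdmissible ι ι' V 𝒰 H H' ζ ζ' μ₁) (h₂ : IsAdmissible ι ι' V 𝒰 H H' ζ ζ' μ₂)
    (hq : q ∈ 𝒰) {γ : ℝ → Cotangent (𝓡∂ (d + 1)) M}
    (hγ : IsIntegralCurve (IsHamVec H) γ (Icc 0 (hitTime ι V H ζ q))) (h0 : γ 0 = ζ q) :
    ∫ t in (0 : ℝ)..hitTime ι V H ζ q, ((μ₁ (γ t))⁻¹ - (μ₂ (γ t))⁻¹) = 0 := by
  have h3 : ∀ r ∈ uIcc 0 (hitTime ι V H ζ q), (μ₁ (γ r))⁻¹ - (μ₂ (γ r))⁻¹ =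
      (μ₁ (bichar ι V H ζ q r))⁻¹ - (μ₂ (bichar ι V H ζ q r))⁻¹ := by
    intro r hr
    rw [uIcc_of_le (S.hitTime_pos hq).le] at hr
    rw [S.curve_eqOn hq hγ h0 hr]
  rw [intervalIntegral.integral_congr h3, intervalIntegral.integral_sub
    (h₁.intervalIntegrable S hq) (h₂.intervalIntegrable S hq)]
  exact sub_eq_zero.2 ((h₁.travelTime_eq S S' hq).trans (h₂.travelTime_eq S S' hq).symm)

end Admissible
end
end ZeroEnergy

namespace ZeroEnergy
noncomputable section

/-! ### Maps that change only the time along bicharacteristics -/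

section BoxMap
variable {d : ℕ}
  {B : Type*} [TopologicalSpace B] [ChartedSpace (EuclideanSpace ℝ (Fin d)) B]
  [IsManifold (𝓡 d) ∞ B]
  {M : Type*} [TopologicalSpace M] [ChartedSpace (EuclideanHalfSpace (d + 1)) M]
  [IsManifold (𝓡∂ (d + 1)) ∞ M]
  {M' : Type*} [TopologicalSpace M'] [ChartedSpace (EuclideanHalfSpace (d + 1)) M']
  [IsManifold (𝓡∂ (d + 1)) ∞ M']
  {ι : B → M} {ι' : B → M'} {U V : Set B} {𝒰 : Set (Cotangent (𝓡 d) B)}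
  {H : Cotangent (𝓡∂ (d + 1)) M → ℝ} {ζ : Cotangent (𝓡 d) B → Cotangent (𝓡∂ (d + 1)) M}
  {H' : Cotangent (𝓡∂ (d + 1)) M' → ℝ} {ζ' : Cotangent (𝓡 d) B → Cotangent (𝓡∂ (d + 1)) M'}
  {κ : Cotangent (𝓡∂ (d + 1)) M → Cotangent (𝓡∂ (d + 1)) M'}
  {σ : Cotangent (𝓡 d) B × ℝ → ℝ} {q₀ : Cotangent (𝓡 d) B}

/-- The change of time `(q, s) ↦ (q, σ (q, s))` in the chart at `q₀`. -/
def boxChange (σ : Cotangent (𝓡 d) B × ℝ → ℝ) (q₀ : Cotangent (𝓡 d) B) (x : Phase d × ℝ) :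
    Phase d × ℝ :=
  (x.1, σ ((cchart q₀).symm x.1, x.2))

/-- `σ` is a smooth change of time in `[0, 1]`, depending on the parameter in `𝒰`. -/
structure IsTimeChange (𝒰 : Set (Cotangent (𝓡 d) B)) (σ : Cotangent (𝓡 d) B × ℝ → ℝ) : Prop where
  maps : ∀ q ∈ 𝒰, ∀ s ∈ Icc (0 : ℝ) 1, σ (q, s) ∈ Icc (0 : ℝ) 1
  smooth : ∀ q₀, ContDiffOn ℝ ∞ (boxChange σ q₀) (paramBox 𝒰 q₀)

theorem IsTimeChange.mapsTo (hσ : IsTimeChange 𝒰 σ) :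
    MapsTo (boxChange σ q₀) (paramBox 𝒰 q₀) (paramBox 𝒰 q₀) := fun _ hx =>
  ⟨hx.1, hσ.maps _ hx.1.2 _ hx.2⟩

theorem flowParam_boxChange
    (hκ : ∀ q ∈ 𝒰, ∀ s ∈ Icc (0 : ℝ) 1,
      κ (flowBox ι V H ζ (q, s)) = flowBox ι' V H' ζ' (q, σ (q, s))) {x : Phase d × ℝ}
    (hx : x ∈ paramBox 𝒰 q₀) :
    κ (flowParam ι V H ζ q₀ x) = flowParam ι' V H' ζ' q₀ (boxChange σ q₀ x) :=
  hκ _ hx.1.2 _ hx.2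

variable [T2Space M] [T2Space M']

/-- Near each point of Γ₀, κ is the composition of the smooth local parameters ρ, the change of time
and the flow of H'. -/
theorem IsTimeChange.contMDiffOn (hσ : IsTimeChange 𝒰 σ) (S : IsScattering ι U V 𝒰 H ζ)
    (S' : IsScattering ι' U V 𝒰 H' ζ')
    (hκ : ∀ q ∈ 𝒰, ∀ s ∈ Icc (0 : ℝ) 1,
      κ (flowBox ι V H ζ (q, s)) = flowBox ι' V H' ζ' (q, σ (q, s))) :
    ContMDiffOn (cotModel (𝓡∂ (d + 1))) (cotModel (𝓡∂ (d + 1))) ∞ κ (Gamma H 𝒰 ζ) := by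
  intro p hp
  obtain ⟨⟨q₀, s₀⟩, ⟨hq₀, hs₀⟩, rfl⟩ := S.flowBox_bijOn.surjOn hp
  obtain ⟨ρ, hρs, hρ0, hρ⟩ := S.exists_local_inverse hq₀ hs₀
  set p₀ := flowBox ι V H ζ (q₀, s₀) with hp₀
  set Γ₁ : Set (Cotangent (𝓡∂ (d + 1)) M) := Gamma H 𝒰 ζ ∩ {p | ρ p ∈ paramBox 𝒰 q₀} with hΓ₁
  have hev : ∀ᶠ p in 𝓝[Gamma H 𝒰 ζ] p₀, ρ p ∈ paramBox 𝒰 q₀ ∧ flowParam ι V H ζ q₀ (ρ p) = p := by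
    filter_upwards [mem_nhdsWithin_of_mem_nhds hρ, self_mem_nhdsWithin] with p hp hpΓ
    exact hp (S.energy_eq_zero hpΓ)
  have hΓn : Γ₁ ∈ 𝓝[Gamma H 𝒰 ζ] p₀ := inter_mem self_mem_nhdsWithin (hev.mono fun p h => h.1)
  have hx₀ : ρ p₀ ∈ paramBox 𝒰 q₀ := (hev.self_of_nhdsWithin hp).1
  have h1 : ContMDiffWithinAt (cotModel (𝓡∂ (d + 1))) 𝓘(ℝ, Phase d × ℝ) ∞
      (fun p => boxChange σ q₀ (ρ p)) Γ₁ p₀ :=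
    ContMDiffWithinAt.comp (t := paramBox 𝒰 q₀) p₀ ((hσ.smooth q₀ _ hx₀).contMDiffWithinAt)
      hρs.contMDiffWithinAt fun p hp => hp.2
  have h2 : ContMDiffWithinAt (cotModel (𝓡∂ (d + 1))) (cotModel (𝓡∂ (d + 1))) ∞
      (fun p => flowParam ι' V H' ζ' q₀ (boxChange σ q₀ (ρ p))) Γ₁ p₀ :=
    ContMDiffWithinAt.comp (t := paramBox 𝒰 q₀) p₀
      (S'.contMDiffOn_flowParam_box (q₀ := q₀) _ (hσ.mapsTo hx₀)) h1 fun p hp => hσ.mapsTo hp.2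
  have h3 : ∀ᶠ p in 𝓝[Gamma H 𝒰 ζ] p₀, κ p = flowParam ι' V H' ζ' q₀ (boxChange σ q₀ (ρ p)) := by
    filter_upwards [hev] with p hp
    rw [← flowParam_boxChange hκ hp.1, hp.2]
  exact (h2.mono_of_mem_nhdsWithin hΓn).congr_of_eventuallyEq h3 (h3.self_of_nhdsWithin hp)

/-- A change of time does not alter the q-component of tangent vectors, and this component alone
determines the symplectic form on both sides. -/
theorem IsTimeChange.preservesSymp (hσ : IsTimeChange 𝒰 σ) (S : IsScattering ι U V 𝒰 H ζ)
    (S' : IsScattering ι' U V 𝒰 H' ζ')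
    (hκ : ∀ q ∈ 𝒰, ∀ s ∈ Icc (0 : ℝ) 1,
      κ (flowBox ι V H ζ (q, s)) = flowBox ι' V H' ζ' (q, σ (q, s))) :
    PreservesSymp H (Gamma H 𝒰 ζ) κ := by
  intro p hp L hL v w hv hw
  obtain ⟨⟨q₀, s₀⟩, ⟨hq₀, hs₀⟩, rfl⟩ := S.flowBox_bijOn.surjOn hp
  obtain ⟨J, hJ, hJs, hJr⟩ := S.exists_flow_derivative hq₀ hs₀
  obtain ⟨J', hJ', hJs', -⟩ := S'.exists_flow_derivative hq₀ (hσ.maps q₀ hq₀ s₀ hs₀)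
  rw [← flowParam_center] at hL
  rw [flowParam_center] at hJr
  obtain ⟨u, hu⟩ := (hJr v).1 hv
  obtain ⟨u', hu'⟩ := (hJr w).1 hw
  set x₀ : Phase d × ℝ := (cchart q₀ q₀, s₀) with hx₀
  have hx₀m : x₀ ∈ paramBox 𝒰 q₀ := ⟨center_mem_paramSet hq₀, hs₀⟩
  have hmaps : MapsTo (flowParam ι V H ζ q₀) (paramBox 𝒰 q₀) (Gamma H 𝒰 ζ) := fun x hx =>
    S.flowParam_mem hx.1 hx.2
  have hLJ := HasMFDerivWithinAt.comp x₀ hL hJ hmaps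
  have hbc : boxChange σ q₀ x₀ = (cchart q₀ q₀, σ (q₀, s₀)) := by
    simp only [boxChange, hx₀, (cchart q₀).left_inv (mem_extChartAt_source q₀)]
  obtain ⟨D, hD⟩ : ∃ D : Phase d × ℝ →L[ℝ] Phase d × ℝ,
      HasFDerivWithinAt (boxChange σ q₀) D (paramBox 𝒰 q₀) x₀ :=
    ⟨_, ((hσ.smooth q₀).differentiableOn (by simp) _ hx₀m).hasFDerivWithinAt⟩
  have hD1 : ∀ a, (D a).1 = a.1 := by
    have h1 := (ContinuousLinearMap.fst ℝ (Phase d) ℝ).hasFDerivAt.comp_hasFDerivWithinAt x₀ hD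
    have h2 : HasFDerivWithinAt (fun x : Phase d × ℝ => x.1) (ContinuousLinearMap.fst ℝ (Phase d) ℝ)
        (paramBox 𝒰 q₀) x₀ := (ContinuousLinearMap.fst ℝ (Phase d) ℝ).hasFDerivWithinAt
    have h3 := (S.uniqueDiffOn_paramBox x₀ hx₀m).eq h1 h2
    exact fun a => congrArg (fun F => F a) h3
  have hJ'D : HasMFDerivWithinAt 𝓘(ℝ, Phase d × ℝ) (cotModel (𝓡∂ (d + 1)))
      (κ ∘ flowParam ι V H ζ q₀) (paramBox 𝒰 q₀) x₀ (J'.comp D) := by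
    rw [← hbc] at hJ'
    have h1 := HasMFDerivWithinAt.comp x₀ hJ' (hasMFDerivWithinAt_iff_hasFDerivWithinAt.2 hD)
      hσ.mapsTo
    exact HasMFDerivWithinAt.congr_of_eventuallyEq h1
      (eventually_nhdsWithin_of_forall fun x hx => flowParam_boxChange hκ hx)
      (flowParam_boxChange hκ hx₀m)
  have hUx : UniqueMDiffWithinAt 𝓘(ℝ, Phase d × ℝ) (paramBox 𝒰 q₀) x₀ := by
    rw [uniqueMDiffWithinAt_iff_uniqueDiffWithinAt]
    exact S.uniqueDiffOn_paramBox x₀ hx₀m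
  have hJD : ∀ a, J' (D a) = L (J a) := fun a => congrArg (fun F => F a) (hUx.eq hJ'D hLJ)
  have key : ∀ a b : Phase d × ℝ, sympE (E := EuclideanSpace ℝ (Fin (d + 1))) (L (J a)) (L (J b)) =
      sympE (J a) (J b) := fun a b =>
    (congrArg₂ sympE (hJD a) (hJD b)).symm.trans ((hJs' (D a) (D b)).trans
      ((congrArg₂ sympE (hD1 a) (hD1 b)).trans (hJs a b).symm))
  subst hu
  subst hu'
  exact key u u'

end BoxMap
end
end ZeroEnergy

namespace ZeroEnergy
noncomputable section

/-! ### The normalized travel time -/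

theorem div_mem_unitInterval {a x : ℝ} (ha : 0 < a) (hx : x ∈ Icc 0 a) : x / a ∈ Icc (0 : ℝ) 1 :=
  ⟨div_nonneg hx.1 ha.le, div_le_one_of_le₀ hx.2 ha.le⟩

theorem mul_mem_Icc_of_mem_unitInterval {a x : ℝ} (ha : 0 < a) (hx : x ∈ Icc (0 : ℝ) 1) :
    x * a ∈ Icc 0 a :=
  ⟨mul_nonneg hx.1 ha.le, mul_le_of_le_one_left ha.le hx.2⟩

theorem hasDerivWithinAt_rescale {f : ℝ → ℝ} {f' a s : ℝ} (ha : 0 < a) (b : ℝ)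
    (hf : HasDerivWithinAt f f' (Icc 0 a) (s * a)) :
    HasDerivWithinAt (fun s => f (s * a) / b) (a / b * f') (Icc 0 1) s := by
  have h1 : HasDerivWithinAt (fun s => s * a) a (Icc 0 1) s := by
    simpa using (hasDerivWithinAt_id s (Icc (0 : ℝ) 1)).mul_const a
  have h2 := (hf.comp s h1 fun r hr => mul_mem_Icc_of_mem_unitInterval ha hr).div_const b
  exact h2.congr_deriv (by ring)

section TimeChange
variable {d : ℕ}
  {B : Type*} [TopologicalSpace B] [ChartedSpace (EuclideanSpace ℝ (Fin d)) B]
  [IsManifold (𝓡 d) ∞ B]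
  {M : Type*} [TopologicalSpace M] [ChartedSpace (EuclideanHalfSpace (d + 1)) M]
  [IsManifold (𝓡∂ (d + 1)) ∞ M]
  {M' : Type*} [TopologicalSpace M'] [ChartedSpace (EuclideanHalfSpace (d + 1)) M']
  [IsManifold (𝓡∂ (d + 1)) ∞ M']
  {ι : B → M} {ι' : B → M'} {U V : Set B} {𝒰 : Set (Cotangent (𝓡 d) B)}
  {H : Cotangent (𝓡∂ (d + 1)) M → ℝ} {ζ : Cotangent (𝓡 d) B → Cotangent (𝓡∂ (d + 1)) M}
  {H' : Cotangent (𝓡∂ (d + 1)) M' → ℝ} {ζ' : Cotangent (𝓡 d) B → Cotangent (𝓡∂ (d + 1)) M'}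
  {μ : Cotangent (𝓡∂ (d + 1)) M → ℝ} {q q₀ : Cotangent (𝓡 d) B} {s : ℝ}
  {D : Cotangent (𝓡 d) B → ℝ → ℝ}

/-- The time of the flow of `μ H` as a function of the time of the flow of `H`, both normalized to
`[0, 1]`. -/
def boxTime (ι : B → M) (ι' : B → M') (V : Set B) (H : Cotangent (𝓡∂ (d + 1)) M → ℝ)
    (H' : Cotangent (𝓡∂ (d + 1)) M' → ℝ) (ζ : Cotangent (𝓡 d) B → Cotangent (𝓡∂ (d + 1)) M)
    (ζ' : Cotangent (𝓡 d) B → Cotangent (𝓡∂ (d + 1)) M') (μ : Cotangent (𝓡∂ (d + 1)) M → ℝ)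
    (x : Cotangent (𝓡 d) B × ℝ) : ℝ :=
  travelTime ι V H ζ μ x.1 (x.2 * hitTime ι V H ζ x.1) / hitTime ι' V H' ζ' x.1

/-- The inverse of `boxTime`. -/
def boxTimeInv (ι : B → M) (ι' : B → M') (V : Set B) (H : Cotangent (𝓡∂ (d + 1)) M → ℝ)
    (H' : Cotangent (𝓡∂ (d + 1)) M' → ℝ) (ζ : Cotangent (𝓡 d) B → Cotangent (𝓡∂ (d + 1)) M)
    (ζ' : Cotangent (𝓡 d) B → Cotangent (𝓡∂ (d + 1)) M') (D : Cotangent (𝓡 d) B → ℝ → ℝ)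
    (x : Cotangent (𝓡 d) B × ℝ) : ℝ :=
  D x.1 (x.2 * hitTime ι' V H' ζ' x.1) / hitTime ι V H ζ x.1

theorem IsScattering.contDiffOn_comp_flowParam [T2Space M] (S : IsScattering ι U V 𝒰 H ζ)
    (hμ : ContMDiffOn (cotModel (𝓡∂ (d + 1))) 𝓘(ℝ, ℝ) ∞ μ (Gamma H 𝒰 ζ)) :
    ContDiffOn ℝ ∞ (fun x => μ (flowParam ι V H ζ q₀ x)) (paramBox 𝒰 q₀) := by
  have h1 := ContMDiffOn.comp hμ (S.contMDiffOn_flowParam_box (q₀ := q₀))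
    fun x hx => S.flowParam_mem hx.1 hx.2
  exact h1.contDiffOn

theorem IsScattering.contDiffOn_timeParam_fst [T2Space M] (S : IsScattering ι U V 𝒰 H ζ) :
    ContDiffOn ℝ ∞ (fun x : Phase d × ℝ => timeParam ι V H ζ q₀ x.1) (paramBox 𝒰 q₀) :=
  ContDiffOn.comp (t := paramSet 𝒰 q₀) (g := timeParam ι V H ζ q₀) S.contDiffOn_timeParam
    contDiffOn_fst fun _ hx => hx.1

namespace IsClock
variable (S : IsScattering ι U V 𝒰 H ζ) (S' : IsScattering ι' U V 𝒰 H' ζ')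
  (hD : ∀ q ∈ 𝒰, IsClock ι V 𝒰 H ζ μ q (hitTime ι' V H' ζ' q) (D q))
include S S' hD

theorem boxTime_mem (hq : q ∈ 𝒰) (hs : s ∈ Icc (0 : ℝ) 1) :
    boxTime ι ι' V H H' ζ ζ' μ (q, s) ∈ Icc (0 : ℝ) 1 :=
  div_mem_unitInterval (S'.hitTime_pos hq) ((hD q hq).travel_mem (S.mul_hitTime_mem hq hs))

theorem boxTimeInv_mem (hq : q ∈ 𝒰) (hs : s ∈ Icc (0 : ℝ) 1) :
    boxTimeInv ι ι' V H H' ζ ζ' D (q, s) ∈ Icc (0 : ℝ) 1 :=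
  div_mem_unitInterval (S.hitTime_pos hq) ((hD q hq).mem (S'.mul_hitTime_mem hq hs))

theorem boxTimeInv_boxTime (hq : q ∈ 𝒰) (hs : s ∈ Icc (0 : ℝ) 1) :
    boxTimeInv ι ι' V H H' ζ ζ' D (q, boxTime ι ι' V H H' ζ ζ' μ (q, s)) = s := by
  simp only [boxTimeInv, boxTime]
  rw [div_mul_cancel₀ _ (S'.hitTime_pos hq).ne', (hD q hq).left_inv _ (S.mul_hitTime_mem hq hs),
    mul_div_cancel_right₀ _ (S.hitTime_pos hq).ne']

theorem boxTime_boxTimeInv (hq : q ∈ 𝒰) (hs : s ∈ Icc (0 : ℝ) 1) :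
    boxTime ι ι' V H H' ζ ζ' μ (q, boxTimeInv ι ι' V H H' ζ ζ' D (q, s)) = s := by
  simp only [boxTimeInv, boxTime]
  rw [div_mul_cancel₀ _ (S.hitTime_pos hq).ne', (hD q hq).right_inv _ (S'.mul_hitTime_mem hq hs),
    mul_div_cancel_right₀ _ (S'.hitTime_pos hq).ne']

variable [T2Space M] [T2Space M']

/-- The normalized travel time is a primitive in s of (T/T') μ⁻¹ along the flow. -/
theorem isTimeChange_boxTime (hμ : IsAdmissible ι ι' V 𝒰 H H' ζ ζ' μ) :
    IsTimeChange 𝒰 (boxTime ι ι' V H H' ζ ζ' μ) := by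
  refine ⟨fun q hq s hs => boxTime_mem S S' hD hq hs, fun q₀ => contDiffOn_fst.prodMk ?_⟩
  refine contDiffOn_primitive (P := Phase d) (N := paramSet 𝒰 q₀)
    (F := fun x => timeParam ι V H ζ q₀ x.1 / timeParam ι' V H' ζ' q₀ x.1 *
      (μ (flowParam ι V H ζ q₀ x))⁻¹) (isOpen_paramSet S.isOpen) ?_ (fun z hz => ?_)
    fun z hz s hs => ?_
  · refine (S.contDiffOn_timeParam_fst.div S'.contDiffOn_timeParam_fst fun x hx =>
      (S'.hitTime_pos hx.1.2).ne').mul ((S.contDiffOn_comp_flowParam hμ.smooth).inv fun x hx =>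
      (hμ.pos _ (S.flowParam_mem hx.1 hx.2)).ne')
  · simp [boxTime, travelTime]
  · have hq : (cchart q₀).symm z ∈ 𝒰 := hz.2
    exact hasDerivWithinAt_rescale (S.hitTime_pos hq) (hitTime ι' V H' ζ' ((cchart q₀).symm z))
      ((hD _ hq).hasDerivWithinAt_travel _ (S.mul_hitTime_mem hq hs))

/-- The inverse solves the scalar equation with right-hand side (T'/T) μ along the flow, so its
smoothness, up to s = 0 and s = 1, again comes from dependence on parameters. -/
theorem isTimeChange_boxTimeInv (hμ : IsAdmissible ι ι' V 𝒰 H H' ζ ζ' μ) :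
    IsTimeChange 𝒰 (boxTimeInv ι ι' V H H' ζ ζ' D) := by
  refine ⟨fun q hq s hs => boxTimeInv_mem S S' hD hq hs, fun q₀ => contDiffOn_fst.prodMk ?_⟩
  refine contDiffOn_scalar_flow (P := Phase d) (N := paramSet 𝒰 q₀)
    (F := fun x => timeParam ι' V H' ζ' q₀ x.1 / timeParam ι V H ζ q₀ x.1 *
      μ (flowParam ι V H ζ q₀ x)) (isOpen_paramSet S.isOpen) ?_ (fun z hz => ?_)
    (fun z hz s hs => boxTimeInv_mem S S' hD hz.2 hs) fun z hz s hs => ?_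
  · refine (S'.contDiffOn_timeParam_fst.div S.contDiffOn_timeParam_fst fun x hx =>
      (S.hitTime_pos hx.1.2).ne').mul (S.contDiffOn_comp_flowParam hμ.smooth)
  · simp only [boxTimeInv, zero_mul]
    rw [(hD _ hz.2).map_zero, zero_div]
  · have hq : (cchart q₀).symm z ∈ 𝒰 := hz.2
    have h1 := hasDerivWithinAt_rescale (S'.hitTime_pos hq) (hitTime ι V H ζ ((cchart q₀).symm z))
      ((hD _ hq).hasDerivWithinAt _ (S'.mul_hitTime_mem hq hs))
    refine h1.congr_deriv ?_
    simp only [flowParam, flowBox, boxTimeInv, timeParam]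
    rw [div_mul_cancel₀ _ (S.hitTime_pos hq).ne']

end IsClock

namespace IsAdmissible
variable (hμ : IsAdmissible ι ι' V 𝒰 H H' ζ ζ' μ) (S : IsScattering ι U V 𝒰 H ζ)
  (S' : IsScattering ι' U V 𝒰 H' ζ') [T2Space M]
include hμ S S'

theorem boxTime_one (hq : q ∈ 𝒰) : boxTime ι ι' V H H' ζ ζ' μ (q, 1) = 1 := by
  simp only [boxTime, one_mul]
  rw [hμ.travelTime_eq S S' hq, div_self (S'.hitTime_pos hq).ne']

/-- Travel and hitting times all scale by c⁻¹, because μ has degree zero, so their ratio is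
unchanged; this makes κ homogeneous. -/
theorem boxTime_dil [T2Space M'] (hq : q ∈ 𝒰) {c : ℝ} (hc : 0 < c) (hs : s ∈ Icc (0 : ℝ) 1) :
    boxTime ι ι' V H H' ζ ζ' μ (dil c q, s) = boxTime ι ι' V H H' ζ ζ' μ (q, s) := by
  simp only [boxTime]
  have hT := S.hitTime_pos hq
  have h1 : travelTime ι V H ζ μ (dil c q) (s * (hitTime ι V H ζ q / c)) =
      c⁻¹ * travelTime ι V H ζ μ q (s * hitTime ι V H ζ q) := by
    have hm : s * (hitTime ι V H ζ q / c) ∈ Icc 0 (hitTime ι V H ζ q / c) :=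
      mul_mem_Icc_of_mem_unitInterval (div_pos hT hc) hs
    have h2 : ∀ r ∈ uIcc 0 (s * (hitTime ι V H ζ q / c)),
        (μ (bichar ι V H ζ (dil c q) r))⁻¹ = (μ (bichar ι V H ζ q (c * r)))⁻¹ := by
      intro r hr
      rw [uIcc_of_le hm.1] at hr
      have hr' : r ∈ Icc 0 (hitTime ι V H ζ q / c) := ⟨hr.1, hr.2.trans hm.2⟩
      rw [(S.bichar_dil hq hc).2 r hr', hμ.homogeneous _ (S.bichar_mem hq
        ⟨mul_nonneg hc.le hr.1, (le_div_iff₀' hc).1 hr'.2⟩) c hc]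
    rw [travelTime, intervalIntegral.integral_congr h2,
      intervalIntegral.integral_comp_mul_left (fun r => (μ (bichar ι V H ζ q r))⁻¹) hc.ne',
      mul_zero, smul_eq_mul, travelTime]
    congr 2
    field_simp
  rw [(S.bichar_dil hq hc).1, (S'.bichar_dil hq hc).1, h1]
  field_simp

end IsAdmissible

end TimeChange
end
end ZeroEnergy

namespace ZeroEnergy
noncomputable section

/-! ### Part (b): construction and uniqueness of κ -/

section Conjugation
variable {d : ℕ}
  {B : Type*} [TopologicalSpace B] [ChartedSpace (EuclideanSpace ℝ (Fin d)) B]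
  [IsManifold (𝓡 d) ∞ B]
  {M : Type*} [TopologicalSpace M] [ChartedSpace (EuclideanHalfSpace (d + 1)) M]
  [IsManifold (𝓡∂ (d + 1)) ∞ M]
  {M' : Type*} [TopologicalSpace M'] [ChartedSpace (EuclideanHalfSpace (d + 1)) M']
  [IsManifold (𝓡∂ (d + 1)) ∞ M']
  {ι : B → M} {ι' : B → M'} {U V : Set B} {𝒰 : Set (Cotangent (𝓡 d) B)}
  {H : Cotangent (𝓡∂ (d + 1)) M → ℝ} {ζ : Cotangent (𝓡 d) B → Cotangent (𝓡∂ (d + 1)) M}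
  {H' : Cotangent (𝓡∂ (d + 1)) M' → ℝ} {ζ' : Cotangent (𝓡 d) B → Cotangent (𝓡∂ (d + 1)) M'}
  {μ : Cotangent (𝓡∂ (d + 1)) M → ℝ} {q : Cotangent (𝓡 d) B}
  {κ : Cotangent (𝓡∂ (d + 1)) M → Cotangent (𝓡∂ (d + 1)) M'}

/-- The diffeomorphism in terms of the unnormalized times. -/
theorem map_bichar_eq (S : IsScattering ι U V 𝒰 H ζ) (S' : IsScattering ι' U V 𝒰 H' ζ')
    (hκ : ∀ q ∈ 𝒰, ∀ s ∈ Icc (0 : ℝ) 1, κ (flowBox ι V H ζ (q, s)) =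
      flowBox ι' V H' ζ' (q, boxTime ι ι' V H H' ζ ζ' μ (q, s)))
    (hq : q ∈ 𝒰) {a : ℝ} (ha : a ∈ Icc 0 (hitTime ι V H ζ q)) :
    κ (bichar ι V H ζ q a) = bichar ι' V H' ζ' q (travelTime ι V H ζ μ q a) := by
  have hT := S.hitTime_pos hq
  rw [← S.flowBox_div hq a, hκ q hq _ (div_mem_unitInterval hT ha), boxTime]
  simp only [div_mul_cancel₀ _ hT.ne']
  exact S'.flowBox_div hq _

variable [T2Space M]

/-- Over U both initial covectors restrict to q. Over V the restrictions of the two exit points are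
the values of the scattering relations, and this is the only place where their equality enters. -/
theorem boundaryConditions_of_map_flowBox [T2Space M'] (S : IsScattering ι U V 𝒰 H ζ)
    (S' : IsScattering ι' U V 𝒰 H' ζ') (hsc : SameScattering ι ι' V 𝒰 H H' ζ ζ')
    (h0 : ∀ q ∈ 𝒰, κ (ζ q) = ζ' q)
    (h1 : ∀ q ∈ 𝒰, κ (flowBox ι V H ζ (q, 1)) = flowBox ι' V H' ζ' (q, 1)) :
    BoundaryConditions ι ι' U V (Gamma H 𝒰 ζ) (Gamma H' 𝒰 ζ') κ := by
  simp only [flowBox_one] at h1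
  refine ⟨?_, ?_, ?_⟩
  · rw [S.partOver_U, S'.partOver_U, image_image]
    exact image_congr h0
  · rw [S.partOver_V, S'.partOver_V, image_image]
    exact image_congr h1
  · rintro p (hp | hp) q'
    · rw [S.partOver_U] at hp
      obtain ⟨q, hq, rfl⟩ := hp
      rw [h0 q hq]
      constructor
      · intro h
        rw [h.unique S.incl (S.restriction_zeta q hq)]
        exact S'.restriction_zeta q hq
      · intro h
        rw [h.unique S'.incl (S'.restriction_zeta q hq)]
        exact S.restriction_zeta q hq
    · rw [S.partOver_V] at hp
      obtain ⟨q, hq, rfl⟩ := hp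
      simp only [h1 q hq]
      have h2 := hsc q hq q'
      rw [scatters_iff S hq, scatters_iff S' hq, flowBox_one, flowBox_one] at h2
      constructor
      · intro h
        have hV := (S.exit_spec hq).1
        rw [h.proj_eq, S.incl.embedding.injective.mem_set_image] at hV
        exact (h2.1 ⟨hV, h⟩).2
      · intro h
        have hV := (S'.exit_spec hq).1
        rw [h.proj_eq, S'.incl.embedding.injective.mem_set_image] at hV
        exact (h2.2 ⟨hV, h⟩).2

theorem conjugatesFlows_of_map_flowBox [T2Space M'] (S : IsScattering ι U V 𝒰 H ζ)
    (S' : IsScattering ι' U V 𝒰 H' ζ') {D : Cotangent (𝓡 d) B → ℝ → ℝ}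
    (hD : ∀ q ∈ 𝒰, IsClock ι V 𝒰 H ζ μ q (hitTime ι' V H' ζ' q) (D q))
    (hκ : ∀ q ∈ 𝒰, ∀ s ∈ Icc (0 : ℝ) 1, κ (flowBox ι V H ζ (q, s)) =
      flowBox ι' V H' ζ' (q, boxTime ι ι' V H H' ζ ζ' μ (q, s)))
    (htr : ∀ q ∈ 𝒰, travelTime ι V H ζ μ q (hitTime ι V H ζ q) = hitTime ι' V H' ζ' q) :
    ConjugatesFlows ι U V (Gamma H 𝒰 ζ) μ H H' κ := by
  intro p hp t ht
  obtain ⟨q, hq, a, ha, rfl⟩ := S.mem_Gamma_iff.1 hp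
  have hC := hD q hq
  set T' := hitTime ι' V H' ζ' q with hT'
  set t₀ := travelTime ι V H ζ μ q a with ht₀
  have ht₀m : t₀ ∈ Icc 0 T' := hC.travel_mem ha
  have hDt : D q t₀ = a := hC.left_inv a ha
  have h0 : (0 : ℝ) ∈ Icc 0 T' := S'.zero_mem hq
  have h1 : T' ∈ Icc 0 T' := S'.hitTime_mem hq
  -- Upper bounds for the entry and exit times suffice: they keep t₀ + t inside the range of the
  -- clock.
  have hentry : entryTime (IsHamVecMul (Gamma H 𝒰 ζ) μ H) (ι '' U) (bichar ι V H ζ q a) ≤ t₀ := by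
    have h2 := flowsTo_of_curve hC.curve ht₀m h0
    simp only [hDt, hC.map_zero, (S.bichar_curve hq).2, zero_sub] at h2
    refine entryTime_le ht₀m.1 h2 ?_
    rw [S.proj_zeta hq]
    exact mem_image_of_mem ι (S.over_U q hq)
  have hexit : exitTime (IsHamVecMul (Gamma H 𝒰 ζ) μ H) (ι '' V) (bichar ι V H ζ q a) ≤
      T' - t₀ := by
    have h2 := flowsTo_of_curve hC.curve ht₀m h1
    have h3 : D q T' = hitTime ι V H ζ q := by
      rw [hT', ← htr q hq]
      exact hC.left_inv _ (S.hitTime_mem hq)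
    simp only [hDt, h3] at h2
    exact exitTime_le (sub_nonneg.2 ht₀m.2) h2 (S.exit_spec hq).1
  have htm : t₀ + t ∈ Icc 0 T' := ⟨by linarith [ht.1], by linarith [ht.2]⟩
  refine ⟨bichar ι V H ζ q (D q (t₀ + t)), ?_, ?_⟩
  · have h2 := flowsTo_of_curve hC.curve ht₀m htm
    simp only [hDt, add_sub_cancel_left] at h2
    exact h2
  · rw [map_bichar_eq S S' hκ hq ha, map_bichar_eq S S' hκ hq (hC.mem htm), hC.right_inv _ htm]
    have h2 := flowsTo_of_curve (S'.bichar_curve hq).1 ht₀m htm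
    rw [add_sub_cancel_left] at h2
    exact h2

/-- A map that conjugates the flows is determined by its values at the initial covectors. -/
theorem map_bichar_of_conjugatesFlows [T2Space M'] (S : IsScattering ι U V 𝒰 H ζ)
    (S' : IsScattering ι' U V 𝒰 H' ζ') (hμ : IsAdmissible ι ι' V 𝒰 H H' ζ ζ' μ)
    (h0 : ∀ q ∈ 𝒰, κ (ζ q) = ζ' q) (hc : ConjugatesFlows ι U V (Gamma H 𝒰 ζ) μ H H' κ)
    (hq : q ∈ 𝒰) {a : ℝ} (ha : a ∈ Icc 0 (hitTime ι V H ζ q)) :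
    κ (bichar ι V H ζ q a) = bichar ι' V H' ζ' q (travelTime ι V H ζ μ q a) := by
  obtain ⟨D, hD⟩ := hμ.exists_isClock S S' hq
  set t := travelTime ι V H ζ μ q a with ht
  have htm : t ∈ Icc 0 (hitTime ι' V H' ζ' q) := hD.travel_mem ha
  have ht' : t ∈ Icc (-entryTime (IsHamVecMul (Gamma H 𝒰 ζ) μ H) (ι '' U) (ζ q))
      (exitTime (IsHamVecMul (Gamma H 𝒰 ζ) μ H) (ι '' V) (ζ q)) := by
    rw [hμ.exit_eq q hq]
    exact ⟨(neg_nonpos.2 (entryTime_nonneg _ _ _)).trans htm.1, htm.2⟩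
  obtain ⟨p', ⟨γ, hγ, hγ0, rfl⟩, γ', hγ', hγ0', hγt'⟩ := hc _ (S.zeta_mem hq) t ht'
  rw [uIcc_of_le htm.1] at hγ hγ'
  obtain ⟨b, hb, hγb, hbt, -⟩ := S.curve_mul_eq hμ.smooth.continuousOn hμ.pos hq htm.1 hγ hγ0
  have hba : b = a := by
    rw [← hD.left_inv b hb, hbt, ht, hD.left_inv a ha]
  rw [hγb, hba] at hγt'
  rw [← hγt']
  exact S'.curve_eqOn hq hγ' (hγ0'.trans (h0 q hq)) (right_mem_Icc.2 htm.1)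

/-- In the parameters κ is (q, s) ↦ (q, σ(q, s)), with σ the normalized travel time. Uniqueness
needs only the boundary conditions, which fix κ on ζ(𝒰), and the conjugation, which carries this
along the flow. -/
theorem IsAdmissible.exists_unique_kappa [T2Space M']
    (hμ : IsAdmissible ι ι' V 𝒰 H H' ζ ζ' μ) (S : IsScattering ι U V 𝒰 H ζ)
    (S' : IsScattering ι' U V 𝒰 H' ζ') (hsc : SameScattering ι ι' V 𝒰 H H' ζ ζ') :
    ∃ κ : Cotangent (𝓡∂ (d + 1)) M → Cotangent (𝓡∂ (d + 1)) M',
      (IsHomDiffeo (Gamma H 𝒰 ζ) (Gamma H' 𝒰 ζ') κ ∧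
        PreservesSymp H (Gamma H 𝒰 ζ) κ ∧
        BoundaryConditions ι ι' U V (Gamma H 𝒰 ζ) (Gamma H' 𝒰 ζ') κ ∧
        ConjugatesFlows ι U V (Gamma H 𝒰 ζ) μ H H' κ) ∧
      ∀ κ₁ : Cotangent (𝓡∂ (d + 1)) M → Cotangent (𝓡∂ (d + 1)) M',
        BoundaryConditions ι ι' U V (Gamma H 𝒰 ζ) (Gamma H' 𝒰 ζ') κ₁ →
        ConjugatesFlows ι U V (Gamma H 𝒰 ζ) μ H H' κ₁ → EqOn κ₁ κ (Gamma H 𝒰 ζ) := by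
  have hex : ∀ q, ∃ D : ℝ → ℝ, q ∈ 𝒰 → IsClock ι V 𝒰 H ζ μ q (hitTime ι' V H' ζ' q) D := by
    intro q
    by_cases hq : q ∈ 𝒰
    · obtain ⟨D, hD⟩ := hμ.exists_isClock S S' hq
      exact ⟨D, fun _ => hD⟩
    · exact ⟨id, fun h => absurd h hq⟩
  choose D hD using hex
  set σ := boxTime ι ι' V H H' ζ ζ' μ with hσd
  set τ := boxTimeInv ι ι' V H H' ζ ζ' D with hτd
  have hσ : IsTimeChange 𝒰 σ := IsClock.isTimeChange_boxTime S S' hD hμ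
  have hτ : IsTimeChange 𝒰 τ := IsClock.isTimeChange_boxTimeInv S S' hD hμ
  obtain ⟨κ, hκ⟩ := S.exists_map_flowBox fun x => flowBox ι' V H' ζ' (x.1, σ x)
  obtain ⟨κi, hκi⟩ := S'.exists_map_flowBox fun x => flowBox ι V H ζ (x.1, τ x)
  have hmaps : MapsTo κ (Gamma H 𝒰 ζ) (Gamma H' 𝒰 ζ') := fun p hp => by
    obtain ⟨⟨q, s⟩, ⟨hq, hs⟩, rfl⟩ := S.flowBox_bijOn.surjOn hp
    rw [hκ q hq s hs]
    exact S'.flowBox_bijOn.mapsTo ⟨hq, hσ.maps q hq s hs⟩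
  have hmapsi : MapsTo κi (Gamma H' 𝒰 ζ') (Gamma H 𝒰 ζ) := fun p hp => by
    obtain ⟨⟨q, s⟩, ⟨hq, hs⟩, rfl⟩ := S'.flowBox_bijOn.surjOn hp
    rw [hκi q hq s hs]
    exact S.flowBox_bijOn.mapsTo ⟨hq, hτ.maps q hq s hs⟩
  have hinv : InvOn κi κ (Gamma H 𝒰 ζ) (Gamma H' 𝒰 ζ') := by
    refine ⟨fun p hp => ?_, fun p hp => ?_⟩
    · obtain ⟨⟨q, s⟩, ⟨hq, hs⟩, rfl⟩ := S.flowBox_bijOn.surjOn hp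
      rw [hκ q hq s hs, hκi q hq _ (hσ.maps q hq s hs)]
      simp only [hσd, hτd, IsClock.boxTimeInv_boxTime S S' hD hq hs]
    · obtain ⟨⟨q, s⟩, ⟨hq, hs⟩, rfl⟩ := S'.flowBox_bijOn.surjOn hp
      rw [hκi q hq s hs, hκ q hq _ (hτ.maps q hq s hs)]
      simp only [hσd, hτd, IsClock.boxTime_boxTimeInv S S' hD hq hs]
  have h01 : (0 : ℝ) ∈ Icc (0 : ℝ) 1 := left_mem_Icc.2 zero_le_one
  have h11 : (1 : ℝ) ∈ Icc (0 : ℝ) 1 := right_mem_Icc.2 zero_le_one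
  have hζ : ∀ q ∈ 𝒰, κ (ζ q) = ζ' q := fun q hq => by
    have h1 : σ (q, 0) = 0 := by simp [hσd, boxTime, travelTime]
    have h2 := hκ q hq 0 h01
    simp only [h1] at h2
    rwa [S.flowBox_zero hq, S'.flowBox_zero hq] at h2
  have hend : ∀ q ∈ 𝒰, κ (flowBox ι V H ζ (q, 1)) = flowBox ι' V H' ζ' (q, 1) := fun q hq => by
    rw [hκ q hq 1 h11, hσd, hμ.boxTime_one S S' hq]
  refine ⟨κ, ⟨⟨hσ.contMDiffOn S S' hκ, hinv.bijOn hmaps hmapsi, ⟨κi, hinv,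
    hτ.contMDiffOn S' S hκi⟩, fun p hp c hc => ?_⟩, hσ.preservesSymp S S' hκ,
    boundaryConditions_of_map_flowBox S S' hsc hζ hend,
    conjugatesFlows_of_map_flowBox S S' hD hκ fun q hq => hμ.travelTime_eq S S' hq⟩,
    fun κ₁ hB hc p hp => ?_⟩
  · obtain ⟨⟨q, s⟩, ⟨hq, hs⟩, rfl⟩ := S.flowBox_bijOn.surjOn hp
    rw [← S.flowBox_dil hq hc hs, hκ _ (S.conic q hq c hc) s hs, hκ q hq s hs]
    simp only [hσd, hμ.boxTime_dil S S' hq hc hs]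
    exact S'.flowBox_dil hq hc (hσ.maps q hq s hs)
  · obtain ⟨q, hq, a, ha, rfl⟩ := S.mem_Gamma_iff.1 hp
    rw [map_bichar_of_conjugatesFlows S S' hμ (fun q hq => kappa_zeta S S' hB hq) hc hq ha,
      map_bichar_eq S S' hκ hq ha]

end Conjugation
end
end ZeroEnergy

/-! ### The theorem -/

open ZeroEnergy in
theorem theorem4p2 {d : ℕ} (hd : 1 ≤ d)
    {B : Type*} [TopologicalSpace B] [ChartedSpace (EuclideanSpace ℝ (Fin d)) B]
    [IsManifold (𝓡 d) ∞ B]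
    {M : Type*} [TopologicalSpace M] [T2Space M] [SecondCountableTopology M]
    [ChartedSpace (EuclideanHalfSpace (d + 1)) M] [IsManifold (𝓡∂ (d + 1)) ∞ M]
    {M' : Type*} [TopologicalSpace M'] [T2Space M'] [SecondCountableTopology M']
    [ChartedSpace (EuclideanHalfSpace (d + 1)) M'] [IsManifold (𝓡∂ (d + 1)) ∞ M']
    (ι : B → M) (hι : IsBoundaryInclusion (d := d) ι) (ι' : B → M') (hι' : IsBoundaryInclusion (d := d) ι')
    (U V : Set B) (hU : IsOpen U) (hV : IsOpen V) (hUV : Disjoint U V)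
    (𝒰 : Set (Cotangent (𝓡 d) B))
    (H : Cotangent (𝓡∂ (d + 1)) M → ℝ) (hH : IsHamiltonian H)
    (ζ : Cotangent (𝓡 d) B → Cotangent (𝓡∂ (d + 1)) M)
    (hζ : ScatteringSetup ι U V 𝒰 H ζ)
    (H' : Cotangent (𝓡∂ (d + 1)) M' → ℝ) (hH' : IsHamiltonian H')
    (ζ' : Cotangent (𝓡 d) B → Cotangent (𝓡∂ (d + 1)) M')
    (hζ' : ScatteringSetup ι' U V 𝒰 H' ζ') :
    ((∃ κ : Cotangent (𝓡∂ (d + 1)) M → Cotangent (𝓡∂ (d + 1)) M',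
        IsHomDiffeo (Gamma H 𝒰 ζ) (Gamma H' 𝒰 ζ') κ ∧
        PreservesSymp H (Gamma H 𝒰 ζ) κ ∧
        BoundaryConditions ι ι' U V (Gamma H 𝒰 ζ) (Gamma H' 𝒰 ζ') κ) →
      SameScattering ι ι' V 𝒰 H H' ζ ζ') ∧
    (SameScattering ι ι' V 𝒰 H H' ζ ζ' →
      (∃ μ, IsAdmissible ι ι' V 𝒰 H H' ζ ζ' μ) ∧
      (∀ μ₁ μ₂, IsAdmissible ι ι' V 𝒰 H H' ζ ζ' μ₁ → IsAdmissible ι ι' V 𝒰 H H' ζ ζ' μ₂ →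
        ∀ q ∈ 𝒰, ∀ γ : ℝ → Cotangent (𝓡∂ (d + 1)) M,
          IsIntegralCurve (IsHamVec H) γ (Icc 0 (exitTime (IsHamVec H) (ι '' V) (ζ q))) →
          γ 0 = ζ q →
          ∫ t in (0 : ℝ)..exitTime (IsHamVec H) (ι '' V) (ζ q),
            ((μ₁ (γ t))⁻¹ - (μ₂ (γ t))⁻¹) = 0) ∧
      (∀ μ, IsAdmissible ι ι' V 𝒰 H H' ζ ζ' μ →
        ∃ κ : Cotangent (𝓡∂ (d + 1)) M → Cotangent (𝓡∂ (d + 1)) M',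
          (IsHomDiffeo (Gamma H 𝒰 ζ) (Gamma H' 𝒰 ζ') κ ∧
            PreservesSymp H (Gamma H 𝒰 ζ) κ ∧
            BoundaryConditions ι ι' U V (Gamma H 𝒰 ζ) (Gamma H' 𝒰 ζ') κ ∧
            ConjugatesFlows ι U V (Gamma H 𝒰 ζ) μ H H' κ) ∧
          ∀ κ₁ : Cotangent (𝓡∂ (d + 1)) M → Cotangent (𝓡∂ (d + 1)) M',
            IsHomDiffeo (Gamma H 𝒰 ζ) (Gamma H' 𝒰 ζ') κ₁ ∧
              PreservesSymp H (Gamma H 𝒰 ζ) κ₁ ∧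
              BoundaryConditions ι ι' U V (Gamma H 𝒰 ζ) (Gamma H' 𝒰 ζ') κ₁ ∧
              ConjugatesFlows ι U V (Gamma H 𝒰 ζ) μ H H' κ₁ →
            EqOn κ₁ κ (Gamma H 𝒰 ζ))) := by
  have S : IsScattering ι U V 𝒰 H ζ := ⟨hζ, hH, hι, hUV⟩
  have S' : IsScattering ι' U V 𝒰 H' ζ' := ⟨hζ', hH', hι', hUV⟩
  refine ⟨fun ⟨κ, h1, h2, h3⟩ => sameScattering_of_kappa S S' h1 h2 h3, fun hsc =>
    ⟨exists_admissible S S', fun μ₁ μ₂ h₁ h₂ q hq γ hγ h0 =>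
      integral_inv_sub_inv_eq_zero S S' h₁ h₂ hq hγ h0, fun μ hμ => ?_⟩⟩
  obtain ⟨κ, hκ, hu⟩ := hμ.exists_unique_kappa S S' hsc
  exact ⟨κ, hκ, fun κ₁ h => hu κ₁ h.2.2.1 h.2.2.2⟩
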